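/- Conventions. All objects are smooth; manifolds are Hausdorff and second countable. A projective structure $\mathbf p$ on a manifold $M$ of dimension $N=n+1$ is a class of torsion-free affine connections, two connections $\nabla,\widehat\nabla$ being equivalent if $\widehat\nabla_v Y=\nabla_vY+\Upsilon(v)Y+\Upsilon(Y)v$ for a $1$-form $\Upsilon$. Put $\mathcal E(w)=\big((\Lambda^{N}TM)^{\otimes 2}\big)^{w/(2N+2)}$ and $\mathcal V(w)=\mathcal V\otimes\mathcal E(w)$. A *scale* on an open set is a connection of the (restricted) class that preserves a nowhere-vanishing section of $\mathcal E(w)$ for some $w\neq 0$. With $R(u,v)w=\nabla_u\nabla_vw-\nabla_v\nabla_uw-\nabla_{[u,v]}w$ and $\mathrm{Ric}(v,w)=\mathrm{tr}(u\mapsto R(u,v)w)$, let $\mathsf P(v,w)=\frac{1}{n(n+2)}\big[(n+1)\mathrm{Ric}(v,w)+\mathrm{Ric}(w,v)\big]$. The tractor bundle is $\mathcal T=(J^1\mathcal E(1))^*$; each $\nabla\in\mathbf p$ splits $J^1\mathcal E(1)$ by $j^1\sigma\mapsto(\nabla\sigma,\sigma)$ and so gives $\mathcal T\cong TM(-1)\oplus\mathcal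 E(-1)$; a change of $\nabla$ by $\Upsilon$ changes the splitting by $(\xi,\rho)\mapsto(\xi,\rho-\Upsilon(\xi))$, and the normal tractor connection is $\nabla^{\mathcal T}_v(\xi,\rho)=(\nabla_v\xi+\rho v,\ \nabla_v\rho-\mathsf P(v,\xi))$. For $\mathbb A\in\Gamma(\mathrm{End}\,\mathcal T)$ the vector field $\Pi(\mathbb A)$ is determined by $\mathbb A(0,\nu)=(\nu\,\Pi(\mathbb A),\ast)$. An orientation of $M$ determines, up to a positive constant, a $\nabla^{\mathcal T}$-parallel tractor volume form $\boldsymbol\epsilon\in\Gamma(\Lambda^{N+1}\mathcal T^*)$, positive on $(\nu,t_1,\dots,t_N)$ if $0<\nu\in\mathcal E(-1)$ and $t_a$ lifts $\nu e_a$ for a positively oriented basis $(e_a)$ of a tangent space of $M$. **Theorem.** Let $(M,\mathbf p)$ be a connected oriented projective manifold of dimension $4m+3\ge 11$ with endomorphisms $\mathbb I,\mathbb J,\mathbb K\in\Gamma(\mathrm{End}\,\mathcal T)$ that are $\nabla^{\mathcal T}$-parallel and satisfy $\mathbb I^2=\mathbb J^2=\mathbb K^2=\mathbb I\mathbb J\mathbb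 K=-\mathrm{id}$, such that $\boldsymbol\epsilon$ is positive on every basis of a fibre of $\mathcal T$ of the form $(E_1,\mathbb IE_1,\mathbb JE_1,\mathbb KE_1,\dots,E_{m+1},\mathbb IE_{m+1},\mathbb JE_{m+1},\mathbb KE_{m+1})$. Let $i=\Pi(\mathbb I)$, $j=\Pi(\mathbb J)$, $k=\Pi(\mathbb K)$ and $D=\mathrm{span}\{i,j,k\}\subset TM$. Call a scale $\nabla$ on an open set *$(i,j,k)$-adapted* if there the divergences $\mathrm{tr}(\nabla i),\mathrm{tr}(\nabla j),\mathrm{tr}(\nabla k)$ all vanish. Then every point of $M$ has arbitrarily small open neighbourhoods $U$ on which an $(i,j,k)$-adapted scale exists and for which the leaf space $\widetilde M$ of $D|_U$ (the quotient of $U$ that identifies two points if they are joined in $U$ by a piecewise smooth curve tangent to $D$) is, with the quotient topology, Hausdorff and second countable and carries the structure of a $4m$-dimensional smooth manifold such that $\pi:U\to\widetilde M$ is a submersion. Moreover there is a quaternionic structure $\widetilde Q\subset\mathrm{End}(T\widetilde M)$ on $\widetilde M$, that is, a rank-$3$ subbundle which is locally spanned by smooth $I,J,K$ with $I^2=J^2=K^2=IJK=-\mathrm{id}$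 and is parallel for some torsion-free affine connection. It is canonical in the following sense: for every $(i,j,k)$-adapted scale $\nabla$ on an open set $V\subseteq U$ and every $x\in V$, the elements of $\widetilde Q_{\pi(x)}$ are exactly the endomorphisms of $T_{\pi(x)}\widetilde M\cong T_xM/D_x$ induced by the elements of $\mathrm{span}\{(\nabla i)_x,(\nabla j)_x,(\nabla k)_x\}$. Finally, every $(i,j,k)$-adapted scale $\nabla$ on $U$ descends to a torsion-free affine connection $\widetilde\nabla$ on $\widetilde M$ for which $\widetilde Q$ is parallel. Here "descends" means: the common kernel $H$ of the $1$-forms $\mathsf P(\cdot,i),\mathsf P(\cdot,j),\mathsf P(\cdot,k)$ is a complement of $D$ in $TU$, and $\widetilde\nabla_{\eta}\xi=T\pi(\nabla_{\eta^h}\xi^h)$ for all vector fields $\eta,\xi$ on $\widetilde M$, where $\eta^h,\xi^h\in\Gamma(H)$ are their horizontal lifts. -/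

import Mathlib

open Set Topology Module
open scoped Manifold ContDiff

namespace ProjTractor

noncomputable section

universe u

variable {N : ℕ} {M : Type u} [TopologicalSpace M] [ChartedSpace (EuclideanSpace ℝ (Fin N)) M]

/-! ### Vector fields and torsion-free affine connections -/

variable (N M) in
/-- A (possibly rough) vector field on an `N`-dimensional manifold. -/
abbrev VField : Type u := (x : M) → TangentSpace (𝓡 N) x

variable (N M) in
/-- The underlying map of an affine connection; `cov Y x v` is `(∇_v Y)(x)`. -/
abbrev RawConn : Type u := VField N M → (x : M) → TangentSpace (𝓡 N) x →L[ℝ] TangentSpace (𝓡 N) x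

variable [IsManifold (𝓡 N) ∞ M]

/-- The vector field `X` is smooth on `U`. -/
def SmoothFieldOn (U : Set M) (X : VField N M) : Prop :=
  ContMDiffOn (𝓡 N) (𝓡 N).tangent ∞
    (fun x => Bundle.TotalSpace.mk' (EuclideanSpace ℝ (Fin N)) (E := (TangentSpace (𝓡 N) : M → Type)) x (X x)) U

/-- The vector field `X` is differentiable at `x`. -/
def DiffFieldAt (X : VField N M) (x : M) : Prop :=
  MDifferentiableAt (𝓡 N) (𝓡 N).tangent
    (fun x => Bundle.TotalSpace.mk' (EuclideanSpace ℝ (Fin N)) (E := (TangentSpace (𝓡 N) : M → Type)) x (X x)) x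

variable (N) in
/-- The function `f` is smooth on `U`. -/
abbrev SmoothFunOn (U : Set M) (f : M → ℝ) : Prop := ContMDiffOn (𝓡 N) 𝓘(ℝ, ℝ) ∞ f U

/-- `cov` is a smooth torsion-free affine connection on the open set `U`. Only the values of `cov`
at points of `U` matter. -/
structure IsAffineConnectionOn (U : Set M) (cov : RawConn N M) : Prop where
  isCovariantDerivativeOn : IsCovariantDerivativeOn (EuclideanSpace ℝ (Fin N)) cov U
  smooth : ContMDiffCovariantDerivativeOn (EuclideanSpace ℝ (Fin N)) ∞ cov U
  torsion_free : ∀ x ∈ U, ∀ X Y : VField N M, DiffFieldAt X x → DiffFieldAt Y x →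
    cov Y x (X x) - cov X x (Y x) = VectorField.mlieBracket (𝓡 N) X Y x

/-- The curvature `R(u, v) w = ∇_u ∇_v w - ∇_v ∇_u w - ∇_[u, v] w` at the point `x`, computed
with extensions of `u, v, w` to local smooth vector fields (the value does not depend on them). -/
def curvature (cov : RawConn N M) (x : M)
    (u v w : TangentSpace (𝓡 N) x) : TangentSpace (𝓡 N) x :=
  let X : VField N M := FiberBundle.extend (EuclideanSpace ℝ (Fin N)) u
  let Y : VField N M := FiberBundle.extend (EuclideanSpace ℝ (Fin N)) v
  let Z : VField N M := FiberBundle.extend (EuclideanSpace ℝ (Fin N)) w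
  cov (fun y => cov Z y (Y y)) x u - cov (fun y => cov Z y (X y)) x v
    - cov Z x (VectorField.mlieBracket (𝓡 N) X Y x)

/-- The Ricci tensor `Ric(v, w) = tr (u ↦ R(u, v) w)`. -/
def ricci (cov : RawConn N M) (x : M) (v w : TangentSpace (𝓡 N) x) : ℝ :=
  let b : Basis (Fin N) ℝ (EuclideanSpace ℝ (Fin N)) :=
    (EuclideanSpace.basisFun (Fin N) ℝ).toBasis
  ∑ a, b.coord a (curvature cov x (b a) v w)

/-- The projective Schouten tensor; for `N = n + 1` it is
`P(v, w) = ((n + 1) Ric(v, w) + Ric(w, v)) / (n (n + 2))`. -/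
def schouten (cov : RawConn N M) (x : M)
    (v w : TangentSpace (𝓡 N) x) : ℝ :=
  ((N : ℝ) * ricci cov x v w + ricci cov x w v) / (((N : ℝ) - 1) * ((N : ℝ) + 1))

/-! ### Projective structures -/

/-- At the point `x`, `cov'` is the projective change of `cov` by the covector `Υ`:
`∇'_v Y = ∇_v Y + Υ(v) Y + Υ(Y) v`. -/
def ProjChangeAt (cov cov' : RawConn N M) (x : M) (Υ : TangentSpace (𝓡 N) x →L[ℝ] ℝ) : Prop :=
  ∀ Y : VField N M, DiffFieldAt Y x → ∀ v : TangentSpace (𝓡 N) x,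
    cov' Y x v = cov Y x v + Υ v • Y x + Υ (Y x) • v

/-- Projective equivalence of torsion-free connections on `U`: they differ by a smooth one-form. -/
def ProjEquivOn (U : Set M) (cov cov' : RawConn N M) : Prop :=
  ∃ Υ : (x : M) → TangentSpace (𝓡 N) x →L[ℝ] ℝ,
    (∀ Y : VField N M, SmoothFieldOn U Y → SmoothFunOn N U (fun x => Υ x (Y x))) ∧
    ∀ x ∈ U, ProjChangeAt cov cov' x (Υ x)

variable (N M) in
/-- A projective structure: an equivalence class of smooth torsion-free affine connections. -/
structure ProjectiveStructure where
  carrier : Set (RawConn N M)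
  nonempty : carrier.Nonempty
  isAffineConnection : ∀ cov ∈ carrier, IsAffineConnectionOn univ cov
  mem_iff : ∀ cov ∈ carrier, ∀ cov', IsAffineConnectionOn univ cov' →
    (cov' ∈ carrier ↔ ProjEquivOn univ cov cov')

/-- `cov` is a connection on the open set `U` that belongs to the restriction of `p` to `U`. -/
def ProjectiveStructure.MemOn (p : ProjectiveStructure N M) (U : Set M)
    (cov : RawConn N M) : Prop :=
  IsAffineConnectionOn U cov ∧ ∃ cov₀ ∈ p.carrier, ProjEquivOn U cov₀ cov

/-! ### Densities and scales -/

/-- `F ⊗ E(w)` for an `N`-dimensional vector space `V`, where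
`E(w) = ((Λ^N V)^{⊗ 2})^{w / (2 (N + 1))} = |Λ^N V|^{w / (N + 1)}`: an element `f |e_1 ∧ … ∧ e_N|^{w / (N + 1)}`
is described by its coefficient `f` as a function of the frame `e`. -/
def weighted (N : ℕ) (w : ℝ) (V F : Type*) [AddCommGroup V] [Module ℝ V] [AddCommGroup F]
    [Module ℝ F] : Submodule ℝ ((Fin N → V) → F) where
  carrier := {τ | (∀ e, ¬ LinearIndependent ℝ e → τ e = 0) ∧
    ∀ (A : V ≃ₗ[ℝ] V) (e : Fin N → V),
      τ (fun a => A (e a)) = |LinearMap.det (A : V →ₗ[ℝ] V)| ^ (-w / ((N : ℝ) + 1)) • τ e}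
  add_mem' := by
    rintro τ τ' ⟨h1, h2⟩ ⟨h1', h2'⟩
    refine ⟨fun e he => by simp [h1 e he, h1' e he], fun A e => ?_⟩
    simp [h2 A e, h2' A e]
  zero_mem' := ⟨fun _ _ => rfl, fun _ _ => by simp⟩
  smul_mem' := by
    rintro c τ ⟨h1, h2⟩
    refine ⟨fun e he => by simp [h1 e he], fun A e => ?_⟩
    simp only [Pi.smul_apply, h2 A e]
    rw [smul_comm]

variable (N) in
/-- `e` is a smooth frame of the tangent bundle over the set `V`. -/
abbrev IsFrameOn (e : Fin N → VField N M) (V : Set M) : Prop :=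
  IsLocalFrameOn (𝓡 N) (EuclideanSpace ℝ (Fin N)) ∞ e V

/-- The connection form of the frame `e` in direction `v`, traced: the trace of the endomorphism of
the tangent space at `x` with `e_a ↦ ∇_v e_a`. On a frame-dependent coefficient of weight `w` the
induced connection acts by `∇_v + w / (N + 1) • connTrace`. -/
def connTrace (cov : RawConn N M) {e : Fin N → VField N M} {V : Set M}
    (he : IsFrameOn N e V) {x : M} (hx : x ∈ V) (v : TangentSpace (𝓡 N) x) : ℝ :=
  ∑ a, (he.toBasisAt hx).coord a (cov (e a) x v)

/-- The connection `cov` on `U` is a scale: for some weight `w ≠ 0` there is a nowhere-vanishing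
smooth section `σ` of `E(w)` over `U` that is parallel. -/
def IsScaleOn (U : Set M) (cov : RawConn N M) : Prop :=
  ∃ (w : ℝ) (σ : (x : M) → weighted N w (TangentSpace (𝓡 N) x) ℝ), w ≠ 0 ∧ (∀ x ∈ U, σ x ≠ 0) ∧
    ∀ (V : Set M) (e : Fin N → VField N M), IsOpen V → V ⊆ U → ∀ he : IsFrameOn N e V,
      SmoothFunOn N V (fun y => (σ y).1 (fun a => e a y)) ∧
      ∀ (x : M) (hx : x ∈ V) (v : TangentSpace (𝓡 N) x),
        mvfderiv (𝓡 N) (fun y => (σ y).1 (fun a => e a y)) x v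
          + w / ((N : ℝ) + 1) * connTrace cov he hx v * (σ x).1 (fun a => e a x) = 0

/-! ### The standard tractor bundle -/

/-- The fibre at `x` of the standard tractor bundle `T = (J¹ E(1))*`. A connection `∇` of the
projective class splits `J¹ E(1)` by `j¹ σ ↦ (∇σ, σ)`, hence `T = TM(-1) ⊕ E(-1)`, and a change of
`∇` by `Υ` changes the splitting by `(ξ, ρ) ↦ (ξ, ρ - Υ(ξ))`. So a tractor is a family of pairs
`(ξ, ρ)` of weight `-1`, one for each connection of the class, with this transformation law. -/
def tractor (p : ProjectiveStructure N M) (x : M) : Submodule ℝ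
    (p.carrier → weighted N (-1) (TangentSpace (𝓡 N) x) (TangentSpace (𝓡 N) x × ℝ)) where
  carrier := {t | ∀ (cov cov' : p.carrier) (Υ : TangentSpace (𝓡 N) x →L[ℝ] ℝ),
    ProjChangeAt cov.1 cov'.1 x Υ → ∀ e,
      (t cov').1 e = (((t cov).1 e).1, ((t cov).1 e).2 - Υ ((t cov).1 e).1)}
  add_mem' := by
    intro t t' h h' cov cov' Υ hΥ e
    have h1 := h cov cov' Υ hΥ e
    have h2 := h' cov cov' Υ hΥ e
    simp only [Pi.add_apply, Submodule.coe_add, h1, h2, Prod.mk_add_mk, Prod.fst_add, Prod.snd_add,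
      map_add]
    congr 1
    ring
  zero_mem' := by
    intro cov cov' Υ _ e
    ext <;> simp
  smul_mem' := by
    intro c t h cov cov' Υ hΥ e
    have h1 := h cov cov' Υ hΥ e
    simp only [Pi.smul_apply, Submodule.coe_smul, h1, Prod.smul_mk, Prod.smul_fst, Prod.smul_snd,
      map_smul]
    congr 1
    simp only [smul_eq_mul]
    ring

variable {p : ProjectiveStructure N M}

/-- The component of a tractor in `TM(-1)` in the splitting given by `cov`, with respect to the
frame `e` of the tangent space. -/
def vecPart {x : M} (t : tractor p x) (cov : p.carrier) (e : Fin N → TangentSpace (𝓡 N) x) :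
    TangentSpace (𝓡 N) x := ((t.1 cov).1 e).1

/-- The component of a tractor in `E(-1)` in the splitting given by `cov`, with respect to the
frame `e` of the tangent space. -/
def densPart {x : M} (t : tractor p x) (cov : p.carrier) (e : Fin N → TangentSpace (𝓡 N) x) :
    ℝ := ((t.1 cov).1 e).2

variable (p) in
/-- A (rough) section of the tractor bundle. -/
abbrev TractorField : Type u := (x : M) → tractor p x

/-- Smooth sections of the tractor bundle. -/
def SmoothTractor (t : TractorField p) : Prop :=
  ∀ (cov : p.carrier) (V : Set M) (e : Fin N → VField N M), IsOpen V → IsFrameOn N e V →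
    SmoothFieldOn V (fun y => vecPart (t y) cov (fun a => e a y)) ∧
    SmoothFunOn N V (fun y => densPart (t y) cov (fun a => e a y))

/-- `t'` is the normal tractor derivative of `t` at `x` in direction `v`. In the splitting given by
`∇` in the projective class, `∇_v (ξ, ρ) = (∇_v ξ + ρ v, ∇_v ρ - P(v, ξ))`, the connection dual to
`∇_v (μ, σ) = (∇_v μ + P(v, ·) σ, ∇_v σ - μ(v))` on `J¹ E(1)`. -/
def HasTractorDeriv (t : TractorField p) (x : M) (v : TangentSpace (𝓡 N) x) (t' : tractor p x) :
    Prop :=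
  ∀ (cov : p.carrier) (V : Set M) (e : Fin N → VField N M), IsOpen V → ∀ (he : IsFrameOn N e V)
    (hx : x ∈ V),
    vecPart t' cov (fun a => e a x) =
      cov.1 (fun y => vecPart (t y) cov (fun a => e a y)) x v
        - (connTrace cov.1 he hx v / ((N : ℝ) + 1)) • vecPart (t x) cov (fun a => e a x)
        + densPart (t x) cov (fun a => e a x) • v ∧
    densPart t' cov (fun a => e a x) =
      mvfderiv (𝓡 N) (fun y => densPart (t y) cov (fun a => e a y)) x v
        - connTrace cov.1 he hx v / ((N : ℝ) + 1) * densPart (t x) cov (fun a => e a x)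
        - schouten cov.1 x v (vecPart (t x) cov (fun a => e a x))

variable (p) in
/-- A (rough) section of the endomorphism bundle of the tractor bundle. -/
abbrev TractorEnd : Type u := (x : M) → tractor p x →ₗ[ℝ] tractor p x

/-- `A` is a smooth section of the endomorphism bundle that is parallel for the tractor
connection. -/
def IsParallelEnd (A : TractorEnd p) : Prop :=
  (∀ t : TractorField p, SmoothTractor t → SmoothTractor (fun x => A x (t x))) ∧
  ∀ t : TractorField p, SmoothTractor t → ∀ (x : M) (v : TangentSpace (𝓡 N) x) (t' : tractor p x),
    HasTractorDeriv t x v t' → HasTractorDeriv (fun y => A y (t y)) x v (A x t')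

/-- Three endomorphisms form a hypercomplex structure on a real vector space. -/
def IsHypercomplex {V : Type*} [AddCommGroup V] [Module ℝ V] (I J K : V →ₗ[ℝ] V) : Prop :=
  I ∘ₗ I = -LinearMap.id ∧ J ∘ₗ J = -LinearMap.id ∧ K ∘ₗ K = -LinearMap.id ∧
    I ∘ₗ J ∘ₗ K = -LinearMap.id

/-- A parallel hypercomplex structure on the tractor bundle. -/
def IsParallelHypercomplex (I J K : TractorEnd p) : Prop :=
  IsParallelEnd I ∧ IsParallelEnd J ∧ IsParallelEnd K ∧ ∀ x, IsHypercomplex (V := tractor p x) (I x) (J x) (K x)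

/-- `ξ = Π(A)`: the vector field underlying the endomorphism `A` of the tractor bundle. In a
splitting, `A (0, ν) = (ν ξ, ·)`, where the tractors `(0, ν)` form the subbundle `E(-1)`. -/
def IsProjection (A : TractorEnd p) (ξ : VField N M) : Prop :=
  ∀ (x : M) (t : tractor p x), (∀ cov e, vecPart t cov e = 0) →
    ∀ cov e, vecPart (A x t) cov e = densPart t cov e • ξ x

/-! ### Orientations -/

/-- An orientation of the manifold: an orientation of each tangent space, locally given by a
smooth frame. -/
def IsManifoldOrientation (o : (x : M) → Orientation ℝ (TangentSpace (𝓡 N) x) (Fin N)) : Prop :=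
  ∀ x₀ : M, ∃ (V : Set M) (e : Fin N → VField N M) (he : IsFrameOn N e V), IsOpen V ∧ x₀ ∈ V ∧
    ∀ (x : M) (hx : x ∈ V), (he.toBasisAt hx).orientation = o x

/-- A parallel tractor volume form of the oriented projective manifold: a smooth parallel section
of `Λ^{N+1} T*` that is positive on `(ν, t_1, …, t_N)` if `ν` is a positive element of `E(-1)` and
the `t_a` are lifts of `ν e_a` for a positively oriented basis `e` of the tangent space. -/
structure IsTractorVolumeForm (o : (x : M) → Orientation ℝ (TangentSpace (𝓡 N) x) (Fin N))
    (ε : (x : M) → tractor p x [⋀^Fin (N + 1)]→ₗ[ℝ] ℝ) : Prop where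
  smooth : ∀ t : Fin (N + 1) → TractorField p, (∀ r, SmoothTractor (t r)) →
    SmoothFunOn N univ (fun x => ε x (fun r => t r x))
  parallel : ∀ t : Fin (N + 1) → TractorField p, (∀ r, SmoothTractor (t r)) →
    ∀ (x : M) (v : TangentSpace (𝓡 N) x) (t' : Fin (N + 1) → tractor p x),
      (∀ r, HasTractorDeriv (t r) x v (t' r)) →
      mvfderiv (𝓡 N) (fun y => ε y (fun r => t r y)) x v
        = ∑ r, ε x (Function.update (fun s => t s x) r (t' r))
  positive : ∀ (x : M) (e : Basis (Fin N) ℝ (TangentSpace (𝓡 N) x)), e.orientation = o x →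
    ∀ t : Fin (N + 1) → tractor p x,
      (∀ cov, vecPart (t 0) cov e = 0 ∧ 0 < densPart (t 0) cov e ∧
        ∀ a : Fin N, vecPart (t a.succ) cov e = densPart (t 0) cov e • e a) →
      0 < ε x t

/-- The family `(E_1, I E_1, J E_1, K E_1, …, E_{m+1}, I E_{m+1}, J E_{m+1}, K E_{m+1})`. -/
def quatFamily {V : Type*} [AddCommMonoid V] [Module ℝ V] (I J K : V →ₗ[ℝ] V) {m : ℕ}
    (E : Fin (m + 1) → V) (r : Fin (4 * m + 3 + 1)) : V :=
  let a : Fin (m + 1) := ⟨r.1 / 4, by omega⟩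
  ![E a, I (E a), J (E a), K (E a)] ⟨r.1 % 4, by omega⟩

/-- The volume form `ε` and the hypercomplex structure `(I, J, K)` induce the same orientation. -/
def SameOrientation {V : Type*} [AddCommMonoid V] [Module ℝ V] {m : ℕ}
    (ε : V [⋀^Fin (4 * m + 3 + 1)]→ₗ[ℝ] ℝ) (I J K : V →ₗ[ℝ] V) : Prop :=
  ∀ E : Fin (m + 1) → V, LinearIndependent ℝ (quatFamily I J K E) → 0 < ε (quatFamily I J K E)

/-! ### Adapted scales and the leaf space -/

variable (p) in
/-- `cov` is an `(i, j, k)`-adapted scale of `p` on the open set `U`. -/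
def IsAdaptedScaleOn (i j k : VField N M) (U : Set M) (cov : RawConn N M) : Prop :=
  p.MemOn U cov ∧ IsScaleOn U cov ∧
    ∀ x ∈ U, ∀ ξ ∈ ({i, j, k} : Set (VField N M)),
      LinearMap.trace ℝ (TangentSpace (𝓡 N) x) (cov ξ x : _ →ₗ[ℝ] _) = 0

/-- The distribution `D` spanned by `i, j, k`. -/
def distrib (i j k : VField N M) (x : M) : Submodule ℝ (TangentSpace (𝓡 N) x) :=
  Submodule.span ℝ {i x, j x, k x}

/-- Two points of `U` lie on the same leaf of `D` restricted to `U` if they are connected by a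
finite chain of smooth curves in `U` that are everywhere tangent to `D`. -/
def leafSetoid (i j k : VField N M) (U : Set M) : Setoid U :=
  Relation.EqvGen.setoid fun x y => ∃ γ : ℝ → M, ContMDiff 𝓘(ℝ, ℝ) (𝓡 N) ∞ γ ∧
    (∀ s, γ s ∈ U ∧ mfderiv 𝓘(ℝ, ℝ) (𝓡 N) γ s (1 : ℝ) ∈ distrib i j k (γ s)) ∧
    γ 0 = x ∧ γ 1 = y

/-- The leaf space of `D` restricted to `U`, with the quotient topology. -/
abbrev LeafSpace (i j k : VField N M) (U : Set M) : Type u := Quotient (leafSetoid i j k U)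

/-! ### Quaternionic structures -/

section Quaternionic

variable {n : ℕ} {L : Type u} [TopologicalSpace L] [ChartedSpace (EuclideanSpace ℝ (Fin n)) L]

variable (n L) in
/-- A (rough) section of the endomorphism bundle of the tangent bundle. -/
abbrev EndField : Type u := (y : L) → TangentSpace (𝓡 n) y →L[ℝ] TangentSpace (𝓡 n) y

variable [IsManifold (𝓡 n) ∞ L]

/-- The field of endomorphisms `A` is smooth on `V`. -/
def SmoothEndOn (V : Set L) (A : EndField n L) : Prop :=
  ∀ Y : VField n L, SmoothFieldOn V Y → SmoothFieldOn V (fun y => A y (Y y))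

/-- `Q` is an almost quaternionic structure: around each point it has a smooth local frame
`(I, J, K)` which satisfies the quaternionic relations. -/
def IsAlmostQuaternionic
    (Q : (y : L) → Submodule ℝ (TangentSpace (𝓡 n) y →L[ℝ] TangentSpace (𝓡 n) y)) : Prop :=
  ∀ y₀ : L, ∃ (V : Set L) (I J K : EndField n L), IsOpen V ∧ y₀ ∈ V ∧
    SmoothEndOn V I ∧ SmoothEndOn V J ∧ SmoothEndOn V K ∧
    ∀ y ∈ V, I y ∘L I y = -.id ℝ _ ∧ J y ∘L J y = -.id ℝ _ ∧ K y ∘L K y = -.id ℝ _ ∧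
      I y ∘L J y ∘L K y = -.id ℝ _ ∧
      LinearIndependent ℝ ![I y, J y, K y] ∧ Q y = Submodule.span ℝ {I y, J y, K y}

/-- The subbundle `Q` of the endomorphism bundle is parallel for `cov`: derivatives of local
sections of `Q` are again in `Q`. -/
def IsParallelSubbundle (cov : RawConn n L)
    (Q : (y : L) → Submodule ℝ (TangentSpace (𝓡 n) y →L[ℝ] TangentSpace (𝓡 n) y)) : Prop :=
  ∀ (V : Set L) (A : EndField n L), IsOpen V → SmoothEndOn V A → (∀ y ∈ V, A y ∈ Q y) →
    ∀ y ∈ V, ∀ v : TangentSpace (𝓡 n) y, ∃ B ∈ Q y, ∀ Y : VField n L, SmoothFieldOn V Y →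
      cov (fun z => A z (Y z)) y v - A y (cov Y y v) = B (Y y)

/-- `Q` is a quaternionic structure: it is almost quaternionic, and some smooth torsion-free
affine connection preserves it. -/
def IsQuaternionic
    (Q : (y : L) → Submodule ℝ (TangentSpace (𝓡 n) y →L[ℝ] TangentSpace (𝓡 n) y)) : Prop :=
  IsAlmostQuaternionic Q ∧
    ∃ cov : RawConn n L, IsAffineConnectionOn univ cov ∧ IsParallelSubbundle cov Q

/-! ### Descent along a submersion -/

/-- `Q` is induced by the adapted scale `cov` on `V`: for `x` in `V`, the endomorphisms in `Q (π x)`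
are exactly those that the elements of `span {∇i, ∇j, ∇k}` induce on `T_{π x} L = T_x M / D_x`. -/
def InducedBy (i j k : VField N M) (π : M → L) (V : Set M) (cov : RawConn N M)
    (Q : (y : L) → Submodule ℝ (TangentSpace (𝓡 n) y →L[ℝ] TangentSpace (𝓡 n) y)) : Prop :=
  ∀ x ∈ V, ∀ A : TangentSpace (𝓡 n) (π x) →L[ℝ] TangentSpace (𝓡 n) (π x),
    A ∈ Q (π x) ↔ ∃ B ∈ Submodule.span ℝ {cov i x, cov j x, cov k x},
      A ∘L mfderiv (𝓡 N) (𝓡 n) π x = mfderiv (𝓡 N) (𝓡 n) π x ∘L B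

/-- The common kernel `H` of the one-forms `P(·, i), P(·, j), P(·, k)` at `x`. -/
def horizontal (i j k : VField N M) (cov : RawConn N M) (x : M) : Set (TangentSpace (𝓡 N) x) :=
  {v | schouten cov x v (i x) = 0 ∧ schouten cov x v (j x) = 0 ∧ schouten cov x v (k x) = 0}

/-- The connection `cov` on `U` descends to `covL` on `L`: `H` is a complement of `D` over `U`, and
`covL_η Y = dπ (cov_{η^h} Y^h)`, where `η^h, Y^h` are the horizontal lifts of `η, Y`. -/
def DescendsTo (i j k : VField N M) (U : Set M) (π : M → L) (cov : RawConn N M)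
    (covL : RawConn n L) : Prop :=
  (∀ x ∈ U, ∃ H : Submodule ℝ (TangentSpace (𝓡 N) x),
    (H : Set (TangentSpace (𝓡 N) x)) = horizontal i j k cov x ∧ IsCompl H (distrib i j k x)) ∧
  ∀ (Y : VField n L) (Yh : VField N M), SmoothFieldOn univ Y →
    (∀ x ∈ U, Yh x ∈ horizontal i j k cov x ∧ mfderiv (𝓡 N) (𝓡 n) π x (Yh x) = Y (π x)) →
    ∀ x ∈ U, ∀ v ∈ horizontal i j k cov x,
      mfderiv (𝓡 N) (𝓡 n) π x (cov Yh x v) = covL Y (π x) (mfderiv (𝓡 N) (𝓡 n) π x v)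

end Quaternionic

end

end ProjTractor

open ProjTractor

/-! In the splitting given by a connection `∇` of the class, an endomorphism of the tractor bundle
is a block matrix with an endomorphism field `A`, a vector field `i`, a one-form `β` and a function
`c`. It is parallel exactly if four first-order equations hold, among them `∇i = A - c` and `dc = β
+ P(·, i)`. The endomorphisms of a hypercomplex triple are trace-free, so `tr ∇i = -(N + 1) c`: a
scale is adapted if and only if all three functions `c` vanish in its splitting. Then `∇i_a = A_a`
and `β_a = -P(·, i_a)`, and `P` is symmetric because a scale has closed connection trace
(`ParTriple.adData`). The quaternion relations, read block by block, give `β_a(i_b) = -δ_ab`, `A_a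
i_{a+1} = i_{a+2}`, and `A_a A_{a+1} = A_{a+2}` up to a multiple of `i_a`. Hence `i, j, k` are
independent with `[i, j] = -2k` and its cyclic versions, `D` is involutive, `H = ⋂ ker β_a` is a
complement of `D`, and the `A_a` preserve `H` and induce quaternionic endomorphisms `J_a` of `T/D ≅
H`.

The Frobenius theorem (`exists_frobenius_chart`) provides a chart with convex image in which `D` is
the kernel of a linear surjection `q`. By convexity the leaves are exactly the fibres of `q`, so
that the leaf space is an open subset of the model space. The Frobenius theorem itself comes from
straightening a commuting frame by its flow; smooth dependence of the flow is the inverse function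
theorem in a Banach space of curves.

For the existence of an adapted scale, take the density that is 1 on the frame formed by `i, j, k`
and constant fields transverse to `D`. It is invariant under `i, j, k`, since brackets with the
transverse fields lie in `D` and the Lie algebra spanned by `i, j, k` is unimodular
(`exists_invariant_volume`). A projective change realises any prescribed connection trace, in
particular the one that preserves this density.

For the descent, horizontal lifts of constant fields commute with the `i_b` (`fderiv_hor_i`). The
derivative of `J_a` along `i_b` is therefore the commutator `[J_a, J_b]`: each `J_a` rotates along
the leaf, but the span is constant (`descSpan_eq`). The derivative of the induced connection form
along `i_b` is, modulo `D`, the curvature `R(i_b, X)Y` for horizontal `X, Y`. Modulo `D` this is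
symmetric in `X, Y` by the Bianchi identity and linear over all `J_a`, and a symmetric bilinear map
that is linear over the quaternions vanishes (`q_curvC_i_hor`). So the connection descends. On
horizontal vectors `∇A_a` takes values in `D`, so the `J_a` are parallel in horizontal directions,
which makes their span parallel on the quotient (`parallel_descSpan`). Finally, a change of scale by
`υ` changes `A_a` by `υ ⊗ i_a`, which is invisible modulo `D`; this is why the quaternionic
structure does not depend on the scale. -/

open Set Topology Module
open scoped Manifold ContDiff

namespace ProjTractor

noncomputable section

set_option linter.unusedSectionVars false

universe u

/-! ### Smooth dependence of integral curves and the Frobenius theorem -/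

section

/-! ### Composition operators and Volterra integration on spaces of continuous curves -/

section CurveSpaces

variable {K : Type*} [TopologicalSpace K] [CompactSpace K]
  {E F : Type u} [NormedAddCommGroup E] [NormedSpace ℝ E]
  [NormedAddCommGroup F] [NormedSpace ℝ F]

variable (K E) in
/-- The Banach space of continuous curves `K → E`. -/
def Curves : Type _ := C(K, E)

instance : NormedAddCommGroup (Curves K E) := inferInstanceAs (NormedAddCommGroup C(K, E))

instance : NormedSpace ℝ (Curves K E) := inferInstanceAs (NormedSpace ℝ C(K, E))

instance [CompleteSpace E] : CompleteSpace (Curves K E) := inferInstanceAs (CompleteSpace C(K, E))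

instance : FunLike (Curves K E) K E := inferInstanceAs (FunLike C(K, E) K E)

namespace Curves

/-- The curve with a given continuous underlying function. -/
def mk (f : K → E) (hf : Continuous f) : Curves K E := (⟨f, hf⟩ : C(K, E))

@[simp] lemma mk_apply (f : K → E) (hf : Continuous f) (t : K) : mk f hf t = f t := rfl

@[ext] lemma ext {γ γ' : Curves K E} (h : ∀ t, γ t = γ' t) : γ = γ' := DFunLike.ext _ _ h

@[fun_prop] protected lemma continuous (γ : Curves K E) : Continuous γ :=
  ContinuousMap.continuous (show C(K, E) from γ)

@[simp] lemma add_apply (γ γ' : Curves K E) (t : K) : (γ + γ') t = γ t + γ' t := rfl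

@[simp] lemma smul_apply (c : ℝ) (γ : Curves K E) (t : K) : (c • γ) t = c • γ t := rfl

lemma norm_coe_le_norm (γ : Curves K E) (t : K) : ‖γ t‖ ≤ ‖γ‖ :=
  ContinuousMap.norm_coe_le_norm (show C(K, E) from γ) t

lemma norm_le {γ : Curves K E} {C : ℝ} (hC : 0 ≤ C) : ‖γ‖ ≤ C ↔ ∀ t, ‖γ t‖ ≤ C :=
  ContinuousMap.norm_le (show C(K, E) from γ) hC

end Curves

/-- Pointwise application of a curve of linear maps to a curve. -/
def curveApply : Curves K (E →L[ℝ] F) →L[ℝ] Curves K E →L[ℝ] Curves K F :=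
  LinearMap.mkContinuous₂
    (LinearMap.mk₂ ℝ (fun (L : Curves K (E →L[ℝ] F)) (h : Curves K E) =>
        (Curves.mk (fun t => L t (h t)) (by fun_prop) : Curves K F))
      (fun _ _ _ => by ext; simp) (fun _ _ _ => by ext; simp)
      (fun _ _ _ => by ext; simp) (fun _ _ _ => by ext; simp)) 1
    (fun L h => by
      rw [one_mul]
      refine (Curves.norm_le (by positivity)).2 fun t => ?_
      exact ((L t).le_opNorm (h t)).trans
        (by gcongr; exacts [L.norm_coe_le_norm t, h.norm_coe_le_norm t]))

@[simp] lemma curveApply_apply (L : Curves K (E →L[ℝ] F)) (h : Curves K E) (t : K) :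
    curveApply L h t = L t (h t) := rfl

lemma hasFDerivAt_curveApply (L : Curves K (E →L[ℝ] F)) :
    HasFDerivAt (fun L : Curves K (E →L[ℝ] F) => curveApply L) curveApply L :=
  (curveApply (K := K) (E := E) (F := F)).hasFDerivAt

lemma contDiff_curveApply : ContDiff ℝ ∞ (fun L : Curves K (E →L[ℝ] F) => curveApply L) :=
  (curveApply (K := K) (E := E) (F := F)).contDiff

/-- The composition operator `γ ↦ f ∘ γ`. -/
def curveComp (f : E → F) (hf : Continuous f) (γ : Curves K E) : Curves K F :=
  Curves.mk (fun t => f (γ t)) (by fun_prop)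

@[simp] lemma curveComp_apply (f : E → F) (hf : Continuous f) (γ : Curves K E) (t : K) :
    curveComp f hf γ t = f (γ t) := rfl

/-- Mean value inequality on the segment from `x` to `x + h`, where the derivative differs from
`fderiv ℝ f x` by at most `C * ‖h‖`. The constant is not optimal, but only the quadratic order
matters. -/
lemma norm_taylor_le {f : E → F} (hf : ContDiff ℝ ∞ f) {C : NNReal}
    (hC : LipschitzWith C (fderiv ℝ f)) (x h : E) :
    ‖f (x + h) - f x - fderiv ℝ f x h‖ ≤ C * ‖h‖ * ‖h‖ := by
  have h1 : ∀ y ∈ segment ℝ x (x + h), ‖fderiv ℝ f y - fderiv ℝ f x‖ ≤ C * ‖h‖ := by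
    intro y hy
    rw [← dist_eq_norm]
    refine (hC.dist_le_mul y x).trans ?_
    gcongr
    rw [dist_eq_norm]
    have := norm_sub_le_of_mem_segment hy
    simpa using this
  have h2 := (convex_segment x (x + h)).norm_image_sub_le_of_norm_fderiv_le' (𝕜 := ℝ) (f := f)
    (φ := fderiv ℝ f x)
    (fun y _ => (hf.differentiable (by simp)) y) h1 (left_mem_segment ℝ x (x + h))
    (right_mem_segment ℝ x (x + h))
  simpa using h2

/-- Compact support makes `fderiv ℝ f` globally Lipschitz, so the Taylor remainder at `γ t` is
quadratic in `h t` with a constant that does not depend on `t`. Hence it is quadratic in the sup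
norm of `h`. -/
lemma hasFDerivAt_curveComp [FiniteDimensional ℝ E] {f : E → F} (hf : ContDiff ℝ ∞ f)
    (hs : HasCompactSupport f) (γ : Curves K E) :
    HasFDerivAt (curveComp (K := K) f hf.continuous)
      (curveApply (curveComp (fderiv ℝ f) (hf.continuous_fderiv (by simp)) γ)) γ := by
  obtain ⟨C, hC⟩ : ∃ C, LipschitzWith C (fderiv ℝ f) :=
    ContDiff.lipschitzWith_of_hasCompactSupport (n := 1) (hs.fderiv ℝ)
      ((hf.fderiv_right (m := 1) (by norm_cast))) (by simp)
  rw [hasFDerivAt_iff_isLittleO_nhds_zero]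
  have hO : (fun h : Curves K E => curveComp f hf.continuous (γ + h) - curveComp f hf.continuous γ -
      curveApply (curveComp (fderiv ℝ f) (hf.continuous_fderiv (by simp)) γ) h)
      =O[𝓝 0] (fun h => ‖h‖ * ‖h‖) := by
    refine Asymptotics.IsBigO.of_bound C (Filter.Eventually.of_forall fun h => ?_)
    refine (Curves.norm_le (by positivity)).2 fun t => ?_
    refine (norm_taylor_le hf hC (γ t) (h t)).trans ?_
    rw [Real.norm_of_nonneg (by positivity), mul_assoc]
    gcongr <;> exact h.norm_coe_le_norm t
  refine hO.trans_isLittleO ?_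
  have : (fun h : Curves K E => ‖h‖ * ‖h‖) =o[𝓝 0] (fun h => ‖h‖ * 1) := by
    refine (Asymptotics.isBigO_refl _ _).mul_isLittleO ?_
    rw [Asymptotics.isLittleO_one_iff]
    simpa using (continuous_norm (E := Curves K E)).tendsto 0
  simp only [mul_one] at this
  exact this.of_norm_right

/-- Induction on the order, for all targets at once: the derivative of the composition operator is
built from composition with `fderiv ℝ f`, whose target is `E →L[ℝ] F`. -/
lemma contDiff_nat_curveComp [FiniteDimensional ℝ E] (n : ℕ) : ∀ {F : Type u}
    [NormedAddCommGroup F] [NormedSpace ℝ F] {f : E → F} (hf : ContDiff ℝ ∞ f)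
    (_ : HasCompactSupport f), ContDiff ℝ n (curveComp (K := K) f hf.continuous) := by
  induction n with
  | zero =>
    intro F _ _ f hf hs
    exact contDiff_zero.2 (continuous_iff_continuousAt.2 fun γ =>
      (hasFDerivAt_curveComp hf hs γ).continuousAt)
  | succ n ih =>
    intro F _ _ f hf hs
    rw [Nat.cast_succ, contDiff_succ_iff_fderiv]
    refine ⟨fun γ => (hasFDerivAt_curveComp hf hs γ).differentiableAt, by simp, ?_⟩
    rw [funext fun γ => (hasFDerivAt_curveComp (K := K) hf hs γ).fderiv]
    exact ((contDiff_curveApply (K := K) (E := E) (F := F)).of_le (mod_cast le_top)).comp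
      (ih (hf.fderiv_right (m := ∞) (by simp)) (hs.fderiv ℝ))

lemma contDiff_curveComp [FiniteDimensional ℝ E] {f : E → F} (hf : ContDiff ℝ ∞ f)
    (hs : HasCompactSupport f) : ContDiff ℝ ∞ (curveComp (K := K) f hf.continuous) :=
  contDiff_infty.2 fun n => contDiff_nat_curveComp n hf hs

variable [CompleteSpace E]

/-- The Volterra operator `γ ↦ ∫ τ in 0..t, γ τ` on curves parametrized by the unit interval. -/
def volterra : Curves unitInterval E →L[ℝ] Curves unitInterval E :=
  LinearMap.mkContinuous
    -- `projIcc` continues the curve by its end values, so that the integrand is continuous on all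
    -- of `ℝ`.
    { toFun := fun γ => Curves.mk (fun t => ∫ τ in (0 : ℝ)..t, γ (projIcc 0 1 zero_le_one τ)) (by
        have h : Continuous fun s : ℝ => ∫ τ in (0 : ℝ)..s, γ (projIcc 0 1 zero_le_one τ) :=
          intervalIntegral.continuous_primitive (fun a b => Continuous.intervalIntegrable
            (γ.continuous.comp continuous_projIcc) a b) 0
        exact h.comp continuous_subtype_val)
      map_add' := fun γ γ' => by
        ext t
        exact intervalIntegral.integral_add
          ((γ.continuous.comp continuous_projIcc).intervalIntegrable _ _)
          ((γ'.continuous.comp continuous_projIcc).intervalIntegrable _ _)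
      map_smul' := fun c γ => by
        ext t
        exact intervalIntegral.integral_smul c _ } 1
    (fun γ => by
      rw [one_mul]
      refine (Curves.norm_le (norm_nonneg _)).2 fun t => ?_
      refine (intervalIntegral.norm_integral_le_of_norm_le_const (C := ‖γ‖)
        fun τ _ => γ.norm_coe_le_norm _).trans ?_
      have h1 := t.2.1
      have h2 := t.2.2
      rw [sub_zero, abs_of_nonneg h1]
      exact mul_le_of_le_one_right (norm_nonneg _) h2)

lemma volterra_apply (γ : Curves unitInterval E) (t : unitInterval) :
    volterra γ t = ∫ τ in (0 : ℝ)..t, γ (projIcc 0 1 zero_le_one τ) := rfl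

lemma norm_volterra_le (γ : Curves unitInterval E) : ‖volterra γ‖ ≤ ‖γ‖ := by
  simpa using LinearMap.mkContinuous_norm_le _ zero_le_one _ |> fun h =>
    (volterra (E := E)).le_of_opNorm_le h γ

end CurveSpaces

/-! ### Straightening a commuting frame -/

section Straightening

/-- The inverse function theorem at `a` controls the inverse only near `f a`. Restricting the source
to the open set where the derivative is invertible makes the inverse smooth on its whole domain. -/
lemma exists_smooth_localInverse {E F : Type*} [NormedAddCommGroup E] [NormedSpace ℝ E]
    [CompleteSpace E] [NormedAddCommGroup F] [NormedSpace ℝ F] {f : E → F} {U : Set E}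
    (hU : IsOpen U) (hf : ContDiffOn ℝ ∞ f U) {a : E} (ha : a ∈ U) (f' : E ≃L[ℝ] F)
    (hf' : HasFDerivAt f (f' : E →L[ℝ] F) a) :
    ∃ ψ : OpenPartialHomeomorph E F, a ∈ ψ.source ∧ ψ.source ⊆ U ∧ (∀ x, ψ x = f x) ∧
      ContDiffOn ℝ ∞ ψ.symm ψ.target := by
  have hfa : ContDiffAt ℝ ∞ f a := hf.contDiffAt (hU.mem_nhds ha)
  let ψ₀ := hfa.toOpenPartialHomeomorph f hf' (by simp)
  have hcont : ContinuousOn (fderiv ℝ f) U := hf.continuousOn_fderiv_of_isOpen hU (by simp)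
  let W : Set E := U ∩ (fderiv ℝ f) ⁻¹' (range ((↑) : (E ≃L[ℝ] F) → E →L[ℝ] F))
  have hW : IsOpen W := hcont.isOpen_inter_preimage hU ContinuousLinearEquiv.isOpen
  let ψ := ψ₀.restrOpen W hW
  refine ⟨ψ, ⟨hfa.mem_toOpenPartialHomeomorph_source hf' (by simp), ha, f', hf'.fderiv.symm⟩,
    fun x hx => hx.2.1, fun x => rfl, ?_⟩
  intro y hy
  have hx : ψ.symm y ∈ ψ.source := ψ.map_target hy
  obtain ⟨g, hg⟩ := hx.2.2
  have hfx : ContDiffAt ℝ ∞ f (ψ.symm y) := hf.contDiffAt (hU.mem_nhds hx.2.1)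
  refine (ψ.contDiffAt_symm (f₀' := g) hy ?_ hfx).contDiffWithinAt
  rw [hg]
  exact (hfx.differentiableAt (by simp)).hasFDerivAt

variable {E S : Type u} [NormedAddCommGroup E] [NormedSpace ℝ E] [FiniteDimensional ℝ E]
  [NormedAddCommGroup S] [NormedSpace ℝ S]

local instance : CompleteSpace E := FiniteDimensional.complete ℝ E

/-- Curves constant in time, as a linear map. -/
def constCurve (V : Type u) [NormedAddCommGroup V] [NormedSpace ℝ V] :
    V →L[ℝ] Curves unitInterval V :=
  LinearMap.mkContinuous
    { toFun := fun v => Curves.mk (fun _ => v) continuous_const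
      map_add' := fun _ _ => rfl
      map_smul' := fun _ _ => rfl } 1 (fun v => by
        rw [one_mul]
        exact (Curves.norm_le (norm_nonneg _)).2 fun t => le_rfl)

@[simp] lemma constCurve_apply {V : Type u} [NormedAddCommGroup V] [NormedSpace ℝ V] (v : V)
    (t : unitInterval) : constCurve V v t = v := rfl

/-- The Volterra operator has norm at most 1, so the equation gives `‖u‖ ≤ C * ‖s‖ * ‖u‖` with a
factor less than 1. -/
lemma eq_zero_of_volterra_eq {γ : Curves unitInterval (E →L[ℝ] S →L[ℝ] E)} {C : ℝ}
    (hC : ∀ t, ‖γ t‖ ≤ C) {s : S} (hs : C * ‖s‖ < 1) {u : Curves unitInterval E}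
    (hu : u = volterra (curveApply (curveApply γ u) (constCurve S s))) : u = 0 := by
  have hC0 : 0 ≤ C := (norm_nonneg (γ 0)).trans (hC 0)
  have h1 : ‖u‖ ≤ C * ‖s‖ * ‖u‖ := by
    conv_lhs => rw [hu]
    refine (norm_volterra_le _).trans ((Curves.norm_le (by positivity)).2 fun t => ?_)
    simp only [curveApply_apply, constCurve_apply]
    calc ‖(γ t) (u t) s‖ ≤ ‖γ t‖ * ‖u t‖ * ‖s‖ := (γ t).le_opNorm₂ _ _
      _ ≤ C * ‖u‖ * ‖s‖ := by
        gcongr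
        exacts [hC t, u.norm_coe_le_norm t]
      _ = C * ‖s‖ * ‖u‖ := by ring
  by_contra hne
  have : 0 < ‖u‖ := norm_pos_iff.2 hne
  nlinarith

/-- Along a solution `γ` of `γ' = e(γ) s` for a commuting frame `e`, the curve `t • e(γ) v` solves
the linearized equation with inhomogeneity `e(γ) v`. -/
lemma volterra_linearized {e : E → S →L[ℝ] E} (he : ContDiff ℝ ∞ e) {x : E} {s v : S}
    {γ : Curves unitInterval E}
    (hγ : γ = constCurve E x + volterra (curveApply (curveComp e he.continuous γ) (constCurve S s)))
    (hinv : ∀ t, fderiv ℝ e (γ t) (e (γ t) v) s = fderiv ℝ e (γ t) (e (γ t) s) v)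
    {y : Curves unitInterval E} (hy : ∀ t, y t = (t : ℝ) • e (γ t) v) :
    y = volterra (curveApply (curveApply (curveComp (fderiv ℝ e)
      (he.continuous_fderiv (by simp)) γ) y) (constCurve S s) +
      curveApply (curveComp e he.continuous γ) (constCurve S v)) := by
  let pr : ℝ → unitInterval := projIcc 0 1 zero_le_one
  have hpr : Continuous pr := continuous_projIcc
  have hprt : ∀ t : ℝ, t ∈ Icc (0 : ℝ) 1 → ((pr t : unitInterval) : ℝ) = t := fun t ht => by
    simp [pr, projIcc_of_mem zero_le_one ht]
  -- The solution as a primitive on all of `ℝ`: it is differentiable everywhere and equals `γ` on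
  -- the unit interval.
  let g : ℝ → E := fun t => x + ∫ τ in (0 : ℝ)..t, e (γ (pr τ)) s
  have hec : Continuous e := he.continuous
  have hcont : Continuous fun τ => e (γ (pr τ)) s := by fun_prop
  have hg : ∀ t, HasDerivAt g (e (γ (pr t)) s) t := fun t =>
    (hcont.integral_hasStrictDerivAt 0 t).hasDerivAt.const_add x
  have hgγ : ∀ t, t ∈ Icc (0 : ℝ) 1 → g t = γ (pr t) := fun t ht => by
    conv_rhs => rw [hγ]
    simp only [Curves.add_apply, constCurve_apply, volterra_apply, curveApply_apply,
      curveComp_apply, hprt t ht, g]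
    rfl
  have hgc : Continuous g := continuous_iff_continuousAt.2 fun t => (hg t).continuousAt
  -- The product rule produces the inhomogeneity `e(γ) v` and the term `t • De(e(γ) s) v`; `hinv`
  -- then exchanges `s` and `v`, which turns the latter into the linearized equation.
  have hder : ∀ t, HasDerivAt (fun t => t • e (g t) v)
      (t • (fderiv ℝ e (g t) (e (γ (pr t)) s) v) + (1 : ℝ) • e (g t) v) t := fun t => by
    have h1 : HasDerivAt (fun t => e (g t)) (fderiv ℝ e (g t) (e (γ (pr t)) s)) t :=
      ((he.differentiable (by simp)) (g t)).hasFDerivAt.comp_hasDerivAt t (hg t)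
    have h2 : HasDerivAt (fun t => e (g t) v) (fderiv ℝ e (g t) (e (γ (pr t)) s) v) t := by
      simpa using h1.clm_apply (hasDerivAt_const t v)
    exact (hasDerivAt_id t).smul h2
  have hdc : Continuous (fderiv ℝ e) := he.continuous_fderiv (by simp)
  ext t
  have hint := intervalIntegral.integral_eq_sub_of_hasDerivAt (a := 0) (b := (t : ℝ))
    (fun τ _ => hder τ) (Continuous.intervalIntegrable (by fun_prop) _ _)
  rw [hy, volterra_apply]
  have hgt : g t = γ t := by rw [hgγ t t.2]; simp [pr]
  rw [zero_smul, sub_zero, hgt] at hint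
  rw [← hint]
  refine intervalIntegral.integral_congr fun τ hτ => ?_
  rw [uIcc_of_le t.2.1] at hτ
  have hτ' : τ ∈ Icc (0 : ℝ) 1 := ⟨hτ.1, hτ.2.trans t.2.2⟩
  simp only [Curves.add_apply, curveApply_apply, curveComp_apply, constCurve_apply, hy,
    hgγ τ hτ', one_smul, map_smul, smul_apply]
  change _ = (pr τ : ℝ) • _ + _
  rw [hprt τ hτ', hinv]

set_option maxHeartbeats 800000 in
/-- The integral curves `γ' = e(γ) p(x - z₀)`, `γ(0) = z₀ + π (x - z₀)`, depend smoothly on `x`. -/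
lemma exists_smooth_integralCurves {e₁ : E → S →L[ℝ] E} (he₁ : ContDiff ℝ ∞ e₁)
    (hs₁ : HasCompactSupport e₁) (z₀ : E) (p : E →L[ℝ] S) (π : E →L[ℝ] E) :
    ∃ (Ω : Set E) (γ : E → Curves unitInterval E), IsOpen Ω ∧ z₀ ∈ Ω ∧ ContDiffOn ℝ ∞ γ Ω ∧
      γ z₀ = constCurve E z₀ ∧ ∀ x ∈ Ω, γ x = constCurve E (z₀ + π (x - z₀)) +
      volterra (curveApply (curveComp e₁ he₁.continuous (γ x)) (constCurve S (p (x - z₀)))) := by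
  let X := Curves unitInterval E × E
  let m : X → Curves unitInterval E := fun q =>
    curveApply (curveComp e₁ he₁.continuous q.1) (constCurve S (p (q.2 - z₀)))
  -- The first component is the defect of the integral equation, the second carries the parameter
  -- `x`. A local inverse of `G`, evaluated at `(0, x)`, is the solution together with its smooth
  -- dependence on `x`.
  let G : X → X := fun q =>
    (q.1 - constCurve E (z₀ + π (q.2 - z₀)) - volterra (m q), q.2)
  have hm : ContDiff ℝ ∞ m := by
    refine ContDiff.clm_apply ?_ ?_
    · exact contDiff_curveApply.comp
        ((contDiff_curveComp he₁ hs₁).comp contDiff_fst)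
    · exact (constCurve S).contDiff.comp (p.contDiff.comp (contDiff_snd.sub contDiff_const))
  have hG : ContDiff ℝ ∞ G := by
    refine ((contDiff_fst.sub ?_).sub (volterra.contDiff.comp hm)).prodMk contDiff_snd
    exact (constCurve E).contDiff.comp
      (contDiff_const.add (π.contDiff.comp (contDiff_snd.sub contDiff_const)))
  let a : X := (constCurve E z₀, z₀)
  let ℓ : E →L[ℝ] Curves unitInterval E :=
    constCurve E ∘L π + volterra ∘L constCurve E ∘L (e₁ z₀) ∘L p
  -- At the base point the velocity parameter `p (x - z₀)` is zero, which removes the term with the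
  -- derivative of `e₁`. What remains of the derivative of `G` is unipotent, so its inverse is
  -- explicit.
  let G' : X ≃L[ℝ] X := ContinuousLinearEquiv.equivOfInverse
    ((ContinuousLinearMap.fst ℝ _ _ - ℓ ∘L ContinuousLinearMap.snd ℝ _ _).prod
      (ContinuousLinearMap.snd ℝ _ _))
    ((ContinuousLinearMap.fst ℝ _ _ + ℓ ∘L ContinuousLinearMap.snd ℝ _ _).prod
      (ContinuousLinearMap.snd ℝ _ _))
    (fun q => Prod.ext (sub_add_cancel _ _) rfl) (fun q => Prod.ext (add_sub_cancel_right _ _) rfl)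
  have hG' : HasFDerivAt G (G' : X →L[ℝ] X) a := by
    have h1 : HasFDerivAt (fun q : X => curveApply (curveComp e₁ he₁.continuous q.1))
        (curveApply ∘L (curveApply (curveComp (fderiv ℝ e₁) (he₁.continuous_fderiv (by simp)) a.1))
          ∘L ContinuousLinearMap.fst ℝ _ _) a :=
      (hasFDerivAt_curveApply _).comp a
        ((hasFDerivAt_curveComp he₁ hs₁ a.1).comp a hasFDerivAt_fst)
    have h2 : HasFDerivAt (fun q : X => constCurve S (p (q.2 - z₀)))
        (constCurve S ∘L p ∘L ContinuousLinearMap.snd ℝ _ _) a :=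
      (constCurve S).hasFDerivAt.comp a (p.hasFDerivAt.comp a (hasFDerivAt_snd.sub_const _))
    have h3 := volterra.hasFDerivAt.comp a (h1.clm_apply h2)
    have h4 : HasFDerivAt (fun q : X => constCurve E (z₀ + π (q.2 - z₀)))
        (constCurve E ∘L π ∘L ContinuousLinearMap.snd ℝ _ _) a :=
      (constCurve E).hasFDerivAt.comp a
        ((π.hasFDerivAt.comp a (hasFDerivAt_snd.sub_const _)).const_add _)
    have h5 := ((hasFDerivAt_fst.sub h4).sub h3).prodMk (hasFDerivAt_snd (𝕜 := ℝ) (p := a))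
    refine h5.congr_fderiv ?_
    refine ContinuousLinearMap.ext fun q => Prod.ext ?_ rfl
    have hz : p (a.2 - z₀) = 0 := by simp [a]
    have hG'q : (G' q).1 = q.1 - (constCurve E (π q.2) + volterra (constCurve E (e₁ z₀ (p q.2)))) :=
      rfl
    have hc : curveApply (curveComp e₁ he₁.continuous a.1) (constCurve S (p q.2)) =
        constCurve E (e₁ z₀ (p q.2)) := rfl
    refine Eq.trans ?_ hG'q.symm
    change q.1 - constCurve E (π q.2) - volterra
      (curveApply (curveComp e₁ he₁.continuous a.1) (constCurve S (p q.2)) +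
      curveApply (curveApply (curveComp (fderiv ℝ e₁) (he₁.continuous_fderiv (by simp)) a.1) q.1)
        (constCurve S (p (a.2 - z₀)))) = _
    rw [hz, map_zero, map_zero, add_zero, hc, sub_sub]
  obtain ⟨ψ, haψ, -, hψG, hψs⟩ := exists_smooth_localInverse isOpen_univ hG.contDiffOn
    (mem_univ a) G' hG'
  have hGa : G a = (0, z₀) := by
    simp only [G, a, m, sub_self, map_zero, add_zero]
  let Ω : Set E := {x | ((0 : Curves unitInterval E), x) ∈ ψ.target}
  have hΩ : IsOpen Ω := ψ.open_target.preimage (by fun_prop)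
  have hz₀Ω : z₀ ∈ Ω := by
    have := ψ.map_source haψ
    rwa [hψG, hGa] at this
  let γ : E → Curves unitInterval E := fun x => (ψ.symm (0, x)).1
  have hγs : ContDiffOn ℝ ∞ γ Ω := contDiff_fst.comp_contDiffOn
    (hψs.comp (contDiff_const.prodMk contDiff_id).contDiffOn fun x hx => hx)
  have hγz₀ : γ z₀ = constCurve E z₀ := by
    have := ψ.left_inv haψ
    rw [hψG, hGa] at this
    simp only [γ, this, a]
  have hγeq : ∀ x ∈ Ω, γ x = constCurve E (z₀ + π (x - z₀)) +
      volterra (curveApply (curveComp e₁ he₁.continuous (γ x)) (constCurve S (p (x - z₀)))) := by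
    intro x hx
    have h1 := ψ.right_inv hx
    rw [hψG] at h1
    have h2 : (ψ.symm (0, x)).2 = x := congrArg Prod.snd h1
    have h3 := congrArg Prod.fst h1
    simp only [G, m, h2] at h3
    rw [sub_sub, sub_eq_zero] at h3
    exact h3
  exact ⟨Ω, γ, hΩ, hz₀Ω, hγs, hγz₀, hγeq⟩

/-- The derivative of the family of integral curves in the direction of the frame. -/
lemma fderiv_integralCurves {e₁ : E → S →L[ℝ] E} (he₁ : ContDiff ℝ ∞ e₁)
    (hs₁ : HasCompactSupport e₁) {z₀ : E} {p : E →L[ℝ] S} {π : E →L[ℝ] E}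
    (hp : ∀ v, p (e₁ z₀ v) = v) (hπe : ∀ v, π (e₁ z₀ v) = 0)
    {Ω : Set E} (hΩ : IsOpen Ω) {γ : E → Curves unitInterval E}
    (hγeq : ∀ x ∈ Ω, γ x = constCurve E (z₀ + π (x - z₀)) +
      volterra (curveApply (curveComp e₁ he₁.continuous (γ x)) (constCurve S (p (x - z₀)))))
    {x : E} (hx : x ∈ Ω) (hγd : DifferentiableAt ℝ γ x)
    {C : ℝ} (hC : ∀ z, ‖fderiv ℝ e₁ z‖ ≤ C) (hCx : C * ‖p (x - z₀)‖ < 1)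
    (hinv : ∀ t u v, fderiv ℝ e₁ (γ x t) (e₁ (γ x t) u) v = fderiv ℝ e₁ (γ x t) (e₁ (γ x t) v) u)
    (v : S) (t : unitInterval) :
    fderiv ℝ γ x (e₁ z₀ v) t = (t : ℝ) • e₁ (γ x t) v := by
  set w := fderiv ℝ γ x (e₁ z₀ v) with hw
  let s := p (x - z₀)
  let DN := curveComp (fderiv ℝ e₁) (he₁.continuous_fderiv (by simp)) (γ x)
  have hweq : w = volterra (curveApply (curveApply DN w) (constCurve S s) +
      curveApply (curveComp e₁ he₁.continuous (γ x)) (constCurve S v)) := by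
    have h1 : HasFDerivAt (fun y : E => curveApply (curveComp e₁ he₁.continuous (γ y)))
        (curveApply ∘L (curveApply DN) ∘L fderiv ℝ γ x) x :=
      (hasFDerivAt_curveApply _).comp x
        ((hasFDerivAt_curveComp he₁ hs₁ (γ x)).comp x hγd.hasFDerivAt)
    have h2 : HasFDerivAt (fun y : E => constCurve S (p (y - z₀))) (constCurve S ∘L p) x :=
      (constCurve S).hasFDerivAt.comp x (p.hasFDerivAt.comp x ((hasFDerivAt_id x).sub_const _))
    have h3 := volterra.hasFDerivAt.comp x (h1.clm_apply h2)
    have h4 : HasFDerivAt (fun y : E => constCurve E (z₀ + π (y - z₀))) (constCurve E ∘L π) x :=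
      (constCurve E).hasFDerivAt.comp x
        ((π.hasFDerivAt.comp x ((hasFDerivAt_id x).sub_const _)).const_add _)
    have h5 := (h4.add h3).congr_of_eventuallyEq
      (Filter.eventuallyEq_of_mem (hΩ.mem_nhds hx) hγeq)
    have h6 := congrArg (fun L : E →L[ℝ] Curves unitInterval E => L (e₁ z₀ v)) h5.fderiv
    rw [hw]
    refine h6.trans ?_
    simp only [add_apply, ContinuousLinearMap.comp_apply, hπe, map_zero, zero_add,
      ContinuousLinearMap.flip_apply, hp]
    rw [add_comm]
  -- By the commutation hypothesis `y` solves the same inhomogeneous linear Volterra equation as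
  -- `w`; the difference solves the homogeneous one and vanishes.
  let y : Curves unitInterval E := Curves.mk (fun t => (t : ℝ) • e₁ (γ x t) v) (by
    have := he₁.continuous
    fun_prop)
  have hyeq := volterra_linearized he₁ (s := s) (v := v) (hγeq x hx) (fun t => hinv t v s) (y := y) (fun t => rfl)
  have hzero : w - y = 0 := by
    refine eq_zero_of_volterra_eq (γ := DN) (s := s) (fun t => hC _) hCx ?_
    conv_lhs => rw [hweq, hyeq]
    rw [← map_sub]
    congr 1
    simp only [map_sub, sub_apply]
    abel
  exact congrArg (fun g : Curves unitInterval E => g t) (sub_eq_zero.1 hzero)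

/-- Integral curves with vanishing velocity are constant. -/
lemma integralCurves_fderiv_ker {e₁ : E → S →L[ℝ] E} (he₁ : ContDiff ℝ ∞ e₁)
    {z₀ : E} {p : E →L[ℝ] S} {π : E →L[ℝ] E}
    {Ω : Set E} (hΩ : IsOpen Ω) (hz₀Ω : z₀ ∈ Ω) {γ : E → Curves unitInterval E}
    (hγeq : ∀ x ∈ Ω, γ x = constCurve E (z₀ + π (x - z₀)) +
      volterra (curveApply (curveComp e₁ he₁.continuous (γ x)) (constCurve S (p (x - z₀)))))
    (hd : DifferentiableAt ℝ (fun x => γ x 1) z₀) {k : E} (hk : p k = 0) (hπk : π k = k) :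
    fderiv ℝ (fun x => γ x 1) z₀ k = k := by
  have hl : HasDerivAt (fun τ : ℝ => z₀ + τ • k) k 0 := by
    simpa using ((hasDerivAt_id (0 : ℝ)).smul_const k).const_add z₀
  have hl0 : z₀ + (0 : ℝ) • k = z₀ := by simp
  have h2 : HasDerivAt (fun τ : ℝ => γ (z₀ + τ • k) 1) (fderiv ℝ (fun x => γ x 1) z₀ k) 0 :=
    HasFDerivAt.comp_hasDerivAt_of_eq (0 : ℝ) hd.hasFDerivAt hl hl0.symm
  have h3 : (fun τ : ℝ => γ (z₀ + τ • k) 1) =ᶠ[𝓝 0] fun τ => z₀ + τ • k := by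
    have : ∀ᶠ τ : ℝ in 𝓝 0, z₀ + τ • k ∈ Ω :=
      hl.continuousAt.eventually (by simpa using hΩ.mem_nhds hz₀Ω)
    filter_upwards [this] with τ hτ
    have := hγeq _ hτ
    simp only [add_sub_cancel_left, map_smul, hk, smul_zero, hπk, map_zero, add_zero] at this
    simp only [this]
    simp
  exact h2.unique (hl.congr_of_eventuallyEq h3)

/-- Composition operators need globally defined maps of compact support. The cut-off agrees with `e`
near every point of a ball, so derivatives agree there too. -/
lemma exists_cutoff {F : Type*} [NormedAddCommGroup F] [NormedSpace ℝ F] {e : E → F} {O : Set E}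
    (hO : IsOpen O) (he : ContDiffOn ℝ ∞ e O) {z₀ : E} (hz₀ : z₀ ∈ O) :
    ∃ (e₁ : E → F) (r : ℝ), 0 < r ∧ ContDiff ℝ ∞ e₁ ∧ HasCompactSupport e₁ ∧
      Metric.ball z₀ r ⊆ O ∧ ∀ z ∈ Metric.ball z₀ r, e₁ =ᶠ[𝓝 z] e := by
  obtain ⟨R, hR, hRO⟩ := Metric.isOpen_iff.1 hO z₀ hz₀
  let b : ContDiffBump z₀ := ⟨R / 4, R / 2, by positivity, by linarith⟩
  let e₁ : E → F := fun z => b z • e z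
  have hbs : tsupport b ⊆ O := by
    rw [b.tsupport_eq]
    exact (Metric.closedBall_subset_ball (by change R / 2 < R; linarith)).trans hRO
  have he₁ : ContDiff ℝ ∞ e₁ := by
    rw [contDiff_iff_contDiffAt]
    intro z
    by_cases hz : z ∈ tsupport b
    · exact b.contDiff.contDiffAt.smul (he.contDiffAt (hO.mem_nhds (hbs hz)))
    · have : e₁ =ᶠ[𝓝 z] fun _ => 0 := by
        filter_upwards [(isClosed_tsupport b).isOpen_compl.mem_nhds hz] with y hy
        simp [e₁, image_eq_zero_of_notMem_tsupport hy]
      exact contDiffAt_const.congr_of_eventuallyEq this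
  have hs₁ : HasCompactSupport e₁ := b.hasCompactSupport.smul_right
  have heq : ∀ z ∈ Metric.ball z₀ (R / 4), e₁ =ᶠ[𝓝 z] e := fun z hz => by
    filter_upwards [Metric.isOpen_ball.mem_nhds hz] with y hy
    simp [e₁, b.one_of_mem_closedBall (Metric.ball_subset_closedBall hy)]
  have hBO : Metric.ball z₀ (R / 4) ⊆ O :=
    (Metric.ball_subset_ball (by linarith)).trans hRO
  exact ⟨e₁, R / 4, by positivity, he₁, hs₁, hBO, heq⟩

set_option maxHeartbeats 400000 in
/-- A commuting frame `e` (given by a projection `p` with `p ∘ e = id`) can be straightened. -/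
theorem exists_straightening {e : E → S →L[ℝ] E} {O : Set E} (hO : IsOpen O)
    (he : ContDiffOn ℝ ∞ e O) {z₀ : E} (hz₀ : z₀ ∈ O) (p : E →L[ℝ] S)
    (hp : ∀ v, p (e z₀ v) = v)
    (hinv : ∀ z ∈ O, ∀ u v, fderiv ℝ e z (e z u) v = fderiv ℝ e z (e z v) u) :
    ∃ Φ : OpenPartialHomeomorph E E, z₀ ∈ Φ.source ∧ Φ.target ⊆ O ∧ Φ z₀ = z₀ ∧
      ContDiffOn ℝ ∞ Φ Φ.source ∧ ContDiffOn ℝ ∞ Φ.symm Φ.target ∧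
      ∀ x ∈ Φ.source, ∀ v, fderiv ℝ Φ x (e z₀ v) = e (Φ x) v := by
  obtain ⟨e₁, r, hr, he₁, hs₁, hBO, heq⟩ := exists_cutoff hO he hz₀
  have hz₀B : z₀ ∈ Metric.ball z₀ r := Metric.mem_ball_self hr
  have he₁z₀ : e₁ z₀ = e z₀ := (heq z₀ hz₀B).self_of_nhds
  obtain ⟨C, hC⟩ : ∃ C, ∀ z, ‖fderiv ℝ e₁ z‖ ≤ C :=
    (he₁.continuous_fderiv (by simp)).bounded_above_of_compact_support (hs₁.fderiv ℝ)
  -- The projection to `ker p` along the range of `e z₀`. A point `x` is thereby split into a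
  -- starting point `z₀ + π (x - z₀)` and a velocity `p (x - z₀)`.
  obtain ⟨π, hπ⟩ : ∃ π : E →L[ℝ] E, ∀ y, π y = y - e z₀ (p y) :=
    ⟨ContinuousLinearMap.id ℝ E - (e z₀) ∘L p, fun _ => rfl⟩
  have hπe : ∀ v, π (e z₀ v) = 0 := fun v => by rw [hπ, hp, sub_self]
  obtain ⟨Ω, γ, hΩ, hz₀Ω, hγs, hγz₀, hγeq⟩ := exists_smooth_integralCurves he₁ hs₁ z₀ p π
  -- the region where everything is controlled
  let Ω₁ : Set E := Ω ∩ γ ⁻¹' Metric.ball (constCurve E z₀) r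
  have hΩ₁ : IsOpen Ω₁ := hγs.continuousOn.isOpen_inter_preimage hΩ Metric.isOpen_ball
  -- Smallness of the velocity makes the linearized Volterra operator a contraction.
  let Ω₂ : Set E := Ω₁ ∩ {x | C * ‖p (x - z₀)‖ < 1}
  have hΩ₂ : IsOpen Ω₂ := hΩ₁.inter (isOpen_lt (by fun_prop) continuous_const)
  have hz₀Ω₂ : z₀ ∈ Ω₂ := by
    refine ⟨⟨hz₀Ω, ?_⟩, by simp⟩
    rw [mem_preimage, hγz₀]
    exact Metric.mem_ball_self hr
  have hγB : ∀ x ∈ Ω₂, ∀ t, γ x t ∈ Metric.ball z₀ r := fun x hx t => by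
    have h1 : dist (γ x) (constCurve E z₀) < r := hx.1.2
    rw [dist_eq_norm] at h1
    rw [Metric.mem_ball, dist_eq_norm]
    exact ((γ x - constCurve E z₀).norm_coe_le_norm t).trans_lt h1
  let Φ₀ : E → E := fun x => γ x 1
  let ev : Curves unitInterval E →L[ℝ] E := LinearMap.mkContinuous
    { toFun := fun g => g 1, map_add' := fun _ _ => rfl, map_smul' := fun _ _ => rfl } 1
    (fun g => by rw [one_mul]; exact g.norm_coe_le_norm 1)
  have hΦ₀ : ContDiffOn ℝ ∞ Φ₀ Ω₂ :=
    ev.contDiff.comp_contDiffOn (hγs.mono fun x hx => hx.1.1)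
  have hder : ∀ x ∈ Ω₂, ∀ v, fderiv ℝ Φ₀ x (e z₀ v) = e (Φ₀ x) v := by
    intro x hx v
    have hγd : DifferentiableAt ℝ γ x :=
      (hγs.contDiffAt (hΩ.mem_nhds hx.1.1)).differentiableAt (by simp)
    have hΦd : fderiv ℝ Φ₀ x (e z₀ v) = fderiv ℝ γ x (e z₀ v) 1 := by
      have : HasFDerivAt Φ₀ (ev ∘L fderiv ℝ γ x) x := ev.hasFDerivAt.comp x hγd.hasFDerivAt
      rw [this.fderiv]; rfl
    rw [hΦd, ← he₁z₀, fderiv_integralCurves he₁ hs₁ (by simpa [he₁z₀] using hp)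
      (by simpa [he₁z₀] using hπe) hΩ hγeq hx.1.1 hγd hC hx.2 (fun t u v => by
        have h1 := heq _ (hγB x hx t)
        rw [h1.fderiv_eq, h1.self_of_nhds]
        exact hinv _ (hBO (hγB x hx t)) u v)]
    change ((1 : unitInterval) : ℝ) • e₁ (γ x 1) v = _
    rw [(heq _ (hγB x hx 1)).self_of_nhds]
    simp [Φ₀]
  have hΦ₀z₀ : Φ₀ z₀ = z₀ := by simp [Φ₀, hγz₀]
  -- The derivative at `z₀` is the identity on the range of `e z₀` by `hder`, and on `ker p` because
  -- the curves with zero velocity are constant.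
  have hder₀ : HasFDerivAt Φ₀ ((ContinuousLinearEquiv.refl ℝ E : E ≃L[ℝ] E) : E →L[ℝ] E) z₀ := by
    have hd : DifferentiableAt ℝ Φ₀ z₀ :=
      (hΦ₀.contDiffAt (hΩ₂.mem_nhds hz₀Ω₂)).differentiableAt (by simp)
    refine hd.hasFDerivAt.congr_fderiv ?_
    ext y
    have hy : y = e z₀ (p y) + π y := by rw [hπ]; abel
    have hpπ : p (π y) = 0 := by rw [hπ, map_sub, hp, sub_self]
    have hππ : π (π y) = π y := by rw [hπ (π y), hpπ, map_zero, sub_zero]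
    have h1 : fderiv ℝ Φ₀ z₀ (π y) = π y :=
      integralCurves_fderiv_ker he₁ hΩ hz₀Ω hγeq hd hpπ hππ
    conv_lhs => rw [hy, map_add, hder _ hz₀Ω₂, h1, hΦ₀z₀]
    simpa using hy.symm
  let Ω₃ : Set E := Ω₂ ∩ Φ₀ ⁻¹' O
  have hΩ₃ : IsOpen Ω₃ := hΦ₀.continuousOn.isOpen_inter_preimage hΩ₂ hO
  obtain ⟨Φ, hzΦ, hΦΩ, hΦeq, hΦs⟩ := exists_smooth_localInverse hΩ₃
    (hΦ₀.mono inter_subset_left) ⟨hz₀Ω₂, by simpa [hΦ₀z₀] using hz₀⟩ _ hder₀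
  have hΦfun : (Φ : E → E) = Φ₀ := funext hΦeq
  refine ⟨Φ, hzΦ, fun y hy => ?_, ?_, ?_, hΦs, ?_⟩
  · have := (hΦΩ (Φ.map_target hy)).2
    simp only [mem_preimage, ← hΦeq] at this
    rwa [Φ.right_inv hy] at this
  · rw [hΦeq, hΦ₀z₀]
  · rw [hΦfun]
    exact hΦ₀.mono fun x hx => (hΦΩ hx).1
  · intro x hx v
    rw [hΦfun]
    exact hder x (hΦΩ hx).1 v

/-- **Frobenius theorem.** An involutive frame `X` of rank `dim S` can be mapped into the kernel of
a linear map `q` by a local diffeomorphism onto a convex set. -/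
theorem exists_frobenius_chart {F : Type*} [NormedAddCommGroup F] [NormedSpace ℝ F]
    [FiniteDimensional ℝ F] [FiniteDimensional ℝ S]
    {X : E → S →L[ℝ] E} {O : Set E} (hO : IsOpen O) (hX : ContDiffOn ℝ ∞ X O) {z₀ : E}
    (hz₀ : z₀ ∈ O) (hinj : Function.Injective (X z₀))
    (hbr : ∀ z ∈ O, ∀ u v, ∃ w, fderiv ℝ X z (X z u) v - fderiv ℝ X z (X z v) u = X z w)
    (hdim : finrank ℝ E = finrank ℝ S + finrank ℝ F) :
    ∃ (Ψ : OpenPartialHomeomorph E E) (q : E →L[ℝ] F), z₀ ∈ Ψ.source ∧ Ψ.source ⊆ O ∧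
      Convex ℝ Ψ.target ∧ ContDiffOn ℝ ∞ Ψ Ψ.source ∧ ContDiffOn ℝ ∞ Ψ.symm Ψ.target ∧
      Function.Surjective q ∧ ∀ z ∈ Ψ.source, ∀ s, q (fderiv ℝ Ψ z (X z s)) = 0 := by
  have : CompleteSpace S := FiniteDimensional.complete ℝ S
  obtain ⟨p₀, hp₀⟩ := (X z₀ : S →ₗ[ℝ] E).exists_leftInverse_of_injective
    (LinearMap.ker_eq_bot.2 hinj)
  let p : E →L[ℝ] S := LinearMap.toContinuousLinearMap p₀
  have hp : ∀ s, p (X z₀ s) = s := fun s => LinearMap.congr_fun hp₀ s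
  let M : E → S →L[ℝ] S := fun z => p ∘L X z
  have hM : ContDiffOn ℝ ∞ M O := contDiffOn_const.clm_comp hX
  let O' : Set E := O ∩ M ⁻¹' (range ((↑) : (S ≃L[ℝ] S) → S →L[ℝ] S))
  have hO' : IsOpen O' := hM.continuousOn.isOpen_inter_preimage hO ContinuousLinearEquiv.isOpen
  have hz₀' : z₀ ∈ O' := ⟨hz₀, ContinuousLinearEquiv.refl ℝ S, by ext s; simp [M, hp]⟩
  -- The frame with the same span as `X`, normalised by `p ∘ e = id`.
  let e : E → S →L[ℝ] E := fun z => X z ∘L (M z).inverse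
  have he : ContDiffOn ℝ ∞ e O' := by
    refine (hX.mono inter_subset_left).clm_comp fun z hz => ?_
    have h1 : ContDiffAt ℝ ∞ ContinuousLinearMap.inverse (M z) :=
      ContinuousLinearMap.IsInvertible.contDiffAt_map_inverse hz.2
    exact h1.comp_contDiffWithinAt z ((hM.mono inter_subset_left) z hz)
  have hMinv : ∀ z ∈ O', ∀ s, M z ((M z).inverse s) = s := fun z hz s => by
    obtain ⟨g, hg⟩ := hz.2
    rw [← hg, ContinuousLinearMap.inverse_equiv]
    exact g.apply_symm_apply s
  have hMinv' : ∀ z ∈ O', ∀ s, (M z).inverse (M z s) = s := fun z hz s => by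
    obtain ⟨g, hg⟩ := hz.2
    rw [← hg, ContinuousLinearMap.inverse_equiv]
    exact g.symm_apply_apply s
  have hpe : ∀ z ∈ O', ∀ v, p (e z v) = v := fun z hz v => hMinv z hz v
  have hXe : ∀ z ∈ O', ∀ s, X z s = e z (M z s) := fun z hz s => by
    simp only [e, ContinuousLinearMap.comp_apply, hMinv' z hz]
  -- The bracket of two fields of the normalised frame lies in the range of `e` by involutivity, and
  -- `p` kills it because `p ∘ e` is constant. As `p` is injective on the range of `e`, the bracket
  -- is zero.
  have hinv : ∀ z ∈ O', ∀ u v, fderiv ℝ e z (e z u) v = fderiv ℝ e z (e z v) u := by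
    intro z hz u v
    have hed : DifferentiableAt ℝ e z := (he.contDiffAt (hO'.mem_nhds hz)).differentiableAt (by simp)
    have hMd : DifferentiableAt ℝ M z := (hM.contDiffAt (hO.mem_nhds hz.1)).differentiableAt (by simp)
    have hXd : ∀ x s, fderiv ℝ X z x s = fderiv ℝ e z x (M z s) + e z (fderiv ℝ M z x s) := by
      intro x s
      have h1 : X =ᶠ[𝓝 z] fun y => e y ∘L M y := by
        filter_upwards [hO'.mem_nhds hz] with y hy
        ext s
        exact hXe y hy s
      rw [h1.fderiv_eq, (hed.hasFDerivAt.clm_comp hMd.hasFDerivAt).fderiv]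
      simp [add_comm]
    have hpd : ∀ x s, p (fderiv ℝ e z x s) = 0 := by
      intro x s
      have h1 : (fun y => p ∘L e y) =ᶠ[𝓝 z] fun _ => ContinuousLinearMap.id ℝ S := by
        filter_upwards [hO'.mem_nhds hz] with y hy
        ext s
        exact hpe y hy s
      have h2 := h1.fderiv_eq (𝕜 := ℝ)
      have h0 : HasFDerivAt (fun _ : E => p) (0 : E →L[ℝ] E →L[ℝ] S) z := hasFDerivAt_const p z
      rw [(h0.clm_comp hed.hasFDerivAt).fderiv] at h2
      simpa using congrArg (fun L : E →L[ℝ] S →L[ℝ] S => L x s) h2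
    obtain ⟨w, hw⟩ := hbr z hz.1 ((M z).inverse u) ((M z).inverse v)
    rw [hXd, hXd, hMinv z hz, hMinv z hz, hXe z hz w, hXe z hz, hXe z hz, hMinv z hz,
      hMinv z hz] at hw
    have h3 := congrArg p hw
    simp only [map_sub, map_add, hpd, hpe z hz, zero_add] at h3
    rw [← h3, map_sub] at hw
    rw [← sub_eq_zero]
    rw [← sub_eq_zero] at hw
    rw [← hw]
    abel
  obtain ⟨Φ, hzΦ, hΦO, hΦz₀, hΦ, hΦs, hΦe⟩ := exists_straightening hO' he hz₀' p
    (hpe z₀ hz₀') hinv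
  -- The source is shrunk to a ball, so that the target of the inverse is convex.
  obtain ⟨r, hr, hrΦ⟩ := Metric.isOpen_iff.1 Φ.open_source z₀ hzΦ
  let Φ' := Φ.restrOpen (Metric.ball z₀ r) Metric.isOpen_ball
  have hΦ's : Φ'.source = Metric.ball z₀ r := by
    rw [Φ.restrOpen_source]; exact inter_eq_right.2 hrΦ
  -- a linear map with kernel spanned by the frame at `z₀`
  have hrank : finrank ℝ (E ⧸ LinearMap.range (X z₀ : S →ₗ[ℝ] E)) = finrank ℝ F := by
    have h1 := Submodule.finrank_quotient_add_finrank (LinearMap.range (X z₀ : S →ₗ[ℝ] E))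
    rw [LinearMap.finrank_range_of_inj hinj] at h1
    omega
  let ι := LinearEquiv.ofFinrankEq _ _ hrank
  let q : E →L[ℝ] F := LinearMap.toContinuousLinearMap
    ((ι : _ →ₗ[ℝ] F) ∘ₗ (LinearMap.range (X z₀ : S →ₗ[ℝ] E)).mkQ)
  have hqX : ∀ s, q (X z₀ s) = 0 := fun s => by
    change ι ((LinearMap.range (X z₀ : S →ₗ[ℝ] E)).mkQ (X z₀ s)) = 0
    have h0 : (LinearMap.range (X z₀ : S →ₗ[ℝ] E)).mkQ (X z₀ s) = 0 :=
      (Submodule.Quotient.mk_eq_zero _).2 ⟨s, rfl⟩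
    rw [h0, map_zero]
  refine ⟨Φ'.symm, q, ?_, ?_, ?_, ?_, ?_, ?_, ?_⟩
  · rw [← hΦz₀]
    exact Φ'.map_source (by rw [hΦ's]; exact Metric.mem_ball_self hr)
  · exact fun y hy => (hΦO hy.1).1
  · change Convex ℝ Φ'.source
    rw [hΦ's]
    exact convex_ball _ _
  · exact hΦs.mono fun y hy => hy.1
  · exact hΦ.mono fun y hy => hy.1
  · exact ι.surjective.comp (Submodule.mkQ_surjective _)
  · intro z hz s
    have hzt : z ∈ Φ.target := hz.1
    have hx : Φ.symm z ∈ Φ.source := Φ.map_target hzt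
    have hzO := hΦO hzt
    have h1 : HasFDerivAt Φ (fderiv ℝ Φ (Φ.symm z)) (Φ.symm z) :=
      ((hΦ.contDiffAt (Φ.open_source.mem_nhds hx)).differentiableAt (by simp)).hasFDerivAt
    have h2 : HasFDerivAt Φ.symm (fderiv ℝ Φ.symm z) (Φ (Φ.symm z)) := by
      rw [Φ.right_inv hzt]
      exact ((hΦs.contDiffAt (Φ.open_target.mem_nhds hzt)).differentiableAt (by simp)).hasFDerivAt
    have h3 := (h2.comp _ h1).fderiv
    have h4 : (Φ.symm ∘ Φ) =ᶠ[𝓝 (Φ.symm z)] id := by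
      filter_upwards [Φ.open_source.mem_nhds hx] with y hy using Φ.left_inv hy
    rw [h4.fderiv_eq, fderiv_id] at h3
    -- `Φ.symm` carries `X z s` back to the value at `z₀` of a frame field, which is killed by `q`.
    have h5 := congrArg (fun L : E →L[ℝ] E => L (e z₀ (M z s))) h3
    simp only [ContinuousLinearMap.comp_apply, ContinuousLinearMap.id_apply,
      hΦe _ hx, Φ.right_inv hzt] at h5
    rw [hXe z hzO]
    change q (fderiv ℝ Φ.symm z _) = 0
    rw [← h5]
    exact hqX _

end Straightening

end

/-! ### Transport of vector fields, brackets and functions to the model space -/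

section

variable {N : ℕ} {M : Type u} [TopologicalSpace M] [ChartedSpace (EuclideanSpace ℝ (Fin N)) M]

/-! ### Vector fields in a chart -/

/-- The model space. -/
abbrev Eu (N : ℕ) : Type := EuclideanSpace ℝ (Fin N)

/-- The derivative of a chart, with values in the model space. -/
def tg (φ : OpenPartialHomeomorph M (Eu N)) (x : M) : TangentSpace (𝓡 N) x →L[ℝ] Eu N :=
  mfderiv (𝓡 N) 𝓘(ℝ, Eu N) φ x

/-- The inverse of the derivative of a chart. -/
def tgInv (φ : OpenPartialHomeomorph M (Eu N)) (x : M) : Eu N →L[ℝ] TangentSpace (𝓡 N) x :=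
  (tg φ x).inverse

/-- The vector field `Y` in the chart `φ`. -/
def coord (φ : OpenPartialHomeomorph M (Eu N)) (Y : VField N M) (z : Eu N) : Eu N :=
  tg φ (φ.symm z) (Y (φ.symm z))

/-- The vector field which is given by `f` in the chart `φ`. -/
def field (φ : OpenPartialHomeomorph M (Eu N)) (f : Eu N → Eu N) : VField N M :=
  fun x => tgInv φ x (f (φ x))

variable [IsManifold (𝓡 N) ∞ M] {φ : OpenPartialHomeomorph M (Eu N)}

lemma contMDiffOn_chart (hφ : φ ∈ IsManifold.maximalAtlas (𝓡 N) ∞ M) :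
    ContMDiffOn (𝓡 N) 𝓘(ℝ, Eu N) ∞ φ φ.source := contMDiffOn_of_mem_maximalAtlas hφ

lemma contMDiffOn_chart_symm (hφ : φ ∈ IsManifold.maximalAtlas (𝓡 N) ∞ M) :
    ContMDiffOn 𝓘(ℝ, Eu N) (𝓡 N) ∞ φ.symm φ.target := contMDiffOn_symm_of_mem_maximalAtlas hφ

lemma mdifferentiable_chart' (hφ : φ ∈ IsManifold.maximalAtlas (𝓡 N) ∞ M) :
    φ.MDifferentiable (𝓡 N) 𝓘(ℝ, Eu N) :=
  ⟨(contMDiffOn_chart hφ).mdifferentiableOn (by simp),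
    (contMDiffOn_chart_symm hφ).mdifferentiableOn (by simp)⟩

/-- The derivative of a chart as an equivalence. -/
lemma exists_tg_equiv (hφ : φ ∈ IsManifold.maximalAtlas (𝓡 N) ∞ M) {x : M} (hx : x ∈ φ.source) :
    ∃ g : TangentSpace (𝓡 N) x ≃L[ℝ] Eu N, (g : TangentSpace (𝓡 N) x →L[ℝ] Eu N) = tg φ x ∧
      (g.symm : Eu N →L[ℝ] TangentSpace (𝓡 N) x) = tgInv φ x := by
  let g : TangentSpace (𝓡 N) x ≃L[ℝ] Eu N := (mdifferentiable_chart' hφ).mfderiv hx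
  have hg : (g : TangentSpace (𝓡 N) x →L[ℝ] Eu N) = tg φ x := rfl
  refine ⟨g, hg, ?_⟩
  rw [tgInv, ← hg, ContinuousLinearMap.inverse_equiv]

lemma tg_tgInv (hφ : φ ∈ IsManifold.maximalAtlas (𝓡 N) ∞ M) {x : M} (hx : x ∈ φ.source)
    (w : Eu N) : tg φ x (tgInv φ x w) = w := by
  obtain ⟨g, h1, h2⟩ := exists_tg_equiv hφ hx
  rw [← h1, ← h2]
  exact g.apply_symm_apply w

lemma tgInv_tg (hφ : φ ∈ IsManifold.maximalAtlas (𝓡 N) ∞ M) {x : M} (hx : x ∈ φ.source)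
    (v : TangentSpace (𝓡 N) x) : tgInv φ x (tg φ x v) = v := by
  obtain ⟨g, h1, h2⟩ := exists_tg_equiv hφ hx
  rw [← h1, ← h2]
  exact g.symm_apply_apply v

lemma coord_field (hφ : φ ∈ IsManifold.maximalAtlas (𝓡 N) ∞ M) (f : Eu N → Eu N) {z : Eu N}
    (hz : z ∈ φ.target) : coord φ (field φ f) z = f z := by
  rw [coord, field, tg_tgInv hφ (φ.map_target hz), φ.right_inv hz]

lemma coord_apply (Y : VField N M) {x : M} (hx : x ∈ φ.source) :
    coord φ Y (φ x) = tg φ x (Y x) := by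
  rw [coord, φ.left_inv hx]

lemma field_coord (hφ : φ ∈ IsManifold.maximalAtlas (𝓡 N) ∞ M) (Y : VField N M) {x : M}
    (hx : x ∈ φ.source) : field φ (coord φ Y) x = Y x := by
  rw [field, coord_apply Y hx, tgInv_tg hφ hx]

lemma isInvertible_mfderiv_chart_symm (hφ : φ ∈ IsManifold.maximalAtlas (𝓡 N) ∞ M) {z : Eu N}
    (hz : z ∈ φ.target) : (mfderiv 𝓘(ℝ, Eu N) (𝓡 N) φ.symm z).IsInvertible :=
  ⟨(mdifferentiable_chart' hφ).symm.mfderiv hz, rfl⟩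

/-- The derivatives of `φ` and `φ.symm` are inverse to each other. This makes the general results on
pullbacks of vector fields (regularity, naturality of the bracket) available for `coord`. -/
lemma mpullback_chart_symm (hφ : φ ∈ IsManifold.maximalAtlas (𝓡 N) ∞ M) (Y : VField N M) {z : Eu N}
    (hz : z ∈ φ.target) :
    VectorField.mpullback 𝓘(ℝ, Eu N) (𝓡 N) φ.symm Y z = coord φ Y z := by
  have h := (mdifferentiable_chart' hφ).comp_symm_deriv hz
  rw [VectorField.mpullback_apply]
  obtain ⟨g, hg⟩ := isInvertible_mfderiv_chart_symm hφ hz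
  rw [← hg, ContinuousLinearMap.inverse_equiv]
  change g.symm (Y (φ.symm z)) = _
  rw [← hg] at h
  have h1 := congrArg (fun L => L (g.symm (Y (φ.symm z)))) h
  simp only [ContinuousLinearMap.comp_apply] at h1
  have h2 : (g : _ →L[ℝ] _) (g.symm (Y (φ.symm z))) = Y (φ.symm z) := g.apply_symm_apply _
  rw [h2] at h1
  exact h1.symm

lemma isInvertible_mfderiv_chart (hφ : φ ∈ IsManifold.maximalAtlas (𝓡 N) ∞ M) {x : M}
    (hx : x ∈ φ.source) : (mfderiv (𝓡 N) 𝓘(ℝ, Eu N) φ x).IsInvertible :=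
  ⟨(mdifferentiable_chart' hφ).mfderiv hx, rfl⟩

lemma contMDiffAt_coord (hφ : φ ∈ IsManifold.maximalAtlas (𝓡 N) ∞ M) {Y : VField N M} {x : M}
    (hx : x ∈ φ.source) (hY : ContMDiffAt (𝓡 N) (𝓡 N).tangent ∞
      (fun x => Bundle.TotalSpace.mk' (Eu N) (E := (TangentSpace (𝓡 N) : M → Type)) x (Y x)) x) :
    ContDiffAt ℝ ∞ (coord φ Y) (φ x) := by
  have hz := φ.map_source hx
  have h1 : ContMDiffAt 𝓘(ℝ, Eu N) (𝓡 N) ∞ φ.symm (φ x) :=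
    (contMDiffOn_chart_symm hφ).contMDiffAt (φ.open_target.mem_nhds hz)
  have h2 := ContMDiffAt.mpullback_vectorField_preimage (V := Y) (f := φ.symm) (x₀ := φ x) (m := ∞)
    (by rw [φ.left_inv hx]; exact hY) h1 (isInvertible_mfderiv_chart_symm hφ hz) (by simp)
  have h3 := contMDiffAt_vectorSpace_iff_contDiffAt.1 h2
  refine h3.congr_of_eventuallyEq ?_
  filter_upwards [φ.open_target.mem_nhds hz] with y hy
  exact (mpullback_chart_symm hφ Y hy).symm

lemma mdifferentiableAt_coord (hφ : φ ∈ IsManifold.maximalAtlas (𝓡 N) ∞ M) {Y : VField N M} {x : M}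
    (hx : x ∈ φ.source) (hY : DiffFieldAt Y x) : DifferentiableAt ℝ (coord φ Y) (φ x) := by
  have hz := φ.map_source hx
  have h1 : ContMDiffAt 𝓘(ℝ, Eu N) (𝓡 N) ∞ φ.symm (φ x) :=
    (contMDiffOn_chart_symm hφ).contMDiffAt (φ.open_target.mem_nhds hz)
  have h2 := MDifferentiableAt.mpullback_vectorField (V := Y) (f := φ.symm) (x₀ := φ x) (n := 2)
    (by rw [φ.left_inv hx]; exact hY) (h1.of_le (by norm_cast))
    (isInvertible_mfderiv_chart_symm hφ hz) le_rfl
  have h3 : DifferentiableAt ℝ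
      (VectorField.mpullback 𝓘(ℝ, Eu N) (𝓡 N) φ.symm Y : Eu N → Eu N) (φ x) := by
    apply MDifferentiableAt.differentiableAt
    exact ((contMDiff_snd_tangentBundle_modelSpace (n := ∞) (Eu N)
      𝓘(ℝ, Eu N)).contMDiffAt.mdifferentiableAt (by simp)).comp _ h2
  refine h3.congr_of_eventuallyEq ?_
  filter_upwards [φ.open_target.mem_nhds hz] with y hy
  exact (mpullback_chart_symm hφ Y hy).symm

lemma contMDiffAt_field (hφ : φ ∈ IsManifold.maximalAtlas (𝓡 N) ∞ M) {f : Eu N → Eu N} {x : M}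
    (hx : x ∈ φ.source) (hf : ContDiffAt ℝ ∞ f (φ x)) : ContMDiffAt (𝓡 N) (𝓡 N).tangent ∞
      (fun x => Bundle.TotalSpace.mk' (Eu N) (E := (TangentSpace (𝓡 N) : M → Type)) x
        (field φ f x)) x := by
  have h1 : ContMDiffAt (𝓡 N) 𝓘(ℝ, Eu N) ∞ φ x :=
    (contMDiffOn_chart hφ).contMDiffAt (φ.open_source.mem_nhds hx)
  exact ContMDiffAt.mpullback_vectorField_preimage (m := ∞)
    (contMDiffAt_vectorSpace_iff_contDiffAt (V := f) |>.2 hf) h1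
    (isInvertible_mfderiv_chart hφ hx) (by simp)

lemma diffFieldAt_field (hφ : φ ∈ IsManifold.maximalAtlas (𝓡 N) ∞ M) {f : Eu N → Eu N} {x : M}
    (hx : x ∈ φ.source) (hf : DifferentiableAt ℝ f (φ x)) : DiffFieldAt (field φ f) x := by
  have h1 : ContMDiffAt (𝓡 N) 𝓘(ℝ, Eu N) ∞ φ x :=
    (contMDiffOn_chart hφ).contMDiffAt (φ.open_source.mem_nhds hx)
  refine MDifferentiableAt.mpullback_vectorField (I' := 𝓘(ℝ, Eu N)) (V := f) (f := φ) (n := 2) ?_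
    (h1.of_le (by norm_cast)) (isInvertible_mfderiv_chart hφ hx) le_rfl
  rw [mdifferentiableAt_totalSpace]
  refine ⟨mdifferentiableAt_id, ?_⟩
  convert! hf.mdifferentiableAt with y
  simp

lemma field_coord_eventuallyEq (hφ : φ ∈ IsManifold.maximalAtlas (𝓡 N) ∞ M) (Y : VField N M) {x : M}
    (hx : x ∈ φ.source) : ∀ᶠ y in 𝓝 x, field φ (coord φ Y) y = Y y := by
  filter_upwards [φ.open_source.mem_nhds hx] with y hy using field_coord hφ Y hy

lemma contMDiffAt_vfield_iff (hφ : φ ∈ IsManifold.maximalAtlas (𝓡 N) ∞ M) {Y : VField N M} {x : M}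
    (hx : x ∈ φ.source) : ContMDiffAt (𝓡 N) (𝓡 N).tangent ∞
      (fun x => Bundle.TotalSpace.mk' (Eu N) (E := (TangentSpace (𝓡 N) : M → Type)) x (Y x)) x ↔
    ContDiffAt ℝ ∞ (coord φ Y) (φ x) := by
  refine ⟨contMDiffAt_coord hφ hx, fun h => ?_⟩
  refine (contMDiffAt_field hφ hx h).congr_of_eventuallyEq ?_
  filter_upwards [field_coord_eventuallyEq hφ Y hx] with y hy
  rw [hy]

lemma diffFieldAt_iff (hφ : φ ∈ IsManifold.maximalAtlas (𝓡 N) ∞ M) {Y : VField N M} {x : M}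
    (hx : x ∈ φ.source) : DiffFieldAt Y x ↔ DifferentiableAt ℝ (coord φ Y) (φ x) := by
  refine ⟨mdifferentiableAt_coord hφ hx, fun h => ?_⟩
  refine (diffFieldAt_field hφ hx h).congr_of_eventuallyEq ?_
  filter_upwards [field_coord_eventuallyEq hφ Y hx] with y hy
  rw [hy]

lemma smoothFieldOn_iff_forall {U : Set M} (hU : IsOpen U) {Y : VField N M} :
    SmoothFieldOn U Y ↔ ∀ x ∈ U, ContMDiffAt (𝓡 N) (𝓡 N).tangent ∞
      (fun x => Bundle.TotalSpace.mk' (Eu N) (E := (TangentSpace (𝓡 N) : M → Type)) x (Y x)) x :=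
  ⟨fun h x hx => h.contMDiffAt (hU.mem_nhds hx), fun h x hx => (h x hx).contMDiffWithinAt⟩

lemma SmoothFieldOn.contDiffAt_coord (hφ : φ ∈ IsManifold.maximalAtlas (𝓡 N) ∞ M) {U : Set M}
    (hU : IsOpen U) {Y : VField N M} (hY : SmoothFieldOn U Y) {x : M} (hxU : x ∈ U)
    (hx : x ∈ φ.source) : ContDiffAt ℝ ∞ (coord φ Y) (φ x) :=
  (contMDiffAt_vfield_iff hφ hx).1 ((smoothFieldOn_iff_forall hU).1 hY x hxU)

lemma smoothFieldOn_iff_coord (hφ : φ ∈ IsManifold.maximalAtlas (𝓡 N) ∞ M) {U : Set M}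
    (hU : IsOpen U) (hUφ : U ⊆ φ.source) {Y : VField N M} :
    SmoothFieldOn U Y ↔ ∀ x ∈ U, ContDiffAt ℝ ∞ (coord φ Y) (φ x) := by
  rw [smoothFieldOn_iff_forall hU]
  exact forall₂_congr fun _ hx => contMDiffAt_vfield_iff hφ (hUφ hx)

lemma SmoothFieldOn.diffFieldAt {U : Set M} (hU : IsOpen U) {Y : VField N M}
    (hY : SmoothFieldOn U Y) {x : M} (hxU : x ∈ U) : DiffFieldAt Y x :=
  ((smoothFieldOn_iff_forall hU).1 hY x hxU).mdifferentiableAt (by simp)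

lemma isManifold_minSmoothness : IsManifold (𝓡 N) (minSmoothness ℝ 2) M := by
  rw [minSmoothness_of_isRCLikeNormedField]
  exact IsManifold.of_le (n := ∞) (by norm_cast)

lemma mlieBracket_modelSpace (V W : (z : Eu N) → TangentSpace 𝓘(ℝ, Eu N) z) (z : Eu N) :
    VectorField.mlieBracket 𝓘(ℝ, Eu N) V W z = VectorField.lieBracket ℝ V W z := by
  rw [← VectorField.mlieBracketWithin_univ, VectorField.mlieBracketWithin_eq_lieBracketWithin]
  exact congrFun (VectorField.lieBracketWithin_univ (𝕜 := ℝ) (V := (V : Eu N → Eu N)) (W := W)) z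

/-- Naturality of the bracket under pullback by `φ.symm`, together with the formula `[X, Y] = DY(X)
- DX(Y)` in the model space. -/
lemma tg_mlieBracket (hφ : φ ∈ IsManifold.maximalAtlas (𝓡 N) ∞ M) {X Y : VField N M} {x : M}
    (hx : x ∈ φ.source) (hX : DiffFieldAt X x) (hY : DiffFieldAt Y x) :
    tg φ x (VectorField.mlieBracket (𝓡 N) X Y x) =
      fderiv ℝ (coord φ Y) (φ x) (tg φ x (X x)) - fderiv ℝ (coord φ X) (φ x) (tg φ x (Y x)) := by
  have hz := φ.map_source hx
  have : IsManifold (𝓡 N) (minSmoothness ℝ 2) M := isManifold_minSmoothness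
  have h1 : ContMDiffAt 𝓘(ℝ, Eu N) (𝓡 N) ∞ φ.symm (φ x) :=
    (contMDiffOn_chart_symm hφ).contMDiffAt (φ.open_target.mem_nhds hz)
  have h2 := VectorField.mpullback_mlieBracket (V := X) (W := Y) (f := φ.symm) (x₀ := φ x) (n := 2)
    (by rw [φ.left_inv hx]; exact hX) (by rw [φ.left_inv hx]; exact hY)
    (h1.of_le (by norm_cast)) (by simp)
  rw [mpullback_chart_symm hφ _ hz, coord_apply _ hx] at h2
  have hev : ∀ Z : VField N M, VectorField.mpullback 𝓘(ℝ, Eu N) (𝓡 N) φ.symm Z =ᶠ[𝓝 (φ x)]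
      coord φ Z := fun Z => by
    filter_upwards [φ.open_target.mem_nhds hz] with y hy using mpullback_chart_symm hφ Z hy
  rw [h2, (hev X).mlieBracket_vectorField_eq (hev Y)]
  refine (mlieBracket_modelSpace _ _ _).trans ?_
  rw [← coord_apply X hx, ← coord_apply Y hx]
  rfl

/-! ### Functions in a chart -/

lemma contMDiffAt_fun_iff (hφ : φ ∈ IsManifold.maximalAtlas (𝓡 N) ∞ M) {F : Type*}
    [NormedAddCommGroup F] [NormedSpace ℝ F] {f : M → F} {x : M} (hx : x ∈ φ.source) :
    ContMDiffAt (𝓡 N) 𝓘(ℝ, F) ∞ f x ↔ ContDiffAt ℝ ∞ (f ∘ φ.symm) (φ x) := by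
  have hz := φ.map_source hx
  have h1 : ContMDiffAt 𝓘(ℝ, Eu N) (𝓡 N) ∞ φ.symm (φ x) :=
    (contMDiffOn_chart_symm hφ).contMDiffAt (φ.open_target.mem_nhds hz)
  have h2 : ContMDiffAt (𝓡 N) 𝓘(ℝ, Eu N) ∞ φ x :=
    (contMDiffOn_chart hφ).contMDiffAt (φ.open_source.mem_nhds hx)
  refine ⟨fun h => ?_, fun h => ?_⟩
  · exact (ContMDiffAt.comp (φ x) (by rw [φ.left_inv hx]; exact h) h1).contDiffAt
  · refine (ContMDiffAt.comp x h.contMDiffAt h2).congr_of_eventuallyEq ?_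
    filter_upwards [φ.open_source.mem_nhds hx] with y hy
    simp [φ.left_inv hy]

lemma smoothFunOn_iff_forall {U : Set M} (hU : IsOpen U) {f : M → ℝ} :
    SmoothFunOn N U f ↔ ∀ x ∈ U, ContMDiffAt (𝓡 N) 𝓘(ℝ, ℝ) ∞ f x :=
  ⟨fun h x hx => h.contMDiffAt (hU.mem_nhds hx), fun h x hx => (h x hx).contMDiffWithinAt⟩

lemma mvfderiv_eq_fderiv (hφ : φ ∈ IsManifold.maximalAtlas (𝓡 N) ∞ M) {f : M → ℝ} {x : M}
    (hx : x ∈ φ.source) (hf : DifferentiableAt ℝ (f ∘ φ.symm) (φ x)) (v : TangentSpace (𝓡 N) x) :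
    mvfderiv (𝓡 N) f x v = fderiv ℝ (f ∘ φ.symm) (φ x) (tg φ x v) := by
  have h2 : MDifferentiableAt (𝓡 N) 𝓘(ℝ, Eu N) φ x :=
    (mdifferentiable_chart' hφ).mdifferentiableAt hx
  have h3 : f =ᶠ[𝓝 x] (f ∘ φ.symm) ∘ φ := by
    filter_upwards [φ.open_source.mem_nhds hx] with y hy
    simp [φ.left_inv hy]
  have h4 := (hf.hasFDerivAt.hasMFDerivAt.comp x h2.hasMFDerivAt).congr_of_eventuallyEq h3
  change mfderiv (𝓡 N) 𝓘(ℝ, ℝ) f x v = _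
  rw [h4.mfderiv]
  rfl

end

/-! ### Coordinate curvature, cut-off functions and Christoffel forms -/

section

/-! ### Curvature of a connection on an open set of a vector space -/

section Coordinates

variable {E : Type*} [NormedAddCommGroup E] [NormedSpace ℝ E]

/-- The curvature `(v, w) ↦ (u ↦ R(u, v) w)` of the connection `D + Γ`, where `Γ z w v` is the value
of the Christoffel form in direction `v` on the vector `w`. -/
def curvC (Γ : E → E →L[ℝ] E →L[ℝ] E) (z : E) : E →ₗ[ℝ] E →ₗ[ℝ] E →ₗ[ℝ] E :=
  LinearMap.mk₂ ℝ (fun v w =>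
    ((((fderiv ℝ Γ z).flip w).flip v - fderiv ℝ Γ z v w + Γ z (Γ z w v)
      - (Γ z).flip v ∘L Γ z w : E →L[ℝ] E) : E →ₗ[ℝ] E))
    (fun v v' w => by ext u; simp; abel)
    (fun c v w => by ext u; simp [smul_sub, smul_add])
    (fun v w w' => by ext u; simp; abel)
    (fun c v w => by ext u; simp [smul_sub, smul_add])

lemma curvC_apply (Γ : E → E →L[ℝ] E →L[ℝ] E) (z u v w : E) :
    curvC Γ z v w u = fderiv ℝ Γ z u w v - fderiv ℝ Γ z v w u + Γ z (Γ z w v) u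
      - Γ z (Γ z w u) v := rfl

/-- The Ricci form of the connection `D + Γ`. -/
def ricC (Γ : E → E →L[ℝ] E →L[ℝ] E) (z : E) : E →ₗ[ℝ] E →ₗ[ℝ] ℝ :=
  (curvC Γ z).compr₂ (LinearMap.trace ℝ E)

/-- The projective Schouten form of the connection `D + Γ`. -/
def schC (Γ : E → E →L[ℝ] E →L[ℝ] E) (z : E) : E →ₗ[ℝ] E →ₗ[ℝ] ℝ :=
  (((finrank ℝ E : ℝ) - 1) * ((finrank ℝ E : ℝ) + 1))⁻¹ •
    ((finrank ℝ E : ℝ) • ricC Γ z + (ricC Γ z).flip)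

lemma ricC_apply (Γ : E → E →L[ℝ] E →L[ℝ] E) (z v w : E) :
    ricC Γ z v w = LinearMap.trace ℝ E (curvC Γ z v w) := rfl

lemma schC_apply (Γ : E → E →L[ℝ] E →L[ℝ] E) (z v w : E) :
    schC Γ z v w = ((finrank ℝ E : ℝ) * ricC Γ z v w + ricC Γ z w v) /
      (((finrank ℝ E : ℝ) - 1) * ((finrank ℝ E : ℝ) + 1)) := by
  rw [div_eq_inv_mul]
  rfl

/-- A basis of the finite-dimensional space `E` identifies `E →L[ℝ] F` with a finite power of `F`,
so smoothness may be tested on vectors. -/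
lemma contDiffAt_clm_iff {D F : Type*} [NormedAddCommGroup D] [NormedSpace ℝ D]
    [NormedAddCommGroup F] [NormedSpace ℝ F] [FiniteDimensional ℝ E] {f : D → E →L[ℝ] F} {x : D} :
    ContDiffAt ℝ ∞ f x ↔ ∀ y, ContDiffAt ℝ ∞ (fun x => f x y) x := by
  refine ⟨fun h y => h.clm_apply contDiffAt_const, fun h => ?_⟩
  let d := finrank ℝ E
  have hd : d = finrank ℝ (Fin d → ℝ) := (finrank_fin_fun ℝ).symm
  let e₁ := ContinuousLinearEquiv.ofFinrankEq hd
  let e₂ := (e₁.arrowCongr (1 : F ≃L[ℝ] F)).trans (ContinuousLinearEquiv.piRing (Fin d))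
  have h2 : f = e₂.symm ∘ (e₂ ∘ f) := by
    ext z
    simp
  rw [h2]
  exact e₂.symm.contDiff.contDiffAt.comp x (contDiffAt_pi.mpr fun i => h _)

end Coordinates

variable {N : ℕ} {M : Type u} [TopologicalSpace M] [ChartedSpace (EuclideanSpace ℝ (Fin N)) M]
  [IsManifold (𝓡 N) ∞ M] {φ : OpenPartialHomeomorph M (Eu N)}

/-! ### Cut-off functions -/

lemma exists_bump [T2Space M] {V : Set M} (hV : IsOpen V) {x : M} (hx : x ∈ V) :
    ∃ χ : M → ℝ, ContMDiff (𝓡 N) 𝓘(ℝ, ℝ) ∞ χ ∧ (∀ᶠ y in 𝓝 x, χ y = 1) ∧ tsupport χ ⊆ V := by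
  obtain ⟨f, -, hf⟩ := (SmoothBumpFunction.nhds_basis_tsupport (I := 𝓡 N) x).mem_iff.1
    (hV.mem_nhds hx)
  exact ⟨f, f.contMDiff, f.eventuallyEq_one, hf⟩

lemma SmoothFieldOn.bump_smul {V : Set M} (hV : IsOpen V) {Y : VField N M} (hY : SmoothFieldOn V Y)
    {χ : M → ℝ} (hχ : ContMDiff (𝓡 N) 𝓘(ℝ, ℝ) ∞ χ) (hs : tsupport χ ⊆ V) :
    SmoothFieldOn univ (fun y => χ y • Y y) := by
  rw [smoothFieldOn_iff_forall isOpen_univ]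
  intro x _
  by_cases hx : x ∈ V
  · exact (hχ x).smul_section ((smoothFieldOn_iff_forall hV).1 hY x hx)
  · have h0 : ∀ᶠ y in 𝓝 x, χ y = 0 := by
      filter_upwards [(isClosed_tsupport χ).isOpen_compl.mem_nhds fun h => hx (hs h)] with y hy
      exact image_eq_zero_of_notMem_tsupport hy
    have h1 : SmoothFieldOn univ (0 : VField N M) := Bundle.contMDiffOn_zeroSection ℝ _
    refine ((smoothFieldOn_iff_forall isOpen_univ).1 h1 x (mem_univ x)).congr_of_eventuallyEq ?_
    filter_upwards [h0] with y hy
    simp [hy]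

/-! ### Connections in a chart -/

/-- The smoothness axiom on `U` speaks only of fields that are smooth on `U`. A field on `V` must
first be multiplied by a bump function; by locality this does not change its derivative near the
point. -/
lemma IsAffineConnectionOn.mono [T2Space M] {U V : Set M} {cov : RawConn N M}
    (h : IsAffineConnectionOn U cov) (hU : IsOpen U) (hV : IsOpen V) (hVU : V ⊆ U) :
    IsAffineConnectionOn V cov where
  isCovariantDerivativeOn := h.isCovariantDerivativeOn.mono hVU
  torsion_free x hx := h.torsion_free x (hVU hx)
  smooth := ⟨fun {σ} hσ x hx => by
    have hσ' : SmoothFieldOn V σ := hσ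
    obtain ⟨χ, h1, h2, h3⟩ := exists_bump (N := N) hV hx
    have h4 := hσ'.bump_smul hV h1 h3
    have h5 := h.smooth.contMDiff (σ := fun y => χ y • σ y) (h4.mono (subset_univ U))
    refine ContMDiffAt.contMDiffWithinAt ?_
    refine (h5.contMDiffAt (hU.mem_nhds (hVU hx))).congr_of_eventuallyEq ?_
    filter_upwards [h2.eventually_nhds, hV.mem_nhds hx] with y hy hyV
    have h6 : cov σ y = cov (fun y => χ y • σ y) y := by
      refine h.isCovariantDerivativeOn.congr_of_eventuallyEq (hσ'.diffFieldAt hV hyV)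
        (h4.diffFieldAt isOpen_univ (mem_univ y)) (hU.mem_nhds (hVU hyV)) ?_
      filter_upwards [hy] with w hw
      simp [hw]
    rw [h6]⟩

lemma IsAffineConnectionOn.congr {U : Set M} {cov : RawConn N M} (h : IsAffineConnectionOn U cov)
    (hU : IsOpen U) {X Y : VField N M} {x : M} (hx : x ∈ U) (hX : DiffFieldAt X x)
    (hY : DiffFieldAt Y x) (hXY : ∀ᶠ y in 𝓝 x, X y = Y y) : cov X x = cov Y x :=
  h.isCovariantDerivativeOn.congr_of_eventuallyEq hX hY (hU.mem_nhds hx) hXY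

/-- The constant vector field `w` in the chart `φ`. -/
abbrev cfield (φ : OpenPartialHomeomorph M (Eu N)) (w : Eu N) : VField N M := field φ fun _ => w

/-- The standard basis vectors. -/
abbrev sb (a : Fin N) : Eu N := EuclideanSpace.single a 1

lemma sum_smul_sb (w : Eu N) : ∑ a, w a • sb a = w := by
  have := (EuclideanSpace.basisFun (Fin N) ℝ).sum_repr w
  simpa using this

/-- The Christoffel form of `cov` in the chart `φ`. -/
def chr (φ : OpenPartialHomeomorph M (Eu N)) (cov : RawConn N M) (z : Eu N) :
    Eu N →L[ℝ] Eu N →L[ℝ] Eu N :=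
  ∑ a, (EuclideanSpace.proj (𝕜 := ℝ) a).smulRight
    (tg φ (φ.symm z) ∘L cov (cfield φ (sb a)) (φ.symm z) ∘L tgInv φ (φ.symm z))

lemma chr_apply (cov : RawConn N M) {x : M} (hx : x ∈ φ.source) (w v : Eu N) :
    chr φ cov (φ x) w v = ∑ a, w a • tg φ x (cov (cfield φ (sb a)) x (tgInv φ x v)) := by
  have h : φ.symm (φ x) = x := φ.left_inv hx
  rw [chr]
  generalize φ.symm (φ x) = y at h
  subst h
  simp

lemma diffFieldAt_cfield (hφ : φ ∈ IsManifold.maximalAtlas (𝓡 N) ∞ M) (w : Eu N) {x : M}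
    (hx : x ∈ φ.source) : DiffFieldAt (cfield φ w) x :=
  diffFieldAt_field hφ hx (differentiableAt_const w)

lemma smoothFieldOn_cfield (hφ : φ ∈ IsManifold.maximalAtlas (𝓡 N) ∞ M) (w : Eu N) {U : Set M}
    (hU : U ⊆ φ.source) : SmoothFieldOn U (cfield φ w) :=
  fun _ hx => (contMDiffAt_field hφ (hU hx) contDiffAt_const).contMDiffWithinAt

lemma IsCovariantDerivativeOn_sum {U : Set M} {cov : RawConn N M}
    (h : IsCovariantDerivativeOn (Eu N) cov U) {x : M} (hx : x ∈ U) {ι : Type*} (s : Finset ι)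
    (Y : ι → VField N M) (hY : ∀ a ∈ s, DiffFieldAt (Y a) x) :
    DiffFieldAt (∑ a ∈ s, Y a) x ∧ cov (∑ a ∈ s, Y a) x = ∑ a ∈ s, cov (Y a) x := by
  classical
  induction s using Finset.induction_on with
  | empty =>
    refine ⟨Bundle.mdifferentiableAt_zeroSection .., ?_⟩
    simpa using h.zero hx
  | insert a s ha ih =>
    have h1 := ih fun b hb => hY b (Finset.mem_insert_of_mem hb)
    have h2 := hY a (Finset.mem_insert_self a s)
    rw [Finset.sum_insert ha, Finset.sum_insert ha]
    exact ⟨mdifferentiableAt_add_section h2 h1.1, by rw [h.add h2 h1.1 hx, h1.2]⟩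

/-- The field is expanded in the constant fields `cfield φ (sb a)`, and the Leibniz rule is applied
to the coefficients. Only differentiability of `Y` at the point is needed, which also covers fields
that arise as covariant derivatives. -/
lemma tg_cov (hφ : φ ∈ IsManifold.maximalAtlas (𝓡 N) ∞ M) {U : Set M} (hU : IsOpen U)
    {cov : RawConn N M} (h : IsAffineConnectionOn U cov) {x : M} (hxU : x ∈ U) (hx : x ∈ φ.source)
    {Y : VField N M} (hY : DiffFieldAt Y x) (v : TangentSpace (𝓡 N) x) :
    tg φ x (cov Y x v) =
      fderiv ℝ (coord φ Y) (φ x) (tg φ x v) + chr φ cov (φ x) (tg φ x (Y x)) (tg φ x v) := by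
  have hYc := mdifferentiableAt_coord hφ hx hY
  have hz := φ.map_source hx
  let f : Fin N → M → ℝ := fun a y => coord φ Y (φ y) a
  have hf : ∀ a, (f a ∘ φ.symm) =ᶠ[𝓝 (φ x)] fun z => coord φ Y z a := fun a => by
    filter_upwards [φ.open_target.mem_nhds hz] with z hz
    simp [f, φ.right_inv hz]
  have hfd : ∀ a, HasFDerivAt (f a ∘ φ.symm)
      ((EuclideanSpace.proj (𝕜 := ℝ) a).comp (fderiv ℝ (coord φ Y) (φ x))) (φ x) := fun a =>
    ((EuclideanSpace.proj (𝕜 := ℝ) (ι := Fin N) a).hasFDerivAt.comp _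
      hYc.hasFDerivAt).congr_of_eventuallyEq (hf a)
  have hfm : ∀ a, MDifferentiableAt (𝓡 N) 𝓘(ℝ, ℝ) (f a) x := fun a => by
    have h1 : MDifferentiableAt (𝓡 N) 𝓘(ℝ, Eu N) φ x :=
      (mdifferentiable_chart' hφ).mdifferentiableAt hx
    refine MDifferentiableAt.congr_of_eventuallyEq
      ((hfd a).differentiableAt.mdifferentiableAt.comp x h1) ?_
    filter_upwards [φ.open_source.mem_nhds hx] with y hy
    simp [φ.left_inv hy]
  have hs : ∀ a ∈ (Finset.univ : Finset (Fin N)), DiffFieldAt (f a • cfield φ (sb a)) x :=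
    fun a _ => (hfm a).smul_section (diffFieldAt_cfield hφ _ hx)
  have h1 := IsCovariantDerivativeOn_sum h.isCovariantDerivativeOn hxU Finset.univ _ hs
  have h2 : cov Y x = cov (∑ a, f a • cfield φ (sb a)) x := by
    refine h.congr hU hxU hY h1.1 ?_
    filter_upwards [φ.open_source.mem_nhds hx] with y hy
    have h3 : (∑ a, f a • cfield φ (sb a)) y = ∑ a, f a y • tgInv φ y (sb a) := by
      simp [Finset.sum_apply, field]
    rw [h3]
    simp_rw [← map_smul]
    rw [← map_sum, sum_smul_sb, coord_apply Y hy, tgInv_tg hφ hy]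
  rw [h2, h1.2, sum_apply, map_sum, chr_apply cov hx]
  conv_rhs => rw [← sum_smul_sb (fderiv ℝ (coord φ Y) (φ x) (tg φ x v))]
  rw [← Finset.sum_add_distrib]
  refine Finset.sum_congr rfl fun a _ => ?_
  rw [h.isCovariantDerivativeOn.leibniz (diffFieldAt_cfield hφ _ hx) (hfm a) hxU]
  have h4 : mvfderiv (𝓡 N) (f a) x v = (fderiv ℝ (coord φ Y) (φ x) (tg φ x v)) a := by
    rw [mvfderiv_eq_fderiv hφ hx (hfd a).differentiableAt, (hfd a).fderiv]
    rfl
  have h5 : tg φ x (cfield φ (sb a) x) = sb a := tg_tgInv hφ hx _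
  have h6 : f a x = (tg φ x (Y x)) a := by simp only [f]; rw [coord_apply Y hx]
  rw [tgInv_tg hφ hx, ← h4, ← h6]
  change tg φ x (f a x • cov (cfield φ (sb a)) x v + mvfderiv (𝓡 N) (f a) x v •
    cfield φ (sb a) x) = _
  rw [map_add, map_smul, map_smul, h5, add_comm]

end

/-! ### Christoffel forms, curvature and projective changes in a chart -/

section

variable {N : ℕ} {M : Type u} [TopologicalSpace M] [ChartedSpace (EuclideanSpace ℝ (Fin N)) M]
  [IsManifold (𝓡 N) ∞ M] {φ : OpenPartialHomeomorph M (Eu N)}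

lemma clm_ext_tg (hφ : φ ∈ IsManifold.maximalAtlas (𝓡 N) ∞ M) {x : M} (hx : x ∈ φ.source)
    {v w : TangentSpace (𝓡 N) x} (h : tg φ x v = tg φ x w) : v = w := by
  rw [← tgInv_tg hφ hx v, h, tgInv_tg hφ hx]

lemma coord_cfield (hφ : φ ∈ IsManifold.maximalAtlas (𝓡 N) ∞ M) (w : Eu N) {z : Eu N}
    (hz : z ∈ φ.target) : coord φ (cfield φ w) z = w := coord_field hφ _ hz

lemma fderiv_coord_cfield (hφ : φ ∈ IsManifold.maximalAtlas (𝓡 N) ∞ M) (w : Eu N) {z : Eu N}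
    (hz : z ∈ φ.target) : fderiv ℝ (coord φ (cfield φ w)) z = 0 := by
  have h : coord φ (cfield φ w) =ᶠ[𝓝 z] fun _ => w := by
    filter_upwards [φ.open_target.mem_nhds hz] with y hy using coord_cfield hφ w hy
  rw [h.fderiv_eq (𝕜 := ℝ)]
  simp

lemma tg_cov_cfield (hφ : φ ∈ IsManifold.maximalAtlas (𝓡 N) ∞ M) {U : Set M} (hU : IsOpen U)
    {cov : RawConn N M} (h : IsAffineConnectionOn U cov) {x : M} (hxU : x ∈ U) (hx : x ∈ φ.source)
    (w : Eu N) (v : TangentSpace (𝓡 N) x) :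
    tg φ x (cov (cfield φ w) x v) = chr φ cov (φ x) w (tg φ x v) := by
  rw [tg_cov hφ hU h hxU hx (diffFieldAt_cfield hφ w hx),
    fderiv_coord_cfield hφ w (φ.map_source hx)]
  have : tg φ x (cfield φ w x) = w := tg_tgInv hφ hx w
  rw [this]
  simp

/-- Torsion-freeness on constant fields, whose bracket vanishes. -/
lemma chr_symm (hφ : φ ∈ IsManifold.maximalAtlas (𝓡 N) ∞ M) {U : Set M} (hU : IsOpen U)
    {cov : RawConn N M} (h : IsAffineConnectionOn U cov) {x : M} (hxU : x ∈ U) (hx : x ∈ φ.source)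
    (v w : Eu N) : chr φ cov (φ x) v w = chr φ cov (φ x) w v := by
  have h1 := h.torsion_free x hxU _ _ (diffFieldAt_cfield hφ v hx) (diffFieldAt_cfield hφ w hx)
  have h2 := congrArg (tg φ x) h1
  rw [tg_mlieBracket hφ hx (diffFieldAt_cfield hφ v hx) (diffFieldAt_cfield hφ w hx),
    fderiv_coord_cfield hφ w (φ.map_source hx), fderiv_coord_cfield hφ v (φ.map_source hx),
    map_sub, tg_cov_cfield hφ hU h hxU hx, tg_cov_cfield hφ hU h hxU hx] at h2
  have h3 : tg φ x (cfield φ w x) = w := tg_tgInv hφ hx w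
  have h4 : tg φ x (cfield φ v x) = v := tg_tgInv hφ hx v
  rw [h3, h4] at h2
  rw [zero_apply, zero_apply, sub_zero] at h2
  exact (sub_eq_zero.1 h2).symm

lemma contDiffAt_chr [T2Space M] (hφ : φ ∈ IsManifold.maximalAtlas (𝓡 N) ∞ M) {U : Set M}
    (hU : IsOpen U) {cov : RawConn N M} (h : IsAffineConnectionOn U cov) {x : M} (hxU : x ∈ U)
    (hx : x ∈ φ.source) : ContDiffAt ℝ ∞ (chr φ cov) (φ x) := by
  have hV : IsOpen (U ∩ φ.source) := hU.inter φ.open_source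
  have h' := h.mono hU hV inter_subset_left
  have hxV : x ∈ U ∩ φ.source := ⟨hxU, hx⟩
  rw [contDiffAt_clm_iff]
  intro w
  rw [contDiffAt_clm_iff]
  intro v
  have h1 := h'.smooth.contMDiff (σ := cfield φ w)
    (smoothFieldOn_cfield hφ w inter_subset_right)
  have h2 : SmoothFieldOn (U ∩ φ.source) (fun y => cov (cfield φ w) y (cfield φ v y)) :=
    h1.clm_bundle_apply (smoothFieldOn_cfield hφ v inter_subset_right)
  refine (h2.contDiffAt_coord hφ hV hxV hx).congr_of_eventuallyEq ?_
  filter_upwards [φ.open_target.mem_nhds (φ.map_source hx),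
    (φ.continuousAt_symm (φ.map_source hx)).preimage_mem_nhds
      (by rw [φ.left_inv hx]; exact hU.mem_nhds hxU)] with z hz hzU
  have h3 := tg_cov_cfield hφ hU h hzU (φ.map_target hz) w (cfield φ v (φ.symm z))
  have h4 : tg φ (φ.symm z) (cfield φ v (φ.symm z)) = v := tg_tgInv hφ (φ.map_target hz) v
  rw [h4, φ.right_inv hz] at h3
  exact h3.symm

/-! ### Connections which are given in a chart -/

/-- The connection `D + Γ` in the chart `φ`. -/
def connOf (φ : OpenPartialHomeomorph M (Eu N)) (Γ : Eu N → Eu N →L[ℝ] Eu N →L[ℝ] Eu N) :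
    RawConn N M := fun Y x =>
  tgInv φ x ∘L (fderiv ℝ (coord φ Y) (φ x) + Γ (φ x) (tg φ x (Y x))) ∘L tg φ x

lemma tg_connOf (hφ : φ ∈ IsManifold.maximalAtlas (𝓡 N) ∞ M)
    (Γ : Eu N → Eu N →L[ℝ] Eu N →L[ℝ] Eu N) (Y : VField N M) {x : M} (hx : x ∈ φ.source)
    (v : TangentSpace (𝓡 N) x) : tg φ x (connOf φ Γ Y x v) =
      fderiv ℝ (coord φ Y) (φ x) (tg φ x v) + Γ (φ x) (tg φ x (Y x)) (tg φ x v) :=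
  tg_tgInv hφ hx _

lemma contMDiffAt_hom_of_forall {L : (x : M) → TangentSpace (𝓡 N) x →L[ℝ] TangentSpace (𝓡 N) x}
    {x₀ : M} (h : ∀ X : VField N M, ContMDiffAt (𝓡 N) (𝓡 N).tangent ∞
        (fun x => Bundle.TotalSpace.mk' (Eu N) (E := (TangentSpace (𝓡 N) : M → Type)) x (X x)) x₀ →
      ContMDiffAt (𝓡 N) (𝓡 N).tangent ∞
        (fun x => Bundle.TotalSpace.mk' (Eu N) (E := (TangentSpace (𝓡 N) : M → Type)) x
          (L x (X x))) x₀) :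
    ContMDiffAt (𝓡 N) ((𝓡 N).prod 𝓘(ℝ, Eu N →L[ℝ] Eu N)) ∞
      (fun x => (⟨x, L x⟩ : Bundle.TotalSpace (Eu N →L[ℝ] Eu N)
        fun x => TangentSpace (𝓡 N) x →L[ℝ] TangentSpace (𝓡 N) x)) x₀ := by
  rw [contMDiffAt_hom_bundle]
  refine ⟨contMDiffAt_id, ?_⟩
  have hφ := IsManifold.chart_mem_maximalAtlas (I := 𝓡 N) (n := ∞) x₀
  rw [contMDiffAt_fun_iff hφ (mem_chart_source _ x₀), contDiffAt_clm_iff]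
  intro w
  let t := trivializationAt (Eu N) (TangentSpace (𝓡 N) : M → Type) x₀
  have hw : ContMDiffAt (𝓡 N) (𝓡 N).tangent ∞
      (fun x => Bundle.TotalSpace.mk' (Eu N) (E := (TangentSpace (𝓡 N) : M → Type)) x
        (t.symmL ℝ x w)) x₀ := by
    rw [Bundle.contMDiffAt_section]
    refine (contMDiffAt_const (c := w)).congr_of_eventuallyEq ?_
    filter_upwards [t.open_baseSet.mem_nhds (FiberBundle.mem_baseSet_trivializationAt' x₀)]
      with y hy
    rw [Bundle.Trivialization.symmL_apply, t.apply_mk_symm hy]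
    exact hy
  have h2 := (Bundle.contMDiffAt_section _).1 (h _ hw)
  have h3 := (contMDiffAt_fun_iff hφ (mem_chart_source _ x₀)).1 h2
  refine h3.congr_of_eventuallyEq ?_
  have h4 : ∀ᶠ y in 𝓝 x₀, y ∈ t.baseSet :=
    t.open_baseSet.mem_nhds (FiberBundle.mem_baseSet_trivializationAt' x₀)
  have h5 := ((chartAt (Eu N) x₀).continuousAt_symm
    ((chartAt (Eu N) x₀).map_source (mem_chart_source (Eu N) x₀)))
  rw [ContinuousAt, (chartAt (Eu N) x₀).left_inv (mem_chart_source (Eu N) x₀)] at h5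
  filter_upwards [h5.eventually h4] with z hz
  simp only [Function.comp_apply, ContinuousLinearMap.inCoordinates,
    ContinuousLinearMap.comp_apply]
  rw [Bundle.Trivialization.continuousLinearMapAt_apply,
    Bundle.Trivialization.coe_linearMapAt_of_mem _ hz]

lemma isAffineConnectionOn_connOf (hφ : φ ∈ IsManifold.maximalAtlas (𝓡 N) ∞ M) {U : Set M}
    (hU : IsOpen U) (hUφ : U ⊆ φ.source) {Γ : Eu N → Eu N →L[ℝ] Eu N →L[ℝ] Eu N}
    (hΓ : ∀ x ∈ U, ContDiffAt ℝ ∞ Γ (φ x))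
    (hs : ∀ x ∈ U, ∀ v w, Γ (φ x) v w = Γ (φ x) w v) : IsAffineConnectionOn U (connOf φ Γ) where
  isCovariantDerivativeOn :=
    { add := fun {σ σ' x} h1 h2 hx => by
        ext1 v
        apply clm_ext_tg hφ (hUφ hx)
        have h3 := mdifferentiableAt_coord hφ (hUφ hx) h1
        have h4 := mdifferentiableAt_coord hφ (hUφ hx) h2
        have h5 : coord φ (σ + σ') = coord φ σ + coord φ σ' := by
          ext1 z
          simp [coord]
        rw [tg_connOf hφ _ _ (hUφ hx), h5, fderiv_add h3 h4]
        change _ = tg φ x (connOf φ Γ σ x v + connOf φ Γ σ' x v)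
        rw [map_add, tg_connOf hφ _ _ (hUφ hx), tg_connOf hφ _ _ (hUφ hx)]
        simp
        abel
      leibniz := fun {σ g x} h1 h2 hx => by
        ext1 v
        apply clm_ext_tg hφ (hUφ hx)
        have h3 := mdifferentiableAt_coord hφ (hUφ hx) h1
        have hz := φ.map_source (hUφ hx)
        have h4 : DifferentiableAt ℝ (g ∘ φ.symm) (φ x) := by
          apply MDifferentiableAt.differentiableAt
          exact MDifferentiableAt.comp (φ x) (by rw [φ.left_inv (hUφ hx)]; exact h2)
            ((mdifferentiable_chart' hφ).symm.mdifferentiableAt hz)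
        have h5 : coord φ (g • σ) = fun z => (g ∘ φ.symm) z • coord φ σ z := by
          ext1 z
          simp [coord]
        rw [tg_connOf hφ _ _ (hUφ hx), h5, fderiv_fun_smul h4 h3]
        change _ = tg φ x (g x • connOf φ Γ σ x v + mvfderiv (𝓡 N) g x v • σ x)
        rw [map_add, map_smul, tg_connOf hφ _ _ (hUφ hx), map_smul,
          mvfderiv_eq_fderiv hφ (hUφ hx) h4, ← coord_apply σ (hUφ hx)]
        have h6 : tg φ x ((g • σ) x) = g x • tg φ x (σ x) := by simp
        rw [h6, ← coord_apply σ (hUφ hx)]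
        simp [φ.left_inv (hUφ hx)]
        abel }
  smooth := ⟨fun {σ} hσ x hx => by
    have hσ' : SmoothFieldOn U σ := hσ
    refine (contMDiffAt_hom_of_forall fun X hX => ?_).contMDiffWithinAt
    rw [contMDiffAt_vfield_iff hφ (hUφ hx)] at hX ⊢
    have h1 := hσ'.contDiffAt_coord hφ hU hx (hUφ hx)
    have h2 : ContDiffAt ℝ ∞ (fun z => fderiv ℝ (coord φ σ) z (coord φ X z) +
        Γ z (coord φ σ z) (coord φ X z)) (φ x) :=
      ((h1.fderiv_right (m := ∞) (by simp)).clm_apply hX).add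
        (((hΓ x hx).clm_apply h1).clm_apply hX)
    refine h2.congr_of_eventuallyEq ?_
    filter_upwards [φ.open_target.mem_nhds (φ.map_source (hUφ hx))] with z hz
    rw [coord, tg_connOf hφ _ _ (φ.map_target hz), φ.right_inv hz]
    rfl⟩
  torsion_free x hx X Y hX hY := by
    apply clm_ext_tg hφ (hUφ hx)
    rw [tg_mlieBracket hφ (hUφ hx) hX hY, map_sub, tg_connOf hφ _ _ (hUφ hx),
      tg_connOf hφ _ _ (hUφ hx), hs x hx (tg φ x (Y x))]
    abel

/-! ### Curvature in a chart -/

/-- Product rule for the coordinate expression `DZ(Y) + Γ(Z, Y)` of the inner derivative, which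
holds near `x` and not only at `x`. -/
lemma tg_cov_cov (hφ : φ ∈ IsManifold.maximalAtlas (𝓡 N) ∞ M) {U : Set M} (hU : IsOpen U)
    {cov : RawConn N M} (h : IsAffineConnectionOn U cov) {V : Set M} (hV : IsOpen V) (hVU : V ⊆ U)
    (hVφ : V ⊆ φ.source) {Y Z : VField N M} (hY : SmoothFieldOn V Y) (hZ : SmoothFieldOn V Z) {x : M}
    (hx : x ∈ V) (hΓ : DifferentiableAt ℝ (chr φ cov) (φ x)) (u : TangentSpace (𝓡 N) x) :
    tg φ x (cov (fun y => cov Z y (Y y)) x u) =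
      fderiv ℝ (fderiv ℝ (coord φ Z)) (φ x) (tg φ x u) (tg φ x (Y x)) +
      fderiv ℝ (coord φ Z) (φ x) (fderiv ℝ (coord φ Y) (φ x) (tg φ x u)) +
      (fderiv ℝ (chr φ cov) (φ x) (tg φ x u) (tg φ x (Z x)) (tg φ x (Y x)) +
        chr φ cov (φ x) (fderiv ℝ (coord φ Z) (φ x) (tg φ x u)) (tg φ x (Y x)) +
        chr φ cov (φ x) (tg φ x (Z x)) (fderiv ℝ (coord φ Y) (φ x) (tg φ x u))) +
      chr φ cov (φ x) (fderiv ℝ (coord φ Z) (φ x) (tg φ x (Y x)) +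
        chr φ cov (φ x) (tg φ x (Z x)) (tg φ x (Y x))) (tg φ x u) := by
  have hYc := hY.contDiffAt_coord hφ hV hx (hVφ hx)
  have hZc := hZ.contDiffAt_coord hφ hV hx (hVφ hx)
  have hYd := hYc.differentiableAt (by simp)
  have hZd := hZc.differentiableAt (by simp)
  have hZdd : DifferentiableAt ℝ (fderiv ℝ (coord φ Z)) (φ x) :=
    (hZc.fderiv_right (m := ∞) (by simp)).differentiableAt (by simp)
  have hev : coord φ (fun y => cov Z y (Y y)) =ᶠ[𝓝 (φ x)] fun z =>
      fderiv ℝ (coord φ Z) z (coord φ Y z) + chr φ cov z (coord φ Z z) (coord φ Y z) := by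
    have h5 := φ.continuousAt_symm (φ.map_source (hVφ hx))
    rw [ContinuousAt, φ.left_inv (hVφ hx)] at h5
    filter_upwards [h5.eventually (hV.mem_nhds hx), φ.open_target.mem_nhds
      (φ.map_source (hVφ hx))] with z hz hzt
    have h6 := tg_cov hφ hU h (hVU hz) (hVφ hz) (hZ.diffFieldAt hV hz) (Y (φ.symm z))
    rw [φ.right_inv hzt] at h6
    exact h6
  have hd := (hZdd.hasFDerivAt.clm_apply hYd.hasFDerivAt).add
    ((hΓ.hasFDerivAt.clm_apply hZd.hasFDerivAt).clm_apply hYd.hasFDerivAt)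
  have hd' := hd.congr_of_eventuallyEq hev
  have hdiff : DiffFieldAt (fun y => cov Z y (Y y)) x :=
    (diffFieldAt_iff hφ (hVφ hx)).2 hd'.differentiableAt
  rw [tg_cov hφ hU h (hVU hx) (hVφ hx) hdiff, hd'.fderiv, tg_cov hφ hU h (hVU hx) (hVφ hx)
    (hZ.diffFieldAt hV hx)]
  simp only [coord_apply _ (hVφ hx), add_apply,
    ContinuousLinearMap.comp_apply, ContinuousLinearMap.flip_apply]
  abel

/-- The derivatives of the extensions chosen in `curvature` cancel: the second derivatives of the
third one by symmetry, the first derivatives of the other two against the bracket term. -/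
lemma tg_curvature [T2Space M] (hφ : φ ∈ IsManifold.maximalAtlas (𝓡 N) ∞ M) {U : Set M}
    (hU : IsOpen U) {cov : RawConn N M} (h : IsAffineConnectionOn U cov) {x : M} (hxU : x ∈ U)
    (hx : x ∈ φ.source) (u v w : TangentSpace (𝓡 N) x) : tg φ x (curvature cov x u v w) =
      curvC (chr φ cov) (φ x) (tg φ x v) (tg φ x w) (tg φ x u) := by
  obtain ⟨sX, hsX, hX⟩ := FiberBundle.exists_contMDiffOn_extend (k := ∞) (𝓡 N) (Eu N)
    (V := (TangentSpace (𝓡 N) : M → Type)) u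
  obtain ⟨sY, hsY, hY⟩ := FiberBundle.exists_contMDiffOn_extend (k := ∞) (𝓡 N) (Eu N)
    (V := (TangentSpace (𝓡 N) : M → Type)) v
  obtain ⟨sZ, hsZ, hZ⟩ := FiberBundle.exists_contMDiffOn_extend (k := ∞) (𝓡 N) (Eu N)
    (V := (TangentSpace (𝓡 N) : M → Type)) w
  obtain ⟨V, hVs, hV, hxV⟩ := mem_nhds_iff.1 (Filter.inter_mem (Filter.inter_mem hsX
    (Filter.inter_mem hsY hsZ)) ((hU.inter φ.open_source).mem_nhds ⟨hxU, hx⟩))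
  have hX' : SmoothFieldOn V (FiberBundle.extend (Eu N) u) := hX.mono fun y hy => (hVs hy).1.1
  have hY' : SmoothFieldOn V (FiberBundle.extend (Eu N) v) := hY.mono fun y hy => (hVs hy).1.2.1
  have hZ' : SmoothFieldOn V (FiberBundle.extend (Eu N) w) := hZ.mono fun y hy => (hVs hy).1.2.2
  have hVU : V ⊆ U := fun y hy => (hVs hy).2.1
  have hVφ : V ⊆ φ.source := fun y hy => (hVs hy).2.2
  have hΓ := (contDiffAt_chr hφ hU h hxU hx).differentiableAt (by simp)
  have h1 := tg_cov_cov hφ hU h hV hVU hVφ hY' hZ' hxV hΓ u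
  have h2 := tg_cov_cov hφ hU h hV hVU hVφ hX' hZ' hxV hΓ v
  have h3 := tg_cov hφ hU h hxU hx (hZ'.diffFieldAt hV hxV)
    (VectorField.mlieBracket (𝓡 N) (FiberBundle.extend (Eu N) u) (FiberBundle.extend (Eu N) v) x)
  rw [tg_mlieBracket hφ hx (hX'.diffFieldAt hV hxV) (hY'.diffFieldAt hV hxV)] at h3
  have hZc := hZ'.contDiffAt_coord hφ hV hxV hx
  have hsym := (hZc.isSymmSndFDerivAt (by rw [minSmoothness_of_isRCLikeNormedField]; norm_cast)) (tg φ x u) (tg φ x v)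
  have h4 : tg φ x (curvature cov x u v w) =
      tg φ x (cov (fun y => cov (FiberBundle.extend (Eu N) w) y (FiberBundle.extend (Eu N) v y)) x u)
      - tg φ x (cov (fun y => cov (FiberBundle.extend (Eu N) w) y (FiberBundle.extend (Eu N) u y)) x v)
      - tg φ x (cov (FiberBundle.extend (Eu N) w) x (VectorField.mlieBracket (𝓡 N)
        (FiberBundle.extend (Eu N) u) (FiberBundle.extend (Eu N) v) x)) := by
    rw [← map_sub, ← map_sub]
    rfl
  rw [h4, h1, h2, h3, curvC_apply]
  simp only [FiberBundle.extend_apply_self, map_sub, map_add, add_apply, hsym]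
  abel

lemma trace_eq_sum_coord {V ι : Type*} [AddCommGroup V] [Module ℝ V] [Fintype ι]
    (b : Basis ι ℝ V) (L : V →ₗ[ℝ] V) : LinearMap.trace ℝ V L = ∑ a, b.coord a (L (b a)) := by
  classical
  rw [LinearMap.trace_eq_matrix_trace ℝ b, Matrix.trace]
  simp [LinearMap.toMatrix_apply]

/-- `ricci` sums over the standard basis of the model space, used as a basis of the tangent space.
This is a trace, hence independent of the basis and invariant under conjugation by the derivative of
the chart. -/
lemma ricci_eq [T2Space M] (hφ : φ ∈ IsManifold.maximalAtlas (𝓡 N) ∞ M) {U : Set M}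
    (hU : IsOpen U) {cov : RawConn N M} (h : IsAffineConnectionOn U cov) {x : M} (hxU : x ∈ U)
    (hx : x ∈ φ.source) (v w : TangentSpace (𝓡 N) x) : ricci cov x v w =
      ricC (chr φ cov) (φ x) (tg φ x v) (tg φ x w) := by
  obtain ⟨g, h1, h2⟩ := exists_tg_equiv hφ hx
  have h3 : ∀ u, curvature cov x u v w =
      g.symm.toLinearEquiv.conj (curvC (chr φ cov) (φ x) (tg φ x v) (tg φ x w)) u := fun u => by
    apply clm_ext_tg hφ hx
    rw [tg_curvature hφ hU h hxU hx, LinearEquiv.conj_apply_apply]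
    have h4 : ∀ w, g w = tg φ x w := fun w => by rw [← h1]; rfl
    have h5 : ∀ w, tg φ x (g.symm w) = w := fun w => by rw [← h4, g.apply_symm_apply]
    change _ = tg φ x (g.symm _)
    rw [h5]
    change _ = curvC _ _ _ _ (g u)
    rw [h4]
  rw [ricC_apply, ← LinearMap.trace_conj' _ g.symm.toLinearEquiv]
  refine Eq.trans ?_ (trace_eq_sum_coord (V := TangentSpace (𝓡 N) x)
    (EuclideanSpace.basisFun (Fin N) ℝ).toBasis _).symm
  rw [ricci]
  exact Finset.sum_congr rfl fun a _ =>
    congrArg ((EuclideanSpace.basisFun (Fin N) ℝ).toBasis.coord a) (h3 _)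

lemma schouten_eq [T2Space M] (hφ : φ ∈ IsManifold.maximalAtlas (𝓡 N) ∞ M) {U : Set M}
    (hU : IsOpen U) {cov : RawConn N M} (h : IsAffineConnectionOn U cov) {x : M} (hxU : x ∈ U)
    (hx : x ∈ φ.source) (v w : TangentSpace (𝓡 N) x) : schouten cov x v w =
      schC (chr φ cov) (φ x) (tg φ x v) (tg φ x w) := by
  rw [schouten, ricci_eq hφ hU h hxU hx, ricci_eq hφ hU h hxU hx, schC_apply]
  simp

/-! ### Projective changes in a chart -/

lemma ProjChangeAt.chr_eq (hφ : φ ∈ IsManifold.maximalAtlas (𝓡 N) ∞ M) {U : Set M} (hU : IsOpen U)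
    {cov cov' : RawConn N M} (h : IsAffineConnectionOn U cov) (h' : IsAffineConnectionOn U cov')
    {x : M} (hxU : x ∈ U) (hx : x ∈ φ.source) {Υ : TangentSpace (𝓡 N) x →L[ℝ] ℝ}
    (hΥ : ProjChangeAt cov cov' x Υ) (w v : Eu N) : chr φ cov' (φ x) w v =
      chr φ cov (φ x) w v + Υ (tgInv φ x v) • w + Υ (tgInv φ x w) • v := by
  have h1 := hΥ (cfield φ w) (diffFieldAt_cfield hφ w hx) (tgInv φ x v)
  have h2 := congrArg (tg φ x) h1
  rw [map_add, map_add, map_smul, map_smul, tg_cov_cfield hφ hU h' hxU hx,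
    tg_cov_cfield hφ hU h hxU hx, tg_tgInv hφ hx] at h2
  have h3 : tg φ x (cfield φ w x) = w := tg_tgInv hφ hx w
  rw [h3] at h2
  exact h2

lemma projChangeAt_of_chr (hφ : φ ∈ IsManifold.maximalAtlas (𝓡 N) ∞ M) {U : Set M} (hU : IsOpen U)
    {cov cov' : RawConn N M} (h : IsAffineConnectionOn U cov) (h' : IsAffineConnectionOn U cov')
    {x : M} (hxU : x ∈ U) (hx : x ∈ φ.source) {υ : Eu N →L[ℝ] ℝ}
    (hυ : ∀ w v, chr φ cov' (φ x) w v = chr φ cov (φ x) w v + υ v • w + υ w • v) :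
    ProjChangeAt cov cov' x (υ ∘L tg φ x) := by
  intro Y hY v
  apply clm_ext_tg hφ hx
  rw [map_add, map_add, map_smul, map_smul, tg_cov hφ hU h' hxU hx hY, tg_cov hφ hU h hxU hx hY, hυ]
  simp only [ContinuousLinearMap.comp_apply]
  abel

end

/-! ### Projective changes and parallel hypercomplex triples in coordinates -/

section

section Coordinates

variable {E : Type*} [NormedAddCommGroup E] [NormedSpace ℝ E]

/-! ### Projective changes on an open set of a vector space -/

/-- The form `q(u, w) = (∇υ)(u, w) - υ(u) υ(w)`, which is minus the change of the Schouten form. -/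
def schChange (Γ : E → E →L[ℝ] E →L[ℝ] E) (υ : E → E →L[ℝ] ℝ) (z u w : E) : ℝ :=
  fderiv ℝ υ z u w - υ z (Γ z w u) - υ z u * υ z w

/-- `Dυ` enters through the derivative of `Γ'` and the quadratic terms in `υ` through the products
of `Γ'`. After the symmetry of `Γ` has been used, everything is grouped into values of `schChange`.
-/
lemma curvC_projChange {Γ Γ' : E → E →L[ℝ] E →L[ℝ] E} {υ : E → E →L[ℝ] ℝ} {z : E}
    (hΓ : DifferentiableAt ℝ Γ z) (hΓ' : DifferentiableAt ℝ Γ' z) (hυ : DifferentiableAt ℝ υ z)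
    (hs : ∀ v w, Γ z v w = Γ z w v)
    (hc : ∀ᶠ y in 𝓝 z, ∀ w v, Γ' y w v = Γ y w v + υ y v • w + υ y w • v) (u v w : E) :
    curvC Γ' z v w u = curvC Γ z v w u
      + (schChange Γ υ z u v - schChange Γ υ z v u) • w
      + schChange Γ υ z u w • v - schChange Γ υ z v w • u := by
  have hd : ∀ u w v, fderiv ℝ Γ' z u w v =
      fderiv ℝ Γ z u w v + fderiv ℝ υ z u v • w + fderiv ℝ υ z u w • v := fun u w v => by
    have h1 : HasFDerivAt (fun y => Γ' y w v) _ z :=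
      (hΓ'.hasFDerivAt.clm_apply (hasFDerivAt_const w z)).clm_apply (hasFDerivAt_const v z)
    have h2 : HasFDerivAt (fun y => Γ y w v + υ y v • w + υ y w • v) _ z :=
      (((hΓ.hasFDerivAt.clm_apply (hasFDerivAt_const w z)).clm_apply (hasFDerivAt_const v z)).add
        ((hυ.hasFDerivAt.clm_apply (hasFDerivAt_const v z)).smul_const w)).add
        ((hυ.hasFDerivAt.clm_apply (hasFDerivAt_const w z)).smul_const v)
    have h3 := h1.unique (h2.congr_of_eventuallyEq (hc.mono fun y hy => hy w v))
    have h4 := congrArg (fun L : E →L[ℝ] E => L u) h3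
    simpa using h4
  have hz := hc.self_of_nhds
  simp only [curvC_apply, hd, hz, schChange, map_add, map_smul, add_apply, smul_apply]
  rw [hs w u, hs v u, hs w v]
  module

/-- Write `s` for `schChange`. The curvature changes by two rank-one endomorphisms and a multiple of
the identity, so its trace gives `Ric'(v, w) = Ric(v, w) + s(w, v) - N s(v, w)`. The combination `N
Ric + Ricᵀ` cancels the transposed terms and leaves the factor `-(N² - 1)`, which is the
normalisation of the Schouten form. -/
lemma schC_projChange [FiniteDimensional ℝ E] (hN : 2 ≤ finrank ℝ E)
    {Γ Γ' : E → E →L[ℝ] E →L[ℝ] E} {υ : E → E →L[ℝ] ℝ} {z : E}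
    (hΓ : DifferentiableAt ℝ Γ z) (hΓ' : DifferentiableAt ℝ Γ' z) (hυ : DifferentiableAt ℝ υ z)
    (hs : ∀ v w, Γ z v w = Γ z w v)
    (hc : ∀ᶠ y in 𝓝 z, ∀ w v, Γ' y w v = Γ y w v + υ y v • w + υ y w • v) (v w : E) :
    schC Γ' z v w = schC Γ z v w - schChange Γ υ z v w := by
  have hric : ∀ v w, ricC Γ' z v w = ricC Γ z v w + schChange Γ υ z w v
      - finrank ℝ E * schChange Γ υ z v w := fun v w => by
    let q : E → E →ₗ[ℝ] ℝ := fun w =>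
      ((fderiv ℝ υ z).flip w - υ z ∘L Γ z w - υ z w • υ z : E →L[ℝ] ℝ)
    have hq : ∀ u w, q w u = schChange Γ υ z u w := fun u w => by
      simp [q, schChange, mul_comm]
    let qt : E →ₗ[ℝ] ℝ := (fderiv ℝ υ z v - υ z ∘L (Γ z).flip v - υ z v • υ z : E →L[ℝ] ℝ)
    have hqt : ∀ u, qt u = schChange Γ υ z v u := fun u => by simp [qt, schChange]
    have h1 : curvC Γ' z v w = curvC Γ z v w + (q v - qt).smulRight w + (q w).smulRight v -
        schChange Γ υ z v w • LinearMap.id := by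
      ext u
      rw [curvC_projChange hΓ hΓ' hυ hs hc]
      simp [hq, hqt]
    rw [ricC_apply, h1, ricC_apply, map_sub, map_add, map_add, map_smul, LinearMap.trace_id,
      LinearMap.trace_smulRight, LinearMap.trace_smulRight]
    simp only [LinearMap.sub_apply, hq, hqt, smul_eq_mul]
    ring
  have h2 : (2 : ℝ) ≤ finrank ℝ E := by exact_mod_cast hN
  rw [schC_apply, schC_apply, hric, hric]
  have h3 : (finrank ℝ E : ℝ) - 1 ≠ 0 := by linarith
  have h4 : (finrank ℝ E : ℝ) + 1 ≠ 0 := by linarith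
  field_simp
  ring

lemma fin3_add_one_one (a : Fin 3) : a + 1 + 1 = a + 2 := by fin_cases a <;> rfl
lemma fin3_add_one_two (a : Fin 3) : a + 1 + 2 = a := by fin_cases a <;> rfl
lemma fin3_add_two_one (a : Fin 3) : a + 2 + 1 = a := by fin_cases a <;> rfl
lemma fin3_add_two_two (a : Fin 3) : a + 2 + 2 = a + 1 := by fin_cases a <;> rfl

/-! ### Parallel hypercomplex structures in coordinates -/

/-- The connection form of the tractor connection. -/
def om (Γ : E → E →L[ℝ] E →L[ℝ] E) (z v : E) (c : E × ℝ) : E × ℝ :=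
  (Γ z c.1 v + c.2 • v, -schC Γ z v c.1)

/-- A parallel hypercomplex structure on the tractor bundle of the connection `D + Γ` over the open
set `O`. -/
structure ParTriple (Γ : E → E →L[ℝ] E →L[ℝ] E) (O : Set E)
    (T : Fin 3 → E → (E × ℝ →L[ℝ] E × ℝ)) : Prop where
  isOpen : IsOpen O
  contDiffOn_conn : ContDiffOn ℝ ∞ Γ O
  symm : ∀ z ∈ O, ∀ v w, Γ z v w = Γ z w v
  contDiffOn : ∀ a, ContDiffOn ℝ ∞ (T a) O
  par : ∀ a, ∀ z ∈ O, ∀ v c, fderiv ℝ (T a) z v c = T a z (om Γ z v c) - om Γ z v (T a z c)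
  sq : ∀ a, ∀ z ∈ O, ∀ c, T a z (T a z c) = -c
  mul : ∀ a, ∀ z ∈ O, ∀ c, T a z (T (a + 1) z c) = T (a + 2) z c

/-- The derivative of the change of splitting by a one-form. -/
def shear (υ : E →L[ℝ] ℝ) : E × ℝ →L[ℝ] E × ℝ :=
  ContinuousLinearMap.inr ℝ E ℝ ∘L υ ∘L ContinuousLinearMap.fst ℝ E ℝ

variable {Γ Γ' : E → E →L[ℝ] E →L[ℝ] E} {O : Set E} {T : Fin 3 → E → (E × ℝ →L[ℝ] E × ℝ)}

/-- The upper left block. -/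
def blkA (S : E × ℝ →L[ℝ] E × ℝ) : E →L[ℝ] E :=
  ContinuousLinearMap.fst ℝ E ℝ ∘L S ∘L ContinuousLinearMap.inl ℝ E ℝ

/-- The lower left block. -/
def blkB (S : E × ℝ →L[ℝ] E × ℝ) : E →L[ℝ] ℝ :=
  ContinuousLinearMap.snd ℝ E ℝ ∘L S ∘L ContinuousLinearMap.inl ℝ E ℝ

/-- The upper right block. -/
def blkI (S : E × ℝ →L[ℝ] E × ℝ) : E := (S (0, 1)).1

/-- The lower right block. -/
def blkC (S : E × ℝ →L[ℝ] E × ℝ) : ℝ := (S (0, 1)).2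

lemma apply_eq_blk (S : E × ℝ →L[ℝ] E × ℝ) (c : E × ℝ) :
    S c = (blkA S c.1 + c.2 • blkI S, blkB S c.1 + c.2 * blkC S) := by
  have h : c = (c.1, 0) + c.2 • ((0, 1) : E × ℝ) := by ext <;> simp
  conv_lhs => rw [h, map_add, map_smul]
  rfl

lemma ParTriple.mul' (h : ParTriple Γ O T) (a : Fin 3) {z : E} (hz : z ∈ O) (c : E × ℝ) :
    T (a + 1) z (T a z c) = -T (a + 2) z c := by
  have h1 := h.mul (a + 1) z hz c
  rw [fin3_add_one_one, fin3_add_one_two] at h1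
  rw [← h1, h.sq _ z hz]

lemma ParTriple.mono {O' : Set E} (h : ParTriple Γ O T) (hO' : IsOpen O') (hs : O' ⊆ O) :
    ParTriple Γ O' T where
  isOpen := hO'
  contDiffOn_conn := h.contDiffOn_conn.mono hs
  symm z hz := h.symm z (hs hz)
  contDiffOn a := (h.contDiffOn a).mono hs
  par a z hz := h.par a z (hs hz)
  sq a z hz := h.sq a z (hs hz)
  mul a z hz := h.mul a z (hs hz)

/-- The endomorphism `S` in the splitting which is changed by `υ`. -/
def conjShear (υ : E →L[ℝ] ℝ) (S : E × ℝ →L[ℝ] E × ℝ) : E × ℝ →L[ℝ] E × ℝ :=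
  (.id ℝ (E × ℝ) - shear υ) ∘L S ∘L (.id ℝ (E × ℝ) + shear υ)

lemma conjShear_apply (υ : E →L[ℝ] ℝ) (S : E × ℝ →L[ℝ] E × ℝ) (c : E × ℝ) :
    conjShear υ S c = S (c + (0, υ c.1)) - (0, υ (S (c + (0, υ c.1))).1) := by
  rfl

/-- `shear υ` squares to zero, so the two outer factors of `conjShear` are inverse to each other and
conjugation is multiplicative. -/
lemma conjShear_conjShear (υ : E →L[ℝ] ℝ) (S S' : E × ℝ →L[ℝ] E × ℝ) (c : E × ℝ) :
    conjShear υ S (conjShear υ S' c) = conjShear υ (S ∘L S') c := by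
  rw [conjShear_apply υ S', conjShear_apply, conjShear_apply, ContinuousLinearMap.comp_apply]
  generalize S' (c + (0, υ c.1)) = d
  have h2 : d - (0, υ d.1) + (0, υ (d - (0, υ d.1)).1) = d := by ext <;> simp
  rw [h2]

/-- The algebraic relations are invariant under conjugation. For parallelism, the first derivative
of the shear contributes exactly the terms by which the Schouten form changes, so the tractor
connection does not depend on the splitting. -/
lemma ParTriple.projChange [FiniteDimensional ℝ E] (h : ParTriple Γ O T) (hN : 2 ≤ finrank ℝ E)
    (hΓ' : ContDiffOn ℝ ∞ Γ' O) {υ : E → E →L[ℝ] ℝ} (hυ : ContDiffOn ℝ ∞ υ O)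
    (hc : ∀ z ∈ O, ∀ w v, Γ' z w v = Γ z w v + υ z v • w + υ z w • v) :
    ParTriple Γ' O (fun a z => conjShear (υ z) (T a z)) where
  isOpen := h.isOpen
  contDiffOn_conn := hΓ'
  symm z hz v w := by rw [hc z hz, hc z hz, h.symm z hz v w]; abel
  contDiffOn a := by
    have h1 : ContDiffOn ℝ ∞ (fun z => shear (υ z)) O :=
      contDiffOn_const.clm_comp (hυ.clm_comp contDiffOn_const)
    exact (contDiffOn_const.sub h1).clm_comp ((h.contDiffOn a).clm_comp (contDiffOn_const.add h1))
  sq a z hz c := by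
    have h1 : T a z ∘L T a z = -.id ℝ _ := ContinuousLinearMap.ext fun c => h.sq a z hz c
    rw [conjShear_conjShear, h1, conjShear_apply]
    ext <;> simp
  mul a z hz c := by
    have h1 : T a z ∘L T (a + 1) z = T (a + 2) z := ContinuousLinearMap.ext fun c => h.mul a z hz c
    rw [conjShear_conjShear, h1]
  par a z hz v c := by
    have hOz := h.isOpen.mem_nhds hz
    have dυ := ((hυ.contDiffAt hOz).differentiableAt (by simp)).hasFDerivAt
    have dT := (((h.contDiffOn a).contDiffAt hOz).differentiableAt (by simp)).hasFDerivAt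
    have dΓ := ((h.contDiffOn_conn.contDiffAt hOz).differentiableAt (by simp))
    have dΓ' := ((hΓ'.contDiffAt hOz).differentiableAt (by simp))
    have hP := fun w => schC_projChange hN dΓ dΓ' dυ.differentiableAt (h.symm z hz)
      (by filter_upwards [hOz] with y hy using hc y hy) v w
    have h1 : ContDiffAt ℝ ∞ (fun z => shear (υ z)) z :=
      contDiffAt_const.clm_comp ((hυ.contDiffAt hOz).clm_comp contDiffAt_const)
    have h2 : HasFDerivAt (fun y => conjShear (υ y) (T a y)) _ z :=
      (((contDiffAt_const.sub h1).clm_comp (((h.contDiffOn a).contDiffAt hOz).clm_comp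
        (contDiffAt_const.add h1))).differentiableAt (by simp)).hasFDerivAt
    have h3 := h2.clm_apply (hasFDerivAt_const c z)
    have h4 : HasFDerivAt (fun y => c + ContinuousLinearMap.inr ℝ E ℝ (υ y c.1)) _ z :=
      (((ContinuousLinearMap.inr ℝ E ℝ).hasFDerivAt (x := υ z c.1)).comp z
        (dυ.clm_apply (hasFDerivAt_const c.1 z))).const_add c
    have h5 := dT.clm_apply h4
    have h6 := h5.sub (((ContinuousLinearMap.inr ℝ E ℝ).hasFDerivAt).comp z
        (dυ.clm_apply (((ContinuousLinearMap.fst ℝ E ℝ).hasFDerivAt).comp z h5)))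
    have h7 := h3.unique (h6.congr_of_eventuallyEq (.of_forall fun y => conjShear_apply _ _ _))
    have h8 := congrArg (fun L : E →L[ℝ] E × ℝ => L v) h7
    simp only [ContinuousLinearMap.flip_apply, ContinuousLinearMap.comp_apply, add_apply,
      sub_apply, zero_apply, map_zero, zero_add, Function.comp_apply, h.par a z hz] at h8
    have hP' : ∀ w, schC Γ' z v w = schC Γ z v w - schChange Γ υ z v w := hP
    refine Eq.trans ?_ (h8.trans ?_)
    · rfl
    rw [conjShear_apply, conjShear_apply]
    have h9 := apply_eq_blk (T a z)
    simp only [h9, om, hP', hc z hz, schChange]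
    ext
    · simp
      module
    · simp
      ring

lemma blkA_conjShear (υ : E →L[ℝ] ℝ) (S : E × ℝ →L[ℝ] E × ℝ) (w : E) :
    blkA (conjShear υ S) w = blkA S w + υ w • blkI S := by
  change (conjShear υ S (w, 0)).1 = _
  rw [conjShear_apply, apply_eq_blk S]
  simp

lemma blkI_conjShear (υ : E →L[ℝ] ℝ) (S : E × ℝ →L[ℝ] E × ℝ) :
    blkI (conjShear υ S) = blkI S := by
  rw [blkI, conjShear_apply, apply_eq_blk S]
  simp

/-! ### Consequences of parallelism -/

lemma ParTriple.differentiableAt (h : ParTriple Γ O T) (a : Fin 3) {z : E} (hz : z ∈ O) :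
    DifferentiableAt ℝ (T a) z :=
  ((h.contDiffOn a).contDiffAt (h.isOpen.mem_nhds hz)).differentiableAt (by simp)

lemma ParTriple.fderiv_apply (h : ParTriple Γ O T) (a : Fin 3) {z : E} (hz : z ∈ O)
    (c : E × ℝ) : HasFDerivAt (fun y => T a y c) ((fderiv ℝ (T a) z).flip c) z := by
  simpa using (h.differentiableAt a hz).hasFDerivAt.clm_apply (hasFDerivAt_const c z)

lemma ParTriple.fderiv_fst (h : ParTriple Γ O T) (a : Fin 3) {z : E} (hz : z ∈ O) (v : E)
    (c : E × ℝ) : fderiv ℝ (fun y => (T a y c).1) z v =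
      (T a z (om Γ z v c) - om Γ z v (T a z c)).1 := by
  rw [((h.fderiv_apply a hz c).fst).fderiv, ← h.par a z hz]
  rfl

lemma ParTriple.fderiv_snd (h : ParTriple Γ O T) (a : Fin 3) {z : E} (hz : z ∈ O) (v : E)
    (c : E × ℝ) : fderiv ℝ (fun y => (T a y c).2) z v =
      (T a z (om Γ z v c) - om Γ z v (T a z c)).2 := by
  rw [((h.fderiv_apply a hz c).snd).fderiv, ← h.par a z hz]
  rfl

/-- Parallelism applied to `(0, 1)`, which `om` maps to `(v, 0)`. In covariant form it reads `∇i = A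
- c`; the other blocks give `∇c`, `∇A` and `∇β` in the same way. -/
lemma ParTriple.fderiv_blkI (h : ParTriple Γ O T) (a : Fin 3) {z : E} (hz : z ∈ O) (v : E) :
    fderiv ℝ (fun y => blkI (T a y)) z v =
      blkA (T a z) v - blkC (T a z) • v - Γ z (blkI (T a z)) v := by
  refine (h.fderiv_fst a hz v (0, 1)).trans ?_
  simp only [apply_eq_blk (T a z), om]
  simp
  abel

lemma ParTriple.fderiv_blkC (h : ParTriple Γ O T) (a : Fin 3) {z : E} (hz : z ∈ O) (v : E) :
    fderiv ℝ (fun y => blkC (T a y)) z v =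
      blkB (T a z) v + schC Γ z v (blkI (T a z)) := by
  refine (h.fderiv_snd a hz v (0, 1)).trans ?_
  simp only [apply_eq_blk (T a z), om]
  simp

lemma ParTriple.fderiv_blkA (h : ParTriple Γ O T) (a : Fin 3) {z : E} (hz : z ∈ O) (v w : E) :
    fderiv ℝ (fun y => blkA (T a y)) z v w =
      blkA (T a z) (Γ z w v) - schC Γ z v w • blkI (T a z) - Γ z (blkA (T a z) w) v
        - blkB (T a z) w • v := by
  have h1 : DifferentiableAt ℝ (fun y => blkA (T a y)) z :=
    (differentiableAt_const _).clm_comp ((h.differentiableAt a hz).clm_comp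
      (differentiableAt_const _))
  have h2 := (h1.hasFDerivAt.clm_apply (hasFDerivAt_const w z)).fderiv
  have h3 := congrArg (fun L : E →L[ℝ] E => L v) h2
  refine Eq.trans ?_ (h3.symm.trans ((h.fderiv_fst a hz v (w, 0)).trans ?_))
  · simp
  simp only [apply_eq_blk (T a z), om]
  simp
  module

lemma ParTriple.fderiv_blkB (h : ParTriple Γ O T) (a : Fin 3) {z : E} (hz : z ∈ O) (v w : E) :
    fderiv ℝ (fun y => blkB (T a y)) z v w =
      blkB (T a z) (Γ z w v) - blkC (T a z) * schC Γ z v w + schC Γ z v (blkA (T a z) w) := by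
  have h1 : DifferentiableAt ℝ (fun y => blkB (T a y)) z :=
    (differentiableAt_const _).clm_comp ((h.differentiableAt a hz).clm_comp
      (differentiableAt_const _))
  have h2 := (h1.hasFDerivAt.clm_apply (hasFDerivAt_const w z)).fderiv
  have h3 := congrArg (fun L : E →L[ℝ] ℝ => L v) h2
  refine Eq.trans ?_ (h3.symm.trans ((h.fderiv_snd a hz v (w, 0)).trans ?_))
  · simp
  simp only [apply_eq_blk (T a z), om]
  simp
  ring

lemma contDiffOn_blkA (h : ParTriple Γ O T) (a : Fin 3) :
    ContDiffOn ℝ ∞ (fun y => blkA (T a y)) O :=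
  contDiffOn_const.clm_comp ((h.contDiffOn a).clm_comp contDiffOn_const)

lemma contDiffOn_blkB (h : ParTriple Γ O T) (a : Fin 3) :
    ContDiffOn ℝ ∞ (fun y => blkB (T a y)) O :=
  contDiffOn_const.clm_comp ((h.contDiffOn a).clm_comp contDiffOn_const)

lemma contDiffOn_blkI (h : ParTriple Γ O T) (a : Fin 3) :
    ContDiffOn ℝ ∞ (fun y => blkI (T a y)) O :=
  ((h.contDiffOn a).clm_apply contDiffOn_const).fst

section Relations

variable {X Y Z : E × ℝ →L[ℝ] E × ℝ}

lemma blk_mul (h : ∀ c, X (Y c) = Z c) :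
    (∀ w, blkA X (blkA Y w) + blkB Y w • blkI X = blkA Z w) ∧
    blkA X (blkI Y) + blkC Y • blkI X = blkI Z ∧
    (∀ w, blkB X (blkA Y w) + blkC X * blkB Y w = blkB Z w) ∧
    blkB X (blkI Y) + blkC X * blkC Y = blkC Z := by
  have h1 : ∀ c, (X (Y c)).1 = (Z c).1 := fun c => by rw [h]
  have h2 : ∀ c, (X (Y c)).2 = (Z c).2 := fun c => by rw [h]
  simp only [apply_eq_blk] at h1 h2
  refine ⟨fun w => ?_, ?_, fun w => ?_, ?_⟩
  · simpa using h1 (w, 0)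
  · simpa using h1 (0, 1)
  · simpa [mul_comm] using h2 (w, 0)
  · simpa [mul_comm] using h2 (0, 1)

end Relations

/-- The blocks of the relations in a hypercomplex triple. -/
lemma ParTriple.blk_sq (h : ParTriple Γ O T) (a : Fin 3) {z : E} (hz : z ∈ O) :
    (∀ w, blkA (T a z) (blkA (T a z) w) + blkB (T a z) w • blkI (T a z) = -w) ∧
    blkA (T a z) (blkI (T a z)) + blkC (T a z) • blkI (T a z) = 0 ∧
    (∀ w, blkB (T a z) (blkA (T a z) w) + blkC (T a z) * blkB (T a z) w = 0) ∧
    blkB (T a z) (blkI (T a z)) + blkC (T a z) * blkC (T a z) = -1 := by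
  have := blk_mul (X := T a z) (Y := T a z) (Z := -.id ℝ _) (h.sq a z hz)
  simpa [blkA, blkB, blkI, blkC] using this

lemma ParTriple.blk_mul (h : ParTriple Γ O T) (a : Fin 3) {z : E} (hz : z ∈ O) :
    (∀ w, blkA (T a z) (blkA (T (a + 1) z) w) + blkB (T (a + 1) z) w • blkI (T a z) =
      blkA (T (a + 2) z) w) ∧
    blkA (T a z) (blkI (T (a + 1) z)) + blkC (T (a + 1) z) • blkI (T a z) = blkI (T (a + 2) z) ∧
    (∀ w, blkB (T a z) (blkA (T (a + 1) z) w) + blkC (T a z) * blkB (T (a + 1) z) w =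
      blkB (T (a + 2) z) w) ∧
    blkB (T a z) (blkI (T (a + 1) z)) + blkC (T a z) * blkC (T (a + 1) z) = blkC (T (a + 2) z) :=
  ProjTractor.blk_mul (h.mul a z hz)

lemma ParTriple.blk_mul' (h : ParTriple Γ O T) (a : Fin 3) {z : E} (hz : z ∈ O) :
    (∀ w, blkA (T (a + 1) z) (blkA (T a z) w) + blkB (T a z) w • blkI (T (a + 1) z) =
      -blkA (T (a + 2) z) w) ∧
    blkA (T (a + 1) z) (blkI (T a z)) + blkC (T a z) • blkI (T (a + 1) z) =
      -blkI (T (a + 2) z) ∧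
    (∀ w, blkB (T (a + 1) z) (blkA (T a z) w) + blkC (T (a + 1) z) * blkB (T a z) w =
      -blkB (T (a + 2) z) w) ∧
    blkB (T (a + 1) z) (blkI (T a z)) + blkC (T (a + 1) z) * blkC (T a z) =
      -blkC (T (a + 2) z) := by
  have := ProjTractor.blk_mul (X := T (a + 1) z) (Y := T a z) (Z := -T (a + 2) z) (h.mul' a hz)
  simpa [blkA, blkB, blkI, blkC] using this

/-- `[i, j] = -2 k`. -/
lemma ParTriple.bracket (h : ParTriple Γ O T) (a : Fin 3) {z : E} (hz : z ∈ O) :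
    fderiv ℝ (fun y => blkI (T (a + 1) y)) z (blkI (T a z)) -
      fderiv ℝ (fun y => blkI (T a y)) z (blkI (T (a + 1) z)) = (-2 : ℝ) • blkI (T (a + 2) z) := by
  -- By symmetry of `Γ` the bracket is `∇` of one field along the other, skew-symmetrised, and `∇i =
  -- A - c`. The upper right blocks of the two products `T_a T_{a+1}` and `T_{a+1} T_a` evaluate it
  -- to `-2` times the third field.
  rw [h.fderiv_blkI _ hz, h.fderiv_blkI _ hz, h.symm z hz (blkI (T a z))]
  have h1 := (h.blk_mul a hz).2.1
  have h2 := (h.blk_mul' a hz).2.1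
  linear_combination (norm := module) h2 - h1

/-- If `∑ g_a i_a = 0`, then `(0, 1)` is an eigenvector of `X = ∑ g_a T_a` with a real eigenvalue.
Since `X² = -|g|²`, the square of this eigenvalue is `-|g|²`, and so `g = 0`. -/
lemma ParTriple.linearIndependent (h : ParTriple Γ O T) {z : E} (hz : z ∈ O) :
    LinearIndependent ℝ (fun a => blkI (T a z)) := by
  rw [Fintype.linearIndependent_iff]
  intro g hg
  rw [Fin.sum_univ_three] at hg
  have s0 := (h.blk_sq 0 hz).2.2.2
  have s1 := (h.blk_sq 1 hz).2.2.2
  have s2 := (h.blk_sq 2 hz).2.2.2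
  have m0 := (h.blk_mul 0 hz).2.2.2
  have m1 := (h.blk_mul 1 hz).2.2.2
  have m2 := (h.blk_mul 2 hz).2.2.2
  have n0 := (h.blk_mul' 0 hz).2.2.2
  have n1 := (h.blk_mul' 1 hz).2.2.2
  have n2 := (h.blk_mul' 2 hz).2.2.2
  have e0 := congrArg (blkB (T 0 z)) hg
  have e1 := congrArg (blkB (T 1 z)) hg
  have e2 := congrArg (blkB (T 2 z)) hg
  simp only [map_add, map_smul, map_zero, smul_eq_mul] at e0 e1 e2
  simp only [Fin.isValue, zero_add, Fin.reduceAdd] at m0 m1 m2 n0 n1 n2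
  have key : (g 0 * blkC (T 0 z) + g 1 * blkC (T 1 z) + g 2 * blkC (T 2 z)) ^ 2 =
      -(g 0 ^ 2 + g 1 ^ 2 + g 2 ^ 2) := by
    linear_combination g 0 ^ 2 * s0 + g 1 ^ 2 * s1 + g 2 ^ 2 * s2 + g 0 * g 1 * (m0 + n0) +
      g 1 * g 2 * (m1 + n1) + g 2 * g 0 * (m2 + n2) - g 0 * e0 - g 1 * e1 - g 2 * e2
  have k : g 0 ^ 2 + g 1 ^ 2 + g 2 ^ 2 = 0 := by
    have k1 := sq_nonneg (g 0 * blkC (T 0 z) + g 1 * blkC (T 1 z) + g 2 * blkC (T 2 z))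
    rw [key] at k1
    linarith only [k1, sq_nonneg (g 0), sq_nonneg (g 1), sq_nonneg (g 2)]
  have z0 : g 0 = 0 := pow_eq_zero_iff two_ne_zero |>.1 (by
    linarith only [k, sq_nonneg (g 0), sq_nonneg (g 1), sq_nonneg (g 2)])
  have z1 : g 1 = 0 := pow_eq_zero_iff two_ne_zero |>.1 (by
    linarith only [k, sq_nonneg (g 0), sq_nonneg (g 1), sq_nonneg (g 2)])
  have z2 : g 2 = 0 := pow_eq_zero_iff two_ne_zero |>.1 (by
    linarith only [k, sq_nonneg (g 0), sq_nonneg (g 1), sq_nonneg (g 2)])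
  exact fun a => match a with
    | 0 => z0
    | 1 => z1
    | 2 => z2

/-- The trace of a hypercomplex endomorphism vanishes. -/
lemma ParTriple.trace_blkA [FiniteDimensional ℝ E] (h : ParTriple Γ O T) (a : Fin 3) {z : E}
    (hz : z ∈ O) : LinearMap.trace ℝ E (blkA (T a z)) = -blkC (T a z) := by
  have h1 := h.blk_mul (a + 1) hz
  have h2 := h.blk_mul' (a + 1) hz
  rw [fin3_add_one_one, fin3_add_one_two] at h1 h2
  -- Upper left blocks of `T_a = T_{a+1} T_{a+2}` and of `-T_a = T_{a+2} T_{a+1}`. The traces of the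
  -- products of `A`-blocks agree, and the rank-one corrections are evaluated by the lower right
  -- blocks.
  have e1 : ((blkA (T a z) : E →L[ℝ] E) : E →ₗ[ℝ] E) =
      (blkA (T (a + 1) z) : E →ₗ[ℝ] E) * (blkA (T (a + 2) z) : E →ₗ[ℝ] E)
        + (blkB (T (a + 2) z) : E →ₗ[ℝ] ℝ).smulRight (blkI (T (a + 1) z)) := by
    ext w
    simpa using (h1.1 w).symm
  have e2 : -((blkA (T a z) : E →L[ℝ] E) : E →ₗ[ℝ] E) =
      (blkA (T (a + 2) z) : E →ₗ[ℝ] E) * (blkA (T (a + 1) z) : E →ₗ[ℝ] E)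
        + (blkB (T (a + 1) z) : E →ₗ[ℝ] ℝ).smulRight (blkI (T (a + 2) z)) := by
    ext w
    simpa using (h2.1 w).symm
  have t1 := congrArg (LinearMap.trace ℝ E) e1
  have t2 := congrArg (LinearMap.trace ℝ E) e2
  rw [map_add, LinearMap.trace_smulRight] at t1 t2
  rw [map_neg, LinearMap.trace_mul_comm] at t2
  have u1 := h1.2.2.2
  have u2 := h2.2.2.2
  simp only [ContinuousLinearMap.coe_coe] at t1 t2
  linarith

end Coordinates

end

/-! ### Adapted splittings and horizontal calculus along the leaves -/

section

section Coordinates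

variable {E : Type*} [NormedAddCommGroup E] [NormedSpace ℝ E]
  {Γ Γ' : E → E →L[ℝ] E →L[ℝ] E} {O : Set E} {T : Fin 3 → E → (E × ℝ →L[ℝ] E × ℝ)}

/-! ### Symmetry of the Ricci form -/

/-- The trace of the connection form. -/
def traceC (Γ : E → E →L[ℝ] E →L[ℝ] E) (z v : E) : ℝ :=
  LinearMap.trace ℝ E ((Γ z).flip v : E →ₗ[ℝ] E)

lemma trace_comp_comm [FiniteDimensional ℝ E] (A B : E →L[ℝ] E) :
    LinearMap.trace ℝ E ((A ∘L B : E →L[ℝ] E) : E →ₗ[ℝ] E) =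
      LinearMap.trace ℝ E ((B ∘L A : E →L[ℝ] E) : E →ₗ[ℝ] E) :=
  LinearMap.trace_mul_comm ℝ (A : E →ₗ[ℝ] E) (B : E →ₗ[ℝ] E)

lemma fderiv_conn_symm (hO : IsOpen O) (hΓ : ContDiffOn ℝ ∞ Γ O)
    (hs : ∀ z ∈ O, ∀ v w, Γ z v w = Γ z w v) {z : E} (hz : z ∈ O) (u v w : E) :
    fderiv ℝ Γ z u v w = fderiv ℝ Γ z u w v := by
  have d := ((hΓ.contDiffAt (hO.mem_nhds hz)).differentiableAt (by simp)).hasFDerivAt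
  have h1 : HasFDerivAt (fun y => Γ y v w) _ z :=
    (d.clm_apply (hasFDerivAt_const v z)).clm_apply (hasFDerivAt_const w z)
  have h2 : HasFDerivAt (fun y => Γ y w v) _ z :=
    (d.clm_apply (hasFDerivAt_const w z)).clm_apply (hasFDerivAt_const v z)
  have h3 := h1.unique (h2.congr_of_eventuallyEq (by
    filter_upwards [hO.mem_nhds hz] with y hy using hs y hy v w))
  simpa using congrArg (fun L : E →L[ℝ] E => L u) h3

/-- By the first Bianchi identity the skew part of the Ricci form is, up to a factor, the exterior
derivative of the connection trace; `hθ` says that this trace is closed. -/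
lemma ricC_symm [FiniteDimensional ℝ E] (hO : IsOpen O) (hΓ : ContDiffOn ℝ ∞ Γ O)
    (hs : ∀ z ∈ O, ∀ v w, Γ z v w = Γ z w v) {z : E} (hz : z ∈ O)
    (hθ : ∀ v w, fderiv ℝ (fun y => traceC Γ y w) z v = fderiv ℝ (fun y => traceC Γ y v) z w)
    (v w : E) : ricC Γ z v w = ricC Γ z w v := by
  have d := ((hΓ.contDiffAt (hO.mem_nhds hz)).differentiableAt (by simp)).hasFDerivAt
  have hD := fderiv_conn_symm hO hΓ hs hz
  have h1 : ∀ v w, fderiv ℝ (fun y => traceC Γ y w) z v =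
      LinearMap.trace ℝ E ((fderiv ℝ Γ z v).flip w : E →ₗ[ℝ] E) := fun v w => by
    let tr : (E →L[ℝ] E →L[ℝ] E) →L[ℝ] ℝ := LinearMap.toContinuousLinearMap
      { toFun := fun G => LinearMap.trace ℝ E (G.flip w : E →ₗ[ℝ] E)
        map_add' := fun G G' => by rw [← map_add]; rfl
        map_smul' := fun c G => by rw [RingHom.id_apply, ← map_smul]; rfl }
    have h2 : HasFDerivAt (tr ∘ Γ) (tr ∘L fderiv ℝ Γ z) z :=
      (tr.hasFDerivAt (x := Γ z)).comp z d
    have h3 : (fun y => traceC Γ y w) = tr ∘ Γ := rfl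
    rw [h3, h2.fderiv]
    rfl
  have h2 : ∀ v w, ricC Γ z v w =
      LinearMap.trace ℝ E ((((fderiv ℝ Γ z).flip w).flip v : E →L[ℝ] E) : E →ₗ[ℝ] E)
      - LinearMap.trace ℝ E ((fderiv ℝ Γ z v).flip w : E →ₗ[ℝ] E)
      + LinearMap.trace ℝ E ((Γ z (Γ z w v) : E →L[ℝ] E) : E →ₗ[ℝ] E)
      - LinearMap.trace ℝ E (((Γ z).flip v ∘L Γ z w : E →L[ℝ] E) : E →ₗ[ℝ] E) := fun v w => by
    rw [← map_sub, ← map_add, ← map_sub, ricC_apply]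
    congr 1
    ext u
    simp [curvC_apply, hD v w u]
  have h3 : ((fderiv ℝ Γ z).flip w).flip v = ((fderiv ℝ Γ z).flip v).flip w := by
    ext u
    simp [hD u w v]
  have h4 : ∀ v, (Γ z).flip v = Γ z v := fun v => by
    ext u
    simp [hs z hz u v]
  have h5 := hθ v w
  rw [h1, h1] at h5
  rw [h2, h2, h3, h5, hs z hz w v, h4, h4, trace_comp_comm]

lemma schC_symm_of_ricC {z : E} (h : ∀ v w, ricC Γ z v w = ricC Γ z w v) (v w : E) :
    schC Γ z v w = schC Γ z w v := by
  rw [schC_apply, schC_apply, h v w]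

/-! ### Adapted connections -/

/-- The tensors of a parallel hypercomplex structure on the tractor bundle in the splitting of an
adapted connection. -/
structure AdData (Γ : E → E →L[ℝ] E →L[ℝ] E) (O : Set E) (A : Fin 3 → E → E →L[ℝ] E)
    (i : Fin 3 → E → E) (β : Fin 3 → E → E →L[ℝ] ℝ) : Prop where
  isOpen : IsOpen O
  contDiffOn_conn : ContDiffOn ℝ ∞ Γ O
  contDiffOn_A : ∀ a, ContDiffOn ℝ ∞ (A a) O
  contDiffOn_i : ∀ a, ContDiffOn ℝ ∞ (i a) O
  contDiffOn_β : ∀ a, ContDiffOn ℝ ∞ (β a) O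
  symm : ∀ z ∈ O, ∀ v w, Γ z v w = Γ z w v
  sch_symm : ∀ z ∈ O, ∀ v w, schC Γ z v w = schC Γ z w v
  β_eq : ∀ a, ∀ z ∈ O, ∀ v, β a z v = -schC Γ z v (i a z)
  di : ∀ a, ∀ z ∈ O, ∀ v, fderiv ℝ (i a) z v = A a z v - Γ z (i a z) v
  dA : ∀ a, ∀ z ∈ O, ∀ v w, fderiv ℝ (A a) z v w = A a z (Γ z w v) - schC Γ z v w • i a z
    - Γ z (A a z w) v - β a z w • v
  dβ : ∀ a, ∀ z ∈ O, ∀ v w, fderiv ℝ (β a) z v w = β a z (Γ z w v) + schC Γ z v (A a z w)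
  A_i : ∀ a, ∀ z ∈ O, A a z (i a z) = 0
  A_i_one : ∀ a, ∀ z ∈ O, A a z (i (a + 1) z) = i (a + 2) z
  A_one_i : ∀ a, ∀ z ∈ O, A (a + 1) z (i a z) = -i (a + 2) z
  β_i : ∀ a, ∀ z ∈ O, β a z (i a z) = -1
  β_i_one : ∀ a, ∀ z ∈ O, β a z (i (a + 1) z) = 0
  β_one_i : ∀ a, ∀ z ∈ O, β (a + 1) z (i a z) = 0
  A_A : ∀ a, ∀ z ∈ O, ∀ w, A a z (A a z w) = -w - β a z w • i a z
  A_A_one : ∀ a, ∀ z ∈ O, ∀ w,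
    A a z (A (a + 1) z w) = A (a + 2) z w - β (a + 1) z w • i a z
  A_one_A : ∀ a, ∀ z ∈ O, ∀ w,
    A (a + 1) z (A a z w) = -A (a + 2) z w - β a z w • i (a + 1) z
  β_A : ∀ a, ∀ z ∈ O, ∀ w, β a z (A a z w) = 0
  β_A_one : ∀ a, ∀ z ∈ O, ∀ w, β a z (A (a + 1) z w) = β (a + 2) z w
  β_one_A : ∀ a, ∀ z ∈ O, ∀ w, β (a + 1) z (A a z w) = -β (a + 2) z w

/-- With vanishing lower right blocks, the equation for `dc` becomes `β = -P(·, i)`, the equation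
for `∇i` becomes `∇i = A`, and the block relations lose their `c`-terms. -/
lemma ParTriple.adData (h : ParTriple Γ O T) (hc : ∀ a, ∀ z ∈ O, blkC (T a z) = 0)
    (hP : ∀ z ∈ O, ∀ v w, schC Γ z v w = schC Γ z w v) :
    AdData Γ O (fun a z => blkA (T a z)) (fun a z => blkI (T a z)) (fun a z => blkB (T a z)) where
  isOpen := h.isOpen
  contDiffOn_conn := h.contDiffOn_conn
  contDiffOn_A := contDiffOn_blkA h
  contDiffOn_i := contDiffOn_blkI h
  contDiffOn_β := contDiffOn_blkB h
  symm := h.symm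
  sch_symm := hP
  β_eq a z hz v := by
    have h1 := h.fderiv_blkC a hz v
    have h2 : (fun y => blkC (T a y)) =ᶠ[𝓝 z] fun _ => 0 := by
      filter_upwards [h.isOpen.mem_nhds hz] with y hy using hc a y hy
    rw [h2.fderiv_eq (𝕜 := ℝ)] at h1
    simp only [fderiv_fun_const, Pi.zero_apply, zero_apply] at h1
    linarith
  di a z hz v := by simp [h.fderiv_blkI a hz, hc a z hz]
  dA a z hz v w := h.fderiv_blkA a hz v w
  dβ a z hz v w := by simp [h.fderiv_blkB a hz, hc a z hz]
  A_i a z hz := by simpa [hc _ z hz] using (h.blk_sq a hz).2.1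
  A_i_one a z hz := by simpa [hc _ z hz] using (h.blk_mul a hz).2.1
  A_one_i a z hz := by simpa [hc _ z hz] using (h.blk_mul' a hz).2.1
  β_i a z hz := by simpa [hc _ z hz] using (h.blk_sq a hz).2.2.2
  β_i_one a z hz := by simpa [hc _ z hz] using (h.blk_mul a hz).2.2.2
  β_one_i a z hz := by simpa [hc _ z hz] using (h.blk_mul' a hz).2.2.2
  A_A a z hz w := eq_sub_of_add_eq ((h.blk_sq a hz).1 w)
  A_A_one a z hz w := eq_sub_of_add_eq ((h.blk_mul a hz).1 w)
  A_one_A a z hz w := eq_sub_of_add_eq ((h.blk_mul' a hz).1 w)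
  β_A a z hz w := by simpa [hc _ z hz] using (h.blk_sq a hz).2.2.1 w
  β_A_one a z hz w := by simpa [hc _ z hz] using (h.blk_mul a hz).2.2.1 w
  β_one_A a z hz w := by simpa [hc _ z hz] using (h.blk_mul' a hz).2.2.1 w

/-! ### The projection to the leaf space -/

variable {F : Type*} [NormedAddCommGroup F] [NormedSpace ℝ F]
  {A : Fin 3 → E → E →L[ℝ] E} {i : Fin 3 → E → E} {β : Fin 3 → E → E →L[ℝ] ℝ}

/-- Adapted data on an open set, together with a linear projection `q` with right inverse `r`, whose
fibres are the leaves. -/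
structure FibData (Γ : E → E →L[ℝ] E →L[ℝ] E) (O : Set E) (A : Fin 3 → E → E →L[ℝ] E)
    (i : Fin 3 → E → E) (β : Fin 3 → E → E →L[ℝ] ℝ) (q : E →L[ℝ] F) (r : F →L[ℝ] E) : Prop
    extends AdData Γ O A i β where
  q_r : ∀ y, q (r y) = y
  q_i : ∀ a, ∀ z ∈ O, q (i a z) = 0
  finrank_eq : finrank ℝ E = finrank ℝ F + 3

/-- The horizontal lift. -/
def hor (i : Fin 3 → E → E) (β : Fin 3 → E → E →L[ℝ] ℝ) (r : F →L[ℝ] E) (z : E) : F →L[ℝ] E :=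
  r + ∑ a, (β a z ∘L r).smulRight (i a z)

/-- The endomorphisms induced on the base. -/
def desc (A : Fin 3 → E → E →L[ℝ] E) (i : Fin 3 → E → E) (β : Fin 3 → E → E →L[ℝ] ℝ)
    (q : E →L[ℝ] F) (r : F →L[ℝ] E) (a : Fin 3) (z : E) : F →L[ℝ] F :=
  q ∘L A a z ∘L hor i β r z

/-- The connection form induced on the base. -/
def descConn (Γ : E → E →L[ℝ] E →L[ℝ] E) (i : Fin 3 → E → E) (β : Fin 3 → E → E →L[ℝ] ℝ)
    (q : E →L[ℝ] F) (r : F →L[ℝ] E) (z : E) : F →L[ℝ] F →L[ℝ] F :=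
  ((ContinuousLinearMap.compL ℝ F E F q) ∘L
    ((ContinuousLinearMap.compL ℝ F E E).flip (hor i β r z))) ∘L Γ z ∘L hor i β r z

variable {q : E →L[ℝ] F} {r : F →L[ℝ] E}

lemma descConn_apply (z : E) (y y' : F) : descConn Γ i β q r z y y' =
    q (Γ z (hor i β r z y) (hor i β r z y')) := rfl

lemma desc_apply (a : Fin 3) (z : E) (y : F) : desc A i β q r a z y =
    q (A a z (hor i β r z y)) := rfl

lemma fin3_cases (a b : Fin 3) : b = a ∨ b = a + 1 ∨ b = a + 2 := by revert a b; decide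
lemma fin3_ne_one (a : Fin 3) : a ≠ a + 1 := by revert a; decide
lemma fin3_ne_two (a : Fin 3) : a ≠ a + 2 := by revert a; decide

namespace FibData

lemma β_i_ite (h : FibData Γ O A i β q r) (a b : Fin 3) {z : E} (hz : z ∈ O) :
    β a z (i b z) = if a = b then -1 else 0 := by
  have h0 := h.β_i a z hz
  have h1 := h.β_i_one a z hz
  have h2 := h.β_one_i (a + 2) z hz
  rw [fin3_add_two_one] at h2
  rcases fin3_cases a b with rfl | rfl | rfl
  · simp [h0]
  · rw [h1, if_neg (fin3_ne_one a)]
  · rw [h2, if_neg (fin3_ne_two a)]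

lemma β_hor (h : FibData Γ O A i β q r) (a : Fin 3) {z : E} (hz : z ∈ O) (y : F) :
    β a z (hor i β r z y) = 0 := by
  simp [hor, h.β_i_ite _ _ hz]

lemma q_hor (h : FibData Γ O A i β q r) {z : E} (hz : z ∈ O) (y : F) :
    q (hor i β r z y) = y := by
  simp [hor, h.q_i _ z hz, h.q_r]

lemma linearIndependent (h : FibData Γ O A i β q r) {z : E} (hz : z ∈ O) :
    LinearIndependent ℝ (fun a => i a z) := by
  rw [Fintype.linearIndependent_iff]
  intro g hg b
  have := congrArg (β b z) hg
  simpa [h.β_i_ite _ _ hz] using this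

lemma ker_eq [FiniteDimensional ℝ E] (h : FibData Γ O A i β q r) {z : E} (hz : z ∈ O) :
    LinearMap.ker (q : E →ₗ[ℝ] F) = Submodule.span ℝ (Set.range fun a => i a z) := by
  symm
  apply Submodule.eq_of_le_of_finrank_eq
  · rw [Submodule.span_le]
    rintro _ ⟨a, rfl⟩
    exact h.q_i a z hz
  · rw [finrank_span_eq_card (h.linearIndependent hz), Fintype.card_fin]
    have h1 := (q : E →ₗ[ℝ] F).finrank_range_add_finrank_ker
    rw [LinearMap.range_eq_top.2 fun y => ⟨r y, h.q_r y⟩, finrank_top, h.finrank_eq] at h1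
    omega

/-- `w - hor (q w)` is in the kernel of `q`, hence a combination of the `i a z`. Its coefficients
are read off with the forms `β`; the sign comes from `β_a(i_a) = -1`. -/
lemma decomp [FiniteDimensional ℝ E] (h : FibData Γ O A i β q r) {z : E} (hz : z ∈ O) (w : E) :
    w = hor i β r z (q w) - ∑ a, β a z w • i a z := by
  have h1 : w - hor i β r z (q w) ∈ LinearMap.ker (q : E →ₗ[ℝ] F) := by
    simp [h.q_hor hz]
  rw [h.ker_eq hz, Submodule.mem_span_range_iff_exists_fun] at h1
  obtain ⟨c, hc⟩ := h1
  have h2 : ∀ b, β b z w = -c b := fun b => by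
    have := congrArg (β b z) hc
    simp [h.β_i_ite _ _ hz, h.β_hor b hz] at this
    exact this.symm
  simp only [h2, neg_smul, Finset.sum_neg_distrib, hc]
  abel

lemma ext_of [FiniteDimensional ℝ E] (h : FibData Γ O A i β q r) {z : E} (hz : z ∈ O) {w w' : E}
    (hq : q w = q w') (hβ : ∀ a, β a z w = β a z w') : w = w' := by
  rw [h.decomp hz w, h.decomp hz w', hq]
  simp only [hβ]

lemma q_A_i (h : FibData Γ O A i β q r) (a b : Fin 3) {z : E} (hz : z ∈ O) :
    q (A a z (i b z)) = 0 := by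
  have h2 := h.A_one_i (a + 2) z hz
  rw [fin3_add_two_one, fin3_add_two_two] at h2
  rcases fin3_cases a b with rfl | rfl | rfl
  · rw [h.A_i _ z hz, map_zero]
  · rw [h.A_i_one _ z hz, h.q_i _ z hz]
  · rw [h2, map_neg, h.q_i _ z hz, neg_zero]

lemma q_A [FiniteDimensional ℝ E] (h : FibData Γ O A i β q r) (a : Fin 3) {z : E} (hz : z ∈ O)
    (w : E) : q (A a z w) = desc A i β q r a z (q w) := by
  conv_lhs => rw [h.decomp hz w]
  simp [h.q_A_i _ _ hz, desc_apply]

lemma q_A_eq_zero [FiniteDimensional ℝ E] (h : FibData Γ O A i β q r) (a : Fin 3) {z : E}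
    (hz : z ∈ O) {w : E} (hw : q w = 0) : q (A a z w) = 0 := by
  rw [h.q_A a hz, hw, map_zero]

lemma β_A_hor (h : FibData Γ O A i β q r) (a b : Fin 3) {z : E} (hz : z ∈ O) (y : F) :
    β b z (A a z (hor i β r z y)) = 0 := by
  have h2 := h.β_A_one (a + 2) z hz (hor i β r z y)
  rw [fin3_add_two_one, fin3_add_two_two] at h2
  rcases fin3_cases a b with rfl | rfl | rfl
  · rw [h.β_A _ z hz]
  · rw [h.β_one_A _ z hz, h.β_hor _ hz, neg_zero]
  · rw [h2, h.β_hor _ hz]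

/-- Each composite of some `β_b` with `A_a` is zero or, up to sign, another `β`, so `A_a` preserves
the horizontal space. -/
lemma hor_desc [FiniteDimensional ℝ E] (h : FibData Γ O A i β q r) (a : Fin 3) {z : E} (hz : z ∈ O)
    (y : F) : hor i β r z (desc A i β q r a z y) = A a z (hor i β r z y) :=
  h.ext_of hz (by rw [h.q_hor hz, desc_apply]) fun b => by rw [h.β_hor b hz, h.β_A_hor a b hz]

lemma desc_desc [FiniteDimensional ℝ E] (h : FibData Γ O A i β q r) (a b : Fin 3) {z : E}
    (hz : z ∈ O) (y : F) : desc A i β q r a z (desc A i β q r b z y) =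
      q (A a z (A b z (hor i β r z y))) := by
  rw [desc_apply, h.hor_desc b hz]

lemma desc_sq [FiniteDimensional ℝ E] (h : FibData Γ O A i β q r) (a : Fin 3) {z : E}
    (hz : z ∈ O) (y : F) : desc A i β q r a z (desc A i β q r a z y) = -y := by
  rw [h.desc_desc a a hz, h.A_A a z hz, h.β_hor a hz, map_sub, map_neg, h.q_hor hz]
  simp

lemma desc_mul [FiniteDimensional ℝ E] (h : FibData Γ O A i β q r) (a : Fin 3) {z : E}
    (hz : z ∈ O) (y : F) : desc A i β q r a z (desc A i β q r (a + 1) z y) =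
      desc A i β q r (a + 2) z y := by
  rw [h.desc_desc _ _ hz, h.A_A_one a z hz, h.β_hor _ hz, map_sub, desc_apply]
  simp

lemma desc_mul' [FiniteDimensional ℝ E] (h : FibData Γ O A i β q r) (a : Fin 3) {z : E}
    (hz : z ∈ O) (y : F) : desc A i β q r (a + 1) z (desc A i β q r a z y) =
      -desc A i β q r (a + 2) z y := by
  rw [h.desc_desc _ _ hz, h.A_one_A a z hz, h.β_hor _ hz, map_sub, map_neg, desc_apply]
  simp

/-! #### Differentiation along the leaves -/

lemma hasFDerivAt_conn (h : FibData Γ O A i β q r) {z : E} (hz : z ∈ O) :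
    HasFDerivAt Γ (fderiv ℝ Γ z) z :=
  ((h.contDiffOn_conn.contDiffAt (h.isOpen.mem_nhds hz)).differentiableAt (by simp)).hasFDerivAt

lemma hasFDerivAt_A (h : FibData Γ O A i β q r) (a : Fin 3) {z : E} (hz : z ∈ O) :
    HasFDerivAt (A a) (fderiv ℝ (A a) z) z :=
  (((h.contDiffOn_A a).contDiffAt (h.isOpen.mem_nhds hz)).differentiableAt (by simp)).hasFDerivAt

lemma hasFDerivAt_i (h : FibData Γ O A i β q r) (a : Fin 3) {z : E} (hz : z ∈ O) :
    HasFDerivAt (i a) (fderiv ℝ (i a) z) z :=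
  (((h.contDiffOn_i a).contDiffAt (h.isOpen.mem_nhds hz)).differentiableAt (by simp)).hasFDerivAt

lemma hasFDerivAt_β (h : FibData Γ O A i β q r) (a : Fin 3) {z : E} (hz : z ∈ O) :
    HasFDerivAt (β a) (fderiv ℝ (β a) z) z :=
  (((h.contDiffOn_β a).contDiffAt (h.isOpen.mem_nhds hz)).differentiableAt (by simp)).hasFDerivAt

lemma contDiffOn_hor [FiniteDimensional ℝ F] (h : FibData Γ O A i β q r) :
    ContDiffOn ℝ ∞ (hor i β r) O := by
  refine contDiffOn_const.add (ContDiffOn.sum fun a _ => ?_)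
  exact ((h.contDiffOn_β a).clm_comp contDiffOn_const).smulRight (h.contDiffOn_i a)

lemma hasFDerivAt_hor [FiniteDimensional ℝ F] (h : FibData Γ O A i β q r) {z : E} (hz : z ∈ O) :
    HasFDerivAt (hor i β r) (fderiv ℝ (hor i β r) z) z :=
  ((h.contDiffOn_hor.contDiffAt (h.isOpen.mem_nhds hz)).differentiableAt (by simp)).hasFDerivAt

lemma contDiffOn_desc [FiniteDimensional ℝ F] (h : FibData Γ O A i β q r) (a : Fin 3) :
    ContDiffOn ℝ ∞ (desc A i β q r a) O :=
  contDiffOn_const.clm_comp ((h.contDiffOn_A a).clm_comp h.contDiffOn_hor)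

lemma contDiffOn_descConn [FiniteDimensional ℝ F] (h : FibData Γ O A i β q r) :
    ContDiffOn ℝ ∞ (descConn Γ i β q r) O :=
  (contDiffOn_const.clm_comp (contDiffOn_const.clm_apply h.contDiffOn_hor)).clm_comp
    (h.contDiffOn_conn.clm_comp h.contDiffOn_hor)

/-- Differentiation of `q ∘ i_b = 0`, with `∇i_b = A_b`. -/
lemma q_conn_i (h : FibData Γ O A i β q r) (b : Fin 3) {z : E} (hz : z ∈ O) (v : E) :
    q (Γ z (i b z) v) = q (A b z v) := by
  have h1 : HasFDerivAt (fun y => q (i b y)) _ z := q.hasFDerivAt.comp z (h.hasFDerivAt_i b hz)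
  have h2 := h1.unique ((hasFDerivAt_const (0 : F) z).congr_of_eventuallyEq (by
    filter_upwards [h.isOpen.mem_nhds hz] with y hy using h.q_i b y hy))
  have h3 := congrArg (fun L : E →L[ℝ] F => L v) h2
  simp only [ContinuousLinearMap.comp_apply, zero_apply, h.di b z hz, map_sub] at h3
  exact (sub_eq_zero.1 h3).symm

lemma q_fderiv_hor [FiniteDimensional ℝ F] (h : FibData Γ O A i β q r) {z : E} (hz : z ∈ O) (v : E)
    (y : F) : q (fderiv ℝ (hor i β r) z v y) = 0 := by
  have h1 : HasFDerivAt (fun x => q (hor i β r x y)) _ z := q.hasFDerivAt.comp z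
    ((h.hasFDerivAt_hor hz).clm_apply (hasFDerivAt_const y z))
  have h2 := h1.unique ((hasFDerivAt_const y z).congr_of_eventuallyEq (by
    filter_upwards [h.isOpen.mem_nhds hz] with x hx using h.q_hor hx y))
  have h3 := congrArg (fun L : E →L[ℝ] F => L v) h2
  simpa using h3

lemma β_fderiv_hor [FiniteDimensional ℝ F] (h : FibData Γ O A i β q r) (c : Fin 3) {z : E}
    (hz : z ∈ O) (v : E) (y : F) : β c z (fderiv ℝ (hor i β r) z v y) =
      -fderiv ℝ (β c) z v (hor i β r z y) := by
  have h1 : HasFDerivAt (fun x => β c x (hor i β r x y)) _ z := (h.hasFDerivAt_β c hz).clm_apply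
    ((h.hasFDerivAt_hor hz).clm_apply (hasFDerivAt_const y z))
  have h2 := h1.unique ((hasFDerivAt_const 0 z).congr_of_eventuallyEq (by
    filter_upwards [h.isOpen.mem_nhds hz] with x hx using h.β_hor c hx y))
  have h3 := congrArg (fun L : E →L[ℝ] ℝ => L v) h2
  simp only [ContinuousLinearMap.comp_apply, add_apply, ContinuousLinearMap.flip_apply,
    zero_apply, map_zero, zero_add] at h3
  linarith

lemma sch_i_A_hor (h : FibData Γ O A i β q r) (a b : Fin 3) {z : E} (hz : z ∈ O) (y : F) :
    schC Γ z (i b z) (A a z (hor i β r z y)) = 0 := by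
  have h1 := h.β_eq b z hz (A a z (hor i β r z y))
  rw [h.β_A_hor a b hz, ← h.sch_symm z hz (i b z)] at h1
  linarith

lemma sch_i_hor (h : FibData Γ O A i β q r) (b : Fin 3) {z : E} (hz : z ∈ O) (y : F) :
    schC Γ z (i b z) (hor i β r z y) = 0 := by
  have h1 := h.β_eq b z hz (hor i β r z y)
  rw [h.β_hor b hz, ← h.sch_symm z hz (i b z)] at h1
  linarith

/-- The right-hand side expresses that `∇` of the lift along `i_b` equals `∇` of `i_b` along the
lift: horizontal lifts of constant fields commute with `i_b`. Both sides are compared under `q` and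
under the `β_c`; the latter comparison uses that `P(i_b, ·)` vanishes on horizontal vectors. -/
lemma fderiv_hor_i [FiniteDimensional ℝ E] [FiniteDimensional ℝ F] (h : FibData Γ O A i β q r)
    (b : Fin 3) {z : E} (hz : z ∈ O) (y : F) : fderiv ℝ (hor i β r) z (i b z) y =
      A b z (hor i β r z y) - Γ z (hor i β r z y) (i b z) := by
  refine h.ext_of hz ?_ fun c => ?_
  · rw [h.q_fderiv_hor hz, map_sub, h.symm z hz, h.q_conn_i b hz, sub_self]
  · rw [h.β_fderiv_hor c hz, h.dβ c z hz, h.sch_i_A_hor c b hz, map_sub, h.β_A_hor b c hz]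
    ring

lemma fderiv_desc [FiniteDimensional ℝ F] (h : FibData Γ O A i β q r) (a : Fin 3) {z : E}
    (hz : z ∈ O) (v : E) (y : F) : fderiv ℝ (desc A i β q r a) z v y =
      q (fderiv ℝ (A a) z v (hor i β r z y)) + q (A a z (fderiv ℝ (hor i β r) z v y)) := by
  have h1 : HasFDerivAt (fun x => desc A i β q r a x y) _ z := q.hasFDerivAt.comp z
    ((h.hasFDerivAt_A a hz).clm_apply
      ((h.hasFDerivAt_hor hz).clm_apply (hasFDerivAt_const y z)))
  have h2 := ((((h.contDiffOn_desc a).contDiffAt (h.isOpen.mem_nhds hz)).differentiableAt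
    (by simp)).hasFDerivAt.clm_apply (hasFDerivAt_const y z)).unique h1
  have h3 := congrArg (fun L : E →L[ℝ] F => L v) h2
  simp only [ContinuousLinearMap.comp_apply, add_apply, ContinuousLinearMap.flip_apply,
    zero_apply, map_zero, zero_add, map_add] at h3
  exact h3.trans (add_comm _ _)

lemma q_dA [FiniteDimensional ℝ E] (h : FibData Γ O A i β q r) (a : Fin 3) {z : E}
    (hz : z ∈ O) (v w : E) : q (fderiv ℝ (A a) z v w) =
      q (A a z (Γ z w v)) - q (Γ z (A a z w) v) - β a z w • q v := by
  rw [h.dA a z hz]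
  simp [h.q_i a z hz]

/-- Along the leaves the induced endomorphisms rotate by commutators. They do not descend one by
one, but their span will. -/
lemma fderiv_desc_i [FiniteDimensional ℝ E] [FiniteDimensional ℝ F] (h : FibData Γ O A i β q r)
    (a b : Fin 3) {z : E} (hz : z ∈ O) (y : F) : fderiv ℝ (desc A i β q r a) z (i b z) y =
      desc A i β q r a z (desc A i β q r b z y) - desc A i β q r b z (desc A i β q r a z y) := by
  rw [h.fderiv_desc a hz, h.fderiv_hor_i b hz, h.q_dA a hz, h.desc_desc a b hz, h.desc_desc b a hz,
    map_sub, map_sub, h.symm z hz (A a z _) (i b z), h.q_conn_i b hz, h.q_i b z hz]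
  simp

/-- The induced endomorphisms are parallel in horizontal directions: on a horizontal vector `w` the
derivative `∇A_a` reduces to a multiple of `i_a`, because `β_a w = 0`. -/
lemma fderiv_desc_hor [FiniteDimensional ℝ E] [FiniteDimensional ℝ F] (h : FibData Γ O A i β q r)
    (a : Fin 3) {z : E} (hz : z ∈ O) (y y' : F) :
    fderiv ℝ (desc A i β q r a) z (hor i β r z y') y =
      desc A i β q r a z (descConn Γ i β q r z y y') -
        descConn Γ i β q r z (desc A i β q r a z y) y' := by
  rw [h.fderiv_desc a hz, h.q_A_eq_zero a hz (h.q_fderiv_hor hz _ _), h.q_dA a hz,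
    h.β_hor a hz, h.q_A a hz (Γ z _ _), descConn_apply, descConn_apply, h.hor_desc a hz]
  simp

end FibData

end Coordinates

end

/-! ### Curvature identities, descent of the connection and of the quaternionic span -/

section

section Coordinates

variable {E F : Type*} [NormedAddCommGroup E] [NormedSpace ℝ E] [NormedAddCommGroup F]
  [NormedSpace ℝ F] {Γ : E → E →L[ℝ] E →L[ℝ] E} {O : Set E}
  {A : Fin 3 → E → E →L[ℝ] E} {i : Fin 3 → E → E} {β : Fin 3 → E → E →L[ℝ] ℝ}
  {q : E →L[ℝ] F} {r : F →L[ℝ] E}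

namespace FibData

/-! ### Curvature identities -/

lemma hasFDerivAt_fderiv_i (h : FibData Γ O A i β q r) (a : Fin 3) {z : E} (hz : z ∈ O) :
    HasFDerivAt (fderiv ℝ (i a)) (fderiv ℝ (fderiv ℝ (i a)) z) z :=
  ((((h.contDiffOn_i a).contDiffAt (h.isOpen.mem_nhds hz)).fderiv_right (m := ∞)
    (by simp)).differentiableAt (by simp)).hasFDerivAt

lemma hasFDerivAt_fderiv_A (h : FibData Γ O A i β q r) (a : Fin 3) {z : E} (hz : z ∈ O) :
    HasFDerivAt (fderiv ℝ (A a)) (fderiv ℝ (fderiv ℝ (A a)) z) z :=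
  ((((h.contDiffOn_A a).contDiffAt (h.isOpen.mem_nhds hz)).fderiv_right (m := ∞)
    (by simp)).differentiableAt (by simp)).hasFDerivAt

lemma snd_fderiv_symm {G : Type*} [NormedAddCommGroup G] [NormedSpace ℝ G] {f : E → G}
    (hO : IsOpen O) (hf : ContDiffOn ℝ ∞ f O) {z : E} (hz : z ∈ O) (u v : E) :
    fderiv ℝ (fderiv ℝ f) z u v = fderiv ℝ (fderiv ℝ f) z v u :=
  (hf.contDiffAt (hO.mem_nhds hz)).isSymmSndFDerivAt
    (by rw [minSmoothness_of_isRCLikeNormedField]; norm_cast) u v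

/-- Ricci identity for `i_a`: skew-symmetrising the derivative of `∇i_a = A_a` leaves only the
`β`-terms, since the `P`-terms cancel by symmetry. -/
lemma curvC_i (h : FibData Γ O A i β q r) (a : Fin 3) {z : E} (hz : z ∈ O) (u v : E) :
    curvC Γ z v (i a z) u = β a z u • v - β a z v • u := by
  have hd : ∀ u v, fderiv ℝ (fderiv ℝ (i a)) z u v = fderiv ℝ (A a) z u v
      - (fderiv ℝ Γ z u (i a z) v + Γ z (fderiv ℝ (i a) z u) v) := fun u v => by
    have h1 := (h.hasFDerivAt_fderiv_i a hz).clm_apply (hasFDerivAt_const v z)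
    have h2 := ((h.hasFDerivAt_A a hz).clm_apply (hasFDerivAt_const v z)).sub
      (((h.hasFDerivAt_conn hz).clm_apply (h.hasFDerivAt_i a hz)).clm_apply
        (hasFDerivAt_const v z))
    have h3 := h1.unique (h2.congr_of_eventuallyEq (by
      filter_upwards [h.isOpen.mem_nhds hz] with y hy using h.di a y hy v))
    have h4 := congrArg (fun L : E →L[ℝ] E => L u) h3
    simp only [ContinuousLinearMap.comp_apply, add_apply, ContinuousLinearMap.flip_apply,
      zero_apply, map_zero, zero_add, sub_apply] at h4
    rw [h4]
    abel
  have hs := snd_fderiv_symm h.isOpen (h.contDiffOn_i a) hz u v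
  rw [hd, hd, h.di a z hz, h.di a z hz, h.dA a z hz, h.dA a z hz, h.symm z hz v u,
    h.sch_symm z hz v u] at hs
  simp only [map_sub, sub_apply] at hs
  rw [curvC_apply]
  linear_combination (norm := module) (-1 : ℝ) • hs

/-- Ricci identity for `A_a` modulo the leaf directions. Applying `q` before the second
differentiation removes the term `P(v, w) i_a`, so that no derivative of `P` occurs. -/
lemma q_curvC_A [FiniteDimensional ℝ E] (h : FibData Γ O A i β q r) (a : Fin 3) {z : E}
    (hz : z ∈ O) (u v w : E) : q (curvC Γ z v (A a z w) u) =
      q (A a z (curvC Γ z v w u)) + schC Γ z u w • q (A a z v) - schC Γ z v w • q (A a z u)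
        - schC Γ z u (A a z w) • q v + schC Γ z v (A a z w) • q u := by
  have hd : ∀ u v, q (fderiv ℝ (fderiv ℝ (A a)) z u v w) =
      q (fderiv ℝ (A a) z u (Γ z w v)) + q (A a z (fderiv ℝ Γ z u w v))
      - (q (fderiv ℝ Γ z u (A a z w) v) + q (Γ z (fderiv ℝ (A a) z u w) v))
      - fderiv ℝ (β a) z u w • q v := fun u v => by
    have hc : ∀ w : E, HasFDerivAt (fun _ : E => w) (0 : E →L[ℝ] E) z := fun w =>
      hasFDerivAt_const w z
    have h1 : HasFDerivAt (fun y => q (fderiv ℝ (A a) y v w)) _ z := q.hasFDerivAt.comp z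
      (((h.hasFDerivAt_fderiv_A a hz).clm_apply (hc v)).clm_apply (hc w))
    have h2 : HasFDerivAt (fun y => q (A a y (Γ y w v))) _ z := q.hasFDerivAt.comp z
      ((h.hasFDerivAt_A a hz).clm_apply
        (((h.hasFDerivAt_conn hz).clm_apply (hc w)).clm_apply (hc v)))
    have h3 : HasFDerivAt (fun y => q (Γ y (A a y w) v)) _ z := q.hasFDerivAt.comp z
      (((h.hasFDerivAt_conn hz).clm_apply
        ((h.hasFDerivAt_A a hz).clm_apply (hc w))).clm_apply (hc v))
    have h4 : HasFDerivAt (fun y => β a y w • q v) _ z :=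
      ((h.hasFDerivAt_β a hz).clm_apply (hc w)).smul_const (q v)
    have h5 := h1.unique (((h2.sub h3).sub h4).congr_of_eventuallyEq (by
      filter_upwards [h.isOpen.mem_nhds hz] with y hy using h.q_dA a hy v w))
    have h6 := congrArg (fun L : E →L[ℝ] F => L u) h5
    simp only [ContinuousLinearMap.comp_apply, add_apply, ContinuousLinearMap.flip_apply,
      zero_apply, map_zero, zero_add, sub_apply, ContinuousLinearMap.smulRight_apply,
      map_add] at h6
    rw [h6]
    abel
  have hs : q (fderiv ℝ (fderiv ℝ (A a)) z u v w) = q (fderiv ℝ (fderiv ℝ (A a)) z v u w) := by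
    rw [snd_fderiv_symm h.isOpen (h.contDiffOn_A a) hz u v]
  have e1 := h.q_conn_i a hz v
  have e2 := h.q_conn_i a hz u
  rw [hd, hd, h.q_dA a hz, h.q_dA a hz, h.dA a z hz, h.dA a z hz, h.dβ a z hz, h.dβ a z hz] at hs
  simp only [map_sub, map_smul, sub_apply, smul_apply] at hs
  rw [e1, e2, h.symm z hz v u] at hs
  rw [curvC_apply, curvC_apply]
  simp only [map_sub, map_add]
  linear_combination (norm := module) (-1 : ℝ) • hs

/-- The curvature between the leaf directions and horizontal directions is vertical. -/
lemma q_curvC_i_hor [FiniteDimensional ℝ E] [FiniteDimensional ℝ F] (h : FibData Γ O A i β q r)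
    (b : Fin 3) {z : E} (hz : z ∈ O) (y y' : F) :
    q (curvC Γ z (hor i β r z y) (hor i β r z y') (i b z)) = 0 := by
  -- The curvature as a bilinear map on the base. It is symmetric by the first Bianchi identity,
  -- because `R(y, y') i_b = 0` for horizontal `y, y'`.
  obtain ⟨B, hB⟩ : ∃ B : F → F → F, ∀ y y', B y y' =
    q (curvC Γ z (hor i β r z y) (hor i β r z y') (i b z)) := ⟨_, fun _ _ => rfl⟩
  have hsymm : ∀ y y', B y y' = B y' y := fun y y' => by
    have h1 := h.curvC_i b hz (hor i β r z y) (hor i β r z y')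
    rw [h.β_hor b hz, h.β_hor b hz, zero_smul, zero_smul, sub_self] at h1
    rw [hB, hB, ← sub_eq_zero, ← map_sub]
    have hD := fderiv_conn_symm h.isOpen h.contDiffOn_conn h.symm hz
    have h2 : curvC Γ z (hor i β r z y) (hor i β r z y') (i b z) -
        curvC Γ z (hor i β r z y') (hor i β r z y) (i b z) =
        -curvC Γ z (hor i β r z y') (i b z) (hor i β r z y) := by
      simp only [curvC_apply]
      rw [hD (i b z) _ (hor i β r z y), hD (hor i β r z y) _ (i b z),
        hD (hor i β r z y') _ (i b z), h.symm z hz (hor i β r z y') (hor i β r z y),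
        h.symm z hz (hor i β r z y') (i b z), h.symm z hz (hor i β r z y) (i b z)]
      abel
    rw [h2, h1, neg_zero, map_zero]
  have hA : ∀ a y y', B y (desc A i β q r a z y') = desc A i β q r a z (B y y') :=
      fun a y y' => by
    rw [hB, hB, h.hor_desc a hz, h.q_curvC_A a hz, h.sch_i_hor b hz, h.sch_i_A_hor a b hz,
      h.q_A_i a b hz, h.q_i b z hz, h.q_A a hz (curvC _ _ _ _ _)]
    simp
  -- Symmetry and linearity over the `J_a` allow `B (J_0 y) (J_1 y')` to be computed as `J_1 J_0 B`
  -- and as `J_0 J_1 B`. These are opposite, so `J_2 B = 0` and `B = 0`.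
  have h0 : B y y' = 0 := by
    have h1 := hA 1 (desc A i β q r 0 z y) y'
    rw [hsymm, hA, hsymm, hA, hsymm (desc A i β q r 0 z y), hA, hsymm y' y] at h1
    have h3 := h.desc_mul 0 hz (B y y')
    have h4 := h.desc_mul' 0 hz (B y y')
    simp only [Fin.isValue, zero_add] at h3 h4
    rw [h3, h4] at h1
    have h5 : desc A i β q r 2 z (B y y') = 0 := by
      have h6 : (2 : ℝ) • desc A i β q r 2 z (B y y') = 0 := by
        rw [two_smul]
        nth_rewrite 1 [h1]
        simp
      simpa using h6
    have h7 := h.desc_sq 2 hz (B y y')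
    rw [h5, map_zero] at h7
    simpa using h7.symm
  rw [← hB, h0]

/-- Since the lifts commute with `i_b`, this is the Lie derivative of `∇` along `i_b` modulo `D`,
that is `∇∇i_b + R(i_b, ·)`. On horizontal vectors the first term is vertical by `q_dA`, the second
by `q_curvC_i_hor`. -/
lemma fderiv_descConn_i [FiniteDimensional ℝ E] [FiniteDimensional ℝ F]
    (h : FibData Γ O A i β q r) (b : Fin 3) {z : E} (hz : z ∈ O) :
    fderiv ℝ (descConn Γ i β q r) z (i b z) = 0 := by
  ext1 y'
  ext1 y
  have hc : ∀ w : F, HasFDerivAt (fun _ : E => w) (0 : E →L[ℝ] F) z := fun w =>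
    hasFDerivAt_const w z
  have hce : ∀ w : E, HasFDerivAt (fun _ : E => w) (0 : E →L[ℝ] E) z := fun w =>
    hasFDerivAt_const w z
  have hh : ∀ y, HasFDerivAt (fun x => hor i β r x y) ((fderiv ℝ (hor i β r) z).flip y) z :=
    fun y => by simpa using (h.hasFDerivAt_hor hz).clm_apply (hc y)
  have h1 : HasFDerivAt (fun x => descConn Γ i β q r x y' y) _ z := q.hasFDerivAt.comp z
    (((h.hasFDerivAt_conn hz).clm_apply (hh y')).clm_apply (hh y))
  have h2 := ((((h.contDiffOn_descConn.contDiffAt (h.isOpen.mem_nhds hz)).differentiableAt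
    (by simp)).hasFDerivAt.clm_apply (hc y')).clm_apply (hc y)).unique h1
  have h3 := congrArg (fun L : E →L[ℝ] F => L (i b z)) h2
  simp only [ContinuousLinearMap.comp_apply, add_apply, ContinuousLinearMap.flip_apply,
    zero_apply, map_zero, zero_add] at h3
  rw [h3]
  change q (Γ z (hor i β r z y') (fderiv ℝ (hor i β r) z (i b z) y) +
    (Γ z (fderiv ℝ (hor i β r) z (i b z) y') (hor i β r z y) +
      fderiv ℝ Γ z (i b z) (hor i β r z y') (hor i β r z y))) = 0
  have h4 : ∀ w v, q (fderiv ℝ Γ z v (i b z) w) + q (Γ z (fderiv ℝ (i b) z v) w) =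
      q (fderiv ℝ (A b) z v w) := fun w v => by
    have h5 : HasFDerivAt (fun x => q (Γ x (i b x) w)) _ z := q.hasFDerivAt.comp z
      (((h.hasFDerivAt_conn hz).clm_apply (h.hasFDerivAt_i b hz)).clm_apply (hce w))
    have h6 : HasFDerivAt (fun x => q (A b x w)) _ z := q.hasFDerivAt.comp z
      ((h.hasFDerivAt_A b hz).clm_apply (hce w))
    have h7 := h5.unique (h6.congr_of_eventuallyEq (by
      filter_upwards [h.isOpen.mem_nhds hz] with x hx using h.q_conn_i b hx w))
    have h8 := congrArg (fun L : E →L[ℝ] F => L v) h7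
    simp only [ContinuousLinearMap.comp_apply, add_apply, ContinuousLinearMap.flip_apply,
      zero_apply, map_zero, zero_add, map_add] at h8
    rw [← h8, add_comm]
  have h5 := h4 (hor i β r z y') (hor i β r z y)
  rw [h.q_dA b hz, h.β_hor b hz, h.di b z hz] at h5
  have h6 := h.q_curvC_i_hor b hz y y'
  rw [curvC_apply] at h6
  have hD := fderiv_conn_symm h.isOpen h.contDiffOn_conn h.symm hz
  have e1 := h.q_conn_i b hz (Γ z (hor i β r z y') (hor i β r z y))
  rw [h.fderiv_hor_i b hz, h.fderiv_hor_i b hz]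
  simp only [map_add, map_sub, sub_apply] at h5 h6 ⊢
  rw [h.symm z hz _ (i b z), e1] at h6
  rw [hD _ (i b z)] at h5
  have s1 := h.symm z hz (hor i β r z y') (A b z (hor i β r z y))
  have s2 := h.symm z hz (hor i β r z y') (Γ z (hor i β r z y) (i b z))
  have s3 := h.symm z hz (hor i β r z y) (i b z)
  rw [s1, s2, s3]
  linear_combination (norm := module) h5 + h6

/-! ### Passing to the base -/

/-- A function whose derivative vanishes along the leaves is constant along the leaves. -/
lemma eq_of_fderiv_i_eq_zero [FiniteDimensional ℝ E] {W : Type*} [NormedAddCommGroup W]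
    [NormedSpace ℝ W] (h : FibData Γ O A i β q r) (hO : Convex ℝ O) {f : E → W}
    (hf : ∀ z ∈ O, DifferentiableAt ℝ f z) (hf0 : ∀ z ∈ O, ∀ b, fderiv ℝ f z (i b z) = 0) {z z' : E}
    (hz : z ∈ O) (hz' : z' ∈ O) (hq : q z = q z') : f z = f z' := by
  -- The direction `z' - z` lies in the kernel of `q`, which is spanned by the fields at every point
  -- of `O`, so the derivative vanishes along the whole segment.
  have h0 : ∀ x ∈ O, fderiv ℝ f x (z' - z) = 0 := fun x hx => by
    have h1 : z' - z ∈ LinearMap.ker (q : E →ₗ[ℝ] F) := by simp [hq]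
    rw [h.ker_eq hx, Submodule.mem_span_range_iff_exists_fun] at h1
    obtain ⟨c, hc⟩ := h1
    rw [← hc, map_sum]
    simp [hf0 x hx]
  have hmem : ∀ s ∈ Icc (0 : ℝ) 1, z + s • (z' - z) ∈ O := fun s hs =>
    hO.add_smul_sub_mem hz hz' hs
  have hd : ∀ s ∈ Icc (0 : ℝ) 1,
      HasDerivWithinAt (fun s : ℝ => f (z + s • (z' - z))) 0 (Icc 0 1) s := fun s hs => by
    have h1 : HasDerivAt (fun s : ℝ => z + s • (z' - z)) (z' - z) s := by
      simpa using ((hasDerivAt_id s).smul_const (z' - z)).const_add z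
    have h2 := (hf _ (hmem s hs)).hasFDerivAt.comp_hasDerivAt s h1
    rw [h0 _ (hmem s hs)] at h2
    exact h2.hasDerivWithinAt
  have h3 := (convex_Icc (0 : ℝ) 1).norm_image_sub_le_of_norm_hasDerivWithin_le (C := 0) hd
    (by simp) (left_mem_Icc.2 zero_le_one) (right_mem_Icc.2 zero_le_one)
  simp only [zero_smul, add_zero, one_smul, add_sub_cancel, zero_mul, norm_le_zero_iff] at h3
  exact (sub_eq_zero.1 h3).symm

lemma descConn_eq [FiniteDimensional ℝ E] [FiniteDimensional ℝ F] (h : FibData Γ O A i β q r)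
    (hO : Convex ℝ O) {z z' : E} (hz : z ∈ O) (hz' : z' ∈ O) (hq : q z = q z') :
    descConn Γ i β q r z = descConn Γ i β q r z' :=
  h.eq_of_fderiv_i_eq_zero hO (fun z hz => (h.contDiffOn_descConn.contDiffAt
    (h.isOpen.mem_nhds hz)).differentiableAt (by simp)) (fun _ hz b => h.fderiv_descConn_i b hz)
    hz hz' hq

/-- The trace as a continuous linear form. -/
def traceL (F : Type*) [NormedAddCommGroup F] [NormedSpace ℝ F] [FiniteDimensional ℝ F] :
    (F →L[ℝ] F) →L[ℝ] ℝ :=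
  LinearMap.toContinuousLinearMap (LinearMap.trace ℝ F ∘ₗ ContinuousLinearMap.coeLM ℝ)

section Quaternionic

variable [FiniteDimensional ℝ E] [FiniteDimensional ℝ F]

lemma traceL_comm (X Y : F →L[ℝ] F) : traceL F (X ∘L Y) = traceL F (Y ∘L X) :=
  trace_comp_comm X Y

lemma traceL_id : traceL F (.id ℝ F) = finrank ℝ F := LinearMap.trace_id ℝ F

lemma desc_comp_self (h : FibData Γ O A i β q r) (a : Fin 3) {z : E} (hz : z ∈ O) :
    desc A i β q r a z ∘L desc A i β q r a z = -.id ℝ F :=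
  ContinuousLinearMap.ext fun y => h.desc_sq a hz y

lemma desc_comp_one (h : FibData Γ O A i β q r) (a : Fin 3) {z : E} (hz : z ∈ O) :
    desc A i β q r a z ∘L desc A i β q r (a + 1) z = desc A i β q r (a + 2) z :=
  ContinuousLinearMap.ext fun y => h.desc_mul a hz y

lemma desc_one_comp (h : FibData Γ O A i β q r) (a : Fin 3) {z : E} (hz : z ∈ O) :
    desc A i β q r (a + 1) z ∘L desc A i β q r a z = -desc A i β q r (a + 2) z :=
  ContinuousLinearMap.ext fun y => h.desc_mul' a hz y

/-- `J_a` is the product of the other two in one order and minus the product in the other order, and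
both products have the same trace. -/
lemma traceL_desc (h : FibData Γ O A i β q r) (a : Fin 3) {z : E} (hz : z ∈ O) :
    traceL F (desc A i β q r a z) = 0 := by
  have h1 := h.desc_comp_one (a + 1) hz
  have h2 := h.desc_one_comp (a + 1) hz
  rw [fin3_add_one_one, fin3_add_one_two] at h1 h2
  have h3 := congrArg (traceL F) h1
  have h4 := congrArg (traceL F) h2
  rw [traceL_comm, h3, map_neg] at h4
  linarith

lemma traceL_desc_desc (h : FibData Γ O A i β q r) (a b : Fin 3) {z : E} (hz : z ∈ O) :
    traceL F (desc A i β q r a z ∘L desc A i β q r b z) =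
      if a = b then -(finrank ℝ F : ℝ) else 0 := by
  have h2 := h.desc_one_comp (a + 2) hz
  rw [fin3_add_two_one] at h2
  rcases fin3_cases a b with rfl | rfl | rfl
  · rw [h.desc_comp_self _ hz, map_neg, traceL_id, if_pos rfl]
  · rw [h.desc_comp_one _ hz, h.traceL_desc _ hz, if_neg (fin3_ne_one a)]
  · rw [h2, map_neg, h.traceL_desc _ hz, if_neg (fin3_ne_two a), neg_zero]

/-- Up to a factor, the orthogonal projection to the span of the induced endomorphisms. -/
def descProj (A : Fin 3 → E → E →L[ℝ] E) (i : Fin 3 → E → E) (β : Fin 3 → E → E →L[ℝ] ℝ)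
    (q : E →L[ℝ] F) (r : F →L[ℝ] E) (z : E) (X : F →L[ℝ] F) : F →L[ℝ] F :=
  ∑ a, traceL F (desc A i β q r a z ∘L X) • desc A i β q r a z

/-- The span of the induced endomorphisms. -/
def descSpan (A : Fin 3 → E → E →L[ℝ] E) (i : Fin 3 → E → E) (β : Fin 3 → E → E →L[ℝ] ℝ)
    (q : E →L[ℝ] F) (r : F →L[ℝ] E) (z : E) : Submodule ℝ (F →L[ℝ] F) :=
  Submodule.span ℝ (range fun a => desc A i β q r a z)

lemma descProj_mem (z : E) (X : F →L[ℝ] F) : descProj A i β q r z X ∈ descSpan A i β q r z :=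
  Submodule.sum_mem _ fun a _ => Submodule.smul_mem _ _ (Submodule.subset_span ⟨a, rfl⟩)

/-- For the trace form the `J_a` are orthogonal, each with square length `-finrank ℝ F`; this is the
factor that separates `descProj` from a projection. -/
lemma descProj_eq (h : FibData Γ O A i β q r) {z : E} (hz : z ∈ O) {X : F →L[ℝ] F}
    (hX : X ∈ descSpan A i β q r z) : descProj A i β q r z X = -(finrank ℝ F : ℝ) • X := by
  rw [descSpan, Submodule.mem_span_range_iff_exists_fun] at hX
  obtain ⟨c, rfl⟩ := hX
  simp only [descProj, ContinuousLinearMap.comp_finsetSum, ContinuousLinearMap.comp_smul, map_sum,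
    map_smul, h.traceL_desc_desc _ _ hz]
  simp [Finset.smul_sum, smul_smul, mul_comm]

lemma fin3_sum {W : Type*} [AddCommMonoid W] (f : Fin 3 → W) (b : Fin 3) :
    ∑ a, f a = f b + f (b + 1) + f (b + 2) := by
  rw [Fin.sum_univ_three]
  fin_cases b
  · rfl
  · change _ = f 1 + f 2 + f 0
    abel
  · change _ = f 2 + f 0 + f 1
    abel

lemma hasFDerivAt_desc (h : FibData Γ O A i β q r) (a : Fin 3) {z : E} (hz : z ∈ O) :
    HasFDerivAt (desc A i β q r a) (fderiv ℝ (desc A i β q r a) z) z :=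
  (((h.contDiffOn_desc a).contDiffAt (h.isOpen.mem_nhds hz)).differentiableAt (by simp)).hasFDerivAt

lemma fderiv_desc_i' (h : FibData Γ O A i β q r) (a b : Fin 3) {z : E} (hz : z ∈ O) :
    fderiv ℝ (desc A i β q r a) z (i b z) = desc A i β q r a z ∘L desc A i β q r b z
      - desc A i β q r b z ∘L desc A i β q r a z :=
  ContinuousLinearMap.ext fun y => h.fderiv_desc_i a b hz y

/-- Along `i_b` the triple undergoes an infinitesimal rotation, and the sum `∑ tr(J_a X) J_a` is
rotation invariant. -/
lemma hasFDerivAt_descProj (h : FibData Γ O A i β q r) {z : E} (hz : z ∈ O) (X : F →L[ℝ] F) :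
    ∃ L : E →L[ℝ] F →L[ℝ] F, HasFDerivAt (fun x => descProj A i β q r x X) L z ∧
      ∀ b, L (i b z) = 0 := by
  have hX : HasFDerivAt (fun _ : E => X) (0 : E →L[ℝ] F →L[ℝ] F) z := hasFDerivAt_const X z
  have h1 : ∀ a ∈ (Finset.univ : Finset (Fin 3)), HasFDerivAt (fun x =>
      traceL F (desc A i β q r a x ∘L X) • desc A i β q r a x) _ z := fun a _ =>
    HasFDerivAt.fun_smul ((traceL F).hasFDerivAt.comp z
      ((h.hasFDerivAt_desc a hz).clm_comp hX)) (h.hasFDerivAt_desc a hz)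
  refine ⟨_, HasFDerivAt.fun_sum h1, fun b => ?_⟩
  have h2 := h.desc_one_comp (b + 2) hz
  have h3 := h.desc_comp_one (b + 2) hz
  rw [fin3_add_two_one, fin3_add_two_two] at h2 h3
  simp [fin3_sum _ b, h.fderiv_desc_i' _ _ hz, h2, h3, h.desc_comp_one _ hz, h.desc_one_comp _ hz]
  module

/-- The span is recovered as the image of `descProj`, which is constant along the leaves; this
avoids integrating the rotation of the individual endomorphisms. -/
lemma descSpan_eq (h : FibData Γ O A i β q r) (hF : finrank ℝ F ≠ 0) (hO : Convex ℝ O) {z z' : E}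
    (hz : z ∈ O) (hz' : z' ∈ O) (hq : q z = q z') :
    descSpan A i β q r z = descSpan A i β q r z' := by
  have key : ∀ {z z' : E}, z ∈ O → z' ∈ O → q z = q z' →
      descSpan A i β q r z ≤ descSpan A i β q r z' := fun {z z'} hz hz' hq X hX => by
    have h1 := h.eq_of_fderiv_i_eq_zero hO (f := fun x => descProj A i β q r x X)
      (fun x hx => by
        obtain ⟨L, hL, -⟩ := h.hasFDerivAt_descProj hx X
        exact hL.differentiableAt)
      (fun x hx b => by
        obtain ⟨L, hL, hb⟩ := h.hasFDerivAt_descProj hx X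
        rw [hL.fderiv, hb]) hz hz' hq
    rw [h.descProj_eq hz hX] at h1
    have h2 : X = (-(finrank ℝ F : ℝ))⁻¹ • descProj A i β q r z' X := by
      rw [← h1, smul_smul, inv_mul_cancel₀ (by simpa using hF), one_smul]
    rw [h2]
    exact Submodule.smul_mem _ _ (descProj_mem _ _)
  exact le_antisymm (key hz hz' hq) (key hz' hz hq.symm)

lemma linearIndependent_desc (h : FibData Γ O A i β q r) (hF : finrank ℝ F ≠ 0) {z : E}
    (hz : z ∈ O) : LinearIndependent ℝ (fun a => desc A i β q r a z) := by
  rw [Fintype.linearIndependent_iff]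
  intro g hg b
  have h1 := congrArg (fun X => traceL F (desc A i β q r b z ∘L X)) hg
  simp only [ContinuousLinearMap.comp_finsetSum, ContinuousLinearMap.comp_smul, map_sum,
    map_smul, h.traceL_desc_desc _ _ hz] at h1
  simpa [hF] using h1

/-- The span of the induced endomorphisms is parallel. -/
lemma parallel_descSpan (h : FibData Γ O A i β q r) (hF : finrank ℝ F ≠ 0) {z : E} (hz : z ∈ O)
    {X : F → F →L[ℝ] F} (hX : DifferentiableAt ℝ X (q z))
    (hXs : ∀ᶠ y in 𝓝 (q z), ∀ z' ∈ O, q z' = y → X y ∈ descSpan A i β q r z') (η : F) :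
    ∃ B ∈ descSpan A i β q r z, ∀ Y, fderiv ℝ X (q z) η Y + descConn Γ i β q r z (X (q z) Y) η
      - X (q z) (descConn Γ i β q r z Y η) = B Y := by
  -- A section of `q` through `z` whose derivative at `q z` is the horizontal lift. Horizontality at
  -- this one point is enough, as only first derivatives there are used.
  let s : F → E := fun y => z + hor i β r z (y - q z)
  have hs0 : s (q z) = z := by simp [s]
  have hs : HasFDerivAt s (hor i β r z) (q z) := by
    have h1 : HasFDerivAt (fun y => y - q z) (.id ℝ F) (q z) :=
      (hasFDerivAt_id (q z)).sub_const (q z)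
    have h2 : HasFDerivAt (fun y => hor i β r z (y - q z)) (hor i β r z ∘L .id ℝ F) (q z) :=
      (hor i β r z).hasFDerivAt.comp (q z) h1
    have h3 := h2.const_add z
    rwa [ContinuousLinearMap.comp_id] at h3
  have hsO : ∀ᶠ y in 𝓝 (q z), s y ∈ O :=
    hs.continuousAt.eventually_mem (by rw [hs0]; exact h.isOpen.mem_nhds hz)
  have hqs : ∀ y, q (s y) = y := fun y => by simp [s, h.q_hor hz]
  let c : Fin 3 → F → ℝ := fun a y =>
    (-(finrank ℝ F : ℝ))⁻¹ * traceL F (desc A i β q r a (s y) ∘L X y)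
  have hd : ∀ a, HasFDerivAt (fun y => desc A i β q r a (s y))
      (fderiv ℝ (desc A i β q r a) z ∘L hor i β r z) (q z) := fun a => by
    have h1 := h.hasFDerivAt_desc a hz
    exact HasFDerivAt.comp (q z) (by rw [hs0]; exact h1) hs
  have hc : ∀ a, ∃ L, HasFDerivAt (c a) L (q z) := fun a =>
    ⟨_, ((traceL F).hasFDerivAt.comp (q z) ((hd a).clm_comp hX.hasFDerivAt)).const_mul _⟩
  choose L hL using hc
  -- The trace form provides differentiable coefficients of `X` with respect to the moving frame
  -- `J_a (s y)`.
  have hXc : X =ᶠ[𝓝 (q z)] fun y => ∑ a, c a y • desc A i β q r a (s y) := by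
    filter_upwards [hXs, hsO] with y hy hyO
    have h1 := h.descProj_eq hyO (hy _ hyO (hqs y))
    have h2 : X y = (-(finrank ℝ F : ℝ))⁻¹ • descProj A i β q r (s y) (X y) := by
      rw [h1, smul_smul, inv_mul_cancel₀ (by simpa using hF), one_smul]
    conv_lhs => rw [h2]
    simp [descProj, Finset.smul_sum, smul_smul, c]
  have hX0 := hXc.self_of_nhds
  have hXd := (HasFDerivAt.fun_sum (u := Finset.univ)
    fun a _ => HasFDerivAt.fun_smul (hL a) (hd a)).congr_of_eventuallyEq hXc
  -- The `J_a ∘ s` are parallel at `q z` by `fderiv_desc_hor`, so only the derivatives of the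
  -- coefficients survive.
  refine ⟨∑ a, L a η • desc A i β q r a z, Submodule.sum_mem _ fun a _ =>
    Submodule.smul_mem _ _ (Submodule.subset_span ⟨a, rfl⟩), fun Y => ?_⟩
  rw [hXd.fderiv, hX0]
  simp [hs0, h.fderiv_desc_hor _ hz, Fin.sum_univ_three]
  module

end Quaternionic

end FibData

end Coordinates

end

/-! ### Determinants and densities in a chart -/

section

variable {N : ℕ}

/-! ### Determinants -/

/-- The standard basis. -/
abbrev stdB (N : ℕ) : Basis (Fin N) ℝ (Eu N) := (EuclideanSpace.basisFun (Fin N) ℝ).toBasis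

/-- The standard volume form. -/
def volF (N : ℕ) : ContinuousMultilinearMap ℝ (fun _ : Fin N => Eu N) ℝ where
  toMultilinearMap := (stdB N).det.toMultilinearMap
  cont := by
    change Continuous fun v : Fin N → Eu N => (stdB N).det v
    simp only [Basis.det_apply]
    refine Continuous.matrix_det (continuous_matrix fun a b => ?_)
    have h : ∀ a (w : Eu N), (stdB N).repr w a = w a := fun a w => by simp [stdB]
    simp only [Basis.toMatrix_apply, h]
    fun_prop

lemma volF_apply (v : Fin N → Eu N) : volF N v = (stdB N).det v := rfl

lemma volF_sb : volF N sb = 1 := by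
  have h : (sb : Fin N → Eu N) = stdB N := by
    ext1 a
    simp
  rw [volF_apply, h, Basis.det_self]

lemma volF_ne_zero_iff {v : Fin N → Eu N} : volF N v ≠ 0 ↔ LinearIndependent ℝ v := by
  rw [volF_apply]
  constructor
  · intro h
    exact ((stdB N).is_basis_iff_det.2 (isUnit_iff_ne_zero.2 h)).1
  · intro h
    refine ((stdB N).is_basis_iff_det.1 ⟨h, ?_⟩).ne_zero
    exact h.span_eq_top_of_card_eq_finrank' (by simp)

lemma volF_map (L : Eu N →ₗ[ℝ] Eu N) (v : Fin N → Eu N) :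
    volF N (fun a => L (v a)) = LinearMap.det L * volF N v :=
  (stdB N).det_comp L v

/-- Cramer's rule. -/
lemma volF_update (B : Basis (Fin N) ℝ (Eu N)) (a : Fin N) (w : Eu N) :
    volF N (Function.update B a w) = B.coord a w * volF N B := by
  have h := congrArg (fun L : Eu N →ₗ[ℝ] ℝ => L w)
    ((stdB N).det_smul_mk_coord_eq_det_update B.linearIndependent B.span_eq.ge a)
  have hB : Basis.mk B.linearIndependent B.span_eq.ge = B := by
    ext1 b
    simp
  rw [hB] at h
  rw [volF_apply, volF_apply, mul_comm]
  exact h.symm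

/-- The derivative of the volume of a frame. -/
lemma hasFDerivAt_volF {H : Type*} [NormedAddCommGroup H] [NormedSpace ℝ H] {f : Fin N → H → Eu N}
    {f' : Fin N → H →L[ℝ] Eu N} {z : H} (hf : ∀ a, HasFDerivAt (f a) (f' a) z)
    (B : Basis (Fin N) ℝ (Eu N)) (hB : ∀ a, B a = f a z) :
    ∃ L : H →L[ℝ] ℝ, HasFDerivAt (fun y => volF N (fun a => f a y)) L z ∧
      ∀ v, L v = (∑ a, B.coord a (f' a v)) * volF N (fun a => f a z) := by
  have h1 := HasFDerivAt.multilinear_comp (f := volF N) (g := f) hf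
  refine ⟨_, h1, fun v => ?_⟩
  have hB' : (fun a => f a z) = B := by
    ext1 a
    rw [hB]
  rw [Finset.sum_mul]
  simp only [hB', sum_apply, ContinuousLinearMap.comp_apply]
  refine Finset.sum_congr rfl fun a _ => ?_
  rw [← volF_update]
  rfl


/-! ### Densities in a chart -/

variable {M : Type u} [TopologicalSpace M] [ChartedSpace (EuclideanSpace ℝ (Fin N)) M]
  [IsManifold (𝓡 N) ∞ M] {φ : OpenPartialHomeomorph M (Eu N)}

/-- The volume in a chart of a frame of a tangent space. -/
def dens (φ : OpenPartialHomeomorph M (Eu N)) (x : M) (e : Fin N → TangentSpace (𝓡 N) x) : ℝ :=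
  |volF N (fun a => tg φ x (e a))|

/-- The coordinate frame of a chart. -/
abbrev fr (φ : OpenPartialHomeomorph M (Eu N)) (a : Fin N) : VField N M := cfield φ (sb a)

lemma tg_cfield (hφ : φ ∈ IsManifold.maximalAtlas (𝓡 N) ∞ M) (w : Eu N) {x : M}
    (hx : x ∈ φ.source) : tg φ x (cfield φ w x) = w := by
  rw [← coord_apply _ hx, coord_cfield hφ w (φ.map_source hx)]

lemma cfield_apply (hφ : φ ∈ IsManifold.maximalAtlas (𝓡 N) ∞ M) (w : Eu N) {x : M}
    (hx : x ∈ φ.source) : cfield φ w x = tgInv φ x w := by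
  rw [← tgInv_tg hφ hx (cfield φ w x), tg_cfield hφ w hx]

lemma linearIndependent_tg (hφ : φ ∈ IsManifold.maximalAtlas (𝓡 N) ∞ M) {x : M}
    (hx : x ∈ φ.source) (e : Fin N → TangentSpace (𝓡 N) x) :
    LinearIndependent ℝ (fun a => tg φ x (e a)) ↔ LinearIndependent ℝ e := by
  obtain ⟨g, hg, -⟩ := exists_tg_equiv hφ hx
  have h := LinearMap.linearIndependent_iff (v := e) (g.toLinearEquiv : _ →ₗ[ℝ] Eu N)
    (LinearMap.ker_eq_bot.2 g.injective)
  rw [← h, ← hg]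
  rfl

lemma dens_pos (hφ : φ ∈ IsManifold.maximalAtlas (𝓡 N) ∞ M) {x : M}
    (hx : x ∈ φ.source) {e : Fin N → TangentSpace (𝓡 N) x} (he : LinearIndependent ℝ e) :
    0 < dens φ x e :=
  abs_pos.2 (volF_ne_zero_iff.2 ((linearIndependent_tg hφ hx e).2 he))

lemma dens_eq_zero (hφ : φ ∈ IsManifold.maximalAtlas (𝓡 N) ∞ M) {x : M}
    (hx : x ∈ φ.source) {e : Fin N → TangentSpace (𝓡 N) x} (he : ¬ LinearIndependent ℝ e) :
    dens φ x e = 0 := by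
  rw [← linearIndependent_tg hφ hx, ← volF_ne_zero_iff, not_not] at he
  rw [dens, he, abs_zero]

lemma dens_fr (hφ : φ ∈ IsManifold.maximalAtlas (𝓡 N) ∞ M) {x : M} (hx : x ∈ φ.source) :
    dens φ x (fun a => fr φ a x) = 1 := by
  have h : (fun a => tg φ x (fr φ a x)) = (sb : Fin N → Eu N) := funext fun a => tg_cfield hφ _ hx
  rw [dens, h, volF_sb, abs_one]

lemma linearIndependent_sb : LinearIndependent ℝ (sb : Fin N → Eu N) :=
  volF_ne_zero_iff.1 (by rw [volF_sb]; exact one_ne_zero)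

lemma linearIndependent_fr (hφ : φ ∈ IsManifold.maximalAtlas (𝓡 N) ∞ M) {x : M}
    (hx : x ∈ φ.source) : LinearIndependent ℝ (fun a => fr φ a x) := by
  rw [← linearIndependent_tg hφ hx]
  have h : (fun a => tg φ x (fr φ a x)) = (sb : Fin N → Eu N) := funext fun a => tg_cfield hφ _ hx
  rw [h]
  exact linearIndependent_sb

lemma dens_map (hφ : φ ∈ IsManifold.maximalAtlas (𝓡 N) ∞ M) {x : M} (hx : x ∈ φ.source)
    (A : TangentSpace (𝓡 N) x →ₗ[ℝ] TangentSpace (𝓡 N) x) (e : Fin N → TangentSpace (𝓡 N) x) :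
    dens φ x (fun a => A (e a)) = |LinearMap.det A| * dens φ x e := by
  obtain ⟨g, hg, -⟩ := exists_tg_equiv hφ hx
  have h1 := LinearMap.det_conj A g.toLinearEquiv
  have h2 := volF_map ((g.toLinearEquiv : _ →ₗ[ℝ] Eu N) ∘ₗ A ∘ₗ
    (g.toLinearEquiv.symm : Eu N →ₗ[ℝ] _)) (fun a => g (e a))
  rw [h1] at h2
  have h3 : (fun a => ((g.toLinearEquiv : _ →ₗ[ℝ] Eu N) ∘ₗ A ∘ₗ
    (g.toLinearEquiv.symm : Eu N →ₗ[ℝ] _)) (g (e a))) = fun a => g (A (e a)) := by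
    funext a
    exact congrArg (fun v => g (A v)) (g.symm_apply_apply (e a))
  rw [h3] at h2
  have h4 : ∀ v, tg φ x v = g v := fun v => by rw [← hg]; rfl
  rw [dens, dens, ← abs_mul]
  simp only [h4]
  rw [h2]

lemma span_frame {x : M} {e : Fin N → TangentSpace (𝓡 N) x} (he : LinearIndependent ℝ e) :
    ⊤ ≤ Submodule.span ℝ (range e) := by
  have : FiniteDimensional ℝ (TangentSpace (𝓡 N) x) := inferInstanceAs (FiniteDimensional ℝ (Eu N))
  exact (he.span_eq_top_of_card_eq_finrank'
    ((Fintype.card_fin N).trans (finrank_euclideanSpace_fin (𝕜 := ℝ) (n := N)).symm)).ge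

/-- The weighted element with a given value on the coordinate frame. -/
def wElt (hφ : φ ∈ IsManifold.maximalAtlas (𝓡 N) ∞ M) {x : M} (hx : x ∈ φ.source) {w : ℝ}
    (hw : w ≠ 0) {F : Type*} [AddCommGroup F] [Module ℝ F] (f : F) :
    weighted N w (TangentSpace (𝓡 N) x) F :=
  ⟨fun e => dens φ x e ^ (-w / ((N : ℝ) + 1)) • f, fun e he => by
    beta_reduce
    -- On dependent families the value must be 0, and `0 ^ s = 0` needs a nonzero exponent; this is
    -- where `w ≠ 0` enters.
    rw [dens_eq_zero hφ hx he, Real.zero_rpow (div_ne_zero (neg_ne_zero.2 hw) (by positivity)),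
      zero_smul], fun A e => by
    have h := dens_map hφ hx (A : TangentSpace (𝓡 N) x →ₗ[ℝ] TangentSpace (𝓡 N) x) e
    have h0 : 0 ≤ dens φ x e := abs_nonneg _
    rw [smul_smul, ← Real.mul_rpow (abs_nonneg _) h0, ← h]
    rfl⟩

/-- Any two frames are related by an automorphism, so an element of weight `w` is determined by its
value on the coordinate frame. -/
lemma weighted_apply (hφ : φ ∈ IsManifold.maximalAtlas (𝓡 N) ∞ M) {x : M} (hx : x ∈ φ.source)
    {w : ℝ} (hw : w ≠ 0) {F : Type*} [AddCommGroup F] [Module ℝ F]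
    (τ : weighted N w (TangentSpace (𝓡 N) x) F) (e : Fin N → TangentSpace (𝓡 N) x) :
    τ.1 e = dens φ x e ^ (-w / ((N : ℝ) + 1)) • τ.1 (fun a => fr φ a x) := by
  by_cases he : LinearIndependent ℝ e
  · let b := Basis.mk he (span_frame he)
    have hf := linearIndependent_fr hφ hx
    let b₀ := Basis.mk hf (span_frame hf)
    let A : TangentSpace (𝓡 N) x ≃ₗ[ℝ] TangentSpace (𝓡 N) x := b₀.equiv b (Equiv.refl _)
    have hA : (fun a => A (fr φ a x)) = e := by
      funext a
      have h1 : b₀ a = fr φ a x := Basis.mk_apply ..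
      have h2 : b a = e a := Basis.mk_apply ..
      have h3 : A (b₀ a) = b a := Basis.equiv_apply ..
      exact (congrArg A h1).symm.trans (h3.trans h2)
    have h4 := τ.2.2 A (fun a => fr φ a x)
    have h5 := dens_map hφ hx (A : TangentSpace (𝓡 N) x →ₗ[ℝ] TangentSpace (𝓡 N) x)
      (fun a => fr φ a x)
    rw [dens_fr hφ hx, mul_one] at h5
    rw [← h5] at h4
    have h6 : (fun a => (A : TangentSpace (𝓡 N) x →ₗ[ℝ] TangentSpace (𝓡 N) x) (fr φ a x)) = e := hA
    rw [h6, hA] at h4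
    exact h4
  · rw [τ.2.1 e he, dens_eq_zero hφ hx he,
      Real.zero_rpow (div_ne_zero (neg_ne_zero.2 hw) (by positivity)), zero_smul]

lemma isFrameOn_fr (hφ : φ ∈ IsManifold.maximalAtlas (𝓡 N) ∞ M) {U : Set M} (hU : U ⊆ φ.source) :
    IsFrameOn N (fr φ : Fin N → VField N M) U where
  linearIndependent hx := linearIndependent_fr hφ (hU hx)
  generating hx := span_frame (linearIndependent_fr hφ (hU hx))
  contMDiffOn a := smoothFieldOn_cfield hφ (sb a) hU

/-- The trace of the connection form of a frame. -/
lemma connTrace_eq_trace (hφ : φ ∈ IsManifold.maximalAtlas (𝓡 N) ∞ M) {U : Set M} (hU : IsOpen U)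
    {cov : RawConn N M} (h : IsAffineConnectionOn U cov) {e : Fin N → VField N M} {V : Set M}
    (hV : IsOpen V) (he : IsFrameOn N e V) {x : M} (hx : x ∈ V) (hxU : x ∈ U) (hxφ : x ∈ φ.source)
    (v : TangentSpace (𝓡 N) x) :
    ∃ B : Basis (Fin N) ℝ (Eu N), (∀ a, B a = coord φ (e a) (φ x)) ∧
      connTrace cov he hx v =
        ∑ a, B.coord a (fderiv ℝ (coord φ (e a)) (φ x) (tg φ x v))
          + traceC (chr φ cov) (φ x) (tg φ x v) := by
  obtain ⟨g, hg, -⟩ := exists_tg_equiv hφ hxφ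
  have h4 : ∀ v, tg φ x v = g v := fun v => by rw [← hg]; rfl
  let B := (he.toBasisAt hx).map g.toLinearEquiv
  have hB : ∀ a, B a = coord φ (e a) (φ x) := fun a => by
    rw [coord_apply _ hxφ, h4]
    exact congrArg g (he.toBasisAt_coe hx a)
  have hBc : ∀ a w, (he.toBasisAt hx).coord a w = B.coord a (tg φ x w) := fun a w => by
    rw [h4]
    exact congrArg (fun u => (he.toBasisAt hx).coord a u) (g.symm_apply_apply w).symm
  refine ⟨B, hB, ?_⟩
  rw [connTrace, traceC, trace_eq_sum_coord B, ← Finset.sum_add_distrib]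
  refine Finset.sum_congr rfl fun a _ => ?_
  rw [hBc, tg_cov hφ hU h hxU hxφ (SmoothFieldOn.diffFieldAt hV (he.contMDiffOn a) hx), map_add, hB,
    coord_apply _ hxφ]
  rfl

end

/-! ### Tractors and the tractor connection in a chart -/

section

variable {N : ℕ} {M : Type u} [TopologicalSpace M] [ChartedSpace (EuclideanSpace ℝ (Fin N)) M]
  [IsManifold (𝓡 N) ∞ M] {φ : OpenPartialHomeomorph M (Eu N)}

/-! ### Derivatives of densities -/

lemma contDiff_volF : ContDiff ℝ ∞ (volF N : (Fin N → Eu N) → ℝ) := (volF N).contDiff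

/-- The logarithmic derivative of the density of a frame. -/
lemma hasFDerivAt_dens_rpow (hφ : φ ∈ IsManifold.maximalAtlas (𝓡 N) ∞ M) {U : Set M}
    (hU : IsOpen U) {cov : RawConn N M} (h : IsAffineConnectionOn U cov) {e : Fin N → VField N M}
    {V : Set M} (hV : IsOpen V) (he : IsFrameOn N e V) {x : M} (hx : x ∈ V) (hxU : x ∈ U)
    (hxφ : x ∈ φ.source) (s : ℝ) :
    ContDiffAt ℝ ∞ (fun z => dens φ (φ.symm z) (fun a => e a (φ.symm z)) ^ s) (φ x) ∧
    ∃ L : Eu N →L[ℝ] ℝ,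
      HasFDerivAt (fun z => dens φ (φ.symm z) (fun a => e a (φ.symm z)) ^ s) L (φ x) ∧
      ∀ v, L (tg φ x v) = s * (connTrace cov he hx v - traceC (chr φ cov) (φ x) (tg φ x v)) *
        dens φ x (fun a => e a x) ^ s := by
  have hpos : 0 < dens φ x (fun a => e a x) := dens_pos hφ hxφ (he.linearIndependent hx)
  have hsm : ∀ a, ContDiffAt ℝ ∞ (coord φ (e a)) (φ x) := fun a =>
    SmoothFieldOn.contDiffAt_coord hφ hV (he.contMDiffOn a) hx hxφ
  have hval : dens φ x (fun a => e a x) = |volF N (fun a => coord φ (e a) (φ x))| := by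
    simp only [coord_apply _ hxφ]
    rfl
  rw [hval] at hpos ⊢
  have hne : volF N (fun a => coord φ (e a) (φ x)) ≠ 0 := abs_pos.1 hpos
  have hc : ContDiffAt ℝ ∞ (fun z => volF N (fun a => coord φ (e a) z)) (φ x) :=
    contDiff_volF.contDiffAt.comp (φ x) (contDiffAt_pi.2 hsm)
  refine ⟨(hc.abs hne).rpow_const_of_ne hpos.ne', ?_⟩
  -- The direction 0 serves only to produce the basis `B` of frame vectors; it is the same basis for
  -- every direction.
  obtain ⟨B, hB, hct⟩ := connTrace_eq_trace hφ hU h hV he hx hxU hxφ (φ := φ) 0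
  obtain ⟨L, hL, hLv⟩ := hasFDerivAt_volF (f := fun a z => coord φ (e a) z)
    (fun a => ((hsm a).differentiableAt (by simp)).hasFDerivAt) B hB
  refine ⟨_, (hL.abs hne).rpow_const (Or.inl hpos.ne'), fun v => ?_⟩
  obtain ⟨B', hB', hct⟩ := connTrace_eq_trace hφ hU h hV he hx hxU hxφ (φ := φ) v
  have hBB : B' = B := Basis.eq_of_apply_eq fun a => (hB' a).trans (hB a).symm
  rw [hct, hBB, Real.rpow_sub_one hpos.ne']
  simp only [smul_apply, hLv, smul_eq_mul, add_sub_cancel_right]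
  have h1 := sign_mul_self (volF N (fun a => coord φ (e a) (φ x)))
  field_simp
  linear_combination (s * ∑ a, B.coord a (fderiv ℝ (coord φ (e a)) (φ x) (tg φ x v))) * h1

/-! ### One-forms in a chart -/

/-- The coordinate expression of a one-form. -/
def formC (φ : OpenPartialHomeomorph M (Eu N)) (Υ : (x : M) → TangentSpace (𝓡 N) x →L[ℝ] ℝ)
    (z : Eu N) : Eu N →L[ℝ] ℝ := Υ (φ.symm z) ∘L tgInv φ (φ.symm z)

lemma formC_apply (Υ : (x : M) → TangentSpace (𝓡 N) x →L[ℝ] ℝ) {x : M} (hx : x ∈ φ.source)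
    (w : Eu N) : formC φ Υ (φ x) w = Υ x (tgInv φ x w) := by
  have h : ∀ y, y = x → (Υ y ∘L tgInv φ y) w = Υ x (tgInv φ x w) := by
    rintro y rfl
    rfl
  exact h _ (φ.left_inv hx)

/-- The hypothesis concerns fields that are smooth on all of `U`, so constant fields of the chart
are cut off before it is applied. -/
lemma contDiffAt_formC [T2Space M] (hφ : φ ∈ IsManifold.maximalAtlas (𝓡 N) ∞ M) {U : Set M}
    (hU : IsOpen U) {Υ : (x : M) → TangentSpace (𝓡 N) x →L[ℝ] ℝ}
    (hΥ : ∀ Y : VField N M, SmoothFieldOn U Y → SmoothFunOn N U (fun x => Υ x (Y x))) {x : M}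
    (hxU : x ∈ U) (hx : x ∈ φ.source) : ContDiffAt ℝ ∞ (formC φ Υ) (φ x) := by
  rw [contDiffAt_clm_iff]
  intro w
  obtain ⟨χ, hχ, hχ1, hs⟩ := exists_bump (N := N) φ.open_source hx
  have h1 := (smoothFieldOn_cfield hφ w subset_rfl).bump_smul φ.open_source hχ hs
  have h2 := (smoothFunOn_iff_forall hU).1 (hΥ _ (h1.mono (subset_univ U))) x hxU
  rw [contMDiffAt_fun_iff hφ hx] at h2
  refine h2.congr_of_eventuallyEq ?_
  have h3 : ∀ᶠ z in 𝓝 (φ x), z ∈ φ.target ∧ χ (φ.symm z) = 1 := by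
    have h4 := (φ.continuousAt_symm (φ.map_source hx)).tendsto
    rw [φ.left_inv hx] at h4
    exact (φ.open_target.eventually_mem (φ.map_source hx)).and (h4.eventually hχ1)
  filter_upwards [h3] with z hz
  have h5 := cfield_apply hφ w (φ.map_target hz.1)
  change Υ _ (tgInv φ _ w) = Υ _ (χ _ • cfield φ w _)
  rw [hz.2, one_smul, h5]

lemma ProjChangeAt.chr_eq_formC (hφ : φ ∈ IsManifold.maximalAtlas (𝓡 N) ∞ M) {U : Set M}
    (hU : IsOpen U) {cov cov' : RawConn N M} (h : IsAffineConnectionOn U cov)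
    (h' : IsAffineConnectionOn U cov') {Υ : (x : M) → TangentSpace (𝓡 N) x →L[ℝ] ℝ}
    (hΥ : ∀ x ∈ U, ProjChangeAt cov cov' x (Υ x)) {z : Eu N} (hz : z ∈ φ.target)
    (hzU : φ.symm z ∈ U) (w v : Eu N) : chr φ cov' z w v =
      chr φ cov z w v + formC φ Υ z v • w + formC φ Υ z w • v := by
  have h1 := (hΥ _ hzU).chr_eq hφ hU h h' hzU (φ.map_target hz) w v
  rw [φ.right_inv hz] at h1
  exact h1

/-- The term `υ(v) w` has trace `N υ(v)` in `w`, and the rank-one term `υ(w) v` has trace `υ(v)`. -/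
lemma traceC_projChange {E : Type*} [NormedAddCommGroup E] [NormedSpace ℝ E] [FiniteDimensional ℝ E]
    {Γ Γ' : E → E →L[ℝ] E →L[ℝ] E} {z : E} {υ : E →L[ℝ] ℝ}
    (h : ∀ w v, Γ' z w v = Γ z w v + υ v • w + υ w • v) (v : E) :
    traceC Γ' z v = traceC Γ z v + ((finrank ℝ E : ℝ) + 1) * υ v := by
  have h1 : ((Γ' z).flip v : E →ₗ[ℝ] E) =
      ((Γ z).flip v : E →ₗ[ℝ] E) + υ v • LinearMap.id + (υ : E →ₗ[ℝ] ℝ).smulRight v := by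
    ext w
    simp [h]
  rw [traceC, traceC, h1, map_add, map_add, map_smul, LinearMap.trace_id, LinearMap.trace_smulRight]
  simp only [smul_eq_mul, ContinuousLinearMap.coe_coe]
  ring

/-! ### Tractors in a chart -/

/-- On a field with value `v` at `x`, the change in direction `v` is `2 Υ(v) v`, which determines
`Υ(v)`. -/
lemma ProjChangeAt.unique (hφ : φ ∈ IsManifold.maximalAtlas (𝓡 N) ∞ M) {cov cov' : RawConn N M}
    {x : M} (hx : x ∈ φ.source) {Υ Υ' : TangentSpace (𝓡 N) x →L[ℝ] ℝ}
    (h : ProjChangeAt cov cov' x Υ) (h' : ProjChangeAt cov cov' x Υ') : Υ = Υ' := by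
  ext v
  have h1 := (h (cfield φ (tg φ x v)) (diffFieldAt_cfield hφ _ hx) v).symm.trans
    (h' (cfield φ (tg φ x v)) (diffFieldAt_cfield hφ _ hx) v)
  rw [cfield_apply hφ _ hx, tgInv_tg hφ hx, add_assoc, add_assoc, add_right_inj, ← add_smul,
    ← add_smul, ← sub_eq_zero, ← sub_smul, smul_eq_zero] at h1
  rcases h1 with h1 | h1
  · linarith
  · rw [h1, map_zero, map_zero]

lemma ProjChangeAt.trans {cov cov' cov'' : RawConn N M} {x : M}
    {Υ Υ' : TangentSpace (𝓡 N) x →L[ℝ] ℝ} (h : ProjChangeAt cov cov' x Υ)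
    (h' : ProjChangeAt cov' cov'' x Υ') : ProjChangeAt cov cov'' x (Υ + Υ') := fun Y hY v => by
  rw [h' Y hY v, h Y hY v]
  simp only [add_apply, add_smul]
  abel

lemma ProjChangeAt.refl (cov : RawConn N M) (x : M) : ProjChangeAt cov cov x 0 := fun Y _ v => by
  simp

variable {p : ProjectiveStructure N M}

lemma exists_ups (c₀ cov : p.carrier) : ProjEquivOn univ c₀.1 cov.1 :=
  (p.mem_iff c₀.1 c₀.2 cov.1 (p.isAffineConnection _ cov.2)).1 cov.2

/-- The one-form that relates two connections of the projective class. -/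
def ups (c₀ cov : p.carrier) : (x : M) → TangentSpace (𝓡 N) x →L[ℝ] ℝ := (exists_ups c₀ cov).choose

lemma smooth_ups (c₀ cov : p.carrier) (Y : VField N M) (hY : SmoothFieldOn univ Y) :
    SmoothFunOn N univ (fun x => ups c₀ cov x (Y x)) := (exists_ups c₀ cov).choose_spec.1 Y hY

lemma projChangeAt_ups (c₀ cov : p.carrier) (x : M) : ProjChangeAt c₀.1 cov.1 x (ups c₀ cov x) :=
  (exists_ups c₀ cov).choose_spec.2 x (mem_univ x)

lemma tractor_ext {x : M} {t t' : tractor p x}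
    (h : ∀ cov e, vecPart t cov e = vecPart t' cov e ∧ densPart t cov e = densPart t' cov e) :
    t = t' :=
  Subtype.ext (funext fun cov => Subtype.ext (funext fun e => Prod.ext (h cov e).1 (h cov e).2))

/-- The tractor with given components in the coordinate frame and the splitting of `c₀`. -/
def mkT (hφ : φ ∈ IsManifold.maximalAtlas (𝓡 N) ∞ M) (c₀ : p.carrier) {x : M}
    (hx : x ∈ φ.source) : Eu N × ℝ →ₗ[ℝ] tractor p x where
  toFun c := ⟨fun cov => wElt hφ hx (w := -1) (by norm_num)
      (tgInv φ x c.1, c.2 - ups c₀ cov x (tgInv φ x c.1)), fun cov cov' Υ hΥ e => by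
    have h := ((projChangeAt_ups c₀ cov x).trans hΥ).unique hφ hx (projChangeAt_ups c₀ cov' x)
    simp only [wElt, ← h, Prod.smul_mk, add_apply, map_smul, smul_eq_mul]
    congr 1
    ring⟩
  map_add' c c' := tractor_ext fun cov e => by
    simp only [vecPart, densPart, wElt, Submodule.coe_add, Pi.add_apply, Prod.smul_mk, Prod.fst_add,
      Prod.snd_add, map_add, smul_add, smul_eq_mul, true_and]
    ring
  map_smul' r c := tractor_ext fun cov e => by
    simp only [vecPart, densPart, wElt, Submodule.coe_smul, Pi.smul_apply, Prod.smul_mk,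
      Prod.smul_fst, Prod.smul_snd, map_smul, smul_eq_mul, RingHom.id_apply]
    refine ⟨smul_comm _ _ _, ?_⟩
    ring

lemma vecPart_mkT (hφ : φ ∈ IsManifold.maximalAtlas (𝓡 N) ∞ M) (c₀ : p.carrier) {x : M}
    (hx : x ∈ φ.source) (c : Eu N × ℝ) (cov : p.carrier) (e : Fin N → TangentSpace (𝓡 N) x) :
    vecPart (mkT hφ c₀ hx c) cov e = dens φ x e ^ ((1 : ℝ) / ((N : ℝ) + 1)) • tgInv φ x c.1 := by
  have h : (1 : ℝ) / ((N : ℝ) + 1) = -(-1) / ((N : ℝ) + 1) := by rw [neg_neg]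
  rw [h]
  rfl

lemma densPart_mkT (hφ : φ ∈ IsManifold.maximalAtlas (𝓡 N) ∞ M) (c₀ : p.carrier) {x : M}
    (hx : x ∈ φ.source) (c : Eu N × ℝ) (cov : p.carrier) (e : Fin N → TangentSpace (𝓡 N) x) :
    densPart (mkT hφ c₀ hx c) cov e =
      dens φ x e ^ ((1 : ℝ) / ((N : ℝ) + 1)) * (c.2 - ups c₀ cov x (tgInv φ x c.1)) := by
  have h : (1 : ℝ) / ((N : ℝ) + 1) = -(-1) / ((N : ℝ) + 1) := by rw [neg_neg]
  rw [h]
  rfl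

/-- The components of a tractor in the coordinate frame and the splitting of `c₀`. -/
def compT (φ : OpenPartialHomeomorph M (Eu N)) (c₀ : p.carrier) (x : M) :
    tractor p x →ₗ[ℝ] Eu N × ℝ where
  toFun t := (tg φ x (vecPart t c₀ (fun a => fr φ a x)), densPart t c₀ (fun a => fr φ a x))
  map_add' t t' := by
    simp only [vecPart, densPart, Submodule.coe_add, Pi.add_apply, Prod.fst_add, Prod.snd_add,
      map_add, Prod.mk_add_mk]
  map_smul' r t := by
    simp only [vecPart, densPart, Submodule.coe_smul, Pi.smul_apply, Prod.smul_fst, Prod.smul_snd,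
      map_smul, RingHom.id_apply, Prod.smul_mk]

lemma compT_mkT (hφ : φ ∈ IsManifold.maximalAtlas (𝓡 N) ∞ M) (c₀ : p.carrier) {x : M}
    (hx : x ∈ φ.source) (c : Eu N × ℝ) : compT φ c₀ x (mkT hφ c₀ hx c) = c := by
  have h := (projChangeAt_ups c₀ c₀ x).unique hφ hx (ProjChangeAt.refl c₀.1 x)
  change (tg φ x (vecPart _ _ _), densPart _ _ _) = c
  rw [vecPart_mkT, densPart_mkT, dens_fr hφ hx, Real.one_rpow, one_smul, one_mul, tg_tgInv hφ hx, h,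
    zero_apply, sub_zero]

lemma mkT_compT (hφ : φ ∈ IsManifold.maximalAtlas (𝓡 N) ∞ M) (c₀ : p.carrier) {x : M}
    (hx : x ∈ φ.source) (t : tractor p x) : mkT hφ c₀ hx (compT φ c₀ x t) = t := by
  refine Subtype.ext (funext fun cov => Subtype.ext (funext fun e => ?_))
  rw [weighted_apply hφ hx (by norm_num) (t.1 cov) e, t.2 c₀ cov _ (projChangeAt_ups c₀ cov x)]
  change _ • (tgInv φ x (tg φ x _), densPart _ _ _ - ups c₀ cov x (tgInv φ x (tg φ x _))) = _
  rw [tgInv_tg hφ hx]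
  rfl

/-! ### Local sections of the tractor bundle -/

/-- The section of the tractor bundle with components `c`, cut off by `χ`. -/
def tsec (hφ : φ ∈ IsManifold.maximalAtlas (𝓡 N) ∞ M) (c₀ : p.carrier) (χ : M → ℝ)
    (c : Eu N × ℝ) : TractorField p := by
  classical exact fun y => if h : y ∈ φ.source then mkT hφ c₀ h (χ y • c) else 0

lemma tsec_of_mem (hφ : φ ∈ IsManifold.maximalAtlas (𝓡 N) ∞ M) (c₀ : p.carrier) (χ : M → ℝ)
    (c : Eu N × ℝ) {y : M} (h : y ∈ φ.source) : tsec hφ c₀ χ c y = mkT hφ c₀ h (χ y • c) :=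
  dif_pos h

lemma tsec_of_eq_one (hφ : φ ∈ IsManifold.maximalAtlas (𝓡 N) ∞ M) (c₀ : p.carrier) {χ : M → ℝ}
    (c : Eu N × ℝ) {y : M} (h : y ∈ φ.source) (hχ : χ y = 1) :
    tsec hφ c₀ χ c y = mkT hφ c₀ h c := by
  rw [tsec_of_mem hφ c₀ χ c h, hχ, one_smul]

lemma tsec_of_eq_zero (hφ : φ ∈ IsManifold.maximalAtlas (𝓡 N) ∞ M) (c₀ : p.carrier) {χ : M → ℝ}
    (c : Eu N × ℝ) {y : M} (hχ : χ y = 0) : tsec hφ c₀ χ c y = 0 := by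
  by_cases h : y ∈ φ.source
  · rw [tsec_of_mem hφ c₀ χ c h, hχ, zero_smul, map_zero]
  · exact dif_neg h

lemma coord_vecPart_tsec (hφ : φ ∈ IsManifold.maximalAtlas (𝓡 N) ∞ M) (c₀ : p.carrier) (χ : M → ℝ)
    (c : Eu N × ℝ) (cov : p.carrier) (e : Fin N → VField N M) {z : Eu N} (hz : z ∈ φ.target) :
    coord φ (fun y => vecPart (tsec hφ c₀ χ c y) cov (fun a => e a y)) z =
      dens φ (φ.symm z) (fun a => e a (φ.symm z)) ^ ((1 : ℝ) / ((N : ℝ) + 1)) •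
        χ (φ.symm z) • c.1 := by
  rw [coord, tsec_of_mem hφ c₀ χ c (φ.map_target hz), vecPart_mkT, map_smul,
    tg_tgInv hφ (φ.map_target hz)]
  rfl

lemma densPart_tsec (hφ : φ ∈ IsManifold.maximalAtlas (𝓡 N) ∞ M) (c₀ : p.carrier) (χ : M → ℝ)
    (c : Eu N × ℝ) (cov : p.carrier) (e : Fin N → VField N M) {z : Eu N} (hz : z ∈ φ.target) :
    densPart (tsec hφ c₀ χ c (φ.symm z)) cov (fun a => e a (φ.symm z)) =
      dens φ (φ.symm z) (fun a => e a (φ.symm z)) ^ ((1 : ℝ) / ((N : ℝ) + 1)) *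
        (χ (φ.symm z) * (c.2 - formC φ (ups c₀ cov) z c.1)) := by
  rw [tsec_of_mem hφ c₀ χ c (φ.map_target hz), densPart_mkT, Prod.smul_fst, map_smul, map_smul,
    Prod.smul_snd, smul_eq_mul, smul_eq_mul, ← mul_sub]
  rfl

lemma eventually_symm {x : M} (hx : x ∈ φ.source) {P : M → Prop} (h : ∀ᶠ y in 𝓝 x, P y) :
    ∀ᶠ z in 𝓝 (φ x), z ∈ φ.target ∧ P (φ.symm z) := by
  have h4 := (φ.continuousAt_symm (φ.map_source hx)).tendsto
  rw [φ.left_inv hx] at h4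
  exact (φ.open_target.eventually_mem (φ.map_source hx)).and (h4.eventually h)

/-- The cut-off produces a global smooth section, as required of the test sections in
`IsParallelEnd`. Outside the chart the section vanishes near every point. -/
lemma smoothTractor_tsec [T2Space M] (hφ : φ ∈ IsManifold.maximalAtlas (𝓡 N) ∞ M)
    (c₀ : p.carrier) {χ : M → ℝ} (hχ : ContMDiff (𝓡 N) 𝓘(ℝ, ℝ) ∞ χ) (hs : tsupport χ ⊆ φ.source)
    (c : Eu N × ℝ) : SmoothTractor (tsec hφ c₀ χ c) := by
  intro cov V e hV he
  have hev : ∀ x, x ∉ φ.source → ∀ᶠ y in 𝓝 x, tsec hφ c₀ χ c y = 0 := fun x hx => by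
    filter_upwards [(isClosed_tsupport χ).isOpen_compl.mem_nhds (fun h => hx (hs h))] with y hy
    exact tsec_of_eq_zero hφ c₀ c (image_eq_zero_of_notMem_tsupport hy)
  have hχ' : ∀ x ∈ φ.source, ContDiffAt ℝ ∞ (χ ∘ φ.symm) (φ x) := fun x hx =>
    (contMDiffAt_fun_iff hφ hx).1 hχ.contMDiffAt
  constructor
  · rw [smoothFieldOn_iff_forall hV]
    intro x hxV
    by_cases hx : x ∈ φ.source
    · rw [contMDiffAt_vfield_iff hφ hx]
      have h1 := (hasFDerivAt_dens_rpow hφ isOpen_univ (p.isAffineConnection _ cov.2) hV he hxV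
        (mem_univ x) hx ((1 : ℝ) / ((N : ℝ) + 1))).1
      refine (h1.smul ((hχ' x hx).smul (contDiffAt_const (c := c.1)))).congr_of_eventuallyEq ?_
      filter_upwards [φ.open_target.mem_nhds (φ.map_source hx)] with z hz
      exact coord_vecPart_tsec hφ c₀ χ c cov e hz
    · refine ((Bundle.contMDiffOn_zeroSection ℝ _).contMDiffAt
        Filter.univ_mem).congr_of_eventuallyEq ?_
      filter_upwards [hev x hx] with y hy
      rw [hy]
      rfl
  · rw [smoothFunOn_iff_forall hV]
    intro x hxV
    by_cases hx : x ∈ φ.source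
    · rw [contMDiffAt_fun_iff hφ hx]
      have h1 := (hasFDerivAt_dens_rpow hφ isOpen_univ (p.isAffineConnection _ cov.2) hV he hxV
        (mem_univ x) hx ((1 : ℝ) / ((N : ℝ) + 1))).1
      have h2 := contDiffAt_clm_iff.1 (contDiffAt_formC hφ isOpen_univ (smooth_ups c₀ cov)
        (mem_univ x) hx) c.1
      refine (h1.mul ((hχ' x hx).mul ((contDiffAt_const (c := c.2)).sub h2))).congr_of_eventuallyEq ?_
      filter_upwards [φ.open_target.mem_nhds (φ.map_source hx)] with z hz
      exact densPart_tsec hφ c₀ χ c cov e hz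
    · refine (contMDiffAt_const (c := (0 : ℝ))).congr_of_eventuallyEq ?_
      filter_upwards [hev x hx] with y hy
      rw [hy]
      rfl

/-- The normal tractor connection in a chart. -/
lemma hasTractorDeriv_tsec [T2Space M] (hN : 2 ≤ N) (hφ : φ ∈ IsManifold.maximalAtlas (𝓡 N) ∞ M)
    (c₀ : p.carrier) {χ : M → ℝ} {x : M} (hx : x ∈ φ.source) (hχ : ∀ᶠ y in 𝓝 x, χ y = 1)
    (c : Eu N × ℝ) (v : TangentSpace (𝓡 N) x) :
    HasTractorDeriv (tsec hφ c₀ χ c) x v (mkT hφ c₀ hx (om (chr φ c₀.1) (φ x) (tg φ x v) c -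
      (traceC (chr φ c₀.1) (φ x) (tg φ x v) / ((N : ℝ) + 1)) • c)) := by
  intro cov V e hV he hxV
  have hc := p.isAffineConnection _ cov.2
  have hc₀ := p.isAffineConnection _ c₀.2
  obtain ⟨-, L, hL, hLv⟩ := hasFDerivAt_dens_rpow hφ isOpen_univ hc hV he hxV
    (mem_univ x) hx ((1 : ℝ) / ((N : ℝ) + 1))
  -- The derivative has to be verified in the splitting of every `cov` of the class, so `cov` is
  -- expressed through `c₀` and the one-form `ups c₀ cov`.
  have hΓ := fun y (hy : y ∈ φ.target) w v => ProjChangeAt.chr_eq_formC hφ isOpen_univ hc₀ hc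
    (fun x _ => projChangeAt_ups c₀ cov x) hy (mem_univ _) w v
  have hφx := φ.map_source hx
  have hυ := contDiffAt_formC hφ isOpen_univ (smooth_ups c₀ cov) (mem_univ x) hx
  have hυc : HasFDerivAt (fun z => formC φ (ups c₀ cov) z c.1) _ (φ x) :=
    (hυ.differentiableAt (by simp)).hasFDerivAt.clm_apply (hasFDerivAt_const c.1 (φ x))
  have hfin : (finrank ℝ (Eu N) : ℝ) = N := by simp
  have htr := traceC_projChange (hΓ _ hφx) (tg φ x v)
  rw [hfin] at htr
  have hN1 : (N : ℝ) + 1 ≠ 0 := by positivity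
  have hLv' := hLv v
  rw [htr] at hLv'
  set δ := dens φ x (fun a => e a x) ^ ((1 : ℝ) / ((N : ℝ) + 1)) with hδ
  have hδ' : dens φ (φ.symm (φ x)) (fun a => e a (φ.symm (φ x))) ^ ((1 : ℝ) / ((N : ℝ) + 1)) = δ := by
    have h : ∀ y, y = x → dens φ y (fun a => e a y) ^ ((1 : ℝ) / ((N : ℝ) + 1)) = δ := by
      rintro y rfl
      rfl
    exact h _ (φ.left_inv hx)
  have hvp : HasFDerivAt (coord φ (fun y => vecPart (tsec hφ c₀ χ c y) cov (fun a => e a y)))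
      (L.smulRight c.1) (φ x) := by
    refine (hL.smul_const c.1).congr_of_eventuallyEq ?_
    filter_upwards [eventually_symm hx hχ] with z hz
    rw [coord_vecPart_tsec hφ c₀ χ c cov e hz.1, hz.2, one_smul]
  have hdp := (hL.mul (hυc.const_sub c.2)).congr_of_eventuallyEq
    (f₁ := (fun y => densPart (tsec hφ c₀ χ c y) cov (fun a => e a y)) ∘ φ.symm) (by
      filter_upwards [eventually_symm hx hχ] with z hz
      rw [Function.comp_apply, densPart_tsec hφ c₀ χ c cov e hz.1, hz.2, one_mul]
      rfl)
  have hv1 : vecPart (tsec hφ c₀ χ c x) cov (fun a => e a x) = δ • tgInv φ x c.1 := by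
    rw [tsec_of_eq_one hφ c₀ c hx hχ.self_of_nhds, vecPart_mkT]
  have hd1 : densPart (tsec hφ c₀ χ c x) cov (fun a => e a x) =
      δ * (c.2 - formC φ (ups c₀ cov) (φ x) c.1) := by
    rw [tsec_of_eq_one hφ c₀ c hx hχ.self_of_nhds, densPart_mkT, formC_apply _ hx]
  constructor
  · refine clm_ext_tg hφ hx ?_
    rw [vecPart_mkT, hv1, hd1, map_add, map_sub, tg_cov hφ isOpen_univ hc (mem_univ x) hx
      ((diffFieldAt_iff hφ hx).2 hvp.differentiableAt), hvp.fderiv, hv1]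
    simp only [map_smul, smul_apply, tg_tgInv hφ hx, hΓ _ hφx, ContinuousLinearMap.smulRight_apply,
      hLv', om, Prod.fst_sub, Prod.smul_fst, ← hδ]
    match_scalars <;> field_simp <;> ring
  -- In the lower component the derivative of the one-form yields the terms of `schChange`, which
  -- match the change of the Schouten form from `c₀` to `cov`.
  · rw [densPart_mkT, mvfderiv_eq_fderiv hφ hx hdp.differentiableAt, hdp.fderiv, hd1, hv1,
      schouten_eq hφ isOpen_univ hc (mem_univ x) hx, map_smul, tg_tgInv hφ hx, map_smul,
      schC_projChange (by simpa using hN)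
        ((contDiffAt_chr hφ isOpen_univ hc₀ (mem_univ x) hx).differentiableAt (by simp))
        ((contDiffAt_chr hφ isOpen_univ hc (mem_univ x) hx).differentiableAt (by simp))
        (hυ.differentiableAt (by simp)) (chr_symm hφ isOpen_univ hc₀ (mem_univ x) hx)
        (by filter_upwards [φ.open_target.mem_nhds hφx] with y hy using hΓ y hy),
      ← formC_apply _ hx]
    simp only [om, Prod.snd_sub, Prod.smul_snd, Prod.fst_sub, Prod.smul_fst, schChange, add_apply,
      smul_apply, smul_eq_mul, neg_apply, hLv', hδ', map_sub, map_add,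
      map_smul, ContinuousLinearMap.comp_apply, ContinuousLinearMap.flip_apply, zero_apply, map_zero, zero_add]
    rw [← hδ]
    field_simp
    ring

end

/-! ### Parallel endomorphisms of the tractor bundle in a chart -/

section

variable {N : ℕ} {M : Type u} [TopologicalSpace M] [ChartedSpace (EuclideanSpace ℝ (Fin N)) M]
  [IsManifold (𝓡 N) ∞ M] {φ : OpenPartialHomeomorph M (Eu N)} {p : ProjectiveStructure N M}

/-! ### Parallel endomorphisms of the tractor bundle in a chart -/

/-- The coordinate expression of an endomorphism of the tractor bundle. -/
def endC (hφ : φ ∈ IsManifold.maximalAtlas (𝓡 N) ∞ M) (c₀ : p.carrier) (A : TractorEnd p)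
    (z : Eu N) : Eu N × ℝ →L[ℝ] Eu N × ℝ := by
  classical
  exact
    if h : z ∈ φ.target then
      LinearMap.toContinuousLinearMap
        (compT φ c₀ (φ.symm z) ∘ₗ A (φ.symm z) ∘ₗ mkT hφ c₀ (φ.map_target h))
    else 0

lemma endC_apply (hφ : φ ∈ IsManifold.maximalAtlas (𝓡 N) ∞ M) (c₀ : p.carrier) (A : TractorEnd p)
    {x : M} (hx : x ∈ φ.source) (c : Eu N × ℝ) :
    endC hφ c₀ A (φ x) c = compT φ c₀ x (A x (mkT hφ c₀ hx c)) := by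
  have h1 : endC hφ c₀ A (φ x) = LinearMap.toContinuousLinearMap
    (compT φ c₀ (φ.symm (φ x)) ∘ₗ A (φ.symm (φ x)) ∘ₗ
      mkT hφ c₀ (φ.map_target (φ.map_source hx))) := dif_pos (φ.map_source hx)
  have h2 : ∀ y (hy : y ∈ φ.source), y = x → compT φ c₀ y (A y (mkT hφ c₀ hy c)) =
      compT φ c₀ x (A x (mkT hφ c₀ hx c)) := by
    rintro y hy rfl
    rfl
  rw [h1]
  exact h2 _ _ (φ.left_inv hx)

lemma endC_endC (hφ : φ ∈ IsManifold.maximalAtlas (𝓡 N) ∞ M) (c₀ : p.carrier) (A B : TractorEnd p)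
    {x : M} (hx : x ∈ φ.source) (c : Eu N × ℝ) : endC hφ c₀ A (φ x) (endC hφ c₀ B (φ x) c) =
      compT φ c₀ x (A x (B x (mkT hφ c₀ hx c))) := by
  rw [endC_apply hφ c₀ B hx, endC_apply hφ c₀ A hx, mkT_compT]

lemma compT_apply (c₀ : p.carrier) (x : M) (t : tractor p x) : compT φ c₀ x t =
    (tg φ x (vecPart t c₀ (fun a => fr φ a x)), densPart t c₀ (fun a => fr φ a x)) := rfl

lemma compT_neg (c₀ : p.carrier) (x : M) (t : tractor p x) :
    compT φ c₀ x (-t) = -compT φ c₀ x t := by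
  have h1 : vecPart (-t) c₀ (fun a => fr φ a x) = -vecPart t c₀ (fun a => fr φ a x) := rfl
  have h2 : densPart (-t) c₀ (fun a => fr φ a x) = -densPart t c₀ (fun a => fr φ a x) := rfl
  rw [compT_apply, compT_apply, h1, h2, map_neg, Prod.neg_mk]

lemma endC_eventually (hφ : φ ∈ IsManifold.maximalAtlas (𝓡 N) ∞ M) (c₀ : p.carrier)
    (A : TractorEnd p) {χ : M → ℝ} {x : M} (hx : x ∈ φ.source) (hχ : ∀ᶠ y in 𝓝 x, χ y = 1)
    (c : Eu N × ℝ) : ∀ᶠ z in 𝓝 (φ x), endC hφ c₀ A z c =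
      (coord φ (fun y => vecPart (A y (tsec hφ c₀ χ c y)) c₀ (fun a => fr φ a y)) z,
        densPart (A (φ.symm z) (tsec hφ c₀ χ c (φ.symm z))) c₀ (fun a => fr φ a (φ.symm z))) := by
  filter_upwards [eventually_symm hx hχ] with z hz
  have h := endC_apply hφ c₀ A (φ.map_target hz.1) c
  rw [φ.right_inv hz.1, ← tsec_of_eq_one hφ c₀ c (φ.map_target hz.1) hz.2, compT_apply] at h
  exact h

/-- The columns of the matrix are the components of the images of the sections `tsec`, which are
constant in the chart near `x`. -/
lemma IsParallelEnd.contDiffAt_endC [T2Space M] (hφ : φ ∈ IsManifold.maximalAtlas (𝓡 N) ∞ M)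
    (c₀ : p.carrier) {A : TractorEnd p} (hA : IsParallelEnd A) {x : M} (hx : x ∈ φ.source) :
    ContDiffAt ℝ ∞ (endC hφ c₀ A) (φ x) := by
  rw [contDiffAt_clm_iff]
  intro c
  obtain ⟨χ, hχ, hχ1, hs⟩ := exists_bump (N := N) φ.open_source hx
  have h := hA.1 _ (smoothTractor_tsec hφ c₀ hχ hs c) c₀ φ.source (fr φ) φ.open_source
    (isFrameOn_fr hφ subset_rfl)
  refine ContDiffAt.congr_of_eventuallyEq (ContDiffAt.prodMk ?_ ?_)
    (endC_eventually hφ c₀ A hx hχ1 c)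
  · exact h.1.contDiffAt_coord hφ φ.open_source hx hx
  · exact (contMDiffAt_fun_iff hφ hx).1 ((smoothFunOn_iff_forall φ.open_source).1 h.2 x hx)

lemma connTrace_fr (hφ : φ ∈ IsManifold.maximalAtlas (𝓡 N) ∞ M) {U : Set M} (hU : IsOpen U)
    {cov : RawConn N M} (h : IsAffineConnectionOn U cov) {V : Set M} (hV : IsOpen V)
    (hVφ : V ⊆ φ.source) {x : M} (hx : x ∈ V) (hxU : x ∈ U) (v : TangentSpace (𝓡 N) x) :
    connTrace cov (isFrameOn_fr hφ hVφ) hx v = traceC (chr φ cov) (φ x) (tg φ x v) := by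
  obtain ⟨B, -, hct⟩ := connTrace_eq_trace hφ hU h hV (isFrameOn_fr hφ hVφ) hx hxU (hVφ hx) v
  rw [hct, add_eq_right]
  refine Finset.sum_eq_zero fun a _ => ?_
  rw [fderiv_coord_cfield hφ _ (φ.map_source (hVφ hx)), zero_apply, map_zero]

/-- The tractor derivative of the image of a local section. -/
lemma IsParallelEnd.endC_om [T2Space M] (hN : 2 ≤ N)
    (hφ : φ ∈ IsManifold.maximalAtlas (𝓡 N) ∞ M) (c₀ : p.carrier) {A : TractorEnd p}
    (hA : IsParallelEnd A) {x : M} (hx : x ∈ φ.source) {χ : M → ℝ}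
    (hχ : ContMDiff (𝓡 N) 𝓘(ℝ, ℝ) ∞ χ) (hχ1 : ∀ᶠ y in 𝓝 x, χ y = 1)
    (hs : tsupport χ ⊆ φ.source) (v : Eu N) (c : Eu N × ℝ) {X : VField N M} {f : M → ℝ}
    (hX : X = fun y => vecPart (A y (tsec hφ c₀ χ c y)) c₀ (fun a => fr φ a y))
    (hf : f = fun y => densPart (A y (tsec hφ c₀ χ c y)) c₀ (fun a => fr φ a y))
    (d1 : DifferentiableAt ℝ (coord φ X) (φ x)) (d2 : DifferentiableAt ℝ (f ∘ φ.symm) (φ x)) :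
    endC hφ c₀ A (φ x) (om (chr φ c₀.1) (φ x) v c) =
      (fderiv ℝ (coord φ X) (φ x) v, fderiv ℝ (f ∘ φ.symm) (φ x) v) +
        om (chr φ c₀.1) (φ x) v (endC hφ c₀ A (φ x) c) := by
  have hc₀ := p.isAffineConnection _ c₀.2
  have hF := isFrameOn_fr hφ subset_rfl
  -- The weight of the densities adds a scalar multiple of `c` to the tractor derivative. It
  -- commutes with `A` and cancels at the end, which is why `om` omits it.
  set c' := om (chr φ c₀.1) (φ x) (tg φ x (tgInv φ x v)) c -
    (traceC (chr φ c₀.1) (φ x) (tg φ x (tgInv φ x v)) / ((N : ℝ) + 1)) • c with hc'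
  have H := hA.2 _ (smoothTractor_tsec hφ c₀ hχ hs c) x (tgInv φ x v) _
    (hasTractorDeriv_tsec hN hφ c₀ hx hχ1 c _) c₀ φ.source (fr φ) φ.open_source hF hx
  have h1 : vecPart (A x (mkT hφ c₀ hx c')) c₀ (fun a => fr φ a x) = c₀.1 X x (tgInv φ x v) -
      (connTrace c₀.1 hF hx (tgInv φ x v) / ((N : ℝ) + 1)) • X x + f x • tgInv φ x v := by
    subst hX hf
    exact H.1
  have h2 : densPart (A x (mkT hφ c₀ hx c')) c₀ (fun a => fr φ a x) =
      mvfderiv (𝓡 N) f x (tgInv φ x v) - connTrace c₀.1 hF hx (tgInv φ x v) / ((N : ℝ) + 1) * f x -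
        schouten c₀.1 x (tgInv φ x v) (X x) := by
    subst hX hf
    exact H.2
  clear H
  have hXx : compT φ c₀ x (A x (mkT hφ c₀ hx c)) = (tg φ x (X x), f x) := by
    rw [← tsec_of_eq_one hφ c₀ c hx hχ1.self_of_nhds]
    subst hX hf
    rfl
  have h5 := (endC_apply hφ c₀ A hx c).trans hXx
  have h6 := endC_apply hφ c₀ A hx c'
  have hct := connTrace_fr hφ isOpen_univ hc₀ φ.open_source subset_rfl hx (mem_univ x)
    (tgInv φ x v)
  have hv := tg_tgInv hφ hx v
  rw [hv] at hct hc'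
  have h1' : tg φ x (vecPart (A x (mkT hφ c₀ hx c')) c₀ (fun a => fr φ a x)) =
      fderiv ℝ (coord φ X) (φ x) v + chr φ c₀.1 (φ x) (tg φ x (X x)) v -
        (traceC (chr φ c₀.1) (φ x) v / ((N : ℝ) + 1)) • tg φ x (X x) + f x • v := by
    have h7 := tg_cov hφ isOpen_univ hc₀ (mem_univ x) hx ((diffFieldAt_iff hφ hx).2 d1)
      (tgInv φ x v)
    rw [hv] at h7
    rw [h1, (tg φ x).map_add, (tg φ x).map_sub, (tg φ x).map_smul, (tg φ x).map_smul, h7, hct, hv]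
  have h2' : densPart (A x (mkT hφ c₀ hx c')) c₀ (fun a => fr φ a x) =
      fderiv ℝ (f ∘ φ.symm) (φ x) v - traceC (chr φ c₀.1) (φ x) v / ((N : ℝ) + 1) * f x -
        schC (chr φ c₀.1) (φ x) v (tg φ x (X x)) := by
    rw [h2, hct, mvfderiv_eq_fderiv hφ hx d2, schouten_eq hφ isOpen_univ hc₀ (mem_univ x) hx, hv]
  have h7 := h6.trans (Prod.ext h1' h2' :
    compT φ c₀ x (A x (mkT hφ c₀ hx c')) = (_, _))
  rw [hc', (endC hφ c₀ A (φ x)).map_sub, (endC hφ c₀ A (φ x)).map_smul, h5, sub_eq_iff_eq_add] at h7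
  rw [h7, h5, om]
  refine Prod.ext ?_ ?_
  · simp only [Prod.fst_add, Prod.smul_fst]
    module
  · simp only [Prod.snd_add, Prod.smul_snd, smul_eq_mul]
    ring

/-- Near `x` the section is constant in the chart, so the derivative of its image is the derivative
of the matrix applied to `c`; `endC_om` evaluates it by parallelism. -/
lemma IsParallelEnd.fderiv_endC [T2Space M] (hN : 2 ≤ N)
    (hφ : φ ∈ IsManifold.maximalAtlas (𝓡 N) ∞ M) (c₀ : p.carrier) {A : TractorEnd p}
    (hA : IsParallelEnd A) {x : M} (hx : x ∈ φ.source) (v : Eu N) (c : Eu N × ℝ) :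
    fderiv ℝ (endC hφ c₀ A) (φ x) v c = endC hφ c₀ A (φ x) (om (chr φ c₀.1) (φ x) v c) -
      om (chr φ c₀.1) (φ x) v (endC hφ c₀ A (φ x) c) := by
  obtain ⟨χ, hχ, hχ1, hs⟩ := exists_bump (N := N) φ.open_source hx
  obtain ⟨X, hX⟩ : ∃ X : VField N M,
    X = fun y => vecPart (A y (tsec hφ c₀ χ c y)) c₀ (fun a => fr φ a y) := ⟨_, rfl⟩
  obtain ⟨f, hf⟩ : ∃ f : M → ℝ,
    f = fun y => densPart (A y (tsec hφ c₀ χ c y)) c₀ (fun a => fr φ a y) := ⟨_, rfl⟩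
  have hsm : SmoothFieldOn φ.source X ∧ SmoothFunOn N φ.source f := by
    rw [hX, hf]
    exact hA.1 _ (smoothTractor_tsec hφ c₀ hχ hs c) c₀ φ.source (fr φ) φ.open_source
      (isFrameOn_fr hφ subset_rfl)
  have hev : ∀ᶠ z in 𝓝 (φ x), endC hφ c₀ A z c = (coord φ X z, (f ∘ φ.symm) z) := by
    rw [hX, hf]
    exact endC_eventually hφ c₀ A hx hχ1 c
  have d1 := (hsm.1.contDiffAt_coord hφ φ.open_source hx hx).differentiableAt (by simp)
  have d2 := ((contMDiffAt_fun_iff hφ hx).1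
    ((smoothFunOn_iff_forall φ.open_source).1 hsm.2 x hx)).differentiableAt (by simp)
  rw [hA.endC_om hN hφ c₀ hx hχ hχ1 hs v c hX hf d1 d2, add_sub_cancel_right]
  have hd := (d1.hasFDerivAt.prodMk d2.hasFDerivAt).congr_of_eventuallyEq hev
  have hd' : HasFDerivAt (fun z => endC hφ c₀ A z c) _ (φ x) :=
    ((hA.contDiffAt_endC hφ c₀ hx).differentiableAt (by simp)).hasFDerivAt.clm_apply
      (hasFDerivAt_const c (φ x))
  have h3 := congrArg (fun L => L v) (hd'.unique hd)
  simpa only [add_apply, ContinuousLinearMap.comp_apply, zero_apply, map_zero, zero_add,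
    ContinuousLinearMap.flip_apply, ContinuousLinearMap.prod_apply] using h3

/-- The cyclic multiplication rules, obtained from `IJK = -1` by multiplying with one of the
endomorphisms. -/
lemma IsHypercomplex.mul_apply {V : Type*} [AddCommGroup V] [Module ℝ V] {I J K : V →ₗ[ℝ] V}
    (h : IsHypercomplex I J K) : (∀ t, I (J t) = K t) ∧ (∀ t, J (K t) = I t) ∧
      ∀ t, K (I t) = J t := by
  have hI : ∀ t, I (I t) = -t := fun t => congrArg (fun L => L t) h.1
  have hJ : ∀ t, J (J t) = -t := fun t => congrArg (fun L => L t) h.2.1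
  have hK : ∀ t, K (K t) = -t := fun t => congrArg (fun L => L t) h.2.2.1
  have hIJK : ∀ t, I (J (K t)) = -t := fun t => congrArg (fun L => L t) h.2.2.2
  have hJK : ∀ t, J (K t) = I t := fun t => by
    have h1 := hI (J (K t))
    rw [hIJK, map_neg] at h1
    exact (neg_injective h1).symm
  refine ⟨fun t => ?_, hJK, fun t => ?_⟩
  · have h1 := hIJK (K t)
    rw [hK, map_neg, map_neg] at h1
    exact neg_injective h1
  · have h1 := hJ (K (I t))
    rw [hJK, hI, map_neg] at h1
    exact (neg_injective h1).symm

/-- A parallel hypercomplex structure on the tractor bundle, in a chart and in the splitting of a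
connection of the projective class. -/
lemma IsParallelHypercomplex.parTriple [T2Space M] (hN : 2 ≤ N)
    (hφ : φ ∈ IsManifold.maximalAtlas (𝓡 N) ∞ M) (c₀ : p.carrier) {I J K : TractorEnd p}
    (h : IsParallelHypercomplex I J K) :
    ParTriple (chr φ c₀.1) φ.target (fun a => endC hφ c₀ (![I, J, K] a)) := by
  have hP : ∀ a, IsParallelEnd (![I, J, K] a) := fun a => match a with
    | 0 => h.1
    | 1 => h.2.1
    | 2 => h.2.2.1
  have hx : ∀ z ∈ φ.target, ∃ x ∈ φ.source, φ x = z := fun z hz =>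
    ⟨φ.symm z, φ.map_target hz, φ.right_inv hz⟩
  have hc₀ := p.isAffineConnection _ c₀.2
  have hsq : ∀ a x t, (![I, J, K] a) x ((![I, J, K] a) x t) = -t := fun a x t => match a with
    | 0 => congrArg (fun L => L t) (h.2.2.2 x).1
    | 1 => congrArg (fun L => L t) (h.2.2.2 x).2.1
    | 2 => congrArg (fun L => L t) (h.2.2.2 x).2.2.1
  have hmul : ∀ a x t, (![I, J, K] a) x ((![I, J, K] (a + 1)) x t) = (![I, J, K] (a + 2)) x t :=
    fun a x t => match a with
    | 0 => (h.2.2.2 x).mul_apply.1 t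
    | 1 => (h.2.2.2 x).mul_apply.2.1 t
    | 2 => (h.2.2.2 x).mul_apply.2.2 t
  constructor
  · exact φ.open_target
  · intro z hz
    obtain ⟨x, hx, rfl⟩ := hx z hz
    exact (contDiffAt_chr hφ isOpen_univ hc₀ (mem_univ x) hx).contDiffWithinAt
  · intro z hz
    obtain ⟨x, hx, rfl⟩ := hx z hz
    exact chr_symm hφ isOpen_univ hc₀ (mem_univ x) hx
  · intro a z hz
    obtain ⟨x, hx, rfl⟩ := hx z hz
    exact ((hP a).contDiffAt_endC hφ c₀ hx).contDiffWithinAt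
  · intro a z hz v c
    obtain ⟨x, hx, rfl⟩ := hx z hz
    exact (hP a).fderiv_endC hN hφ c₀ hx v c
  · intro a z hz c
    obtain ⟨x, hx, rfl⟩ := hx z hz
    rw [endC_endC hφ c₀ _ _ hx, hsq, compT_neg, compT_mkT]
  · intro a z hz c
    obtain ⟨x, hx, rfl⟩ := hx z hz
    rw [endC_endC hφ c₀ _ _ hx, hmul, endC_apply hφ c₀ _ hx]

/-- The projecting vector field in a chart. -/
lemma IsProjection.coord_eq (hφ : φ ∈ IsManifold.maximalAtlas (𝓡 N) ∞ M) (c₀ : p.carrier)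
    {A : TractorEnd p} {ξ : VField N M} (h : IsProjection A ξ) {z : Eu N} (hz : z ∈ φ.target) :
    blkI (endC hφ c₀ A z) = coord φ ξ z := by
  have hx := φ.map_target hz
  have h1 := endC_apply hφ c₀ A hx (0, 1)
  rw [φ.right_inv hz] at h1
  have h0 : ∀ cov e, vecPart (mkT hφ c₀ hx (0, 1)) cov e = 0 := fun cov e =>
    (vecPart_mkT hφ c₀ hx (0, 1) cov e).trans (by
      rw [(tgInv φ (φ.symm z)).map_zero, smul_zero])
  have h2 := h (φ.symm z) (mkT hφ c₀ hx (0, 1)) h0 c₀ (fun a => fr φ a (φ.symm z))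
  have h3 : densPart (mkT hφ c₀ hx (0, 1)) c₀ (fun a => fr φ a (φ.symm z)) = 1 :=
    congrArg Prod.snd (compT_mkT hφ c₀ hx (0, 1))
  have h4 : tg φ (φ.symm z) (vecPart (A (φ.symm z) (mkT hφ c₀ hx (0, 1))) c₀
      (fun a => fr φ a (φ.symm z))) = coord φ ξ z := by
    rw [h2, h3, one_smul, coord]
  exact (congrArg Prod.fst h1).trans h4

end

/-! ### Adapted scales in a chart -/

section

variable {N n : ℕ} {M : Type u} [TopologicalSpace M] [ChartedSpace (EuclideanSpace ℝ (Fin N)) M]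
  [IsManifold (𝓡 N) ∞ M] {φ : OpenPartialHomeomorph M (Eu N)} {p : ProjectiveStructure N M}

/-! ### Adapted scales in a chart -/

/-- The coordinate expression of a set. -/
abbrev img (φ : OpenPartialHomeomorph M (Eu N)) (V : Set M) : Set (Eu N) :=
  φ.target ∩ φ.symm ⁻¹' V

lemma isOpen_img {V : Set M} (hV : IsOpen V) : IsOpen (img φ V) := φ.isOpen_inter_preimage_symm hV

lemma map_mem_img {V : Set M} {x : M} (hxV : x ∈ V) (hx : x ∈ φ.source) : φ x ∈ img φ V :=
  ⟨φ.map_source hx, by rwa [mem_preimage, φ.left_inv hx]⟩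

lemma exists_of_mem_img {V : Set M} {z : Eu N} (hz : z ∈ img φ V) :
    ∃ x ∈ V, x ∈ φ.source ∧ φ x = z :=
  ⟨φ.symm z, hz.2, φ.map_target hz.1, φ.right_inv hz.1⟩

/-- The connection is compared with `c₀` through the member `c₁` of the class to which it is related
on `V`; the two one-forms add up. -/
lemma ProjectiveStructure.MemOn.exists_form [T2Space M]
    (hφ : φ ∈ IsManifold.maximalAtlas (𝓡 N) ∞ M) (c₀ : p.carrier) {V : Set M} (hV : IsOpen V)
    {cov : RawConn N M} (h : p.MemOn V cov) :
    ∃ υ : Eu N → Eu N →L[ℝ] ℝ, ContDiffOn ℝ ∞ υ (img φ V) ∧ ∀ z ∈ img φ V, ∀ w v,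
      chr φ cov z w v = chr φ c₀.1 z w v + υ z v • w + υ z w • v := by
  obtain ⟨haff, c₁, hc₁, Υ, hΥs, hΥ⟩ := h
  have h0 := p.isAffineConnection _ c₀.2
  have h1 := p.isAffineConnection _ hc₁
  refine ⟨fun z => formC φ (ups c₀ ⟨c₁, hc₁⟩) z + formC φ Υ z, fun z hz => ?_, fun z hz w v => ?_⟩
  · obtain ⟨x, hxV, hx, rfl⟩ := exists_of_mem_img hz
    exact ((contDiffAt_formC hφ isOpen_univ (smooth_ups c₀ ⟨c₁, hc₁⟩) (mem_univ x) hx).add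
      (contDiffAt_formC hφ hV hΥs hxV hx)).contDiffWithinAt
  · have e1 := ProjChangeAt.chr_eq_formC hφ isOpen_univ h0 h1
      (fun x _ => projChangeAt_ups c₀ ⟨c₁, hc₁⟩ x) hz.1 (mem_univ _) w v
    have e2 := ProjChangeAt.chr_eq_formC hφ hV (h1.mono isOpen_univ hV (subset_univ V)) haff hΥ
      hz.1 hz.2 w v
    rw [e2, e1]
    simp only [add_apply, add_smul]
    abel

/-- The trace of the connection form of a scale is exact. -/
lemma IsScaleOn.exists_log (hφ : φ ∈ IsManifold.maximalAtlas (𝓡 N) ∞ M) {V : Set M}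
    (hV : IsOpen V) (hVφ : V ⊆ φ.source) {cov : RawConn N M} (hc : IsAffineConnectionOn V cov)
    (h : IsScaleOn V cov) : ∃ ℓ : Eu N → ℝ, ContDiffOn ℝ ∞ ℓ (img φ V) ∧
      ∀ z ∈ img φ V, ∀ v, fderiv ℝ ℓ z v = traceC (chr φ cov) z v := by
  obtain ⟨w, σ, hw, hσ, hpar⟩ := h
  obtain ⟨hsm, hd⟩ := hpar V (fr φ) hV subset_rfl (isFrameOn_fr hφ hVφ)
  obtain ⟨f, hf⟩ : ∃ f : M → ℝ, f = fun y => (σ y).1 (fun a => fr φ a y) := ⟨_, rfl⟩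
  rw [← hf] at hsm
  have hfx : ∀ x, (σ x).1 (fun a => fr φ a x) = f x := fun x => by rw [hf]
  have hN1 : (N : ℝ) + 1 ≠ 0 := by positivity
  have hs : ∀ x ∈ V, ContDiffAt ℝ ∞ (f ∘ φ.symm) (φ x) := fun x hx =>
    (contMDiffAt_fun_iff hφ (hVφ hx)).1 ((smoothFunOn_iff_forall hV).1 hsm x hx)
  have hne : ∀ x ∈ V, (f ∘ φ.symm) (φ x) ≠ 0 := fun x hx h0 => by
    rw [Function.comp_apply, φ.left_inv (hVφ hx)] at h0
    refine hσ x hx (Subtype.ext (funext fun e => ?_))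
    rw [weighted_apply hφ (hVφ hx) hw, hfx, h0, smul_zero]
    rfl
  have hdf : ∀ x ∈ V, ∀ v, fderiv ℝ (f ∘ φ.symm) (φ x) v =
      -(w / ((N : ℝ) + 1) * traceC (chr φ cov) (φ x) v * (f ∘ φ.symm) (φ x)) := fun x hx v => by
    have h1 := hd x hx (tgInv φ x v)
    rw [← hf, hfx, connTrace_fr hφ hV hc hV hVφ hx hx,
      mvfderiv_eq_fderiv hφ (hVφ hx) ((hs x hx).differentiableAt (by simp)),
      tg_tgInv hφ (hVφ hx)] at h1
    rw [Function.comp_apply, φ.left_inv (hVφ hx)]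
    linear_combination h1
  refine ⟨fun z => (-(w / ((N : ℝ) + 1))⁻¹) * Real.log ((f ∘ φ.symm) z), fun z hz => ?_,
    fun z hz v => ?_⟩
  · obtain ⟨x, hxV, hx, rfl⟩ := exists_of_mem_img hz
    exact (contDiffAt_const.mul ((hs x hxV).log (hne x hxV))).contDiffWithinAt
  · obtain ⟨x, hxV, hx, rfl⟩ := exists_of_mem_img hz
    have h1 := ((((hs x hxV).differentiableAt (by simp)).hasFDerivAt.log (hne x hxV)).const_mul
      (-(w / ((N : ℝ) + 1))⁻¹)).fderiv
    rw [h1]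
    simp only [smul_apply, smul_eq_mul, hdf x hxV]
    have := hne x hxV
    field_simp

lemma traceC_closed {E : Type*} [NormedAddCommGroup E] [NormedSpace ℝ E] {O : Set E}
    (hO : IsOpen O) {Γ : E → E →L[ℝ] E →L[ℝ] E} {ℓ : E → ℝ} (hℓ : ContDiffOn ℝ ∞ ℓ O)
    (hd : ∀ z ∈ O, ∀ v, fderiv ℝ ℓ z v = traceC Γ z v) {z : E} (hz : z ∈ O) (v w : E) :
    fderiv ℝ (fun y => traceC Γ y w) z v = fderiv ℝ (fun y => traceC Γ y v) z w := by
  have h1 : ∀ w, (fun y => traceC Γ y w) =ᶠ[𝓝 z] fun y => fderiv ℝ ℓ y w := fun w => by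
    filter_upwards [hO.mem_nhds hz] with y hy using (hd y hy w).symm
  have h2 : ∀ v w, fderiv ℝ (fun y => traceC Γ y w) z v = fderiv ℝ (fderiv ℝ ℓ) z v w :=
    fun v w => by
    rw [(h1 w).fderiv_eq (𝕜 := ℝ)]
    have h3 : HasFDerivAt (fun y => fderiv ℝ ℓ y w) _ z :=
      (((hℓ.contDiffAt (hO.mem_nhds hz)).fderiv_right (m := ∞)
        (by norm_cast)).differentiableAt (by simp)).hasFDerivAt.clm_apply (hasFDerivAt_const w z)
    rw [h3.fderiv]
    simp
  rw [h2, h2]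
  exact FibData.snd_fderiv_symm hO hℓ hz v w

lemma trace_eq_of_tg (hφ : φ ∈ IsManifold.maximalAtlas (𝓡 N) ∞ M) {x : M} (hx : x ∈ φ.source)
    (B : TangentSpace (𝓡 N) x →L[ℝ] TangentSpace (𝓡 N) x) (C : Eu N →L[ℝ] Eu N)
    (h : ∀ v, tg φ x (B v) = C (tg φ x v)) :
    LinearMap.trace ℝ (TangentSpace (𝓡 N) x) (B : _ →ₗ[ℝ] _) = LinearMap.trace ℝ (Eu N) C := by
  obtain ⟨g, hg, -⟩ := exists_tg_equiv hφ hx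
  have h4 : ∀ v, tg φ x v = g v := fun v => by rw [← hg]; rfl
  rw [← LinearMap.trace_conj' (B : TangentSpace (𝓡 N) x →ₗ[ℝ] TangentSpace (𝓡 N) x) g.toLinearEquiv]
  congr 1
  ext1 w
  have h5 := h (g.symm w)
  rw [h4, h4, g.apply_symm_apply] at h5
  exact h5

variable {I J K : TractorEnd p} {i j k : VField N M}

lemma coord_eq_blkI (hφ : φ ∈ IsManifold.maximalAtlas (𝓡 N) ∞ M) (c₀ : p.carrier)
    (hi : IsProjection I i) (hj : IsProjection J j) (hk : IsProjection K k) (a : Fin 3) {z : Eu N}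
    (hz : z ∈ φ.target) : blkI (endC hφ c₀ (![I, J, K] a) z) = coord φ (![i, j, k] a) z :=
  match a with
  | 0 => hi.coord_eq hφ c₀ hz
  | 1 => hj.coord_eq hφ c₀ hz
  | 2 => hk.coord_eq hφ c₀ hz

/-- The coordinate expression of an adapted scale. -/
lemma IsAdaptedScaleOn.fibData [T2Space M] (hN : 2 ≤ N)
    (hφ : φ ∈ IsManifold.maximalAtlas (𝓡 N) ∞ M) (c₀ : p.carrier)
    (hIJK : IsParallelHypercomplex I J K) (hi : IsProjection I i) (hj : IsProjection J j)
    (hk : IsProjection K k) {q : Eu N →L[ℝ] Eu n} {r : Eu n →L[ℝ] Eu N} (hqr : ∀ y, q (r y) = y)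
    (hq : ∀ a, ∀ z ∈ φ.target, q (coord φ (![i, j, k] a) z) = 0) (hNn : N = n + 3)
    {V : Set M} (hV : IsOpen V) (hVφ : V ⊆ φ.source) {cov : RawConn N M}
    (h : IsAdaptedScaleOn p i j k V cov) :
    ∃ (A : Fin 3 → Eu N → Eu N →L[ℝ] Eu N) (ι : Fin 3 → Eu N → Eu N)
      (β : Fin 3 → Eu N → Eu N →L[ℝ] ℝ), FibData (chr φ cov) (img φ V) A ι β q r ∧
      (∀ a, ∀ z ∈ img φ V, ι a z = coord φ (![i, j, k] a) z) ∧
      (∀ a, ∀ z ∈ img φ V, ∀ w, q (A a z w) = q (blkA (endC hφ c₀ (![I, J, K] a) z) w)) ∧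
      ∀ a, ∀ x ∈ V, ∀ v, tg φ x (cov (![i, j, k] a) x v) = A a (φ x) (tg φ x v) := by
  obtain ⟨hmem, hsc, htr⟩ := h
  have hc := hmem.1
  obtain ⟨υ, hυ, hυc⟩ := hmem.exists_form hφ c₀ hV
  obtain ⟨ℓ, hℓ, hℓd⟩ := hsc.exists_log hφ hV hVφ hc
  have hO := isOpen_img (φ := φ) hV
  have hΓ : ContDiffOn ℝ ∞ (chr φ cov) (img φ V) := fun z hz => by
    obtain ⟨x, hxV, hx, rfl⟩ := exists_of_mem_img hz
    exact (contDiffAt_chr hφ hV hc hxV hx).contDiffWithinAt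
  have hT := ((hIJK.parTriple hN hφ c₀).mono hO inter_subset_left).projChange
    (by simpa using hN) hΓ hυ hυc
  set T := fun a z => conjShear (υ z) (endC hφ c₀ (![I, J, K] a) z) with hTdef
  have hI : ∀ a, ∀ z ∈ img φ V, blkI (T a z) = coord φ (![i, j, k] a) z := fun a z hz => by
    rw [hTdef, blkI_conjShear, coord_eq_blkI hφ c₀ hi hj hk a hz.1]
  -- The upper right block of parallelism, `∇i_a = A_a - c_a`, in the splitting of the given scale.
  have hcov : ∀ a, ∀ x ∈ V, ∀ v, tg φ x (cov (![i, j, k] a) x v) =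
      blkA (T a (φ x)) (tg φ x v) - blkC (T a (φ x)) • tg φ x v := fun a x hxV v => by
    have hx := hVφ hxV
    have hz := map_mem_img hxV hx
    have hev : coord φ (![i, j, k] a) =ᶠ[𝓝 (φ x)] fun y => blkI (T a y) := by
      filter_upwards [hO.mem_nhds hz] with y hy using (hI a y hy).symm
    have hd : DiffFieldAt (![i, j, k] a) x := (diffFieldAt_iff hφ hx).2
      ((((contDiffOn_blkI hT a).contDiffAt (hO.mem_nhds hz)).differentiableAt
        (by simp)).congr_of_eventuallyEq hev)
    rw [tg_cov hφ hV hc hxV hx hd, hev.fderiv_eq (𝕜 := ℝ), hT.fderiv_blkI a hz, ← coord_apply _ hx,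
      ← hI a _ hz]
    abel
  have htr' : ∀ a, ∀ x ∈ V, LinearMap.trace ℝ (TangentSpace (𝓡 N) x)
      (cov (![i, j, k] a) x : _ →ₗ[ℝ] _) = 0 := fun a x hx => htr x hx _ (match a with
    | 0 => Or.inl rfl
    | 1 => Or.inr (Or.inl rfl)
    | 2 => Or.inr (Or.inr rfl))
  -- The divergence is `tr A_a - N c_a = -(N + 1) c_a` by `trace_blkA`; adaptedness therefore means
  -- `c_a = 0`.
  have hC : ∀ a, ∀ z ∈ img φ V, blkC (T a z) = 0 := fun a z hz => by
    have hz' := hz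
    obtain ⟨x, hxV, hx, rfl⟩ := exists_of_mem_img hz
    have h1 := trace_eq_of_tg hφ hx (cov (![i, j, k] a) x)
      (blkA (T a (φ x)) - blkC (T a (φ x)) • .id ℝ (Eu N)) (hcov a x hxV)
    rw [htr' a x hxV] at h1
    have h2 : ((blkA (T a (φ x)) - blkC (T a (φ x)) • .id ℝ (Eu N) : Eu N →L[ℝ] Eu N) :
        Eu N →ₗ[ℝ] Eu N) = (blkA (T a (φ x)) : Eu N →ₗ[ℝ] Eu N) -
          blkC (T a (φ x)) • LinearMap.id := rfl
    rw [h2, map_sub, map_smul, LinearMap.trace_id, hT.trace_blkA a hz', finrank_euclideanSpace_fin,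
      smul_eq_mul] at h1
    have h3 : blkC (T a (φ x)) * ((N : ℝ) + 1) = 0 := by linear_combination h1
    exact (mul_eq_zero.1 h3).resolve_right (by positivity)
  -- A scale has an exact connection trace, hence a symmetric Ricci form.
  have hP : ∀ z ∈ img φ V, ∀ v w, schC (chr φ cov) z v w = schC (chr φ cov) z w v :=
    fun z hz => schC_symm_of_ricC (ricC_symm hO hΓ hT.symm hz
      (fun v w => traceC_closed hO hℓ hℓd hz v w))
  have hA := hT.adData hC hP
  refine ⟨_, _, _, ⟨hA, hqr, fun a z hz => ?_, by simp [hNn]⟩, hI, fun a z hz w => ?_,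
    fun a x hx v => ?_⟩
  · rw [hI a z hz, hq a z hz.1]
  -- The change of splitting adds a multiple of `i_a` to `A_a`, which `q` kills. So `q ∘ A_a` does
  -- not depend on the scale.
  · rw [hTdef, blkA_conjShear, map_add, map_smul, coord_eq_blkI hφ c₀ hi hj hk a hz.1, hq a z hz.1,
      smul_zero, add_zero]
  · rw [hcov a x hx, hC a _ (map_mem_img hx (hVφ hx)), zero_smul, sub_zero]

end

/-! ### Existence of adapted scales -/

section

/-! ### An invariant volume -/

section Volume

variable {E F : Type*} [NormedAddCommGroup E] [NormedSpace ℝ E] [NormedAddCommGroup F]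
  [NormedSpace ℝ F]

/-- The linear map `(s, y) ↦ ∑ s_a i_a + r y`. -/
def splitMap (i : Fin 3 → E → E) (r : F →L[ℝ] E) (z : E) : (Fin 3 → ℝ) × F →L[ℝ] E :=
  (∑ a, ((ContinuousLinearMap.proj (R := ℝ) (φ := fun _ : Fin 3 => ℝ) a) ∘L
    ContinuousLinearMap.fst ℝ _ F).smulRight (i a z)) + r ∘L ContinuousLinearMap.snd ℝ _ F

lemma splitMap_apply (i : Fin 3 → E → E) (r : F →L[ℝ] E) (z : E) (c : (Fin 3 → ℝ) × F) :
    splitMap i r z c = ∑ a, c.1 a • i a z + r c.2 := by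
  simp [splitMap]

lemma contDiffAt_splitMap {i : Fin 3 → E → E} {r : F →L[ℝ] E} {z : E}
    (hi : ∀ a, ContDiffAt ℝ ∞ (i a) z) (c : (Fin 3 → ℝ) × F) :
    ContDiffAt ℝ ∞ (fun z => splitMap i r z c) z := by
  have h1 : ∀ a, ContDiffAt ℝ ∞ (fun z => c.1 a • i a z) z := fun a => contDiffAt_const.smul (hi a)
  have h2 : ContDiffAt ℝ ∞ (fun z => ∑ a, c.1 a • i a z) z := ContDiffAt.sum fun a _ => h1 a
  have h3 := h2.add (contDiffAt_const (c := r c.2))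
  exact h3.congr_of_eventuallyEq (Filter.Eventually.of_forall fun z => splitMap_apply i r z c)

lemma fderiv_splitMap {i : Fin 3 → E → E} {r : F →L[ℝ] E} {z : E}
    (hi : ∀ a, HasFDerivAt (i a) (fderiv ℝ (i a) z) z) (c : (Fin 3 → ℝ) × F) (v : E) :
    fderiv ℝ (fun z => splitMap i r z c) z v = ∑ a, c.1 a • fderiv ℝ (i a) z v := by
  have h1 : HasFDerivAt (fun z => ∑ a, c.1 a • i a z) (∑ a, c.1 a • fderiv ℝ (i a) z) z :=
    HasFDerivAt.fun_sum fun a _ => (hi a).const_smul (c.1 a)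
  have h2 := (h1.add_const (r c.2)).congr_of_eventuallyEq
    (Filter.Eventually.of_forall fun z => splitMap_apply i r z c)
  rw [h2.fderiv, sum_apply]
  rfl

variable [FiniteDimensional ℝ E] [FiniteDimensional ℝ F]

/-- The fields `i_a` and the complement `range r` of `ker q` together form a splitting of `E`; it is
injective by independence and bijective by dimension. -/
lemma exists_splitEquiv {i : Fin 3 → E → E} {q : E →L[ℝ] F} {r : F →L[ℝ] E} {z : E}
    (hqr : ∀ y, q (r y) = y) (hq : ∀ a, q (i a z) = 0)
    (hli : LinearIndependent ℝ (fun a => i a z)) (hdim : finrank ℝ E = finrank ℝ F + 3) :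
    ∃ Φ : ((Fin 3 → ℝ) × F) ≃ₗ[ℝ] E, (∀ c, Φ c = ∑ a, c.1 a • i a z + r c.2) ∧
      (∀ b, Φ.symm (i b z) = (Pi.single b 1, 0)) ∧
      ∀ w, q w = 0 → w = ∑ a, (Φ.symm w).1 a • i a z := by
  have hinj : Function.Injective (splitMap i r z : (Fin 3 → ℝ) × F →ₗ[ℝ] E) := by
    rw [← LinearMap.ker_eq_bot, LinearMap.ker_eq_bot']
    intro c hc
    have hc' : ∑ a, c.1 a • i a z + r c.2 = 0 := (splitMap_apply i r z c).symm.trans hc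
    have h2 : c.2 = 0 := by
      have h := congrArg q hc'
      simpa [hqr, hq] using h
    rw [h2, map_zero, add_zero] at hc'
    exact Prod.ext (funext fun a => Fintype.linearIndependent_iff.1 hli c.1 hc' a) h2
  have hd : finrank ℝ ((Fin 3 → ℝ) × F) = finrank ℝ E := by
    rw [finrank_prod, finrank_fin_fun, hdim, add_comm]
  let Φ := LinearEquiv.ofInjectiveOfFinrankEq _ hinj hd
  have hΦ : ∀ c, Φ c = ∑ a, c.1 a • i a z + r c.2 := fun c => splitMap_apply i r z c
  refine ⟨Φ, hΦ, fun b => ?_, fun w hw => ?_⟩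
  · rw [LinearEquiv.symm_apply_eq, hΦ]
    simp [Pi.single_apply]
  · have h1 : w = ∑ a, (Φ.symm w).1 a • i a z + r (Φ.symm w).2 := by
      rw [← hΦ, Φ.apply_symm_apply]
    have h2 : (Φ.symm w).2 = 0 := by
      have h := congrArg q h1
      rw [hw] at h
      simpa [hqr, hq] using h.symm
    rw [h2, map_zero, add_zero] at h1
    exact h1

lemma trace_sum_smulRight (μ : Fin 3 → E →ₗ[ℝ] ℝ) (x : Fin 3 → E) :
    LinearMap.trace ℝ E (∑ a, (μ a).smulRight (x a)) = ∑ a, μ a (x a) := by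
  rw [map_sum]
  exact Finset.sum_congr rfl fun a _ => LinearMap.trace_smulRight ..

/-- The density dual to three fields that span the fibres of a projection and are closed under
brackets. -/
lemma exists_invariant_volume {N : ℕ} {i : Fin 3 → Eu N → Eu N} {q : Eu N →L[ℝ] F}
    {r : F →L[ℝ] Eu N} {O : Set (Eu N)} (hO : IsOpen O) (hi : ∀ a, ContDiffOn ℝ ∞ (i a) O)
    (hqr : ∀ y, q (r y) = y) (hq : ∀ a, ∀ z ∈ O, q (i a z) = 0)
    (hli : ∀ z ∈ O, LinearIndependent ℝ (fun a => i a z))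
    (hdim : finrank ℝ (Eu N) = finrank ℝ F + 3)
    (hbr : ∀ a, ∀ z ∈ O, fderiv ℝ (i (a + 1)) z (i a z) - fderiv ℝ (i a) z (i (a + 1) z) =
      (-2 : ℝ) • i (a + 2) z) {z₀ : Eu N} (hz₀ : z₀ ∈ O) :
    ∃ D : Eu N → ℝ, ContDiffOn ℝ ∞ D O ∧ (∀ z ∈ O, D z ≠ 0) ∧ ∀ z ∈ O, ∀ a,
      fderiv ℝ D z (i a z) = LinearMap.trace ℝ (Eu N) (fderiv ℝ (i a) z : _ →ₗ[ℝ] _) * D z := by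
  -- A fixed identification of `(Fin 3 → ℝ) × F` with the model space. It only serves to index by
  -- `Fin N` the frame consisting of the `i_a` and the constant fields `r y`.
  obtain ⟨Φ₀, -⟩ := exists_splitEquiv hqr (fun a => hq a z₀ hz₀) (hli z₀ hz₀) hdim
  have hsm : ∀ b z, z ∈ O → ContDiffAt ℝ ∞ (fun z => splitMap i r z (Φ₀.symm (sb b))) z :=
    fun b z hz => contDiffAt_splitMap (fun a => (hi a).contDiffAt (hO.mem_nhds hz)) _
  have hbasis : ∀ z ∈ O, ∃ (Φ : ((Fin 3 → ℝ) × F) ≃ₗ[ℝ] Eu N) (B : Basis (Fin N) ℝ (Eu N)),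
      (∀ b, B b = splitMap i r z (Φ₀.symm (sb b))) ∧ (∀ c, Φ c = splitMap i r z c) ∧
      (∀ b, Φ.symm (i b z) = (Pi.single b 1, 0)) ∧
      ∀ w, q w = 0 → w = ∑ a, (Φ.symm w).1 a • i a z := fun z hz => by
    obtain ⟨Φ, h1, h2, h3⟩ := exists_splitEquiv hqr (fun a => hq a z hz) (hli z hz) hdim
    refine ⟨Φ, (stdB N).map (Φ₀.symm.trans Φ), fun b => ?_, fun c => ?_, h2, h3⟩
    · rw [Basis.map_apply, splitMap_apply, ← h1]
      simp
    · rw [h1, splitMap_apply]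
  refine ⟨fun z => volF N (fun b => splitMap i r z (Φ₀.symm (sb b))), fun z hz => ?_,
    fun z hz => ?_, fun z hz c => ?_⟩
  · exact (contDiff_volF.contDiffAt.comp z
      (contDiffAt_pi.2 fun b => hsm b z hz)).contDiffWithinAt
  · obtain ⟨Φ, B, hB, -⟩ := hbasis z hz
    rw [volF_ne_zero_iff]
    have h : (fun b => splitMap i r z (Φ₀.symm (sb b))) = B := funext fun b => (hB b).symm
    rw [h]
    exact B.linearIndependent
  · obtain ⟨Φ, B, hB, hΦ, hΦi, hker⟩ := hbasis z hz
    obtain ⟨L, hL, hLv⟩ := hasFDerivAt_volF (fun b => ((hsm b z hz).differentiableAt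
      (by simp)).hasFDerivAt) B hB
    rw [hL.fderiv, hLv]
    congr 1
    have di : ∀ a, HasFDerivAt (i a) (fderiv ℝ (i a) z) z := fun a =>
      (((hi a).contDiffAt (hO.mem_nhds hz)).differentiableAt (by simp)).hasFDerivAt
    let μ : Fin 3 → Eu N →ₗ[ℝ] ℝ := fun a =>
      LinearMap.proj a ∘ₗ LinearMap.fst ℝ (Fin 3 → ℝ) F ∘ₗ (Φ.symm : Eu N →ₗ[ℝ] _)
    have hμ : ∀ a b, μ a (i b z) = if a = b then 1 else 0 := fun a b => by
      change (Φ.symm (i b z)).1 a = _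
      rw [hΦi]
      exact Pi.single_apply ..
    -- Only the `i_a` in the frame vary, so the derivative of the frame along `i_c` is given by an
    -- endomorphism with trace `∑ μ_a (D i_a (i_c))`.
    have e1 : ∀ b, fderiv ℝ (fun z => splitMap i r z (Φ₀.symm (sb b))) z (i c z) =
        (∑ a, (μ a).smulRight (fderiv ℝ (i a) z (i c z))) (B b) := fun b => by
      rw [fderiv_splitMap di, LinearMap.sum_apply]
      refine Finset.sum_congr rfl fun a _ => ?_
      have h2 : μ a (B b) = (Φ₀.symm (sb b)).1 a := by
        change (Φ.symm (B b)).1 a = _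
        rw [hB, ← hΦ, Φ.symm_apply_apply]
      rw [LinearMap.smulRight_apply, h2]
    -- `D i_c` takes values in `ker q`, so its trace is `∑ μ_a (D i_c (i_a))`.
    have e2 : (fderiv ℝ (i c) z : Eu N →ₗ[ℝ] Eu N) =
        ∑ a, (μ a ∘ₗ (fderiv ℝ (i c) z : Eu N →ₗ[ℝ] Eu N)).smulRight (i a z) := by
      ext1 w
      have h1 : q (fderiv ℝ (i c) z w) = 0 := by
        have h2 := (q.hasFDerivAt (x := i c z)).comp z (di c)
        have h3 : HasFDerivAt (q ∘ i c) (0 : Eu N →L[ℝ] F) z :=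
          (hasFDerivAt_const (0 : F) z).congr_of_eventuallyEq (by
            filter_upwards [hO.mem_nhds hz] with y hy using hq c y hy)
        exact congrArg (fun L => L w) (h2.unique h3)
      rw [LinearMap.sum_apply]
      exact hker _ h1
    rw [Finset.sum_congr rfl fun b _ => congrArg (B.coord b) (e1 b), ← trace_eq_sum_coord B,
      trace_sum_smulRight, e2, trace_sum_smulRight, ← sub_eq_zero, ← Finset.sum_sub_distrib,
      FibData.fin3_sum _ c]
    -- The difference of the two traces is the trace of the bracket with `i_c` on the span of the
    -- fields. It vanishes because no bracket `[i_c, i_a]` has a component along `i_a`.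
    have e3 : ∀ a, μ a (fderiv ℝ (i a) z (i c z)) -
        (μ a ∘ₗ (fderiv ℝ (i c) z : Eu N →ₗ[ℝ] Eu N)) (i a z) =
        μ a (fderiv ℝ (i a) z (i c z) - fderiv ℝ (i c) z (i a z)) := fun a => by
      rw [map_sub]
      rfl
    have h2 := hbr (c + 2) z hz
    have h5 : c + 2 + 1 = c := by fin_cases c <;> rfl
    have h6 : c + 2 + 2 = c + 1 := by fin_cases c <;> rfl
    have h7 : c + 1 ≠ c + 2 := by fin_cases c <;> decide
    rw [h5, h6] at h2
    rw [e3, e3, e3, hbr c z hz, ← neg_sub (fderiv ℝ (i c) z (i (c + 2) z)), h2, sub_self, map_zero,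
      map_neg, map_smul, map_smul, hμ, hμ, if_neg h7, if_neg h7.symm]
    simp

end Volume

/-! ### Existence of adapted scales -/

section Existence

variable {E : Type*} [NormedAddCommGroup E] [NormedSpace ℝ E]

/-- The difference of two projectively equivalent connections. -/
def projDiff (E : Type*) [NormedAddCommGroup E] [NormedSpace ℝ E] :
    (E →L[ℝ] ℝ) →L[ℝ] E →L[ℝ] E →L[ℝ] E :=
  ContinuousLinearMap.smulRightL ℝ E E +
    (ContinuousLinearMap.smulRightL ℝ E (E →L[ℝ] E)).flip (.id ℝ E)

lemma projDiff_apply (υ : E →L[ℝ] ℝ) (w v : E) : projDiff E υ w v = υ v • w + υ w • v := by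
  have h1 : projDiff E υ w v = ContinuousLinearMap.smulRightL ℝ E E υ w v +
    ContinuousLinearMap.smulRightL ℝ E (E →L[ℝ] E) υ (.id ℝ E) w v := rfl
  rw [h1]
  simp

variable {N n : ℕ} {M : Type u} [TopologicalSpace M] [ChartedSpace (EuclideanSpace ℝ (Fin N)) M]
  [IsManifold (𝓡 N) ∞ M] {φ : OpenPartialHomeomorph M (Eu N)} {p : ProjectiveStructure N M}

lemma chr_connOf (hφ : φ ∈ IsManifold.maximalAtlas (𝓡 N) ∞ M) {U : Set M}
    (hU : IsOpen U) {Γ : Eu N → Eu N →L[ℝ] Eu N →L[ℝ] Eu N}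
    (h : IsAffineConnectionOn U (connOf φ Γ)) {x : M} (hxU : x ∈ U) (hx : x ∈ φ.source) :
    chr φ (connOf φ Γ) (φ x) = Γ (φ x) := by
  ext1 w
  ext1 v
  have h1 := tg_cov_cfield hφ hU h hxU hx w (tgInv φ x v)
  rw [tg_connOf hφ Γ _ hx, fderiv_coord_cfield hφ w (φ.map_source hx), zero_apply, zero_add,
    tg_cfield hφ w hx, tg_tgInv hφ hx] at h1
  exact h1.symm

/-- The trace form of a connection with values in a fixed vector space. -/
def traceForm [FiniteDimensional ℝ E] (Γ : E →L[ℝ] E →L[ℝ] E) : E →L[ℝ] ℝ := FibData.traceL E ∘L Γ.flip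

lemma contDiffAt_traceForm [FiniteDimensional ℝ E] {Γ : E → E →L[ℝ] E →L[ℝ] E} {z : E}
    (hΓ : ContDiffAt ℝ ∞ Γ z) : ContDiffAt ℝ ∞ (fun z => traceForm (Γ z)) z := by
  refine contDiffAt_clm_iff.2 fun v => ?_
  have h1 : ContDiffAt ℝ ∞ (fun z => (Γ z).flip v) z := contDiffAt_clm_iff.2 fun w =>
    (hΓ.clm_apply contDiffAt_const).clm_apply contDiffAt_const
  exact (FibData.traceL E).contDiff.contDiffAt.comp z h1

/-- A projective change adds `(N + 1) υ` to the connection trace, so `υ` is found by solving `tr Γ +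
(N + 1) υ = -dD / D`. -/
lemma exists_proj_change_trace {O : Set (Eu N)} (hO : IsOpen O)
    {Γ : Eu N → Eu N →L[ℝ] Eu N →L[ℝ] Eu N} (hΓ : ContDiffOn ℝ ∞ Γ O) {D : Eu N → ℝ}
    (hD : ContDiffOn ℝ ∞ D O) (hD0 : ∀ z ∈ O, D z ≠ 0) :
    ∃ υ : Eu N → Eu N →L[ℝ] ℝ, ContDiffOn ℝ ∞ υ O ∧ ∀ z ∈ O, ∀ v,
      traceC (fun y => Γ y + projDiff (Eu N) (υ y)) z v * D z = -fderiv ℝ D z v := by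
  obtain ⟨υ, hυ⟩ : ∃ υ : Eu N → Eu N →L[ℝ] ℝ, ∀ z, υ z = (-((N : ℝ) + 1)⁻¹ * (D z)⁻¹) •
    fderiv ℝ D z + (-((N : ℝ) + 1)⁻¹) • traceForm (Γ z) := ⟨_, fun z => rfl⟩
  have hυa : ∀ z v, υ z v = -((N : ℝ) + 1)⁻¹ * (D z)⁻¹ * fderiv ℝ D z v +
      -((N : ℝ) + 1)⁻¹ * traceC Γ z v := fun z v => by
    have h1 : traceForm (Γ z) v = traceC Γ z v := rfl
    rw [hυ, add_apply, smul_apply, smul_apply, h1, smul_eq_mul, smul_eq_mul]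
  refine ⟨υ, fun z hz => ContDiffAt.contDiffWithinAt ?_, fun z hz v => ?_⟩
  · have hDz := hD.contDiffAt (hO.mem_nhds hz)
    have h1 : ContDiffAt ℝ ∞ (fderiv ℝ D) z := hDz.fderiv_right (by norm_cast)
    have h2 := contDiffAt_traceForm (hΓ.contDiffAt (hO.mem_nhds hz))
    have h3 : ContDiffAt ℝ ∞ (fun z => -((N : ℝ) + 1)⁻¹ * (D z)⁻¹) z :=
      contDiffAt_const.mul (hDz.inv (hD0 z hz))
    have h4 : ContDiffAt ℝ ∞ (fun z => (-((N : ℝ) + 1)⁻¹ * (D z)⁻¹) • fderiv ℝ D z +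
        (-((N : ℝ) + 1)⁻¹) • traceForm (Γ z)) z := (h3.smul h1).add (h2.const_smul (-((N : ℝ) + 1)⁻¹))
    exact h4.congr_of_eventuallyEq (Filter.Eventually.of_forall hυ)
  · have h1 := traceC_projChange (Γ := Γ) (Γ' := fun y => Γ y + projDiff (Eu N) (υ y)) (z := z)
      (υ := υ z) (fun w v => by rw [add_apply, add_apply, projDiff_apply, add_assoc]) v
    have hN1 : (N : ℝ) + 1 ≠ 0 := by positivity
    have hDz := hD0 z hz
    rw [h1, finrank_euclideanSpace_fin, hυa]
    field_simp
    ring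

/-- A connection whose trace is the logarithmic derivative of a function is a scale. -/
lemma isScaleOn_of_trace (hφ : φ ∈ IsManifold.maximalAtlas (𝓡 N) ∞ M) {cov : RawConn N M}
    (hc : IsAffineConnectionOn φ.source cov) {D : Eu N → ℝ} (hD : ContDiffOn ℝ ∞ D φ.target)
    (hD0 : ∀ z ∈ φ.target, D z ≠ 0)
    (htr : ∀ z ∈ φ.target, ∀ v, traceC (chr φ cov) z v * D z = -fderiv ℝ D z v) :
    IsScaleOn φ.source cov := by
  classical
  have hw : (N : ℝ) + 1 ≠ 0 := by positivity
  -- The weight `N + 1` makes the density exponent `-1`, and `D` is the coefficient of `σ` in the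
  -- coordinate frame.
  let σ : (x : M) → weighted N ((N : ℝ) + 1) (TangentSpace (𝓡 N) x) ℝ := fun x =>
    if hx : x ∈ φ.source then wElt hφ hx hw (D (φ x)) else 0
  have hσ : ∀ x, x ∈ φ.source → ∀ e, (σ x).1 e =
      dens φ x e ^ (-((N : ℝ) + 1) / ((N : ℝ) + 1)) * D (φ x) := fun x hx e => by
    have h : σ x = wElt hφ hx hw (D (φ x)) := dif_pos hx
    rw [h]
    rfl
  refine ⟨(N : ℝ) + 1, σ, hw, fun x hx h0 => ?_, fun V e hV hVφ he => ?_⟩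
  · have h1 := hσ x hx (fun a => fr φ a x)
    rw [h0, dens_fr hφ hx, Real.one_rpow, one_mul] at h1
    exact hD0 _ (φ.map_source hx) h1.symm
  · have key : ∀ x ∈ V, ContDiffAt ℝ ∞ ((fun y => (σ y).1 (fun a => e a y)) ∘ φ.symm) (φ x) ∧
        ∀ (hx : x ∈ V) (v : TangentSpace (𝓡 N) x),
          fderiv ℝ ((fun y => (σ y).1 (fun a => e a y)) ∘ φ.symm) (φ x) (tg φ x v) +
            ((N : ℝ) + 1) / ((N : ℝ) + 1) * connTrace cov he hx v *
              (σ x).1 (fun a => e a x) = 0 := by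
      intro x hx
      have hxφ := hVφ hx
      have hz := φ.map_source hxφ
      obtain ⟨h1, L, hL, hLv⟩ := hasFDerivAt_dens_rpow hφ φ.open_source hc hV he hx hxφ hxφ
        (-((N : ℝ) + 1) / ((N : ℝ) + 1))
      have hDz := hD.contDiffAt (φ.open_target.mem_nhds hz)
      have hev : ((fun y => (σ y).1 (fun a => e a y)) ∘ φ.symm) =ᶠ[𝓝 (φ x)] fun z =>
          dens φ (φ.symm z) (fun a => e a (φ.symm z)) ^ (-((N : ℝ) + 1) / ((N : ℝ) + 1)) * D z := by
        filter_upwards [φ.open_target.mem_nhds hz] with z hz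
        rw [Function.comp_apply, hσ _ (φ.map_target hz), φ.right_inv hz]
      refine ⟨(h1.mul hDz).congr_of_eventuallyEq hev, fun hx v => ?_⟩
      have hd := (hL.mul (hDz.differentiableAt (by simp)).hasFDerivAt).congr_of_eventuallyEq hev
      have hδ : ∀ y, y = x → dens φ y (fun a => e a y) = dens φ x (fun a => e a x) := by
        rintro y rfl
        rfl
      have h3 := htr _ hz (tg φ x v)
      rw [hd.fderiv, hσ x hxφ, add_apply, smul_apply, smul_apply, hLv, hδ _ (φ.left_inv hxφ),
        smul_eq_mul, smul_eq_mul, neg_div, div_self hw]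
      linear_combination (dens φ x (fun a => e a x) ^ (-1 : ℝ)) * h3
    refine ⟨(smoothFunOn_iff_forall hV).2 fun x hx => (contMDiffAt_fun_iff hφ (hVφ hx)).2
      (key x hx).1, fun x hx v => ?_⟩
    rw [mvfderiv_eq_fderiv hφ (hVφ hx) ((key x hx).1.differentiableAt (by simp))]
    exact (key x hx).2 hx v

variable {I J K : TractorEnd p} {i j k : VField N M}

/-- The divergence of `i_a` is the trace of its coordinate derivative plus the connection trace on
`i_a`. The first is `dD(i_a) / D` by invariance of the volume, the second is `-dD(i_a) / D` by the
choice of the projective change. -/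
lemma exists_isAdaptedScaleOn [T2Space M] (hN : 2 ≤ N)
    (hφ : φ ∈ IsManifold.maximalAtlas (𝓡 N) ∞ M) (c₀ : p.carrier)
    (hIJK : IsParallelHypercomplex I J K) (hi : IsProjection I i) (hj : IsProjection J j)
    (hk : IsProjection K k) {q : Eu N →L[ℝ] Eu n} {r : Eu n →L[ℝ] Eu N} (hqr : ∀ y, q (r y) = y)
    (hq : ∀ a, ∀ z ∈ φ.target, q (coord φ (![i, j, k] a) z) = 0) (hNn : N = n + 3)
    (hne : φ.target.Nonempty) : ∃ cov, IsAdaptedScaleOn p i j k φ.source cov := by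
  have hT := hIJK.parTriple hN hφ c₀
  have hI := coord_eq_blkI hφ c₀ hi hj hk
  set T := fun a => endC hφ c₀ (![I, J, K] a) with hTdef
  obtain ⟨z₀, hz₀⟩ := hne
  have hO := φ.open_target
  obtain ⟨D, hD, hD0, hDi⟩ := exists_invariant_volume (i := fun a z => blkI (T a z)) (q := q)
    hO (contDiffOn_blkI hT) hqr (fun a z hz => by rw [hTdef, hI a hz, hq a z hz])
    (fun z hz => hT.linearIndependent hz) (by simp [hNn]) (fun a z hz => hT.bracket a hz) hz₀
  have hΓ := hT.contDiffOn_conn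
  obtain ⟨υ, hυ, hυt⟩ := exists_proj_change_trace hO hΓ hD hD0
  have h0 := p.isAffineConnection _ c₀.2
  set Γ' := fun y => chr φ c₀.1 y + projDiff (Eu N) (υ y) with hΓ'def
  have hΓ's : ∀ z, ∀ w v, Γ' z w v = chr φ c₀.1 z w v + υ z v • w + υ z w • v := fun z w v => by
    rw [hΓ'def, add_apply, add_apply, projDiff_apply, add_assoc]
  have hΓ' : ContDiffOn ℝ ∞ Γ' φ.target := fun z hz => by
    have hυz := hυ.contDiffAt (hO.mem_nhds hz)
    refine (contDiffAt_clm_iff.2 fun w => contDiffAt_clm_iff.2 fun v => ?_).contDiffWithinAt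
    simp only [hΓ's]
    exact ((((hΓ.contDiffAt (hO.mem_nhds hz)).clm_apply contDiffAt_const).clm_apply
      contDiffAt_const).add ((hυz.clm_apply contDiffAt_const).smul contDiffAt_const)).add
      ((hυz.clm_apply contDiffAt_const).smul contDiffAt_const)
  have hc : IsAffineConnectionOn φ.source (connOf φ Γ') :=
    isAffineConnectionOn_connOf hφ φ.open_source subset_rfl
      (fun x hx => hΓ'.contDiffAt (hO.mem_nhds (φ.map_source hx)))
      (fun x hx v w => by
        rw [hΓ's, hΓ's, hT.symm _ (φ.map_source hx) v w]
        abel)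
  have hchr : ∀ z ∈ φ.target, chr φ (connOf φ Γ') z = Γ' z := fun z hz => by
    have h := chr_connOf hφ φ.open_source hc (φ.map_target hz) (φ.map_target hz)
    rwa [φ.right_inv hz] at h
  have htrC : ∀ z ∈ φ.target, ∀ v, traceC (chr φ (connOf φ Γ')) z v * D z = -fderiv ℝ D z v :=
    fun z hz v => by
    rw [traceC, hchr z hz]
    exact hυt z hz v
  refine ⟨connOf φ Γ', ⟨hc, c₀.1, c₀.2, fun x => υ (φ x) ∘L tg φ x, fun Y hY => ?_, fun x hx => ?_⟩,
    isScaleOn_of_trace hφ hc hD hD0 htrC, fun x hx ξ hξ => ?_⟩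
  · rw [smoothFunOn_iff_forall φ.open_source]
    intro x hx
    rw [contMDiffAt_fun_iff hφ hx]
    have h1 := hY.contDiffAt_coord hφ φ.open_source hx hx
    refine ((hυ.contDiffAt (hO.mem_nhds (φ.map_source hx))).clm_apply h1).congr_of_eventuallyEq ?_
    filter_upwards [hO.mem_nhds (φ.map_source hx)] with z hz
    change υ (φ (φ.symm z)) (tg φ _ _) = _
    rw [φ.right_inv hz]
    rfl
  · exact projChangeAt_of_chr hφ φ.open_source (h0.mono isOpen_univ φ.open_source (subset_univ _))
      hc hx hx (fun w v => by rw [hchr _ (φ.map_source hx), hΓ's])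
  · obtain ⟨a, rfl⟩ : ∃ a, ξ = ![i, j, k] a := by
      rcases hξ with rfl | rfl | rfl
      exacts [⟨0, rfl⟩, ⟨1, rfl⟩, ⟨2, rfl⟩]
    have hz := φ.map_source hx
    have hev : coord φ (![i, j, k] a) =ᶠ[𝓝 (φ x)] fun y => blkI (T a y) := by
      filter_upwards [hO.mem_nhds hz] with y hy using (hI a hy).symm
    have hd : DiffFieldAt (![i, j, k] a) x := (diffFieldAt_iff hφ hx).2
      ((((contDiffOn_blkI hT a).contDiffAt (hO.mem_nhds hz)).differentiableAt
        (by simp)).congr_of_eventuallyEq hev)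
    have h1 := trace_eq_of_tg hφ hx (connOf φ Γ' (![i, j, k] a) x)
      (fderiv ℝ (fun y => blkI (T a y)) (φ x) + Γ' (φ x) (blkI (T a (φ x)))) (fun v => by
        rw [tg_cov hφ φ.open_source hc hx hx hd, hev.fderiv_eq (𝕜 := ℝ), hchr _ hz, hI a hz,
          coord_apply _ hx]
        rfl)
    have h2 : ((fderiv ℝ (fun y => blkI (T a y)) (φ x) + Γ' (φ x) (blkI (T a (φ x))) :
        Eu N →L[ℝ] Eu N) : Eu N →ₗ[ℝ] Eu N) =
        (fderiv ℝ (fun y => blkI (T a y)) (φ x) : Eu N →ₗ[ℝ] Eu N) +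
          ((Γ' (φ x)).flip (blkI (T a (φ x))) : Eu N →ₗ[ℝ] Eu N) := by
      ext1 v
      change _ + Γ' (φ x) (blkI (T a (φ x))) v = _ + Γ' (φ x) v (blkI (T a (φ x)))
      rw [hΓ's, hΓ's, hT.symm _ hz v]
      congr 1
      abel
    rw [h1, h2, map_add]
    have h3 := hDi _ hz a
    have h4 := hυt _ hz (blkI (T a (φ x)))
    change LinearMap.trace ℝ (Eu N) ((Γ' (φ x)).flip _ : Eu N →ₗ[ℝ] Eu N) * D (φ x) = _ at h4
    refine (mul_eq_zero.1 ?_).resolve_right (hD0 _ hz)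
    rw [add_mul, h4, h3, add_neg_cancel]

end Existence

end

/-! ### The leaves as fibres of a linear projection -/

section

variable {N n : ℕ} {M : Type u} [TopologicalSpace M] [ChartedSpace (EuclideanSpace ℝ (Fin N)) M]
  [IsManifold (𝓡 N) ∞ M] {φ : OpenPartialHomeomorph M (Eu N)} {i j k : VField N M}
  {q : Eu N →L[ℝ] Eu n} {r : Eu n →L[ℝ] Eu N}

/-! ### The leaf space in a Frobenius chart -/

/-- A chart with convex target in which the leaves of the distribution are the fibres of a linear
projection. -/
structure IsLeafChart (i j k : VField N M) (φ : OpenPartialHomeomorph M (Eu N))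
    (q : Eu N →L[ℝ] Eu n) (r : Eu n →L[ℝ] Eu N) : Prop where
  mem_atlas : φ ∈ IsManifold.maximalAtlas (𝓡 N) ∞ M
  convex : Convex ℝ φ.target
  q_r : ∀ y, q (r y) = y
  q_i : ∀ a, ∀ z ∈ φ.target, q (coord φ (![i, j, k] a) z) = 0
  linearIndependent : ∀ z ∈ φ.target, LinearIndependent ℝ (fun a => coord φ (![i, j, k] a) z)
  dim_eq : N = n + 3

namespace IsLeafChart

/-- `D` is contained in the kernel of `q ∘ dφ`, and both have dimension 3. -/
lemma mem_distrib_iff (h : IsLeafChart i j k φ q r) {x : M} (hx : x ∈ φ.source)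
    (v : TangentSpace (𝓡 N) x) : v ∈ distrib i j k x ↔ q (tg φ x v) = 0 := by
  have hz := φ.map_source hx
  constructor
  · intro hv
    have hle : distrib i j k x ≤
        LinearMap.ker ((q ∘L tg φ x : TangentSpace (𝓡 N) x →L[ℝ] Eu n) : _ →ₗ[ℝ] Eu n) := by
      refine Submodule.span_le.2 ?_
      have h1 : ∀ a, q (tg φ x (![i, j, k] a x)) = 0 := fun a => by
        rw [← coord_apply _ hx, h.q_i a _ hz]
      rintro w (rfl | rfl | rfl)
      exacts [h1 0, h1 1, h1 2]
    exact hle hv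
  · intro hv
    obtain ⟨Φ, -, -, h3⟩ := exists_splitEquiv (i := fun a z => coord φ (![i, j, k] a) z) (r := r)
      h.q_r (fun a => h.q_i a _ hz) (h.linearIndependent _ hz) (by simp [h.dim_eq])
    have h4 := h3 _ hv
    set s := (Φ.symm (tg φ x v)).1
    have h5 : v = ∑ a, s a • (![i, j, k] a x) := by
      refine clm_ext_tg h.mem_atlas hx (h4.trans ?_)
      refine Eq.trans ?_ (map_sum (tg φ x) _ _).symm
      exact Finset.sum_congr rfl fun a _ => by rw [(tg φ x).map_smul, ← coord_apply _ hx]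
    rw [h5]
    refine Submodule.sum_mem _ fun a _ => Submodule.smul_mem _ _ (Submodule.subset_span ?_)
    exact match a with
    | 0 => Or.inl rfl
    | 1 => Or.inr (Or.inl rfl)
    | 2 => Or.inr (Or.inr rfl)

lemma hasDerivAt_chart_curve (hφ : φ ∈ IsManifold.maximalAtlas (𝓡 N) ∞ M) {γ : ℝ → M}
    (hγ : ContMDiff 𝓘(ℝ, ℝ) (𝓡 N) ∞ γ) {s : ℝ} (hs : γ s ∈ φ.source) :
    HasDerivAt (fun s => φ (γ s)) (tg φ (γ s) (mfderiv 𝓘(ℝ, ℝ) (𝓡 N) γ s (1 : ℝ))) s := by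
  have d1 : MDifferentiableAt 𝓘(ℝ, ℝ) (𝓡 N) γ s := hγ.mdifferentiableAt (by simp)
  have d2 := (mdifferentiable_chart' hφ).mdifferentiableAt hs
  obtain ⟨L, hL⟩ : ∃ L : ℝ →L[ℝ] Eu N,
      L = (tg φ (γ s)).comp (mfderiv 𝓘(ℝ, ℝ) (𝓡 N) γ s) := ⟨_, rfl⟩
  have d3 : HasFDerivAt (fun s => φ (γ s)) L s := by
    rw [hL]
    exact (HasMFDerivAt.comp s d2.hasMFDerivAt d1.hasMFDerivAt).hasFDerivAt
  have d4 := d3.hasDerivAt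
  rw [hL] at d4
  exact d4

lemma eq_of_curve (h : IsLeafChart i j k φ q r) {γ : ℝ → M} (hγ : ContMDiff 𝓘(ℝ, ℝ) (𝓡 N) ∞ γ)
    (hγd : ∀ s, γ s ∈ φ.source ∧ mfderiv 𝓘(ℝ, ℝ) (𝓡 N) γ s (1 : ℝ) ∈ distrib i j k (γ s)) :
    q (φ (γ 0)) = q (φ (γ 1)) := by
  have h1 : ∀ s, HasDerivAt (fun s => φ (γ s)) (tg φ (γ s) (mfderiv 𝓘(ℝ, ℝ) (𝓡 N) γ s (1 : ℝ))) s :=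
    fun s => hasDerivAt_chart_curve h.mem_atlas hγ (hγd s).1
  have h2 : ∀ s, HasDerivAt (fun s => q (φ (γ s))) 0 s := fun s => by
    have h3 := q.hasFDerivAt.comp_hasDerivAt s (h1 s)
    rw [(h.mem_distrib_iff (hγd s).1 _).1 (hγd s).2] at h3
    exact h3
  exact is_const_of_deriv_eq_zero (fun s => (h2 s).differentiableAt) (fun s => (h2 s).deriv) 0 1

/-- The straight segment between the two points stays in the convex target and in a fibre of `q`. -/
lemma exists_curve (h : IsLeafChart i j k φ q r) {x y : M} (hx : x ∈ φ.source) (hy : y ∈ φ.source)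
    (hxy : q (φ x) = q (φ y)) : ∃ γ : ℝ → M, ContMDiff 𝓘(ℝ, ℝ) (𝓡 N) ∞ γ ∧
      (∀ s, γ s ∈ φ.source ∧ mfderiv 𝓘(ℝ, ℝ) (𝓡 N) γ s (1 : ℝ) ∈ distrib i j k (γ s)) ∧
      γ 0 = x ∧ γ 1 = y := by
  -- `Real.smoothTransition` is smooth with values in the unit interval, so the curve is defined for
  -- all times and never leaves the segment.
  let c : ℝ → Eu N := fun s => φ x + Real.smoothTransition s • (φ y - φ x)
  have hc : ContDiff ℝ ∞ c := contDiff_const.add (Real.smoothTransition.contDiff.smul contDiff_const)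
  have hcO : ∀ s, c s ∈ φ.target := fun s =>
    h.convex.add_smul_sub_mem (φ.map_source hx) (φ.map_source hy)
      ⟨Real.smoothTransition.nonneg s, Real.smoothTransition.le_one s⟩
  have hγ : ContMDiff 𝓘(ℝ, ℝ) (𝓡 N) ∞ (φ.symm ∘ c) :=
    (contMDiffOn_chart_symm h.mem_atlas).comp_contMDiff hc.contMDiff hcO
  have hφγ : ∀ s, φ ((φ.symm ∘ c) s) = c s := fun s => φ.right_inv (hcO s)
  refine ⟨φ.symm ∘ c, hγ, fun s => ⟨φ.map_target (hcO s), ?_⟩, ?_, ?_⟩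
  · have hs : (φ.symm ∘ c) s ∈ φ.source := φ.map_target (hcO s)
    rw [h.mem_distrib_iff hs]
    have d4 := q.hasFDerivAt.comp_hasDerivAt s (hasDerivAt_chart_curve h.mem_atlas hγ hs)
    have d5 : HasDerivAt (fun s => q (φ ((φ.symm ∘ c) s))) 0 s := by
      have h0 : (fun s => q (φ ((φ.symm ∘ c) s))) = fun _ => q (φ x) := by
        funext s
        rw [hφγ, map_add, map_smul, map_sub, hxy, sub_self, smul_zero, add_zero]
      rw [h0]
      exact hasDerivAt_const s _
    exact d4.unique d5
  · rw [Function.comp_apply]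
    simp [c, φ.left_inv hx]
  · rw [Function.comp_apply]
    simp [c, φ.left_inv hy]

lemma leafSetoid_iff (h : IsLeafChart i j k φ q r) (x y : φ.source) :
    (leafSetoid i j k φ.source) x y ↔ q (φ x) = q (φ y) := by
  constructor
  · intro hxy
    have h1 : Relation.EqvGen (fun x y : φ.source => ∃ γ : ℝ → M,
      ContMDiff 𝓘(ℝ, ℝ) (𝓡 N) ∞ γ ∧ (∀ s, γ s ∈ φ.source ∧
        mfderiv 𝓘(ℝ, ℝ) (𝓡 N) γ s (1 : ℝ) ∈ distrib i j k (γ s)) ∧ γ 0 = x ∧ γ 1 = y) x y := hxy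
    induction h1 with
    | rel x y hr =>
      obtain ⟨γ, hγ, hγd, h0, h1⟩ := hr
      have h2 := h.eq_of_curve hγ hγd
      rwa [h0, h1] at h2
    | refl x => rfl
    | symm x y _ ih => exact (ih (by assumption)).symm
    | trans x y z _ _ ih1 ih2 => exact (ih1 (by assumption)).trans (ih2 (by assumption))
  · intro hxy
    exact Relation.EqvGen.rel x y (h.exists_curve x.2 y.2 hxy)

/-- The leaf space, mapped to the base of the projection. -/
def leafMap (h : IsLeafChart i j k φ q r) : LeafSpace i j k φ.source → Eu n :=
  Quotient.lift (fun x : φ.source => q (φ x)) fun x y hxy => (h.leafSetoid_iff x y).1 hxy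

lemma leafMap_mk (h : IsLeafChart i j k φ q r) (x : φ.source) :
    h.leafMap (Quotient.mk _ x) = q (φ x) := rfl

lemma surjective_q (h : IsLeafChart i j k φ q r) : Function.Surjective q := fun y => ⟨r y, h.q_r y⟩

/-- Injective because the leaves are the fibres, and open because the chart and the surjection `q`
are open maps. The Hausdorff property and second countability are inherited from the model space. -/
lemma isOpenEmbedding_leafMap (h : IsLeafChart i j k φ q r) : IsOpenEmbedding h.leafMap := by
  have hcont : Continuous fun x : φ.source => φ x := φ.continuousOn.domRestrict
  refine IsOpenEmbedding.of_continuous_injective_isOpenMap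
    (Continuous.quotient_lift (q.continuous.comp hcont) _) ?_ ?_
  · intro y y'
    induction y using Quotient.inductionOn with | _ x =>
    induction y' using Quotient.inductionOn with | _ x' =>
    intro hxy
    exact Quotient.sound ((h.leafSetoid_iff x x').2 hxy)
  · intro V hV
    have h1 : h.leafMap '' V = q '' (φ '' (Subtype.val '' (Quotient.mk _ ⁻¹' V))) := by
      ext y
      constructor
      · rintro ⟨l, hl, rfl⟩
        induction l using Quotient.inductionOn with | _ x =>
        exact ⟨φ x, ⟨x, ⟨x, hl, rfl⟩, rfl⟩, rfl⟩
      · rintro ⟨_, ⟨_, ⟨x, hx, rfl⟩, rfl⟩, rfl⟩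
        exact ⟨_, hx, rfl⟩
    rw [h1]
    have h2 : IsOpen (Quotient.mk (leafSetoid i j k φ.source) ⁻¹' V) :=
      hV.preimage continuous_quotient_mk'
    refine q.isOpenMap h.surjective_q _ (φ.isOpen_image_of_subset_source
      (φ.open_source.isOpenMap_subtype_val _ h2) ?_)
    rintro _ ⟨x, -, rfl⟩
    exact x.2

end IsLeafChart

end

/-! ### The leaf space as a manifold -/

section

variable {N n : ℕ} {M : Type u} [TopologicalSpace M] [ChartedSpace (EuclideanSpace ℝ (Fin N)) M]
  [IsManifold (𝓡 N) ∞ M] {φ : OpenPartialHomeomorph M (Eu N)} {i j k : VField N M}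
  {q : Eu N →L[ℝ] Eu n} {r : Eu n →L[ℝ] Eu N}

/-! ### The leaf space as a manifold -/

section Base

variable {L : Type u} [TopologicalSpace L] [ChartedSpace (EuclideanSpace ℝ (Fin n)) L]
  {π : M → L} {ψ : OpenPartialHomeomorph L (Eu n)}

/-- In the charts `φ` and `ψ`, of which the second is global, `π` is the linear map `q`. -/
structure IsLinearIn (φ : OpenPartialHomeomorph M (Eu N)) (ψ : OpenPartialHomeomorph L (Eu n))
    (q : Eu N →L[ℝ] Eu n) (π : M → L) : Prop where
  mem_atlas : φ ∈ IsManifold.maximalAtlas (𝓡 N) ∞ M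
  mem_atlas' : ψ ∈ IsManifold.maximalAtlas (𝓡 n) ∞ L
  source_eq : ψ.source = univ
  target_eq : ψ.target = q '' φ.target
  map_proj : ∀ x ∈ φ.source, ψ (π x) = q (φ x)

namespace IsLinearIn

lemma mem_source (h : IsLinearIn φ ψ q π) (y : L) : y ∈ ψ.source := h.source_eq ▸ mem_univ y

lemma eventuallyEq (h : IsLinearIn φ ψ q π) {x : M} (hx : x ∈ φ.source) :
    π =ᶠ[𝓝 x] ψ.symm ∘ q ∘ φ := by
  filter_upwards [φ.open_source.mem_nhds hx] with y hy
  rw [Function.comp_apply, Function.comp_apply, ← h.map_proj y hy, ψ.left_inv (h.mem_source _)]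

variable [IsManifold (𝓡 n) ∞ L]

lemma mdifferentiableAt (h : IsLinearIn φ ψ q π) {x : M} (hx : x ∈ φ.source) :
    MDifferentiableAt (𝓡 N) (𝓡 n) π x := by
  have hz : q (φ x) ∈ ψ.target := h.target_eq ▸ ⟨_, φ.map_source hx, rfl⟩
  have d1 := (mdifferentiable_chart' h.mem_atlas).mdifferentiableAt hx
  have d2 : MDifferentiableAt 𝓘(ℝ, Eu N) 𝓘(ℝ, Eu n) q (φ x) :=
    q.differentiableAt.mdifferentiableAt
  have d3 := (mdifferentiable_chart' h.mem_atlas').mdifferentiableAt_symm hz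
  exact (d3.comp x (d2.comp x d1)).congr_of_eventuallyEq (h.eventuallyEq hx)

lemma tg_mfderiv (h : IsLinearIn φ ψ q π) {x : M} (hx : x ∈ φ.source) (v : TangentSpace (𝓡 N) x) :
    tg ψ (π x) (mfderiv (𝓡 N) (𝓡 n) π x v) = q (tg φ x v) := by
  have d1 := ((mdifferentiable_chart' h.mem_atlas).mdifferentiableAt hx).hasMFDerivAt
  have d2 : HasMFDerivAt 𝓘(ℝ, Eu N) 𝓘(ℝ, Eu n) q (φ x) q := q.hasFDerivAt.hasMFDerivAt
  have d3 := ((mdifferentiable_chart' h.mem_atlas').mdifferentiableAt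
    (h.mem_source (π x))).hasMFDerivAt
  have d4 := HasMFDerivAt.comp x d3 (h.mdifferentiableAt hx).hasMFDerivAt
  have d5 := HasMFDerivAt.comp x d2 d1
  have hev : ψ ∘ π =ᶠ[𝓝 x] q ∘ φ := by
    filter_upwards [φ.open_source.mem_nhds hx] with y hy using h.map_proj y hy
  have d6 := d5.congr_of_eventuallyEq hev
  exact congrArg (fun T : TangentSpace (𝓡 N) x →L[ℝ] Eu n => T v) (hasMFDerivAt_unique d4 d6)

/-- In the charts the map is `q`, and the right inverse `r` splits off the kernel of `q` as a
complement. -/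
lemma isSubmersionAt (h : IsLinearIn φ ψ q π) (hr : ∀ y, q (r y) = y) {x : M} (hx : x ∈ φ.source) :
    Manifold.IsSubmersionAt (𝓡 N) (𝓡 n) ∞ π x := by
  obtain ⟨e, he⟩ : ∃ e : Eu N ≃L[ℝ] Eu n × LinearMap.ker (q : Eu N →ₗ[ℝ] Eu n),
      ∀ z, (e z).1 = q z := by
    let e := ContinuousLinearEquiv.equivOfRightInverse q r hr
    exact ⟨e, fun z => rfl⟩
  refine ⟨LinearMap.ker (q : Eu N →ₗ[ℝ] Eu n), inferInstance, inferInstance,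
    Manifold.IsSubmersionAtOfComplement.mk_of_charts e φ ψ hx (h.mem_source _) h.mem_atlas
      h.mem_atlas' (fun y _ => h.mem_source _) fun z hz => ?_⟩
  have hz' : z ∈ φ.target := by simpa using hz
  have h1 := h.map_proj _ (φ.map_target hz')
  rw [φ.right_inv hz'] at h1
  simp only [Function.comp_apply, he]
  exact h1

end IsLinearIn

end Base

/-- The projection to the leaf space, extended by a constant. -/
def leafProj (i j k : VField N M) (U : Set M) (l : LeafSpace i j k U) (x : M) :
    LeafSpace i j k U := by
  classical
  exact if hx : x ∈ U then Quotient.mk _ ⟨x, hx⟩ else l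

lemma leafProj_coe {U : Set M} (l : LeafSpace i j k U) (x : U) :
    leafProj i j k U l x = Quotient.mk _ x := dif_pos x.2

namespace IsLeafChart

/-- The open embedding into the model space is used as a single global chart. Outside the leaf chart
the projection takes the arbitrary value `l₀`. -/
lemma exists_manifold (h : IsLeafChart i j k φ q r) {x₀ : M} (hx₀ : x₀ ∈ φ.source) :
    ∃ (_ : ChartedSpace (EuclideanSpace ℝ (Fin n)) (LeafSpace i j k φ.source))
      (_ : IsManifold (𝓡 n) ∞ (LeafSpace i j k φ.source)) (π : M → LeafSpace i j k φ.source)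
      (ψ : OpenPartialHomeomorph (LeafSpace i j k φ.source) (Eu n)),
      (∀ x : φ.source, π x = Quotient.mk _ x) ∧ IsLinearIn φ ψ q π := by
  have l₀ : LeafSpace i j k φ.source := Quotient.mk _ ⟨x₀, hx₀⟩
  have : Nonempty (LeafSpace i j k φ.source) := ⟨l₀⟩
  have he := h.isOpenEmbedding_leafMap
  let inst := he.singletonChartedSpace
  have hM : IsManifold (𝓡 n) ∞ (LeafSpace i j k φ.source) := he.isManifold_singleton
  refine ⟨inst, hM, leafProj i j k φ.source l₀, he.toOpenPartialHomeomorph h.leafMap,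
    fun x => leafProj_coe l₀ x, h.mem_atlas, ?_, by simp, ?_, fun x hx => ?_⟩
  · exact IsManifold.subset_maximalAtlas (mem_singleton _)
  · rw [IsOpenEmbedding.toOpenPartialHomeomorph_target]
    ext y
    constructor
    · rintro ⟨l, rfl⟩
      induction l using Quotient.inductionOn with | _ x =>
      exact ⟨φ x, φ.map_source x.2, rfl⟩
    · rintro ⟨z, hz, rfl⟩
      refine ⟨Quotient.mk _ ⟨φ.symm z, φ.map_target hz⟩, ?_⟩
      rw [h.leafMap_mk, φ.right_inv hz]
  · have h1 : leafProj i j k φ.source l₀ x = Quotient.mk _ ⟨x, hx⟩ := leafProj_coe l₀ ⟨x, hx⟩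
    rw [h1]
    rfl

lemma t2Space (h : IsLeafChart i j k φ q r) : T2Space (LeafSpace i j k φ.source) :=
  h.isOpenEmbedding_leafMap.isEmbedding.t2Space

lemma secondCountableTopology (h : IsLeafChart i j k φ q r) :
    SecondCountableTopology (LeafSpace i j k φ.source) :=
  h.isOpenEmbedding_leafMap.isEmbedding.secondCountableTopology

end IsLeafChart

end

/-! ### The quaternionic structure of the leaf space -/

section

variable {N n : ℕ} {M : Type u} [TopologicalSpace M] [ChartedSpace (EuclideanSpace ℝ (Fin N)) M]
  [IsManifold (𝓡 N) ∞ M] {φ : OpenPartialHomeomorph M (Eu N)} {i j k : VField N M}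
  {q : Eu N →L[ℝ] Eu n} {r : Eu n →L[ℝ] Eu N} {L : Type u} [TopologicalSpace L]
  [ChartedSpace (EuclideanSpace ℝ (Fin n)) L] {π : M → L} {ψ : OpenPartialHomeomorph L (Eu n)}

/-! ### The quaternionic structure of the leaf space -/

/-- An endomorphism of a tangent space in a chart. -/
def conjTg (ψ : OpenPartialHomeomorph L (Eu n)) (y : L) :
    (TangentSpace (𝓡 n) y →L[ℝ] TangentSpace (𝓡 n) y) →ₗ[ℝ] Eu n →L[ℝ] Eu n where
  toFun A := tg ψ y ∘L A ∘L tgInv ψ y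
  map_add' A B := by
    ext1 v
    exact (tg ψ y).map_add _ _
  map_smul' c A := by
    ext1 v
    exact (tg ψ y).map_smul _ _

lemma conjTg_apply (y : L) (A : TangentSpace (𝓡 n) y →L[ℝ] TangentSpace (𝓡 n) y) (w : Eu n) :
    conjTg ψ y A w = tg ψ y (A (tgInv ψ y w)) := rfl

/-- The subbundle of the endomorphism bundle which is given by `S` in the chart `ψ`. -/
def bundleOf (ψ : OpenPartialHomeomorph L (Eu n)) (S : Eu n → Submodule ℝ (Eu n →L[ℝ] Eu n))
    (y : L) : Submodule ℝ (TangentSpace (𝓡 n) y →L[ℝ] TangentSpace (𝓡 n) y) :=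
  (S (ψ y)).comap (conjTg ψ y)

lemma mem_bundleOf {S : Eu n → Submodule ℝ (Eu n →L[ℝ] Eu n)} {y : L}
    {A : TangentSpace (𝓡 n) y →L[ℝ] TangentSpace (𝓡 n) y} :
    A ∈ bundleOf ψ S y ↔ conjTg ψ y A ∈ S (ψ y) := Iff.rfl

/-- The endomorphism field which is given by `X` in the chart `ψ`. -/
def endOf (ψ : OpenPartialHomeomorph L (Eu n)) (X : Eu n → Eu n →L[ℝ] Eu n) : EndField n L :=
  fun y => tgInv ψ y ∘L X (ψ y) ∘L tg ψ y

lemma insert_eq_range {W : Type*} (f : Fin 3 → W) : ({f 0, f 1, f 2} : Set W) = range f := by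
  ext w
  constructor
  · rintro (rfl | rfl | rfl)
    exacts [⟨0, rfl⟩, ⟨1, rfl⟩, ⟨2, rfl⟩]
  · rintro ⟨a, rfl⟩
    exact match a with
    | 0 => Or.inl rfl
    | 1 => Or.inr (Or.inl rfl)
    | 2 => Or.inr (Or.inr rfl)

lemma mem_span_three {W : Type*} [AddCommGroup W] [Module ℝ W] (f : Fin 3 → W) (w : W) :
    w ∈ Submodule.span ℝ {f 0, f 1, f 2} ↔ ∃ c : Fin 3 → ℝ, ∑ a, c a • f a = w := by
  rw [insert_eq_range, Submodule.mem_span_range_iff_exists_fun]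

variable [IsManifold (𝓡 n) ∞ L]

lemma tg_endOf (hψ : ψ ∈ IsManifold.maximalAtlas (𝓡 n) ∞ L)
    (X : Eu n → Eu n →L[ℝ] Eu n) {y : L} (hy : y ∈ ψ.source) (v : TangentSpace (𝓡 n) y) :
    tg ψ y (endOf ψ X y v) = X (ψ y) (tg ψ y v) := tg_tgInv hψ hy _

lemma conjTg_endOf (hψ : ψ ∈ IsManifold.maximalAtlas (𝓡 n) ∞ L)
    (X : Eu n → Eu n →L[ℝ] Eu n) {y : L} (hy : y ∈ ψ.source) :
    conjTg ψ y (endOf ψ X y) = X (ψ y) := by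
  ext1 w
  rw [conjTg_apply, tg_endOf hψ X hy, tg_tgInv hψ hy]

lemma conjTg_tg (hψ : ψ ∈ IsManifold.maximalAtlas (𝓡 n) ∞ L)
    {y : L} (hy : y ∈ ψ.source) (A : TangentSpace (𝓡 n) y →L[ℝ] TangentSpace (𝓡 n) y)
    (v : TangentSpace (𝓡 n) y) : conjTg ψ y A (tg ψ y v) = tg ψ y (A v) := by
  rw [conjTg_apply, tgInv_tg hψ hy]

lemma injective_conjTg (hψ : ψ ∈ IsManifold.maximalAtlas (𝓡 n) ∞ L)
    {y : L} (hy : y ∈ ψ.source) : Function.Injective (conjTg ψ y) := by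
  intro A B hAB
  ext1 v
  refine clm_ext_tg hψ hy ?_
  rw [← conjTg_tg hψ hy, hAB, conjTg_tg hψ hy]

lemma smoothEndOn_endOf (hψ : ψ ∈ IsManifold.maximalAtlas (𝓡 n) ∞ L)
    {X : Eu n → Eu n →L[ℝ] Eu n} {V : Set L} (hV : IsOpen V)
    (hVψ : V ⊆ ψ.source) (hX : ∀ y ∈ V, ContDiffAt ℝ ∞ X (ψ y)) : SmoothEndOn V (endOf ψ X) := by
  intro Y hY
  rw [smoothFieldOn_iff_coord hψ hV hVψ]
  intro y hy
  refine ((hX y hy).clm_apply (hY.contDiffAt_coord hψ hV hy (hVψ hy))).congr_of_eventuallyEq ?_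
  filter_upwards [ψ.open_target.mem_nhds (ψ.map_source (hVψ hy))] with w hw
  rw [coord, tg_endOf hψ X (ψ.map_target hw), ψ.right_inv hw]
  rfl

namespace IsLinearIn

variable {O : Set (Eu N)} {Γ : Eu N → Eu N →L[ℝ] Eu N →L[ℝ] Eu N}
  {A : Fin 3 → Eu N → Eu N →L[ℝ] Eu N} {ι : Fin 3 → Eu N → Eu N} {β : Fin 3 → Eu N → Eu N →L[ℝ] ℝ}
  {S : Eu n → Submodule ℝ (Eu n →L[ℝ] Eu n)} {cov : RawConn N M}

/-- In the charts `∇i_a` is `A_a`, and `q ∘ A_a` factors through `q` as `J_a`. Since `q` is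
surjective, an endomorphism of the quotient is induced by `∑ c_a ∇i_a` exactly if it is `∑ c_a J_a`.
-/
lemma inducedBy (h : IsLinearIn φ ψ q π) {V : Set M} (hVφ : V ⊆ φ.source)
    (hF : FibData Γ (img φ V) A ι β q r)
    (hS : ∀ z ∈ img φ V, S (q z) = FibData.descSpan A ι β q r z)
    (hA : ∀ a, ∀ x ∈ V, ∀ v, tg φ x (cov (![i, j, k] a) x v) = A a (φ x) (tg φ x v)) :
    InducedBy i j k π V cov (bundleOf ψ S) := by
  intro x hxV B
  have hx := hVφ hxV
  have hz := map_mem_img hxV hx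
  have hy := h.mem_source (π x)
  have key : ∀ c : Fin 3 → ℝ, ∑ a, c a • desc A ι β q r a (φ x) = conjTg ψ (π x) B ↔
      B ∘L mfderiv (𝓡 N) (𝓡 n) π x =
        mfderiv (𝓡 N) (𝓡 n) π x ∘L ∑ a, c a • cov (![i, j, k] a) x := by
    intro c
    have e1 : ∀ v, tg ψ (π x) (B (mfderiv (𝓡 N) (𝓡 n) π x v)) =
        conjTg ψ (π x) B (q (tg φ x v)) := fun v => by
      rw [← h.tg_mfderiv hx, conjTg_tg h.mem_atlas' hy]
    have e2 : ∀ v, tg ψ (π x) (mfderiv (𝓡 N) (𝓡 n) π x ((∑ a, c a • cov (![i, j, k] a) x) v)) =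
        (∑ a, c a • desc A ι β q r a (φ x)) (q (tg φ x v)) := fun v => by
      have e3 : tg φ x ((∑ a, c a • cov (![i, j, k] a) x) v) =
          ∑ a, c a • A a (φ x) (tg φ x v) := by
        rw [sum_apply]
        refine (map_sum (tg φ x) _ _).trans (Finset.sum_congr rfl fun a _ => ?_)
        rw [← hA a x hxV]
        exact (tg φ x).map_smul _ _
      rw [h.tg_mfderiv hx, e3, sum_apply, map_sum]
      refine Finset.sum_congr rfl fun a _ => ?_
      rw [map_smul, hF.q_A a hz, smul_apply]
    constructor
    · intro hc
      ext1 v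
      refine clm_ext_tg h.mem_atlas' hy ((e1 v).trans ?_)
      rw [← hc]
      exact (e2 v).symm
    · intro hB
      ext1 w
      obtain ⟨v, hv⟩ : ∃ v, q (tg φ x v) = w := ⟨tgInv φ x (r w), by
        rw [tg_tgInv h.mem_atlas hx, hF.q_r]⟩
      rw [← hv, ← e1, ← e2]
      exact congrArg (tg ψ (π x)) (congrArg
        (fun T : TangentSpace (𝓡 N) x →L[ℝ] TangentSpace (𝓡 n) (π x) => T v) hB).symm
  rw [mem_bundleOf, h.map_proj x hx, hS _ hz, FibData.descSpan,
    Submodule.mem_span_range_iff_exists_fun]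
  constructor
  · rintro ⟨c, hc⟩
    exact ⟨_, (mem_span_three (fun a => cov (![i, j, k] a) x) _).2 ⟨c, rfl⟩, (key c).1 hc⟩
  · rintro ⟨C, hC, hB⟩
    obtain ⟨c, rfl⟩ := (mem_span_three (fun a => cov (![i, j, k] a) x) C).1 hC
    exact ⟨c, (key c).2 hB⟩

/-- The base lifts locally to the total space. -/
lemma exists_section (h : IsLinearIn φ ψ q π) (hr : ∀ y, q (r y) = y) (y₀ : L) :
    ∃ s : Eu n → Eu N, ContDiff ℝ ∞ s ∧ (∀ y, q (s y) = y) ∧ s (ψ y₀) ∈ φ.target := by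
  have h1 : ψ y₀ ∈ q '' φ.target := h.target_eq ▸ ψ.map_source (h.mem_source y₀)
  obtain ⟨z₀, hz₀, hq⟩ := h1
  refine ⟨fun y => z₀ + r (y - ψ y₀), ?_, fun y => ?_, ?_⟩
  · exact contDiff_const.add (r.contDiff.comp (contDiff_id.sub contDiff_const))
  · rw [map_add, hr, hq]
    abel
  · simpa using hz₀

/-- The `J_a` live on the total space; composing them with a local section of `q` gives a local
frame on the base. A different section rotates the frame but keeps its span. -/
lemma isAlmostQuaternionic (h : IsLinearIn φ ψ q π) (hF : FibData Γ φ.target A ι β q r)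
    (hn : n ≠ 0) (hS : ∀ z ∈ φ.target, S (q z) = FibData.descSpan A ι β q r z) :
    IsAlmostQuaternionic (bundleOf ψ S) := by
  intro y₀
  obtain ⟨s, hs, hqs, hs₀⟩ := h.exists_section hF.q_r y₀
  let X : Fin 3 → Eu n → Eu n →L[ℝ] Eu n := fun a y => desc A ι β q r a (s y)
  let V : Set L := ψ.source ∩ ψ ⁻¹' (s ⁻¹' φ.target)
  have hV : IsOpen V := ψ.isOpen_inter_preimage (φ.open_target.preimage hs.continuous)
  have hsm : ∀ a, SmoothEndOn V (endOf ψ (X a)) := fun a =>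
    smoothEndOn_endOf h.mem_atlas' hV inter_subset_left fun y hy =>
      ((hF.contDiffOn_desc a).contDiffAt (φ.open_target.mem_nhds hy.2)).comp _ hs.contDiffAt
  refine ⟨V, endOf ψ (X 0), endOf ψ (X 1), endOf ψ (X 2), hV, ⟨h.mem_source y₀, hs₀⟩, hsm 0, hsm 1,
    hsm 2, fun y hy => ?_⟩
  have hyS := h.mem_source y
  have hz : s (ψ y) ∈ φ.target := hy.2
  have htg : ∀ a v, tg ψ y (endOf ψ (X a) y v) = desc A ι β q r a (s (ψ y)) (tg ψ y v) :=
    fun a v => tg_endOf h.mem_atlas' (X a) hyS v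
  have hneg : ∀ v : TangentSpace (𝓡 n) y, tg ψ y ((-ContinuousLinearMap.id ℝ _ :
      TangentSpace (𝓡 n) y →L[ℝ] TangentSpace (𝓡 n) y) v) = -tg ψ y v := fun v =>
    (tg ψ y).map_neg v
  have hsq : ∀ a, endOf ψ (X a) y ∘L endOf ψ (X a) y = -.id ℝ _ := fun a => by
    ext1 v
    refine clm_ext_tg h.mem_atlas' hyS (Eq.trans ?_ (hneg v).symm)
    rw [ContinuousLinearMap.comp_apply, htg, htg, hF.desc_sq a hz]
  have hconj : ∀ a, conjTg ψ y (endOf ψ (X a) y) = desc A ι β q r a (s (ψ y)) := fun a =>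
    conjTg_endOf h.mem_atlas' (X a) hyS
  refine ⟨hsq 0, hsq 1, hsq 2, ?_, ?_, ?_⟩
  · ext1 v
    refine clm_ext_tg h.mem_atlas' hyS (Eq.trans ?_ (hneg v).symm)
    have h3 := hF.desc_mul 0 hz (desc A ι β q r 2 (s (ψ y)) (tg ψ y v))
    rw [ContinuousLinearMap.comp_apply, ContinuousLinearMap.comp_apply, htg, htg, htg]
    exact h3.trans (hF.desc_sq 2 hz _)
  · refine LinearIndependent.of_comp (conjTg ψ y) ?_
    have h1 : (conjTg ψ y) ∘ ![endOf ψ (X 0) y, endOf ψ (X 1) y, endOf ψ (X 2) y] =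
        fun a => desc A ι β q r a (s (ψ y)) := funext fun a => match a with
      | 0 => hconj 0
      | 1 => hconj 1
      | 2 => hconj 2
    rw [h1]
    exact hF.linearIndependent_desc (by simpa using hn) hz
  · have h1 := insert_eq_range (fun a => endOf ψ (X a) y)
    change _ = Submodule.span ℝ ({(fun a => endOf ψ (X a) y) 0, (fun a => endOf ψ (X a) y) 1,
      (fun a => endOf ψ (X a) y) 2} : Set _)
    rw [h1, ← Submodule.comap_map_eq_of_injective (injective_conjTg h.mem_atlas' hyS)
      (Submodule.span ℝ _), Submodule.map_span, ← range_comp]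
    have h2 : (conjTg ψ y) ∘ (fun a => endOf ψ (X a) y) = fun a => desc A ι β q r a (s (ψ y)) :=
      funext hconj
    rw [h2, bundleOf]
    congr 1
    rw [← hqs (ψ y), hS _ hz, hqs]
    rfl

end IsLinearIn

end

/-! ### Descent of adapted scales to the leaf space -/

section

variable {N n : ℕ} {M : Type u} [TopologicalSpace M] [ChartedSpace (EuclideanSpace ℝ (Fin N)) M]
  [IsManifold (𝓡 N) ∞ M] {φ : OpenPartialHomeomorph M (Eu N)} {i j k : VField N M}
  {q : Eu N →L[ℝ] Eu n} {r : Eu n →L[ℝ] Eu N} {L : Type u} [TopologicalSpace L]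
  [ChartedSpace (EuclideanSpace ℝ (Fin n)) L] {π : M → L} {ψ : OpenPartialHomeomorph L (Eu n)}
  [IsManifold (𝓡 n) ∞ L] {A : Fin 3 → Eu N → Eu N →L[ℝ] Eu N} {ι : Fin 3 → Eu N → Eu N}
  {β : Fin 3 → Eu N → Eu N →L[ℝ] ℝ} {S : Eu n → Submodule ℝ (Eu n →L[ℝ] Eu n)}
  {G : Eu n → Eu n →L[ℝ] Eu n →L[ℝ] Eu n} {cov : RawConn N M}

/-! ### Descent of adapted scales -/

namespace IsLinearIn

lemma exists_lift (h : IsLinearIn φ ψ q π) (y : L) : ∃ z ∈ φ.target, q z = ψ y := by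
  have h1 : ψ y ∈ q '' φ.target := h.target_eq ▸ ψ.map_source (h.mem_source y)
  exact h1

/-- Smoothness of `G` is seen by pulling it back along a local section of `q`; its symmetry is
inherited from `Γ`. -/
lemma isAffineConnectionOn (h : IsLinearIn φ ψ q π)
    {Γ : Eu N → Eu N →L[ℝ] Eu N →L[ℝ] Eu N} (hF : FibData Γ φ.target A ι β q r)
    (hG : ∀ z ∈ φ.target, G (q z) = descConn Γ ι β q r z) :
    IsAffineConnectionOn univ (connOf ψ G) := by
  refine isAffineConnectionOn_connOf h.mem_atlas' isOpen_univ (fun y _ => h.mem_source y)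
    (fun y _ => ?_) fun y _ v w => ?_
  · obtain ⟨s, hs, hqs, hs₀⟩ := h.exists_section hF.q_r y
    have h1 := (hF.contDiffOn_descConn.contDiffAt (φ.open_target.mem_nhds hs₀)).comp _
      hs.contDiffAt
    refine h1.congr_of_eventuallyEq ?_
    filter_upwards [(φ.open_target.preimage hs.continuous).mem_nhds hs₀] with w hw
    rw [Function.comp_apply, ← hG _ hw, hqs]
  · obtain ⟨z, hz, hq⟩ := h.exists_lift y
    rw [← hq, hG z hz, descConn_apply, descConn_apply, hF.symm z hz]

lemma isParallelSubbundle (h : IsLinearIn φ ψ q π) {Γ : Eu N → Eu N →L[ℝ] Eu N →L[ℝ] Eu N}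
    (hF : FibData Γ φ.target A ι β q r) (hn : n ≠ 0)
    (hG : ∀ z ∈ φ.target, G (q z) = descConn Γ ι β q r z)
    (hS : ∀ z ∈ φ.target, S (q z) = FibData.descSpan A ι β q r z) :
    IsParallelSubbundle (connOf ψ G) (bundleOf ψ S) := by
  intro V B hV hB hBS y hy v
  have hyS := h.mem_source y
  have hw := ψ.map_source hyS
  obtain ⟨z, hz, hq⟩ := h.exists_lift y
  obtain ⟨X, hX⟩ : ∃ X : Eu n → Eu n →L[ℝ] Eu n,
      ∀ w, X w = conjTg ψ (ψ.symm w) (B (ψ.symm w)) := ⟨_, fun w => rfl⟩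
  have hXy : X (ψ y) = conjTg ψ y (B y) := by rw [hX, ψ.left_inv hyS]
  have hcoord : ∀ Y : VField n L, ∀ w ∈ ψ.target,
      coord ψ (fun y => B y (Y y)) w = X w (coord ψ Y w) := fun Y w hw => by
    rw [hX, coord, coord, conjTg_tg h.mem_atlas' (ψ.map_target hw)]
  have hVw : ∀ᶠ w in 𝓝 (ψ y), w ∈ ψ.target ∧ ψ.symm w ∈ V :=
    (ψ.isOpen_inter_preimage_symm hV).mem_nhds ⟨hw, by rwa [mem_preimage, ψ.left_inv hyS]⟩
  -- Smoothness of the matrix of `B` is tested on constant fields.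
  have hXs : ContDiffAt ℝ ∞ X (ψ y) := contDiffAt_clm_iff.2 fun w => by
    have h1 := (hB _ (smoothFieldOn_cfield h.mem_atlas' w
      (fun y _ => h.mem_source y))).contDiffAt_coord h.mem_atlas' hV hy hyS
    refine h1.congr_of_eventuallyEq ?_
    filter_upwards [hVw] with w' hw'
    rw [hcoord _ _ hw'.1, coord_cfield h.mem_atlas' w hw'.1]
  have hXd := hXs.differentiableAt (by simp)
  obtain ⟨C, hC, hCY⟩ := hF.parallel_descSpan (by simpa using hn) hz (X := X) (by rwa [hq]) (by
    rw [hq]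
    filter_upwards [hVw] with w hw z' hz' hqz
    rw [← hS z' hz', hqz, hX]
    have h1 := mem_bundleOf.1 (hBS _ hw.2)
    rwa [ψ.right_inv hw.1] at h1) (tg ψ y v)
  refine ⟨endOf ψ (fun _ => C) y, ?_, fun Y hY => clm_ext_tg h.mem_atlas' hyS ?_⟩
  · rw [mem_bundleOf, conjTg_endOf h.mem_atlas' _ hyS, ← hq, hS z hz]
    exact hC
  · have hYd := (hY.contDiffAt_coord h.mem_atlas' hV hy hyS).differentiableAt (by simp)
    have e1 : tg ψ y (connOf ψ G (fun y => B y (Y y)) y v) =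
        fderiv ℝ X (ψ y) (tg ψ y v) (tg ψ y (Y y)) + X (ψ y) (fderiv ℝ (coord ψ Y) (ψ y) (tg ψ y v))
          + G (ψ y) (X (ψ y) (tg ψ y (Y y))) (tg ψ y v) := by
      have hev : coord ψ (fun y => B y (Y y)) =ᶠ[𝓝 (ψ y)] fun w => X w (coord ψ Y w) := by
        filter_upwards [ψ.open_target.mem_nhds hw] with w hw using hcoord Y w hw
      have hd : HasFDerivAt (fun w => X w (coord ψ Y w)) _ (ψ y) :=
        hXd.hasFDerivAt.clm_apply hYd.hasFDerivAt
      rw [tg_connOf h.mem_atlas' G _ hyS, hev.fderiv_eq (𝕜 := ℝ), hd.fderiv, hXy,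
        conjTg_tg h.mem_atlas' hyS, ← coord_apply Y hyS]
      simp only [add_apply, ContinuousLinearMap.comp_apply, ContinuousLinearMap.flip_apply]
      abel
    have e2 : tg ψ y (B y (connOf ψ G Y y v)) = X (ψ y) (fderiv ℝ (coord ψ Y) (ψ y) (tg ψ y v)) +
        X (ψ y) (G (ψ y) (tg ψ y (Y y)) (tg ψ y v)) := by
      rw [← conjTg_tg h.mem_atlas' hyS, tg_connOf h.mem_atlas' G _ hyS, ← hXy, map_add]
    have e3 := hCY (tg ψ y (Y y))
    rw [hq, ← hG z hz, hq] at e3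
    rw [tg_endOf h.mem_atlas' _ hyS, ← e3]
    refine ((tg ψ y).map_sub _ _).trans ?_
    rw [e1, e2]
    abel

/-- In an adapted scale `P(·, i_a) = -β_a`. -/
lemma mem_horizontal_iff [T2Space M] (h : IsLinearIn φ ψ q π)
    (hc : IsAffineConnectionOn φ.source cov) (hF : FibData (chr φ cov) φ.target A ι β q r)
    (hι : ∀ a, ∀ z ∈ φ.target, ι a z = coord φ (![i, j, k] a) z) {x : M} (hx : x ∈ φ.source)
    (v : TangentSpace (𝓡 N) x) :
    v ∈ horizontal i j k cov x ↔ ∀ a, β a (φ x) (tg φ x v) = 0 := by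
  have hz := φ.map_source hx
  have key : ∀ a, schouten cov x v (![i, j, k] a x) = -β a (φ x) (tg φ x v) := fun a => by
    rw [schouten_eq h.mem_atlas φ.open_source hc hx hx, hF.β_eq a _ hz, hι a _ hz,
      coord_apply _ hx, neg_neg]
  have key' : ∀ a, schouten cov x v (![i, j, k] a x) = 0 ↔ β a (φ x) (tg φ x v) = 0 := fun a => by
    rw [key, neg_eq_zero]
  constructor
  · rintro ⟨h0, h1, h2⟩ a
    exact match a with
    | 0 => (key' 0).1 h0
    | 1 => (key' 1).1 h1
    | 2 => (key' 2).1 h2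
  · intro hv
    exact ⟨(key' 0).2 (hv 0), (key' 1).2 (hv 1), (key' 2).2 (hv 2)⟩

lemma descendsTo [T2Space M] (h : IsLinearIn φ ψ q π) (hL : IsLeafChart i j k φ q r)
    (hc : IsAffineConnectionOn φ.source cov) (hF : FibData (chr φ cov) φ.target A ι β q r)
    (hι : ∀ a, ∀ z ∈ φ.target, ι a z = coord φ (![i, j, k] a) z)
    (hG : ∀ z ∈ φ.target, G (q z) = descConn (chr φ cov) ι β q r z) :
    DescendsTo i j k φ.source π cov (connOf ψ G) := by
  constructor
  · intro x hx
    have hz := φ.map_source hx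
    let H : Submodule ℝ (TangentSpace (𝓡 N) x) :=
      ⨅ a, LinearMap.ker ((β a (φ x) ∘L tg φ x : TangentSpace (𝓡 N) x →L[ℝ] ℝ) : _ →ₗ[ℝ] ℝ)
    have hH : ∀ v, v ∈ H ↔ ∀ a, β a (φ x) (tg φ x v) = 0 := fun v => by
      rw [Submodule.mem_iInf]
      exact Iff.rfl
    refine ⟨H, Set.ext fun v => (hH v).trans (h.mem_horizontal_iff hc hF hι hx v).symm, ?_, ?_⟩
    · rw [Submodule.disjoint_def]
      intro v hv hvD
      refine clm_ext_tg h.mem_atlas hx (hF.ext_of hz ?_ fun a => ?_)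
      · rw [(hL.mem_distrib_iff hx v).1 hvD, (tg φ x).map_zero, map_zero]
      · rw [(hH v).1 hv a, (tg φ x).map_zero, map_zero]
    · rw [codisjoint_iff, Submodule.eq_top_iff']
      intro v
      obtain ⟨u, hu⟩ : ∃ u : TangentSpace (𝓡 N) x,
          tg φ x u = hor ι β r (φ x) (q (tg φ x v)) := ⟨_, tg_tgInv h.mem_atlas hx _⟩
      refine Submodule.mem_sup.2 ⟨u, (hH u).2 fun a => ?_, v - u, ?_, add_sub_cancel u v⟩
      · rw [hu, hF.β_hor a hz]
      · rw [hL.mem_distrib_iff hx, (tg φ x).map_sub, map_sub, hu, hF.q_hor hz, sub_self]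
  · intro Y Yh hY hYh x hx v hv
    have hz := φ.map_source hx
    have hyS := h.mem_source (π x)
    have hYd : DifferentiableAt ℝ (coord ψ Y) (q (φ x)) := by
      rw [← h.map_proj x hx]
      exact (hY.contDiffAt_coord h.mem_atlas' isOpen_univ (mem_univ _) hyS).differentiableAt
        (by simp)
    -- The value of `q` and of the forms `β` determine a vector, so the horizontal lift is given by
    -- `hor`.
    have hYh' : ∀ x ∈ φ.source, tg φ x (Yh x) = hor ι β r (φ x) (coord ψ Y (q (φ x))) := by
      intro x hx
      have hz := φ.map_source hx
      obtain ⟨h1, h2⟩ := hYh x hx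
      refine hF.ext_of hz ?_ fun a => ?_
      · rw [← h.tg_mfderiv hx, h2, hF.q_hor hz, ← h.map_proj x hx,
          coord_apply Y (h.mem_source (π x))]
      · rw [(h.mem_horizontal_iff hc hF hι hx _).1 h1 a, hF.β_hor a hz]
    have hev : coord φ Yh =ᶠ[𝓝 (φ x)] fun z => hor ι β r z (coord ψ Y (q z)) := by
      filter_upwards [φ.open_target.mem_nhds hz] with z hz
      have h1 := hYh' _ (φ.map_target hz)
      rwa [φ.right_inv hz] at h1
    have hd := (hF.hasFDerivAt_hor hz).clm_apply
      (hYd.hasFDerivAt.comp (φ x) (q.hasFDerivAt (x := φ x)))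
    have hd' := hd.congr_of_eventuallyEq hev
    have hv' : tg φ x v = hor ι β r (φ x) (q (tg φ x v)) := by
      refine hF.ext_of hz (by rw [hF.q_hor hz]) fun a => ?_
      rw [(h.mem_horizontal_iff hc hF hι hx v).1 hv a, hF.β_hor a hz]
    refine clm_ext_tg h.mem_atlas' hyS ?_
    rw [h.tg_mfderiv hx, tg_connOf h.mem_atlas' G _ hyS, h.tg_mfderiv hx,
      tg_cov h.mem_atlas φ.open_source hc hx hx
        ((diffFieldAt_iff h.mem_atlas hx).2 hd'.differentiableAt), hd'.fderiv, hYh' x hx,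
      h.map_proj x hx, hG _ hz, map_add, descConn_apply, ← hv', ← coord_apply Y hyS,
      h.map_proj x hx]
    -- The derivative of `hor` is vertical, so only the derivative of the field on the base remains.
    congr 1
    simp only [add_apply, ContinuousLinearMap.comp_apply, ContinuousLinearMap.flip_apply, map_add]
    rw [hF.q_fderiv_hor hz, hF.q_hor hz]
    simp

end IsLinearIn

end

/-! ### Existence of leaf charts and assembly of the quotient -/

section

/-! ### Existence of leaf charts -/

section Frobenius

variable {E : Type*} [NormedAddCommGroup E] [NormedSpace ℝ E]

/-- The linear map `s ↦ ∑ s_a i_a`. -/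
def combMap (i : Fin 3 → E → E) (z : E) : (Fin 3 → ℝ) →L[ℝ] E :=
  ∑ a, (ContinuousLinearMap.proj (R := ℝ) (φ := fun _ : Fin 3 => ℝ) a).smulRight (i a z)

lemma combMap_apply (i : Fin 3 → E → E) (z : E) (s : Fin 3 → ℝ) :
    combMap i z s = ∑ a, s a • i a z := by
  simp [combMap]

lemma combMap_single (i : Fin 3 → E → E) (z : E) (a : Fin 3) :
    combMap i z (Pi.single a 1) = i a z := by
  simp [combMap_apply, Pi.single_apply]

lemma contDiffOn_combMap {i : Fin 3 → E → E} {O : Set E} (hi : ∀ a, ContDiffOn ℝ ∞ (i a) O) :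
    ContDiffOn ℝ ∞ (combMap i) O := by
  unfold combMap
  exact ContDiffOn.sum fun a _ => contDiffOn_const.smulRight (hi a)

lemma fderiv_combMap {i : Fin 3 → E → E} {z : E} (hi : ∀ a, DifferentiableAt ℝ (i a) z)
    (v : E) (s : Fin 3 → ℝ) : fderiv ℝ (combMap i) z v s = ∑ a, s a • fderiv ℝ (i a) z v := by
  have h0 : DifferentiableAt ℝ (combMap i) z := by
    unfold combMap
    exact DifferentiableAt.fun_sum fun a _ => (((ContinuousLinearMap.smulRightL ℝ (Fin 3 → ℝ) E)
      (ContinuousLinearMap.proj a)).differentiableAt.comp z (hi a))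
  have h1 : HasFDerivAt (fun z => combMap i z s) _ z := h0.hasFDerivAt.clm_apply
    (hasFDerivAt_const s z)
  have h2 : HasFDerivAt (fun z => ∑ a, s a • i a z) (∑ a, s a • fderiv ℝ (i a) z) z :=
    HasFDerivAt.fun_sum fun a _ => (hi a).hasFDerivAt.const_smul (s a)
  have h3 := h1.unique (h2.congr_of_eventuallyEq
    (Filter.Eventually.of_forall fun z => combMap_apply i z s))
  have h4 := congrArg (fun T : E →L[ℝ] E => T v) h3
  simpa using h4

/-- Three fields with the brackets of the imaginary quaternions are involutive. -/
lemma combMap_involutive {i : Fin 3 → E → E} {z : E} (hi : ∀ a, DifferentiableAt ℝ (i a) z)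
    (hbr : ∀ a, fderiv ℝ (i (a + 1)) z (i a z) - fderiv ℝ (i a) z (i (a + 1) z) =
      (-2 : ℝ) • i (a + 2) z) (s t : Fin 3 → ℝ) :
    ∃ c, fderiv ℝ (combMap i) z (combMap i z s) t - fderiv ℝ (combMap i) z (combMap i z t) s =
      combMap i z c := by
  have h1 : ∀ a b, fderiv ℝ (i a) z (i b z) - fderiv ℝ (i b) z (i a z) ∈
      Submodule.span ℝ (range fun a => i a z) := by
    have hs : ∀ a, i a z ∈ Submodule.span ℝ (range fun a => i a z) := fun a =>
      Submodule.subset_span ⟨a, rfl⟩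
    intro a b
    rcases fin3_cases b a with rfl | rfl | rfl
    · rw [sub_self]
      exact Submodule.zero_mem _
    · rw [hbr]
      exact Submodule.smul_mem _ _ (hs _)
    · have h2 := hbr (b + 2)
      have h5 : b + 2 + 1 = b := by fin_cases b <;> rfl
      rw [h5] at h2
      rw [← neg_sub, h2]
      exact Submodule.neg_mem _ (Submodule.smul_mem _ _ (hs _))
  have h2 : ∑ a, ∑ b, (t a * s b) • (fderiv ℝ (i a) z (i b z) - fderiv ℝ (i b) z (i a z)) ∈
      Submodule.span ℝ (range fun a => i a z) :=
    Submodule.sum_mem _ fun a _ => Submodule.sum_mem _ fun b _ => Submodule.smul_mem _ _ (h1 a b)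
  obtain ⟨c, hc⟩ := (Submodule.mem_span_range_iff_exists_fun ℝ).1 h2
  refine ⟨c, ?_⟩
  rw [combMap_apply i z c, hc, fderiv_combMap hi, fderiv_combMap hi, combMap_apply, combMap_apply]
  simp only [map_sum, map_smul, Finset.smul_sum, smul_smul, smul_sub, Finset.sum_sub_distrib]
  congr 1
  rw [Finset.sum_comm]
  exact Finset.sum_congr rfl fun a _ => Finset.sum_congr rfl fun b _ => by rw [mul_comm]

end Frobenius

variable {N n : ℕ} {M : Type u} [TopologicalSpace M] [ChartedSpace (EuclideanSpace ℝ (Fin N)) M]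
  [IsManifold (𝓡 N) ∞ M] {φ : OpenPartialHomeomorph M (Eu N)} {p : ProjectiveStructure N M}
  {I J K : TractorEnd p} {i j k : VField N M}

lemma trans_mem_maximalAtlas (hφ : φ ∈ IsManifold.maximalAtlas (𝓡 N) ∞ M)
    {Ψ : OpenPartialHomeomorph (Eu N) (Eu N)} (hΨ : ContDiffOn ℝ ∞ Ψ Ψ.source)
    (hΨ' : ContDiffOn ℝ ∞ Ψ.symm Ψ.target) : φ.trans Ψ ∈ IsManifold.maximalAtlas (𝓡 N) ∞ M := by
  refine OpenPartialHomeomorph.mem_maximalAtlas_of_contMDiffOn _ ?_ ?_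
  · exact hΨ.contMDiffOn.comp ((contMDiffOn_chart hφ).mono fun x hx => hx.1) fun x hx => hx.2
  · exact (contMDiffOn_chart_symm hφ).comp (hΨ'.contMDiffOn.mono fun x hx => hx.1) fun x hx => hx.2

lemma tg_trans (hφ : φ ∈ IsManifold.maximalAtlas (𝓡 N) ∞ M)
    {Ψ : OpenPartialHomeomorph (Eu N) (Eu N)} (hΨ : ContDiffOn ℝ ∞ Ψ Ψ.source) {x : M}
    (hx : x ∈ φ.source) (hxΨ : φ x ∈ Ψ.source) (v : TangentSpace (𝓡 N) x) :
    tg (φ.trans Ψ) x v = fderiv ℝ Ψ (φ x) (tg φ x v) := by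
  have d1 := ((mdifferentiable_chart' hφ).mdifferentiableAt hx).hasMFDerivAt
  have d2 : HasMFDerivAt 𝓘(ℝ, Eu N) 𝓘(ℝ, Eu N) Ψ (φ x) (fderiv ℝ Ψ (φ x)) :=
    ((hΨ.contDiffAt (Ψ.open_source.mem_nhds hxΨ)).differentiableAt (by simp)).hasFDerivAt.hasMFDerivAt
  have d3 := (HasMFDerivAt.comp x d2 d1).mfderiv
  exact congrArg (fun T : TangentSpace (𝓡 N) x →L[ℝ] Eu N => T v) d3

/-- The Frobenius theorem is applied to the coordinate expressions of `i, j, k` in a chart around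
`x₀`, which are involutive by `ParTriple.bracket`; the two coordinate changes are then composed. -/
lemma exists_isLeafChart [T2Space M] (hN : 2 ≤ N) (hIJK : IsParallelHypercomplex I J K) (hi : IsProjection I i)
    (hj : IsProjection J j) (hk : IsProjection K k) (hNn : N = n + 3) (x₀ : M) {W : Set M}
    (hW : IsOpen W) (hx₀ : x₀ ∈ W) :
    ∃ (φ : OpenPartialHomeomorph M (Eu N)) (q : Eu N →L[ℝ] Eu n) (r : Eu n →L[ℝ] Eu N),
      IsLeafChart i j k φ q r ∧ x₀ ∈ φ.source ∧ φ.source ⊆ W := by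
  obtain ⟨c, hc⟩ := p.nonempty
  let c₀ : p.carrier := ⟨c, hc⟩
  let φ₀ : OpenPartialHomeomorph M (Eu N) := chartAt _ x₀
  have hφ₀ : φ₀ ∈ IsManifold.maximalAtlas (𝓡 N) ∞ M := IsManifold.chart_mem_maximalAtlas x₀
  have hxφ : x₀ ∈ φ₀.source := mem_chart_source _ x₀
  have hT := hIJK.parTriple hN hφ₀ c₀
  obtain ⟨ι, hι⟩ : ∃ ι : Fin 3 → Eu N → Eu N,
    ι = fun a z => blkI (endC hφ₀ c₀ (![I, J, K] a) z) := ⟨_, rfl⟩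
  have hιc : ∀ a, ∀ z ∈ φ₀.target, ι a z = coord φ₀ (![i, j, k] a) z := fun a z hz => by
    rw [hι]
    exact coord_eq_blkI hφ₀ c₀ hi hj hk a hz
  have hιs : ∀ a, ContDiffOn ℝ ∞ (ι a) φ₀.target := fun a => hι ▸ contDiffOn_blkI hT a
  have hιd : ∀ a, ∀ z ∈ φ₀.target, DifferentiableAt ℝ (ι a) z := fun a z hz =>
    ((hιs a).contDiffAt (φ₀.open_target.mem_nhds hz)).differentiableAt (by simp)
  have hιl : ∀ z ∈ φ₀.target, LinearIndependent ℝ (fun a => ι a z) := fun z hz =>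
    hι ▸ hT.linearIndependent hz
  have hO : IsOpen (img φ₀ W) := isOpen_img hW
  obtain ⟨Ψ, q, hΨ0, hΨO, hΨconv, hΨ, hΨ', hqs, hqX⟩ :=
    exists_frobenius_chart (F := Eu n) (X := combMap ι) hO
      ((contDiffOn_combMap hιs).mono fun z hz => hz.1) (map_mem_img hx₀ hxφ) (by
        intro s t hst
        rw [combMap_apply, combMap_apply, ← sub_eq_zero, ← Finset.sum_sub_distrib] at hst
        have h1 := Fintype.linearIndependent_iff.1 (hιl _ (φ₀.map_source hxφ)) (fun a => s a - t a)
          (by simpa only [sub_smul] using hst)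
        exact funext fun a => sub_eq_zero.1 (h1 a))
      (fun z hz s t => combMap_involutive (fun a => hιd a z hz.1)
        (fun a => by rw [hι]; exact hT.bracket a hz.1) s t)
      (by simp [hNn, add_comm])
  obtain ⟨r, hr⟩ := (q : Eu N →ₗ[ℝ] Eu n).exists_rightInverse_of_surjective
    (LinearMap.range_eq_top.2 hqs)
  have hφ := trans_mem_maximalAtlas hφ₀ hΨ hΨ'
  have htar : (φ₀.trans Ψ).target = Ψ.target := by
    rw [OpenPartialHomeomorph.trans_target]
    exact inter_eq_left.2 fun z hz => (hΨO (Ψ.map_target hz)).1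
  refine ⟨φ₀.trans Ψ, q, r.toContinuousLinearMap, ⟨hφ, htar ▸ hΨconv, fun y => ?_, fun a z hz => ?_,
    fun z hz => ?_, hNn⟩, ⟨hxφ, hΨ0⟩, fun x hx => ?_⟩
  · exact congrArg (fun T : Eu n →ₗ[ℝ] Eu n => T y) hr
  · have hx := (φ₀.trans Ψ).map_target hz
    have hx2 : φ₀ ((φ₀.trans Ψ).symm z) ∈ Ψ.source := hx.2
    have h1 := hqX _ hx2 (Pi.single a 1)
    rw [combMap_single, hιc a _ (φ₀.map_source hx.1), coord_apply _ hx.1] at h1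
    rw [coord, tg_trans hφ₀ hΨ hx.1 hx2]
    exact h1
  · have h1 := (hIJK.parTriple hN hφ c₀).linearIndependent hz
    have h2 : (fun a => coord (φ₀.trans Ψ) (![i, j, k] a) z) =
        fun a => blkI (endC hφ c₀ (![I, J, K] a) z) :=
      funext fun a => (coord_eq_blkI hφ c₀ hi hj hk a hz).symm
    rw [h2]
    exact h1
  · have hx2 : φ₀ x ∈ Ψ.source := hx.2
    have h1 := (hΨO hx2).2
    rwa [mem_preimage, φ₀.left_inv hx.1] at h1

/-! ### The quotient by the leaves -/

/-- The value at a point of `q '' O` is read off at any preimage in `O`; elsewhere it is arbitrary.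
-/
lemma exists_factor {α β γ : Type*} [Nonempty γ] {q : α → β} {O : Set α} {f : α → γ}
    (h : ∀ z ∈ O, ∀ z' ∈ O, q z = q z' → f z = f z') : ∃ S : β → γ, ∀ z ∈ O, S (q z) = f z := by
  classical
  refine ⟨fun y => if hy : ∃ z ∈ O, q z = y then f hy.choose else Classical.arbitrary γ,
    fun z hz => ?_⟩
  have hy : ∃ z' ∈ O, q z' = q z := ⟨z, hz, rfl⟩
  refine (dif_pos hy).trans ?_
  exact h _ hy.choose_spec.1 _ hz hy.choose_spec.2

lemma img_source : img φ φ.source = φ.target :=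
  inter_eq_left.2 fun _ hz => φ.map_target hz

/-- The induced endomorphisms depend only on `q ∘ A_a`, not on the horizontal space, which changes
with the scale. -/
lemma descSpan_congr {O : Set (Eu N)} {Γ Γ' : Eu N → Eu N →L[ℝ] Eu N →L[ℝ] Eu N}
    {A A' : Fin 3 → Eu N → Eu N →L[ℝ] Eu N} {ι ι' : Fin 3 → Eu N → Eu N}
    {β β' : Fin 3 → Eu N → Eu N →L[ℝ] ℝ} {q : Eu N →L[ℝ] Eu n} {r : Eu n →L[ℝ] Eu N} {O' : Set (Eu N)}
    (h : FibData Γ O A ι β q r) (h' : FibData Γ' O' A' ι' β' q r) {z : Eu N} (hz : z ∈ O)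
    (hz' : z ∈ O') (hA : ∀ a w, q (A a z w) = q (A' a z w)) :
    FibData.descSpan A ι β q r z = FibData.descSpan A' ι' β' q r z := by
  rw [FibData.descSpan, FibData.descSpan]
  congr 2
  funext a
  ext1 y
  rw [← h.q_r y, ← h.q_A a hz, ← h'.q_A a hz', hA]

namespace IsLeafChart

variable {q : Eu N →L[ℝ] Eu n} {r : Eu n →L[ℝ] Eu N}

theorem exists_quaternionic_quotient [T2Space M] (h : IsLeafChart i j k φ q r) (hN : 2 ≤ N)
    (hn : n ≠ 0) (hIJK : IsParallelHypercomplex I J K) (hi : IsProjection I i)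
    (hj : IsProjection J j) (hk : IsProjection K k) {L : Type u} [TopologicalSpace L]
    [ChartedSpace (EuclideanSpace ℝ (Fin n)) L] [IsManifold (𝓡 n) ∞ L] {π : M → L}
    {ψ : OpenPartialHomeomorph L (Eu n)} (hπ : IsLinearIn φ ψ q π)
    (hex : ∃ cov, IsAdaptedScaleOn p i j k φ.source cov) :
    ∃ Q : (y : L) → Submodule ℝ (TangentSpace (𝓡 n) y →L[ℝ] TangentSpace (𝓡 n) y),
      IsQuaternionic Q ∧
      (∀ (V : Set M) (cov : RawConn N M), IsOpen V → V ⊆ φ.source →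
        IsAdaptedScaleOn p i j k V cov → InducedBy i j k π V cov Q) ∧
      ∀ cov : RawConn N M, IsAdaptedScaleOn p i j k φ.source cov →
        ∃ covL : RawConn n L, IsAffineConnectionOn univ covL ∧
          DescendsTo i j k φ.source π cov covL ∧ IsParallelSubbundle covL Q := by
  obtain ⟨c, hc⟩ := p.nonempty
  let c₀ : p.carrier := ⟨c, hc⟩
  have hfib := fun (V : Set M) (cov : RawConn N M) (hV : IsOpen V) (hVφ : V ⊆ φ.source)
    (hcov : IsAdaptedScaleOn p i j k V cov) => hcov.fibData hN h.mem_atlas c₀ hIJK hi hj hk h.q_r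
      h.q_i h.dim_eq hV hVφ
  have hF : finrank ℝ (Eu n) ≠ 0 := by simpa using hn
  obtain ⟨cov₀, hcov₀⟩ := hex
  obtain ⟨A₀, ι₀, β₀, hF₀, -, hA₀, -⟩ := hfib _ cov₀ φ.open_source subset_rfl hcov₀
  rw [img_source] at hF₀ hA₀
  -- One adapted scale on the whole chart defines the span on the base.
  obtain ⟨S, hS⟩ := exists_factor fun z hz z' hz' hq => hF₀.descSpan_eq hF h.convex hz hz' hq
  -- For every adapted scale, `q ∘ A_a` equals `q` composed with the upper left block in the
  -- splitting of `c₀`. So every adapted scale, even on a smaller set, induces the same span.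
  have hS' : ∀ {Γ : Eu N → Eu N →L[ℝ] Eu N →L[ℝ] Eu N} {A : Fin 3 → Eu N → Eu N →L[ℝ] Eu N}
      {ι : Fin 3 → Eu N → Eu N} {β : Fin 3 → Eu N → Eu N →L[ℝ] ℝ} {V : Set M},
      FibData Γ (img φ V) A ι β q r →
      (∀ a, ∀ z ∈ img φ V, ∀ w, q (A a z w) = q (blkA (endC h.mem_atlas c₀ (![I, J, K] a) z) w)) →
      ∀ z ∈ img φ V, S (q z) = FibData.descSpan A ι β q r z := fun hF hA z hz =>
    (hS z hz.1).trans (descSpan_congr hF₀ hF hz.1 hz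
      fun a w => (hA₀ a z hz.1 w).trans (hA a z hz w).symm)
  have hdesc : ∀ cov : RawConn N M, IsAdaptedScaleOn p i j k φ.source cov →
      ∃ covL : RawConn n L, IsAffineConnectionOn univ covL ∧
        DescendsTo i j k φ.source π cov covL ∧ IsParallelSubbundle covL (bundleOf ψ S) := by
    intro cov hcov
    obtain ⟨A, ι, β, hFc, hι, hA, -⟩ := hfib _ cov φ.open_source subset_rfl hcov
    have hSc := hS' hFc hA
    rw [img_source] at hFc hι hSc
    obtain ⟨G, hG⟩ := exists_factor fun z hz z' hz' hq => hFc.descConn_eq h.convex hz hz' hq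
    exact ⟨connOf ψ G, hπ.isAffineConnectionOn hFc hG,
      hπ.descendsTo h hcov.1.1 hFc hι hG, hπ.isParallelSubbundle hFc hn hG hSc⟩
  refine ⟨bundleOf ψ S, ⟨hπ.isAlmostQuaternionic hF₀ hn hS, ?_⟩, fun V cov hV hVφ hcov => ?_, hdesc⟩
  · obtain ⟨covL, h1, -, h2⟩ := hdesc cov₀ hcov₀
    exact ⟨covL, h1, h2⟩
  · obtain ⟨A, ι, β, hFc, hι, hA, hcovA⟩ := hfib V cov hV hVφ hcov
    exact hπ.inducedBy hVφ hFc (hS' hFc hA) hcovA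

end IsLeafChart

end

end

end ProjTractor

open ProjTractor

theorem theorem3p9 {m : ℕ} (hm : 2 ≤ m) {M : Type*} [TopologicalSpace M] [T2Space M]
    [SecondCountableTopology M] [ConnectedSpace M]
    [ChartedSpace (EuclideanSpace ℝ (Fin (4 * m + 3))) M] [IsManifold (𝓡 (4 * m + 3)) ∞ M]
    (o : (x : M) → Orientation ℝ (TangentSpace (𝓡 (4 * m + 3)) x) (Fin (4 * m + 3)))
    (ho : IsManifoldOrientation o)
    (p : ProjectiveStructure (4 * m + 3) M)
    (I J K : TractorEnd p) (hIJK : IsParallelHypercomplex I J K)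
    (ε : (x : M) → tractor p x [⋀^Fin (4 * m + 3 + 1)]→ₗ[ℝ] ℝ)
    (hε : IsTractorVolumeForm o ε) (hor : ∀ x, SameOrientation (ε x) (I x) (J x) (K x))
    (i j k : VField (4 * m + 3) M)
    (hi : IsProjection I i) (hj : IsProjection J j) (hk : IsProjection K k)
    (x₀ : M) (W : Set M) (hW : IsOpen W) (hx₀ : x₀ ∈ W) :
    ∃ U : Set M, IsOpen U ∧ x₀ ∈ U ∧ U ⊆ W ∧
      (∃ cov, IsAdaptedScaleOn p i j k U cov) ∧
      T2Space (LeafSpace i j k U) ∧ SecondCountableTopology (LeafSpace i j k U) ∧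
      ∃ (_ : ChartedSpace (EuclideanSpace ℝ (Fin (4 * m))) (LeafSpace i j k U))
        (_ : IsManifold (𝓡 (4 * m)) ∞ (LeafSpace i j k U))
        (π : M → LeafSpace i j k U),
        (∀ x : U, π x = Quotient.mk _ x) ∧
        (∀ x ∈ U, Manifold.IsSubmersionAt (𝓡 (4 * m + 3)) (𝓡 (4 * m)) ∞ π x) ∧
        ∃ Q : (y : LeafSpace i j k U) →
            Submodule ℝ (TangentSpace (𝓡 (4 * m)) y →L[ℝ] TangentSpace (𝓡 (4 * m)) y),
          IsQuaternionic Q ∧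
          (∀ (V : Set M) (cov : RawConn (4 * m + 3) M), IsOpen V → V ⊆ U →
            IsAdaptedScaleOn p i j k V cov → InducedBy i j k π V cov Q) ∧
          ∀ cov : RawConn (4 * m + 3) M, IsAdaptedScaleOn p i j k U cov →
            ∃ covL : RawConn (4 * m) (LeafSpace i j k U),
              IsAffineConnectionOn univ covL ∧ DescendsTo i j k U π cov covL ∧
              IsParallelSubbundle covL Q := by
  -- `U` is the source of a leaf chart inside `W`.
  obtain ⟨φ, q, r, h, hxφ, hφW⟩ := exists_isLeafChart (n := 4 * m) (by omega) hIJK hi hj hk rfl x₀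
    hW hx₀
  obtain ⟨c, hc⟩ := p.nonempty
  have hex := exists_isAdaptedScaleOn (by omega) h.mem_atlas ⟨c, hc⟩ hIJK hi hj hk h.q_r h.q_i
    h.dim_eq ⟨φ x₀, φ.map_source hxφ⟩
  obtain ⟨instC, instM, π, ψ, hmk, hπ⟩ := h.exists_manifold hxφ
  exact ⟨φ.source, φ.open_source, hxφ, hφW, hex, h.t2Space, h.secondCountableTopology, instC, instM,
    π, hmk, fun x hx => hπ.isSubmersionAt h.q_r hx,
    h.exists_quaternionic_quotient (by omega) (by omega) hIJK hi hj hk hπ hex⟩
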